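/- **Conventions.** Let $\Bbbk$ be an algebraically closed field (of any characteristic). A modular fusion category (MFC) is a $\Bbbk$-linear abelian, finitely semisimple, rigid, pivotal and braided monoidal category with simple unit and bilinear $\otimes$ whose left and right twists agree (so it is ribbon, with twist $\theta$) and in which every object $X$ with $c_{Y,X}c_{X,Y}=\mathrm{id}$ for all $Y$ is a finite multiple of $\mathbb 1$. Associators and unitors are suppressed. $X^*$ is the dual, with $\mathrm{ev}_X\colon X^*X\to\mathbb 1$, $\mathrm{coev}_X\colon\mathbb 1\to XX^*$ and, from the pivotal structure, $\widetilde{\mathrm{ev}}_X\colon XX^*\to\mathbb 1$, $\widetilde{\mathrm{coev}}_X\colon\mathbb 1\to X^*X$. $\mathrm{tr}^r_T$, $\mathrm{tr}^l_T$ denote right and left partial traces over $T$. A Frobenius algebra $A=(A,\mu,\eta,\Delta,\varepsilon)$ is *symmetric* if the two maps $A\to A^*$ built from $\varepsilon\mu$ agree. A *section* is $\psi\colon\mathbb 1\to A$ with $\mu(\mu\otimes1)(1\otimes\psi^2\otimes1)\Delta=\mathrm{id}_A$, where $\psi^2=\mu(\psi\otimes\psi)$; it is invertible if it has an inverse with respect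 to $\mu$. Right and left $A$-actions $\rho$ on $K$, $\lambda$ on $L$ induce coactions $\rho^\vee=(\rho\otimes1)(1\otimes\Delta\eta)$, $\lambda^\vee=(1\otimes\lambda)(\Delta\eta\otimes1)$, and the map $h_{\rho,\lambda}=(\rho\otimes\lambda)(1\otimes\Delta\eta\otimes1)$ on $K\otimes L$. Let $q\colon K\otimes L\to K\otimes_AL$ be the projection (the coequalizer of the two actions) and $s\colon K\otimes_AL\to K\otimes L$ the map with $sq=h_{\rho,\lambda}$. A morphism $f$ between relative tensor products is encoded by its *balanced map* $s f q$ between the ordinary tensor products. Given an invertible section $\psi$ of a symmetric $A$, composition of the encoded morphisms is composition of balanced maps with $\psi^2$ inserted in between through the action along which the intermediate relative tensor product is taken, and the identity is encoded by $h$. Duals of modules carry the dual actions. **Orbifold data.** An *orbifold datum* $\mathbb A=(A,T,\alpha,\bar\alpha,\psi,\phi)$ in an MFC $\mathcal C$ consists of a symmetric Frobenius algebra $A$ with an invertible section $\psi$, an $A$-$A\otimes A$-bimodule $T$, i.e. an object with a left action $\lambda_0$ and two right actions $\rho_1,\rho_2$ commuting with $\lambda_0$ and with $\rho_1(\rho_2\otimes1)=\rho_2(\rho_1\otimes1)(1\otimes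 c_{A,A})$, a scalar $\phi\in\Bbbk^\times$, and $A$-$A^{\otimes3}$-bimodule morphisms $\alpha\colon T\otimes_2T\rightleftarrows T\otimes_1T:\bar\alpha$ given by balanced maps $T\otimes T\to T\otimes T$ (where $\otimes_i$ uses $\rho_i$ on the left factor and $\lambda_0$ or the left action on the right factor). Here and below, whenever a strand $X$ attached to $\rho_2$ and a strand $Y$ attached to $\rho_1$ must be exchanged, this is done by $c_{X,Y}\colon XY\to YX$, or by $c_{X,Y}^{-1}\colon YX\to XY$. In the bimodule condition, $\alpha$ sends the action $\rho_1$ of the first tensor factor of its source, $\rho_1$ of the second and $\rho_2$ of the second to $\rho_1$ of the second, $\rho_2$ of the second and $\rho_2$ of the first factor of its target, respectively. Write $\psi_0^2,\psi_1^2,\psi_2^2\colon T\to T$ for the insertions of $\psi^2$ along $\lambda_0,\rho_1,\rho_2$. It is required that * (O1) $(1\otimes\alpha)(\alpha\otimes1)(1\otimes\psi_1^2\otimes1)(1\otimes\alpha)=(\alpha\otimes1)(1\otimes c_{T,T}^{-1})(\alpha\otimes1)$ on $T^{\otimes3}$; * (O2), (O3) $\alpha(\psi_2^2\otimes1)\bar\alpha=h_{\rho_1,\lambda_0}$,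 $\ \bar\alpha(\psi_1^2\otimes1)\alpha=h_{\rho_2,\lambda_0}$; * (O4), (O5) for $Z=(1\otimes\widetilde{\mathrm{ev}}_T\otimes1)(\alpha\otimes1\otimes1)(1\otimes c_{T,T^*}^{-1}\otimes1)(1\otimes1\otimes\mathrm{coev}_T)$ and $\bar Z=(1\otimes\widetilde{\mathrm{ev}}_T\otimes1)(\bar\alpha\otimes1\otimes1)(1\otimes c_{T^*,T}\otimes1)(1\otimes1\otimes\mathrm{coev}_T)$ on $T\otimes T^*$: $\ \bar Z(\psi_2^2\otimes1)Z=h_{\rho_1,\rho_1^*}$, $\ Z(\psi_1^2\otimes1)\bar Z=h_{\rho_2,\rho_2^*}$; * (O6), (O7) for $X=(1\otimes1\otimes\widetilde{\mathrm{ev}}_T)(1\otimes\alpha\otimes1)(\widetilde{\mathrm{coev}}_T\otimes1\otimes1)\colon TT^*\to T^*T$ and $\bar X=(\mathrm{ev}_T\otimes1\otimes1)(1\otimes\bar\alpha\otimes1)(1\otimes1\otimes\mathrm{coev}_T)\colon T^*T\to TT^*$: $\ \bar X(1\otimes\psi_0^2)X=h_{\rho_1,\rho_2^*}$, $\ X(\psi_1^2\otimes1)\bar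 X=h_{\lambda_0^*,\lambda_0}$; * (O8) $\mathrm{tr}^r_T(\lambda_0^\vee\psi_1^2\psi_2^2\lambda_0)=\mathrm{tr}^l_T(\rho_1^\vee\psi_0^2\psi_2^2\rho_1)=\mathrm{tr}^l_T(\rho_2^\vee\psi_0^2\psi_1^2\rho_2)=\phi^{-2}\,\mathrm{id}_A$. For $J\subseteq\{1,2\}$ let $\mathcal C_{\mathbb A}^J$ be the category of $A$-$A$-bimodules $M$ (with actions $\lambda,\rho$) together with, for each $i\in J$, mutually inverse $A$-$A^{\otimes2}$-bimodule morphisms $\tau_i\colon M\otimes_0T\rightleftarrows T\otimes_iM:\bar\tau_i$, given by balanced maps, where $\otimes_0$ is formed with $\lambda_0$, i.e. $\tau_i(\psi^2\otimes1)\bar\tau_i=h_{\rho_i,\lambda}$ and $\bar\tau_i(\psi_i^2\otimes1)\tau_i=h_{\rho,\lambda_0}$ (T4, T5; an unlabelled $\psi^2$ on $M$ acts through $\rho$), such that * (T1) if $1\in J$: $(1\otimes\tau_1)(1\otimes\psi^2\otimes1)(\tau_1\otimes1)(1\otimes\alpha)=(\alpha\otimes1)(1\otimes c_{T,M}^{-1})(\tau_1\otimes1)$;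 * (T2) if $1,2\in J$: $(1\otimes\tau_2)(1\otimes\psi^2\otimes1)(\tau_1\otimes1)(1\otimes\alpha)=(\alpha\otimes1)(\psi_2^2\otimes1\otimes1)(1\otimes\tau_1)(\tau_2\otimes1)$; * (T3) if $2\in J$: $(1\otimes c_{M,T})(\tau_2\otimes1)(1\otimes\alpha)=(\alpha\otimes1)(\psi_2^2\otimes1\otimes1)(1\otimes\tau_2)(\tau_2\otimes1)$; * (T6), (T7) for $i\in J$ the maps $\tau_{M^*,i}=(\mathrm{ev}_M\otimes1\otimes 1)(1\otimes\bar\tau_i\otimes1)(1\otimes1\otimes\mathrm{coev}_M)\colon M^*T\to TM^*$ and $\bar\tau_{M^*,i}=(1\otimes1\otimes\widetilde{\mathrm{ev}}_M)(1\otimes\tau_i\otimes1)(\widetilde{\mathrm{coev}}_M\otimes1\otimes1)\colon TM^*\to M^*T$ satisfy $\bar\tau_{M^*,i}(\psi_i^2\otimes1)\tau_{M^*,i}=h_{\lambda^*,\lambda_0}$ and $\tau_{M^*,i}(1\otimes\psi_0^2)\bar\tau_{M^*,i}=h_{\rho_i,\rho^*}$. Morphisms are bimodule maps $f$ with $\tau_i(f\otimes1)=(1\otimes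 f)\tau_i$ for $i\in J$. Put $\mathcal C_{\mathbb A}=\mathcal C_{\mathbb A}^{\{1,2\}}$, $\mathcal C_{\mathbb A}^i=\mathcal C_{\mathbb A}^{\{i\}}$; $\mathcal C_{\mathbb A}^{\emptyset}$ is the category ${}_A\mathcal C_A$ of bimodules. The tensor product, unit and duals of $\mathcal C_{\mathbb A}^J$ are those of ${}_A\mathcal C_A$; $M\otimes_AN$ has the crossing $(1\otimes q)(1\otimes\psi^2\otimes1)(\tau_i^M\otimes1)(1\otimes\tau_i^N)(\psi^2\otimes1\otimes1)(s\otimes1)$ (all $\psi^2$ act on $M$ through $\rho$), $A$ has the crossing $\rho_i^\vee\lambda_0$, $M^*$ has the crossing $\tau_{M^*,i}$; inverse crossings are analogous. The evaluations of bimodules have the balanced maps $(\mathrm{ev}_M\otimes1)(1\otimes\rho^\vee)\colon M^*M\to A$ and $(1\otimes\widetilde{\mathrm{ev}}_M)(\lambda^\vee\otimes1)\colon MM^*\to A$. The braiding of $\mathcal C_{\mathbb A}$ has the balanced map $\hat c_{M,N}\colon MN\to NM$ equal to $\phi^2$ times the right partial trace over $T$ of $$(1\otimes\bar\tau_2^M)(\bar\tau_1^N\otimes1)(\psi_1^2\psi_2^2\otimes1\otimes1)(1\otimes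 c_{M,N})(\tau_2^M\otimes1)(1\otimes\tau_1^N)(1\otimes1\otimes\psi_1^2\psi_2^2),$$ and the twist of $M$ is $\mathrm{tr}^r_M\bigl(\hat c_{M,M}(1\otimes\psi^2)\bigr)$. **Functors.** A *ribbon Frobenius functor* $F\colon\mathcal C\to\mathcal D$ is a $\Bbbk$-linear functor with a braided lax monoidal structure $(F_2,F_0)$ and an oplax monoidal structure $(\bar F_2,\bar F_0)$ such that $\bar F_2(X,YZ)F_2(XY,Z)=(1\otimes F_2(Y,Z))(\bar F_2(X,Y)\otimes1)$ and $\bar F_2(XY,Z)F_2(X,YZ)=(F_2(X,Y)\otimes1)(1\otimes\bar F_2(Y,Z))$, and such that $F(\theta_X)=\theta_{F(X)}$. Then $F(A)$ is a Frobenius algebra with structure maps $F(\mu)F_2$, $F(\eta)F_0$, $\bar F_2F(\Delta)$, $\bar F_0F(\varepsilon)$, modules are sent to modules by $F(\lambda)F_2$, $F(\rho)F_2$, and $F$ induces a functor $F^A\colon{}_A\mathcal C_A\to{}_{F(A)}\mathcal D_{F(A)}$. $F$ is *compatible* with $\mathbb A$, via $\psi_F\colon\mathbb 1\to F(A)$ and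 $\phi_F\in\Bbbk^\times$, if $\psi_F$ is invertible, for all $A$-$A$-bimodules $M,N$ one has $$F(q)\circ F_2(M,N)\circ(\psi_F^2\otimes1)\circ\bar F_2(M,N)\circ F(s)=\mathrm{id}_{F(M\otimes_AN)}$$ ($\psi_F^2$ acting on $F(M)$ from the right), and (O8) holds for $(F(A),F(T),\psi_F,\phi_F)$. The pair $(F,\mathbb A)$ is *full* if $F^A$ is full. **Theorem.** Let $F\colon\mathcal C\to\mathcal D$ be a ribbon Frobenius functor between MFCs and $\mathbb A=(A,T,\alpha,\bar\alpha,\psi,\phi)$ an orbifold datum in $\mathcal C$, and let $F$ be compatible with $\mathbb A$ via $\psi_F$, $\phi_F$. Put $\alpha^F=\bar F_2F(\alpha)F_2$, $\bar\alpha^F=\bar F_2F(\bar\alpha)F_2$ and, for $M\in\mathcal C_{\mathbb A}^J$, $\tau_i^F=\bar F_2F(\tau_i)F_2$, $\bar\tau_i^F=\bar F_2F(\bar\tau_i)F_2$ (as balanced maps). Then: 1. $F(\mathbb A)=(F(A),F(T),\alpha^F,\bar\alpha^F,\psi_F,\phi_F)$ is an orbifold datum in $\mathcal D$. 2. The functor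 $F^A$ is strong monoidal, with structure isomorphism $F^A_2(M,N)\colon F(M)\otimes_{F(A)}F(N)\to F(M\otimes_AN)$ induced by $F(q)\circ F_2(M,N)$ and $F^A_0=\mathrm{id}_{F(A)}$. 3. For every $J\subseteq\{1,2\}$ and $M\in\mathcal C_{\mathbb A}^J$, the tuple $(F(M),\tau_i^F,\bar\tau_i^F)_{i\in J}$ is an object of $\mathcal D_{F(\mathbb A)}^J$, so that $F^A$ induces functors $F^{\mathbb A}\colon\mathcal C_{\mathbb A}\to\mathcal D_{F(\mathbb A)}$ and $F^{\mathbb A,i}\colon\mathcal C_{\mathbb A}^i\to\mathcal D_{F(\mathbb A)}^i$, $i=1,2$. These are strong monoidal and pivotal: $F^A_2(M,N)$ and $F^A_0$ commute with the crossings, and there are bimodule isomorphisms $F(M^*)\cong F(M)^*$ commuting with the crossings which are compatible with both evaluations of bimodules. 4. $F^{\mathbb A}$ is ribbon: $F^A_2(N,M)\,c_{F(M),F(N)}=F(c_{M,N})\,F^A_2(M,N)$ and $F(\theta_M)=\theta_{F(M)}$ for the braidings and twists of $\mathcal C_{\mathbb A}$ and $\mathcal D_{F(\mathbb A)}$. 5.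 If $(F,\mathbb A)$ is full and $F(\mathbb 1)\neq0$, then $F^{\mathbb A}$, $F^{\mathbb A,1}$ and $F^{\mathbb A,2}$ are full and faithful. -/

import Mathlib

open CategoryTheory MonoidalCategory Limits

universe v₁ v₂ u₁ u₂ w

namespace FrobTransport

/-! ### Pivotal, ribbon and modular fusion categories -/

section Pivotal

/-- A pivotal structure on a monoidal category with chosen duals `Xᘁ`, where
`ε_ X Xᘁ : Xᘁ ⊗ X ⟶ 𝟙_ C` and `η_ X Xᘁ : 𝟙_ C ⟶ X ⊗ Xᘁ` are the chosen (co)evaluations: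
each `Xᘁ` is also a dual of `X` on the other side, the two transposes of a morphism agree, and
the two canonical morphisms `(X ⊗ Y)ᘁ ⟶ Yᘁ ⊗ Xᘁ` agree. -/
class PivotalCategory (C : Type u₁) [Category.{v₁} C] [MonoidalCategory C]
    [RightRigidCategory C] where
  /-- the second pair of duality morphisms `𝟙_ C ⟶ Xᘁ ⊗ X` and `X ⊗ Xᘁ ⟶ 𝟙_ C` -/
  pairing (X : C) : ExactPairing Xᘁ X
  transpose_eq {X Y : C} (f : X ⟶ Y) :
    (𝟙 Yᘁ ⊗≫ Yᘁ ◁ η_ X Xᘁ ⊗≫ Yᘁ ◁ f ▷ Xᘁ ⊗≫ ε_ Y Yᘁ ▷ Xᘁ ⊗≫ 𝟙 Xᘁ : Yᘁ ⟶ Xᘁ) =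
      𝟙 Yᘁ ⊗≫ (pairing X).coevaluation' ▷ Yᘁ ⊗≫ Xᘁ ◁ f ▷ Yᘁ ⊗≫
        Xᘁ ◁ (pairing Y).evaluation' ⊗≫ 𝟙 Xᘁ
  tensor_eq (X Y : C) :
    (𝟙 (X ⊗ Y)ᘁ ⊗≫ (X ⊗ Y)ᘁ ◁ η_ X Xᘁ ⊗≫ (X ⊗ Y)ᘁ ◁ X ◁ η_ Y Yᘁ ▷ Xᘁ ⊗≫
        ε_ (X ⊗ Y) (X ⊗ Y)ᘁ ▷ (Yᘁ ⊗ Xᘁ) ⊗≫ 𝟙 (Yᘁ ⊗ Xᘁ) : (X ⊗ Y)ᘁ ⟶ Yᘁ ⊗ Xᘁ) =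
      𝟙 (X ⊗ Y)ᘁ ⊗≫ (pairing Y).coevaluation' ▷ (X ⊗ Y)ᘁ ⊗≫
        Yᘁ ◁ (pairing X).coevaluation' ▷ Y ▷ (X ⊗ Y)ᘁ ⊗≫
        (Yᘁ ⊗ Xᘁ) ◁ (pairing (X ⊗ Y)).evaluation' ⊗≫ 𝟙 (Yᘁ ⊗ Xᘁ)

variable {C : Type u₁} [Category.{v₁} C] [MonoidalCategory C] [RightRigidCategory C]

/-- The evaluation `X* ⊗ X ⟶ 𝟙`. -/
def ev (X : C) : Xᘁ ⊗ X ⟶ 𝟙_ C := ε_ X Xᘁ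

/-- The coevaluation `𝟙 ⟶ X ⊗ X*`. -/
def coev (X : C) : 𝟙_ C ⟶ X ⊗ Xᘁ := η_ X Xᘁ

variable [PivotalCategory C]

/-- The second evaluation `X ⊗ X* ⟶ 𝟙`. -/
def ev' (X : C) : X ⊗ Xᘁ ⟶ 𝟙_ C := (PivotalCategory.pairing X).evaluation'

/-- The second coevaluation `𝟙 ⟶ X* ⊗ X`. -/
def coev' (X : C) : 𝟙_ C ⟶ Xᘁ ⊗ X := (PivotalCategory.pairing X).coevaluation'

/-- The right partial trace over `T`. -/
def rightTrace {X Y : C} (T : C) (f : X ⊗ T ⟶ Y ⊗ T) : X ⟶ Y :=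
  𝟙 X ⊗≫ X ◁ coev T ⊗≫ f ▷ Tᘁ ⊗≫ Y ◁ ev' T ⊗≫ 𝟙 Y

/-- The left partial trace over `T`. -/
def leftTrace {X Y : C} (T : C) (f : T ⊗ X ⟶ T ⊗ Y) : X ⟶ Y :=
  𝟙 X ⊗≫ coev' T ▷ X ⊗≫ Tᘁ ◁ f ⊗≫ ev T ▷ Y ⊗≫ 𝟙 Y

variable [BraidedCategory C]

/-- The right twist. -/
def twist (X : C) : X ⟶ X := rightTrace X (β_ X X).hom

/-- The left twist. -/
def leftTwist (X : C) : X ⟶ X := leftTrace X (β_ X X).hom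

/-- A braided pivotal category is ribbon if the left and the right twists agree. -/
def IsRibbon (C : Type u₁) [Category.{v₁} C] [MonoidalCategory C] [RightRigidCategory C]
    [PivotalCategory C] [BraidedCategory C] : Prop :=
  ∀ X : C, leftTwist X = twist X

end Pivotal

section Modular

attribute [local instance] Abelian.hasFiniteBiproducts

/-- An abelian `k`-linear category is finitely semisimple: Hom spaces are finite dimensional,
every object is a finite direct sum of simple ones, and there are finitely many simple objects
up to isomorphism. -/
structure IsFinitelySemisimple (k : Type w) [Field k] (C : Type u₁) [Category.{v₁} C]
    [Abelian C] [Linear k C] : Prop where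
  finiteDimensional (X Y : C) : FiniteDimensional k (X ⟶ Y)
  semisimple (X : C) : ∃ (n : ℕ) (S : Fin n → C), (∀ i, Simple (S i)) ∧ Nonempty (X ≅ ⨁ S)
  finite_simples : ∃ (n : ℕ) (S : Fin n → C), ∀ X : C, Simple X → ∃ i, Nonempty (X ≅ S i)

/-- Modular fusion categories: ribbon fusion categories all of whose transparent objects are
multiples of the tensor unit. -/
structure IsModularFusion (k : Type w) [Field k] (C : Type u₁) [Category.{v₁} C]
    [Abelian C] [Linear k C] [MonoidalCategory C] [MonoidalPreadditive C] [MonoidalLinear k C]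
    [RightRigidCategory C] [PivotalCategory C] [BraidedCategory C] : Prop where
  semisimple : IsFinitelySemisimple k C
  simple_unit : Simple (𝟙_ C)
  ribbon : IsRibbon C
  modular (X : C) (h : ∀ Y : C, (β_ X Y).hom ≫ (β_ Y X).hom = 𝟙 (X ⊗ Y)) :
    ∃ n : ℕ, Nonempty (X ≅ ⨁ fun _ : Fin n => 𝟙_ C)

end Modular

/-! ### Frobenius algebras -/

/-- Frobenius algebras in a monoidal category. -/
structure FrobeniusAlgebra (C : Type u₁) [Category.{v₁} C] [MonoidalCategory C] where
  /-- the underlying algebra -/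
  toMon : Mon C
  /-- the comultiplication -/
  comul : toMon.X ⟶ toMon.X ⊗ toMon.X
  /-- the counit -/
  counit : toMon.X ⟶ 𝟙_ C
  counit_comul : comul ≫ counit ▷ toMon.X = (λ_ toMon.X).inv
  comul_counit : comul ≫ toMon.X ◁ counit = (ρ_ toMon.X).inv
  comul_assoc : comul ≫ toMon.X ◁ comul =
    comul ≫ comul ▷ toMon.X ≫ (α_ toMon.X toMon.X toMon.X).hom
  frobenius_left : comul ▷ toMon.X ≫ (α_ toMon.X toMon.X toMon.X).hom ≫
    toMon.X ◁ MonObj.mul = MonObj.mul ≫ comul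
  frobenius_right : toMon.X ◁ comul ≫ (α_ toMon.X toMon.X toMon.X).inv ≫
    MonObj.mul ▷ toMon.X = MonObj.mul ≫ comul

namespace FrobeniusAlgebra

variable {C : Type u₁} [Category.{v₁} C] [MonoidalCategory C] (A : FrobeniusAlgebra C)

/-- The underlying object. -/
abbrev X : C := A.toMon.X

/-- The multiplication. -/
abbrev mul : A.X ⊗ A.X ⟶ A.X := MonObj.mul

/-- The unit. -/
abbrev one : 𝟙_ C ⟶ A.X := MonObj.one

/-- The copairing `Δ ∘ η`. -/
def copairing : 𝟙_ C ⟶ A.X ⊗ A.X := A.one ≫ A.comul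

/-- The product of two elements `𝟙 ⟶ A`. -/
def prod (a b : 𝟙_ C ⟶ A.X) : 𝟙_ C ⟶ A.X := (λ_ (𝟙_ C)).inv ≫ (a ⊗ₘ b) ≫ A.mul

/-- The square of an element. -/
def sq (a : 𝟙_ C ⟶ A.X) : 𝟙_ C ⟶ A.X := A.prod a a

/-- An element is invertible if it has a two-sided inverse for the multiplication. -/
def IsInvertible (a : 𝟙_ C ⟶ A.X) : Prop :=
  ∃ b : 𝟙_ C ⟶ A.X, A.prod a b = A.one ∧ A.prod b a = A.one

/-- `ψ` is a section: `μ ∘ (μ ⊗ id) ∘ (id ⊗ ψ² ⊗ id) ∘ Δ = id`. -/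
def IsSection (ψ : 𝟙_ C ⟶ A.X) : Prop :=
  A.comul ⊗≫ A.X ◁ A.sq ψ ▷ A.X ⊗≫ A.mul ▷ A.X ≫ A.mul = 𝟙 A.X

theorem copairing_mul_left :
    A.X ◁ A.copairing ≫ (α_ _ _ _).inv ≫ A.mul ▷ A.X = (ρ_ A.X).hom ≫ A.comul := by
  rw [copairing, MonoidalCategory.whiskerLeft_comp, Category.assoc, A.frobenius_right,
    MonObj.mul_one_assoc]

theorem copairing_mul_right :
    A.copairing ▷ A.X ≫ (α_ _ _ _).hom ≫ A.X ◁ A.mul = (λ_ A.X).hom ≫ A.comul := by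
  rw [copairing, comp_whiskerRight, Category.assoc, A.frobenius_left, MonObj.one_mul_assoc]

section Modules

variable {M N : C}

/-- The action of an element on a left module. -/
def insL (a : 𝟙_ C ⟶ A.X) (l : A.X ⊗ M ⟶ M) : M ⟶ M := 𝟙 M ⊗≫ a ▷ M ⊗≫ l

/-- The action of an element on a right module. -/
def insR (a : 𝟙_ C ⟶ A.X) (r : M ⊗ A.X ⟶ M) : M ⟶ M := 𝟙 M ⊗≫ M ◁ a ⊗≫ r

/-- The coaction induced by a left action. -/
def coactL (l : A.X ⊗ M ⟶ M) : M ⟶ A.X ⊗ M := 𝟙 M ⊗≫ A.copairing ▷ M ⊗≫ A.X ◁ l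

/-- The coaction induced by a right action. -/
def coactR (r : M ⊗ A.X ⟶ M) : M ⟶ M ⊗ A.X := 𝟙 M ⊗≫ M ◁ A.copairing ⊗≫ r ▷ A.X

/-- The morphism `(r ⊗ l) ∘ (id ⊗ (Δ ∘ η) ⊗ id)` on the tensor product of a right module `M` and
a left module `N`; after insertion of `ψ²` it is the idempotent with image `M ⊗_A N`. -/
def bridge (r : M ⊗ A.X ⟶ M) (l : A.X ⊗ N ⟶ N) : M ⊗ N ⟶ M ⊗ N :=
  𝟙 (M ⊗ N) ⊗≫ M ◁ A.copairing ▷ N ⊗≫ (r ⊗ₘ l)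

theorem bridge_balanced (M N : Bimod A.toMon A.toMon) :
     M.actRight ▷ N.X ≫ A.bridge M.actRight N.actLeft =
    ((α_ _ _ _).hom ≫ M.X ◁ N.actLeft) ≫ A.bridge M.actRight N.actLeft := by
  have h1 : M.actRight ▷ N.X ≫ A.bridge M.actRight N.actLeft =
      𝟙 _ ⊗≫ M.X ◁ (A.X ◁ A.copairing ≫ (α_ _ _ _).inv ≫ A.mul ▷ A.X) ▷ N.X ⊗≫
        (M.actRight ⊗ₘ N.actLeft) := by
    calc
      _ = 𝟙 _ ⊗≫ (M.actRight ▷ 𝟙_ C ≫ M.X ◁ A.copairing) ▷ N.X ⊗≫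
          (M.actRight ⊗ₘ N.actLeft) := by
        rw [bridge]; monoidal
      _ = 𝟙 _ ⊗≫ M.X ◁ A.X ◁ A.copairing ▷ N.X ⊗≫ (M.actRight ▷ A.X ≫ M.actRight) ▷ A.X ▷ N.X ⊗≫
          M.X ◁ N.actLeft := by
        rw [← whisker_exchange, MonoidalCategory.tensorHom_def]; monoidal
      _ = 𝟙 _ ⊗≫ M.X ◁ A.X ◁ A.copairing ▷ N.X ⊗≫
          ((α_ _ _ _).hom ≫ M.X ◁ A.mul ≫ M.actRight) ▷ A.X ▷ N.X ⊗≫ M.X ◁ N.actLeft := by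
        rw [Bimod.right_assoc, Iso.hom_inv_id_assoc]
      _ = _ := by
        rw [MonoidalCategory.tensorHom_def]; monoidal
  have h2 : ((α_ _ _ _).hom ≫ M.X ◁ N.actLeft) ≫ A.bridge M.actRight N.actLeft =
      𝟙 _ ⊗≫ M.X ◁ (A.copairing ▷ A.X ≫ (α_ _ _ _).hom ≫ A.X ◁ A.mul) ▷ N.X ⊗≫
        (M.actRight ⊗ₘ N.actLeft) := by
    calc
      _ = 𝟙 _ ⊗≫ M.X ◁ (𝟙_ C ◁ N.actLeft ≫ A.copairing ▷ N.X) ⊗≫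
          (M.actRight ⊗ₘ N.actLeft) := by
        rw [bridge]; monoidal
      _ = 𝟙 _ ⊗≫ M.X ◁ A.copairing ▷ A.X ▷ N.X ⊗≫ M.X ◁ A.X ◁ (A.X ◁ N.actLeft ≫ N.actLeft) ⊗≫
          M.actRight ▷ N.X := by
        rw [whisker_exchange, MonoidalCategory.tensorHom_def']; monoidal
      _ = 𝟙 _ ⊗≫ M.X ◁ A.copairing ▷ A.X ▷ N.X ⊗≫
          M.X ◁ A.X ◁ ((α_ _ _ _).inv ≫ A.mul ▷ N.X ≫ N.actLeft) ⊗≫ M.actRight ▷ N.X := by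
        rw [Bimod.left_assoc, Iso.inv_hom_id_assoc]
      _ = _ := by
        rw [MonoidalCategory.tensorHom_def']; monoidal
  rw [h1, h2, copairing_mul_left, copairing_mul_right]
  monoidal

variable [RightRigidCategory C] [PivotalCategory C]

/-- The left action on `M*` dual to a right action on `M`. -/
def dualL (r : M ⊗ A.X ⟶ M) : A.X ⊗ Mᘁ ⟶ Mᘁ :=
  𝟙 (A.X ⊗ Mᘁ) ⊗≫ coev' M ▷ A.X ▷ Mᘁ ⊗≫ Mᘁ ◁ r ▷ Mᘁ ⊗≫ Mᘁ ◁ ev' M ⊗≫ 𝟙 Mᘁ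

/-- The right action on `M*` dual to a left action on `M`. -/
def dualR (l : A.X ⊗ M ⟶ M) : Mᘁ ⊗ A.X ⟶ Mᘁ :=
  𝟙 (Mᘁ ⊗ A.X) ⊗≫ Mᘁ ◁ A.X ◁ coev M ⊗≫ Mᘁ ◁ l ▷ Mᘁ ⊗≫ ev M ▷ Mᘁ ⊗≫ 𝟙 Mᘁ

/-- A Frobenius algebra in a pivotal category is symmetric if the two isomorphisms `A ⟶ A*`
given by the pairing `ε ∘ μ` agree. -/
def IsSymmetric : Prop :=
  (𝟙 A.X ⊗≫ A.X ◁ coev A.X ⊗≫ (A.mul ≫ A.counit) ▷ A.Xᘁ ⊗≫ 𝟙 A.Xᘁ : A.X ⟶ A.Xᘁ) =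
    𝟙 A.X ⊗≫ coev' A.X ▷ A.X ⊗≫ A.Xᘁ ◁ (A.mul ≫ A.counit) ⊗≫ 𝟙 A.Xᘁ

end Modules

end FrobeniusAlgebra

/-! ### Relative tensor products -/

section RelTensor

variable {C : Type u₁} [Category.{v₁} C] [MonoidalCategory C] [RightRigidCategory C]
  [PivotalCategory C]

instance tensorLeft_preservesColimits (X : C) :
    PreservesColimitsOfSize.{0, 0} (tensorLeft X) :=
  let _ := PivotalCategory.pairing X
  (tensorLeftAdjunction Xᘁ X).leftAdjoint_preservesColimits

instance tensorRight_preservesColimits (X : C) :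
    PreservesColimitsOfSize.{0, 0} (tensorRight X) :=
  (tensorRightAdjunction X Xᘁ).leftAdjoint_preservesColimits

variable [HasCoequalizers C]

/-- The monoidal category of bimodules over an algebra `A`; the tensor product of `M` and `N` is
the coequalizer `M ⊗_A N` of the two maps `M ⊗ A ⊗ N ⟶ M ⊗ N`, and the unit is `A`. -/
noncomputable instance bimodMonoidal (A : Mon C) : MonoidalCategory (Bimod A A) :=
  letI : Bicategory (Mon C) := Bimod.monBicategory
  inferInstanceAs (MonoidalCategory (EndMonoidal A))

/-- The projection `M ⊗ N ⟶ M ⊗_A N`. -/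
noncomputable def relProj {A : Mon C} (M N : Bimod A A) : M.X ⊗ N.X ⟶ (M ⊗ N).X :=
  coequalizer.π _ _

/-- The morphism `M ⊗_A N ⟶ M ⊗ N` induced by `FrobeniusAlgebra.bridge`; after insertion of
`ψ²` it is a section of the projection. -/
noncomputable def FrobeniusAlgebra.incl (A : FrobeniusAlgebra C) (M N : Bimod A.toMon A.toMon) :
    (M ⊗ N).X ⟶ M.X ⊗ N.X :=
  coequalizer.desc (A.bridge M.actRight N.actLeft) (A.bridge_balanced M N)

end RelTensor

section Functors

variable {C : Type u₁} [Category.{v₁} C] [MonoidalCategory C]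
  {D : Type u₂} [Category.{v₂} D] [MonoidalCategory D] (F : C ⥤ D) [F.LaxMonoidal]

open Functor

/-- The functor on bimodules induced by a lax monoidal functor: the actions on `F(M)` are
`F(λ) ∘ F₂` and `F(ρ) ∘ F₂`. -/
def mapBimod (A : Mon C) : Bimod A A ⥤ Bimod (F.mapMon.obj A) (F.mapMon.obj A) where
  obj M :=
    { X := F.obj M.X
      actLeft := LaxMonoidal.μ F A.X M.X ≫ F.map M.actLeft
      actRight := LaxMonoidal.μ F M.X A.X ≫ F.map M.actRight
      one_actLeft := by
        change (LaxMonoidal.ε F ≫ F.map MonObj.one) ▷ F.obj M.X ≫ LaxMonoidal.μ F A.X M.X ≫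
          F.map M.actLeft = (λ_ (F.obj M.X)).hom
        rw [comp_whiskerRight, Category.assoc, LaxMonoidal.μ_natural_left_assoc, ← F.map_comp,
          Bimod.one_actLeft, LaxMonoidal.left_unitality]
      left_assoc := by
        change (LaxMonoidal.μ F A.X A.X ≫ F.map MonObj.mul) ▷ F.obj M.X ≫
          LaxMonoidal.μ F A.X M.X ≫ F.map M.actLeft = (α_ _ _ _).hom ≫
            F.obj A.X ◁ (LaxMonoidal.μ F A.X M.X ≫ F.map M.actLeft) ≫
              LaxMonoidal.μ F A.X M.X ≫ F.map M.actLeft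
        rw [comp_whiskerRight, Category.assoc, LaxMonoidal.μ_natural_left_assoc, ← F.map_comp,
          Bimod.left_assoc, MonoidalCategory.whiskerLeft_comp, Category.assoc,
          LaxMonoidal.μ_natural_right_assoc, F.map_comp, F.map_comp,
          LaxMonoidal.associativity_assoc]
      actRight_one := by
        change F.obj M.X ◁ (LaxMonoidal.ε F ≫ F.map MonObj.one) ≫ LaxMonoidal.μ F M.X A.X ≫
          F.map M.actRight = (ρ_ (F.obj M.X)).hom
        rw [MonoidalCategory.whiskerLeft_comp, Category.assoc, LaxMonoidal.μ_natural_right_assoc,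
          ← F.map_comp, Bimod.actRight_one, LaxMonoidal.right_unitality]
      right_assoc := by
        change F.obj M.X ◁ (LaxMonoidal.μ F A.X A.X ≫ F.map MonObj.mul) ≫
          LaxMonoidal.μ F M.X A.X ≫ F.map M.actRight = (α_ _ _ _).inv ≫
            (LaxMonoidal.μ F M.X A.X ≫ F.map M.actRight) ▷ F.obj A.X ≫
              LaxMonoidal.μ F M.X A.X ≫ F.map M.actRight
        rw [MonoidalCategory.whiskerLeft_comp, Category.assoc, LaxMonoidal.μ_natural_right_assoc,
          ← F.map_comp, Bimod.right_assoc, comp_whiskerRight, Category.assoc,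
          LaxMonoidal.μ_natural_left_assoc, F.map_comp, F.map_comp,
          LaxMonoidal.associativity_inv_assoc]
      middle_assoc := by
        change (LaxMonoidal.μ F A.X M.X ≫ F.map M.actLeft) ▷ F.obj A.X ≫
          LaxMonoidal.μ F M.X A.X ≫ F.map M.actRight = (α_ _ _ _).hom ≫
            F.obj A.X ◁ (LaxMonoidal.μ F M.X A.X ≫ F.map M.actRight) ≫
              LaxMonoidal.μ F A.X M.X ≫ F.map M.actLeft
        rw [comp_whiskerRight, Category.assoc, LaxMonoidal.μ_natural_left_assoc, ← F.map_comp,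
          Bimod.middle_assoc, MonoidalCategory.whiskerLeft_comp, Category.assoc,
          LaxMonoidal.μ_natural_right_assoc, F.map_comp, F.map_comp,
          LaxMonoidal.associativity_assoc] }
  map f :=
    { hom := F.map f.hom
      left_act_hom := by
        change (LaxMonoidal.μ F A.X _ ≫ F.map _) ≫ F.map f.hom = F.obj A.X ◁ F.map f.hom ≫
          LaxMonoidal.μ F A.X _ ≫ F.map _
        rw [LaxMonoidal.μ_natural_right_assoc, Category.assoc, ← F.map_comp, ← F.map_comp,
          Bimod.Hom.left_act_hom]
      right_act_hom := by
        change (LaxMonoidal.μ F _ A.X ≫ F.map _) ≫ F.map f.hom = F.map f.hom ▷ F.obj A.X ≫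
          LaxMonoidal.μ F _ A.X ≫ F.map _
        rw [LaxMonoidal.μ_natural_left_assoc, Category.assoc, ← F.map_comp, ← F.map_comp,
          Bimod.Hom.right_act_hom] }

variable [F.OplaxMonoidal]

/-- The Frobenius relations between the structure morphisms `F₂`, `F̄₂` of a functor. -/
structure IsFrobenius : Prop where
  left (X Y Z : C) :
    LaxMonoidal.μ F (X ⊗ Y) Z ≫ F.map (α_ X Y Z).hom ≫ OplaxMonoidal.δ F X (Y ⊗ Z) =
      OplaxMonoidal.δ F X Y ▷ F.obj Z ≫ (α_ _ _ _).hom ≫ F.obj X ◁ LaxMonoidal.μ F Y Z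
  right (X Y Z : C) :
    LaxMonoidal.μ F X (Y ⊗ Z) ≫ F.map (α_ X Y Z).inv ≫ OplaxMonoidal.δ F (X ⊗ Y) Z =
      F.obj X ◁ OplaxMonoidal.δ F Y Z ≫ (α_ _ _ _).inv ≫ LaxMonoidal.μ F X Y ▷ F.obj Z

variable {F}

/-- The image of a Frobenius algebra under a Frobenius functor. -/
@[reducible]
def IsFrobenius.mapAlgebra (hF : IsFrobenius F) (A : FrobeniusAlgebra C) :
    FrobeniusAlgebra D where
  toMon := F.mapMon.obj A.toMon
  comul := F.map A.comul ≫ OplaxMonoidal.δ F A.X A.X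
  counit := F.map A.counit ≫ OplaxMonoidal.η F
  counit_comul := by
    change (F.map A.comul ≫ OplaxMonoidal.δ F A.X A.X) ≫
      (F.map A.counit ≫ OplaxMonoidal.η F) ▷ F.obj A.X = (λ_ (F.obj A.X)).inv
    rw [comp_whiskerRight, Category.assoc, OplaxMonoidal.δ_natural_left_assoc,
      OplaxMonoidal.left_unitality, ← F.map_comp_assoc, A.counit_comul]
  comul_counit := by
    change (F.map A.comul ≫ OplaxMonoidal.δ F A.X A.X) ≫
      F.obj A.X ◁ (F.map A.counit ≫ OplaxMonoidal.η F) = (ρ_ (F.obj A.X)).inv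
    rw [MonoidalCategory.whiskerLeft_comp, Category.assoc, OplaxMonoidal.δ_natural_right_assoc,
      OplaxMonoidal.right_unitality, ← F.map_comp_assoc, A.comul_counit]
  comul_assoc := by
    change (F.map A.comul ≫ OplaxMonoidal.δ F A.X A.X) ≫
      F.obj A.X ◁ (F.map A.comul ≫ OplaxMonoidal.δ F A.X A.X) =
        (F.map A.comul ≫ OplaxMonoidal.δ F A.X A.X) ≫
          (F.map A.comul ≫ OplaxMonoidal.δ F A.X A.X) ▷ F.obj A.X ≫ (α_ _ _ _).hom
    simp_rw [comp_whiskerRight, Category.assoc, OplaxMonoidal.δ_natural_left_assoc,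
      MonoidalCategory.whiskerLeft_comp, OplaxMonoidal.δ_natural_right_assoc,
      ← F.map_comp_assoc, A.comul_assoc, F.map_comp, Category.assoc, OplaxMonoidal.associativity]
  frobenius_left := by
    change (F.map A.comul ≫ OplaxMonoidal.δ F A.X A.X) ▷ F.obj A.X ≫ (α_ _ _ _).hom ≫
      F.obj A.X ◁ (LaxMonoidal.μ F A.X A.X ≫ F.map MonObj.mul) =
        (LaxMonoidal.μ F A.X A.X ≫ F.map MonObj.mul) ≫ F.map A.comul ≫ OplaxMonoidal.δ F A.X A.X
    have h := hF.left A.X A.X A.X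
    rw [comp_whiskerRight, MonoidalCategory.whiskerLeft_comp, Category.assoc, ← reassoc_of% h,
      LaxMonoidal.μ_natural_left_assoc, OplaxMonoidal.δ_natural_right, Category.assoc,
      ← F.map_comp_assoc, ← F.map_comp_assoc, ← F.map_comp_assoc, Category.assoc, A.frobenius_left]
  frobenius_right := by
    change F.obj A.X ◁ (F.map A.comul ≫ OplaxMonoidal.δ F A.X A.X) ≫ (α_ _ _ _).inv ≫
      (LaxMonoidal.μ F A.X A.X ≫ F.map MonObj.mul) ▷ F.obj A.X =
        (LaxMonoidal.μ F A.X A.X ≫ F.map MonObj.mul) ≫ F.map A.comul ≫ OplaxMonoidal.δ F A.X A.X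
    have h := hF.right A.X A.X A.X
    rw [comp_whiskerRight, MonoidalCategory.whiskerLeft_comp, Category.assoc, ← reassoc_of% h,
      LaxMonoidal.μ_natural_right_assoc, OplaxMonoidal.δ_natural_left, Category.assoc,
      ← F.map_comp_assoc, ← F.map_comp_assoc, ← F.map_comp_assoc, Category.assoc, A.frobenius_right]

end Functors

/-! ### Orbifold data -/

/-- The labels of the two right actions on `T`. -/
inductive Leg
  | one
  | two

section OrbifoldData

/-- The tuple `(A, T, α, ᾱ, ψ, φ)` underlying an orbifold datum, with the left action and the two
right actions of `A` on `T`. The morphisms `α : T ⊗₂ T ⟶ T ⊗₁ T` and `ᾱ : T ⊗₁ T ⟶ T ⊗₂ T` between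
relative tensor products are given by the corresponding balanced maps, i.e. they are precomposed
with the projection from and composed with the morphism induced by `FrobeniusAlgebra.bridge`
into the tensor product `T ⊗ T`. -/
structure OrbData (k : Type w) (C : Type u₁) [Category.{v₁} C] [MonoidalCategory C] where
  /-- the algebra -/
  A : FrobeniusAlgebra C
  /-- the object `T` -/
  T : C
  /-- the left action -/
  act₀ : A.X ⊗ T ⟶ T
  /-- the two right actions -/
  act (i : Leg) : T ⊗ A.X ⟶ T
  /-- the balanced map of `α` -/
  α : T ⊗ T ⟶ T ⊗ T
  /-- the balanced map of the inverse of `α` -/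
  αbar : T ⊗ T ⟶ T ⊗ T
  /-- the section of `A` -/
  ψ : 𝟙_ C ⟶ A.X
  /-- the scalar -/
  φ : k

variable {k : Type w} {C : Type u₁} [Category.{v₁} C] [MonoidalCategory C]

/-- The braiding used to move an object `Y` past an object `X`, where `X` is attached to the
right action `i` of `T` and `Y` is attached to the other right action. -/
def exch [BraidedCategory C] : (i : Leg) → (X Y : C) → (X ⊗ Y ⟶ Y ⊗ X)
  | .one, X, Y => (β_ Y X).inv
  | .two, X, Y => (β_ X Y).hom

/-- The other leg. -/
def Leg.other : Leg → Leg
  | .one => .two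
  | .two => .one

namespace OrbData

section Raw

variable (𝔸 : OrbData k C)

/-- The insertion of `ψ²` along the left action on `T`. -/
def ins₀ : 𝔸.T ⟶ 𝔸.T := 𝔸.A.insL (𝔸.A.sq 𝔸.ψ) 𝔸.act₀

/-- The insertion of `ψ²` along the right action `i` on `T`. -/
def ins (i : Leg) : 𝔸.T ⟶ 𝔸.T := 𝔸.A.insR (𝔸.A.sq 𝔸.ψ) (𝔸.act i)

/-- The coaction induced by the left action on `T`. -/
def coact₀ : 𝔸.T ⟶ 𝔸.A.X ⊗ 𝔸.T := 𝔸.A.coactL 𝔸.act₀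

/-- The coaction induced by the right action `i` on `T`. -/
def coact (i : Leg) : 𝔸.T ⟶ 𝔸.T ⊗ 𝔸.A.X := 𝔸.A.coactR (𝔸.act i)

variable [RightRigidCategory C] [PivotalCategory C]

/-- The endomorphism of `A` given by a `T`-loop carrying `ψ₁²ψ₂²`, attached to `A` by the left
action and coaction on `T`. -/
def loop₀ : 𝔸.A.X ⟶ 𝔸.A.X :=
  rightTrace 𝔸.T (𝔸.act₀ ≫ 𝔸.ins .one ≫ 𝔸.ins .two ≫ 𝔸.coact₀)

/-- The endomorphism of `A` given by a `T`-loop carrying the squares of `ψ` for the other two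
actions, attached to `A` by the right action `i` on `T` and its coaction. -/
def loop (i : Leg) : 𝔸.A.X ⟶ 𝔸.A.X :=
  leftTrace 𝔸.T (𝔸.act i ≫ 𝔸.ins₀ ≫ 𝔸.ins i.other ≫ 𝔸.coact i)

/-- The condition on the three `T`-loops. -/
def LoopCondition [Field k] [Preadditive C] [Linear k C] : Prop :=
  𝔸.loop₀ = (𝔸.φ ^ 2)⁻¹ • 𝟙 𝔸.A.X ∧ ∀ i, 𝔸.loop i = (𝔸.φ ^ 2)⁻¹ • 𝟙 𝔸.A.X

/-- The balanced map `T ⊗ T* ⟶ T* ⊗ T` obtained by rotating `α`. -/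
def rotα : 𝔸.T ⊗ 𝔸.Tᘁ ⟶ 𝔸.Tᘁ ⊗ 𝔸.T :=
  𝟙 _ ⊗≫ coev' 𝔸.T ▷ 𝔸.T ▷ 𝔸.Tᘁ ⊗≫ 𝔸.Tᘁ ◁ 𝔸.α ▷ 𝔸.Tᘁ ⊗≫ (𝔸.Tᘁ ⊗ 𝔸.T) ◁ ev' 𝔸.T ⊗≫ 𝟙 _

/-- The balanced map `T* ⊗ T ⟶ T ⊗ T*` obtained by rotating `ᾱ`. -/
def rotαbar : 𝔸.Tᘁ ⊗ 𝔸.T ⟶ 𝔸.T ⊗ 𝔸.Tᘁ :=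
  𝟙 _ ⊗≫ (𝔸.Tᘁ ⊗ 𝔸.T) ◁ coev 𝔸.T ⊗≫ 𝔸.Tᘁ ◁ 𝔸.αbar ▷ 𝔸.Tᘁ ⊗≫ ev 𝔸.T ▷ 𝔸.T ▷ 𝔸.Tᘁ ⊗≫ 𝟙 _

variable [BraidedCategory C]

/-- The balanced map `T ⊗ T* ⟶ T ⊗ T*` obtained from `α` by exchanging and bending the second
tensor factors. -/
def bendα : 𝔸.T ⊗ 𝔸.Tᘁ ⟶ 𝔸.T ⊗ 𝔸.Tᘁ :=
  𝟙 _ ⊗≫ (𝔸.T ⊗ 𝔸.Tᘁ) ◁ coev 𝔸.T ⊗≫ 𝔸.T ◁ exch .one 𝔸.Tᘁ 𝔸.T ▷ 𝔸.Tᘁ ⊗≫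
    𝔸.α ▷ (𝔸.Tᘁ ⊗ 𝔸.Tᘁ) ⊗≫ 𝔸.T ◁ ev' 𝔸.T ▷ 𝔸.Tᘁ ⊗≫ 𝟙 _

/-- The balanced map `T ⊗ T* ⟶ T ⊗ T*` obtained from `ᾱ` by exchanging and bending the second
tensor factors. -/
def bendαbar : 𝔸.T ⊗ 𝔸.Tᘁ ⟶ 𝔸.T ⊗ 𝔸.Tᘁ :=
  𝟙 _ ⊗≫ (𝔸.T ⊗ 𝔸.Tᘁ) ◁ coev 𝔸.T ⊗≫ 𝔸.T ◁ exch .two 𝔸.Tᘁ 𝔸.T ▷ 𝔸.Tᘁ ⊗≫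
    𝔸.αbar ▷ (𝔸.Tᘁ ⊗ 𝔸.Tᘁ) ⊗≫ 𝔸.T ◁ ev' 𝔸.T ▷ 𝔸.Tᘁ ⊗≫ 𝟙 _

end Raw

variable [RightRigidCategory C] [PivotalCategory C] [BraidedCategory C]
  [Field k] [Preadditive C] [Linear k C]

open Leg

/-- Orbifold data. -/
structure IsOrbifoldDatum (𝔸 : OrbData k C) : Prop where
  -- `(A, ψ)` is a symmetric separable Frobenius algebra
  symmetric : 𝔸.A.IsSymmetric
  isSection : 𝔸.A.IsSection 𝔸.ψ
  invertible : 𝔸.A.IsInvertible 𝔸.ψ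
  -- `T` is an `A`-`A ⊗ A`-bimodule
  act₀_one : 𝔸.A.one ▷ 𝔸.T ≫ 𝔸.act₀ = (λ_ 𝔸.T).hom
  act₀_mul : 𝔸.A.mul ▷ 𝔸.T ≫ 𝔸.act₀ = 𝟙 _ ⊗≫ 𝔸.A.X ◁ 𝔸.act₀ ≫ 𝔸.act₀
  act_one (i : Leg) : 𝔸.T ◁ 𝔸.A.one ≫ 𝔸.act i = (ρ_ 𝔸.T).hom
  act_mul (i : Leg) : 𝔸.T ◁ 𝔸.A.mul ≫ 𝔸.act i = 𝟙 _ ⊗≫ 𝔸.act i ▷ 𝔸.A.X ≫ 𝔸.act i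
  act₀_act (i : Leg) :
    𝔸.act₀ ▷ 𝔸.A.X ≫ 𝔸.act i = 𝟙 _ ⊗≫ 𝔸.A.X ◁ 𝔸.act i ≫ 𝔸.act₀
  act_act : 𝔸.act two ▷ 𝔸.A.X ≫ 𝔸.act one =
    𝟙 _ ⊗≫ 𝔸.T ◁ exch two 𝔸.A.X 𝔸.A.X ⊗≫ 𝔸.act one ▷ 𝔸.A.X ≫ 𝔸.act two
  -- `α` is the balanced map of an `A`-`A ⊗ A ⊗ A`-bimodule morphism `T ⊗₂ T ⟶ T ⊗₁ T`
  α_balanced : 𝔸.act two ▷ 𝔸.T ≫ 𝔸.α = 𝟙 _ ⊗≫ 𝔸.T ◁ 𝔸.act₀ ≫ 𝔸.α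
  α_cobalanced : 𝔸.α ≫ 𝔸.coact one ▷ 𝔸.T = 𝔸.α ≫ 𝔸.T ◁ 𝔸.coact₀ ⊗≫ 𝟙 _
  α_act₀ : 𝔸.act₀ ▷ 𝔸.T ≫ 𝔸.α = 𝟙 _ ⊗≫ 𝔸.A.X ◁ 𝔸.α ⊗≫ 𝔸.act₀ ▷ 𝔸.T
  α_act_first : 𝔸.T ◁ exch two 𝔸.T 𝔸.A.X ⊗≫ 𝔸.act one ▷ 𝔸.T ≫ 𝔸.α =
    𝟙 _ ⊗≫ 𝔸.α ▷ 𝔸.A.X ⊗≫ 𝔸.T ◁ 𝔸.act one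
  α_act_second : 𝔸.T ◁ 𝔸.act one ≫ 𝔸.α = 𝟙 _ ⊗≫ 𝔸.α ▷ 𝔸.A.X ⊗≫ 𝔸.T ◁ 𝔸.act two
  α_act_third : 𝔸.T ◁ 𝔸.act two ≫ 𝔸.α =
    𝟙 _ ⊗≫ 𝔸.α ▷ 𝔸.A.X ⊗≫ 𝔸.T ◁ exch one 𝔸.T 𝔸.A.X ⊗≫ 𝔸.act two ▷ 𝔸.T
  -- `ᾱ` is the balanced map of an `A`-`A ⊗ A ⊗ A`-bimodule morphism `T ⊗₁ T ⟶ T ⊗₂ T`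
  αbar_balanced : 𝔸.act one ▷ 𝔸.T ≫ 𝔸.αbar = 𝟙 _ ⊗≫ 𝔸.T ◁ 𝔸.act₀ ≫ 𝔸.αbar
  αbar_cobalanced : 𝔸.αbar ≫ 𝔸.coact two ▷ 𝔸.T = 𝔸.αbar ≫ 𝔸.T ◁ 𝔸.coact₀ ⊗≫ 𝟙 _
  αbar_act₀ : 𝔸.act₀ ▷ 𝔸.T ≫ 𝔸.αbar = 𝟙 _ ⊗≫ 𝔸.A.X ◁ 𝔸.αbar ⊗≫ 𝔸.act₀ ▷ 𝔸.T
  αbar_act_first : 𝔸.T ◁ 𝔸.act one ≫ 𝔸.αbar =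
    𝟙 _ ⊗≫ 𝔸.αbar ▷ 𝔸.A.X ⊗≫ 𝔸.T ◁ exch two 𝔸.T 𝔸.A.X ⊗≫ 𝔸.act one ▷ 𝔸.T
  αbar_act_second : 𝔸.T ◁ 𝔸.act two ≫ 𝔸.αbar =
    𝟙 _ ⊗≫ 𝔸.αbar ▷ 𝔸.A.X ⊗≫ 𝔸.T ◁ 𝔸.act one
  αbar_act_third : 𝔸.T ◁ exch one 𝔸.T 𝔸.A.X ⊗≫ 𝔸.act two ▷ 𝔸.T ≫ 𝔸.αbar =
    𝟙 _ ⊗≫ 𝔸.αbar ▷ 𝔸.A.X ⊗≫ 𝔸.T ◁ 𝔸.act two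
  -- the pentagon condition
  O1 : 𝔸.T ◁ 𝔸.α ⊗≫ 𝔸.T ◁ 𝔸.ins one ▷ 𝔸.T ⊗≫ 𝔸.α ▷ 𝔸.T ⊗≫ 𝔸.T ◁ 𝔸.α =
    𝟙 _ ⊗≫ 𝔸.α ▷ 𝔸.T ⊗≫ 𝔸.T ◁ exch one 𝔸.T 𝔸.T ⊗≫ 𝔸.α ▷ 𝔸.T ⊗≫ 𝟙 _
  -- `α` and `ᾱ` are inverse to each other
  O2 : 𝔸.αbar ≫ 𝔸.ins two ▷ 𝔸.T ≫ 𝔸.α = 𝔸.A.bridge (𝔸.act one) 𝔸.act₀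
  O3 : 𝔸.α ≫ 𝔸.ins one ▷ 𝔸.T ≫ 𝔸.αbar = 𝔸.A.bridge (𝔸.act two) 𝔸.act₀
  -- the same for the bent versions
  O4 : 𝔸.bendα ≫ 𝔸.ins two ▷ 𝔸.Tᘁ ≫ 𝔸.bendαbar =
    𝔸.A.bridge (𝔸.act one) (𝔸.A.dualL (𝔸.act one))
  O5 : 𝔸.bendαbar ≫ 𝔸.ins one ▷ 𝔸.Tᘁ ≫ 𝔸.bendα =
    𝔸.A.bridge (𝔸.act two) (𝔸.A.dualL (𝔸.act two))
  O6 : 𝔸.rotα ≫ 𝔸.Tᘁ ◁ 𝔸.ins₀ ≫ 𝔸.rotαbar =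
    𝔸.A.bridge (𝔸.act one) (𝔸.A.dualL (𝔸.act two))
  O7 : 𝔸.rotαbar ≫ 𝔸.ins one ▷ 𝔸.Tᘁ ≫ 𝔸.rotα =
    𝔸.A.bridge (𝔸.A.dualR 𝔸.act₀) 𝔸.act₀
  φ_ne_zero : 𝔸.φ ≠ 0
  O8 : 𝔸.LoopCondition

end OrbData

end OrbifoldData

/-! ### The categories of bimodules with crossings -/

section Crossings

variable {k : Type w} {C : Type u₁} [Category.{v₁} C] [MonoidalCategory C]

/-- A bimodule `M` with morphisms `τ i`, `τbar i` for all `i` in a set `J ⊆ {1, 2}`. The morphisms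
`τ i : M ⊗₀ T ⟶ T ⊗ᵢ M` and `τbar i : T ⊗ᵢ M ⟶ M ⊗₀ T` between relative tensor products are given
by the corresponding balanced maps. -/
structure PreObj (𝔸 : OrbData k C) (J : Set Leg) where
  /-- the bimodule -/
  M : Bimod 𝔸.A.toMon 𝔸.A.toMon
  /-- the balanced map of the crossing -/
  τ (i : J) : M.X ⊗ 𝔸.T ⟶ 𝔸.T ⊗ M.X
  /-- the balanced map of the inverse of the crossing -/
  τbar (i : J) : 𝔸.T ⊗ M.X ⟶ M.X ⊗ 𝔸.T

namespace PreObj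

variable {𝔸 : OrbData k C} {J : Set Leg}

/-- Morphisms are the bimodule morphisms commuting with the `τ i`. -/
@[ext]
structure Hom (M N : PreObj 𝔸 J) where
  /-- the bimodule morphism -/
  hom : M.M ⟶ N.M
  comm (i : J) : hom.hom ▷ 𝔸.T ≫ N.τ i = M.τ i ≫ 𝔸.T ◁ hom.hom

instance : Category (PreObj 𝔸 J) where
  Hom M N := Hom M N
  id M := { hom := 𝟙 M.M, comm := fun i => by simp }
  comp f g :=
    { hom := f.hom ≫ g.hom
      comm := fun i => by simp [g.comm i, reassoc_of% f.comm i] }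
  id_comp f := Hom.ext (Category.id_comp f.hom)
  comp_id f := Hom.ext (Category.comp_id f.hom)
  assoc f g h := Hom.ext (Category.assoc f.hom g.hom h.hom)

variable (M N : PreObj 𝔸 J)

/-- The insertion of `ψ²` along the right action on `M`. -/
def insR : M.M.X ⟶ M.M.X := 𝔸.A.insR (𝔸.A.sq 𝔸.ψ) M.M.actRight

section Pivotal

variable [RightRigidCategory C] [PivotalCategory C]

/-- The crossing `τ i` of the dual `M*`. -/
def dualτ (i : J) : M.M.Xᘁ ⊗ 𝔸.T ⟶ 𝔸.T ⊗ M.M.Xᘁ :=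
  𝟙 _ ⊗≫ (M.M.Xᘁ ⊗ 𝔸.T) ◁ coev M.M.X ⊗≫ M.M.Xᘁ ◁ M.τbar i ▷ M.M.Xᘁ ⊗≫
    ev M.M.X ▷ 𝔸.T ▷ M.M.Xᘁ ⊗≫ 𝟙 _

/-- The inverse crossing `τbar i` of the dual `M*`. -/
def dualτbar (i : J) : 𝔸.T ⊗ M.M.Xᘁ ⟶ M.M.Xᘁ ⊗ 𝔸.T :=
  𝟙 _ ⊗≫ coev' M.M.X ▷ 𝔸.T ▷ M.M.Xᘁ ⊗≫ M.M.Xᘁ ◁ M.τ i ▷ M.M.Xᘁ ⊗≫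
    (M.M.Xᘁ ⊗ 𝔸.T) ◁ ev' M.M.X ⊗≫ 𝟙 _

open Leg

/-- The conditions on the morphisms `τ i`, `τbar i` of an object: they are the balanced maps of
mutually inverse `A`-`A ⊗ A`-bimodule morphisms, compatible with `α` and invertible after
dualising `M`. -/
structure IsCrossing [BraidedCategory C] : Prop where
  τ_balanced (i : J) : M.M.actRight ▷ 𝔸.T ≫ M.τ i = 𝟙 _ ⊗≫ M.M.X ◁ 𝔸.act₀ ≫ M.τ i
  τ_cobalanced (i : J) : M.τ i ≫ 𝔸.coact i ▷ M.M.X =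
    M.τ i ≫ 𝔸.T ◁ 𝔸.A.coactL M.M.actLeft ⊗≫ 𝟙 _
  τ_left (i : J) : M.M.actLeft ▷ 𝔸.T ≫ M.τ i = 𝟙 _ ⊗≫ 𝔸.A.X ◁ M.τ i ⊗≫ 𝔸.act₀ ▷ M.M.X
  τ_right (i : J) : M.M.X ◁ 𝔸.act i ≫ M.τ i =
    𝟙 _ ⊗≫ M.τ i ▷ 𝔸.A.X ⊗≫ 𝔸.T ◁ M.M.actRight
  τ_right_other (i : J) : M.M.X ◁ 𝔸.act (other i) ≫ M.τ i =
    𝟙 _ ⊗≫ M.τ i ▷ 𝔸.A.X ⊗≫ 𝔸.T ◁ exch i M.M.X 𝔸.A.X ⊗≫ 𝔸.act (other i) ▷ M.M.X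
  τbar_balanced (i : J) : 𝔸.act i ▷ M.M.X ≫ M.τbar i =
    𝟙 _ ⊗≫ 𝔸.T ◁ M.M.actLeft ≫ M.τbar i
  τbar_cobalanced (i : J) : M.τbar i ≫ 𝔸.A.coactR M.M.actRight ▷ 𝔸.T =
    M.τbar i ≫ M.M.X ◁ 𝔸.coact₀ ⊗≫ 𝟙 _
  τbar_left (i : J) : 𝔸.act₀ ▷ M.M.X ≫ M.τbar i =
    𝟙 _ ⊗≫ 𝔸.A.X ◁ M.τbar i ⊗≫ M.M.actLeft ▷ 𝔸.T
  τbar_right (i : J) : 𝔸.T ◁ M.M.actRight ≫ M.τbar i =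
    𝟙 _ ⊗≫ M.τbar i ▷ 𝔸.A.X ⊗≫ M.M.X ◁ 𝔸.act i
  τbar_right_other (i : J) :
    𝔸.T ◁ exch i M.M.X 𝔸.A.X ⊗≫ 𝔸.act (other i) ▷ M.M.X ≫ M.τbar i =
      𝟙 _ ⊗≫ M.τbar i ▷ 𝔸.A.X ⊗≫ M.M.X ◁ 𝔸.act (other i)
  T1 (h : one ∈ J) :
    M.M.X ◁ 𝔸.α ⊗≫ M.τ ⟨one, h⟩ ▷ 𝔸.T ⊗≫ 𝔸.T ◁ M.insR ▷ 𝔸.T ⊗≫ 𝔸.T ◁ M.τ ⟨one, h⟩ =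
      𝟙 _ ⊗≫ M.τ ⟨one, h⟩ ▷ 𝔸.T ⊗≫ 𝔸.T ◁ exch one M.M.X 𝔸.T ⊗≫ 𝔸.α ▷ M.M.X ⊗≫ 𝟙 _
  T2 (h₁ : one ∈ J) (h₂ : two ∈ J) :
    M.M.X ◁ 𝔸.α ⊗≫ M.τ ⟨one, h₁⟩ ▷ 𝔸.T ⊗≫ 𝔸.T ◁ M.insR ▷ 𝔸.T ⊗≫ 𝔸.T ◁ M.τ ⟨two, h₂⟩ =
      𝟙 _ ⊗≫ M.τ ⟨two, h₂⟩ ▷ 𝔸.T ⊗≫ 𝔸.T ◁ M.τ ⟨one, h₁⟩ ⊗≫ 𝔸.ins two ▷ 𝔸.T ▷ M.M.X ⊗≫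
        𝔸.α ▷ M.M.X ⊗≫ 𝟙 _
  T3 (h : two ∈ J) :
    M.M.X ◁ 𝔸.α ⊗≫ M.τ ⟨two, h⟩ ▷ 𝔸.T ⊗≫ 𝔸.T ◁ exch two M.M.X 𝔸.T =
      𝟙 _ ⊗≫ M.τ ⟨two, h⟩ ▷ 𝔸.T ⊗≫ 𝔸.T ◁ M.τ ⟨two, h⟩ ⊗≫ 𝔸.ins two ▷ 𝔸.T ▷ M.M.X ⊗≫
        𝔸.α ▷ M.M.X ⊗≫ 𝟙 _
  T4 (i : J) : M.τbar i ≫ M.insR ▷ 𝔸.T ≫ M.τ i = 𝔸.A.bridge (𝔸.act i) M.M.actLeft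
  T5 (i : J) : M.τ i ≫ 𝔸.ins i ▷ M.M.X ≫ M.τbar i = 𝔸.A.bridge M.M.actRight 𝔸.act₀
  T6 (i : J) : M.dualτ i ≫ 𝔸.ins i ▷ M.M.Xᘁ ≫ M.dualτbar i =
    𝔸.A.bridge (𝔸.A.dualR M.M.actLeft) 𝔸.act₀
  T7 (i : J) : M.dualτbar i ≫ M.M.Xᘁ ◁ 𝔸.ins₀ ≫ M.dualτ i =
    𝔸.A.bridge (𝔸.act i) (𝔸.A.dualL M.M.actRight)

end Pivotal

end PreObj

variable [RightRigidCategory C] [PivotalCategory C] [BraidedCategory C]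

/-- The category of bimodules with `T`-crossings labelled by the elements of `J`. -/
abbrev CrossingCat (𝔸 : OrbData k C) (J : Set Leg) :=
  ObjectProperty.FullSubcategory fun M : PreObj 𝔸 J => M.IsCrossing

namespace PreObj

variable {𝔸 : OrbData k C} {J : Set Leg} [HasCoequalizers C]

/-- The tensor product over `A`, with its crossings. -/
noncomputable def tensor (M N : PreObj 𝔸 J) : PreObj 𝔸 J where
  M := M.M ⊗ N.M
  τ i := (𝔸.A.incl M.M N.M ≫ M.insR ▷ N.M.X) ▷ 𝔸.T ⊗≫ M.M.X ◁ N.τ i ⊗≫ M.τ i ▷ N.M.X ⊗≫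
    𝔸.T ◁ (M.insR ▷ N.M.X ≫ relProj M.M N.M)
  τbar i := 𝔸.T ◁ (𝔸.A.incl M.M N.M ≫ M.insR ▷ N.M.X) ⊗≫ M.τbar i ▷ N.M.X ⊗≫
    M.M.X ◁ N.τbar i ⊗≫ (M.insR ▷ N.M.X ≫ relProj M.M N.M) ▷ 𝔸.T

variable (𝔸 J) in
/-- The tensor unit `A`, with its crossings. -/
noncomputable def unit : PreObj 𝔸 J where
  M := 𝟙_ (Bimod 𝔸.A.toMon 𝔸.A.toMon)
  τ i := 𝔸.act₀ ≫ 𝔸.coact i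
  τbar i := 𝔸.act i ≫ 𝔸.coact₀

variable [Field k] [Preadditive C] [Linear k C] (M N : PreObj 𝔸 Set.univ)

open Leg

/-- The balanced map `M ⊗ N ⟶ N ⊗ M` of the braiding. -/
noncomputable def braidBalanced : M.M.X ⊗ N.M.X ⟶ N.M.X ⊗ M.M.X :=
  𝔸.φ ^ 2 • rightTrace 𝔸.T
    (𝟙 _ ⊗≫ (M.M.X ⊗ N.M.X) ◁ (𝔸.ins one ≫ 𝔸.ins two) ⊗≫
      M.M.X ◁ N.τ ⟨one, Set.mem_univ _⟩ ⊗≫ M.τ ⟨two, Set.mem_univ _⟩ ▷ N.M.X ⊗≫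
      (𝔸.ins one ≫ 𝔸.ins two) ▷ M.M.X ▷ N.M.X ⊗≫ 𝔸.T ◁ (β_ M.M.X N.M.X).hom ⊗≫
      N.τbar ⟨one, Set.mem_univ _⟩ ▷ M.M.X ⊗≫ N.M.X ◁ M.τbar ⟨two, Set.mem_univ _⟩ ⊗≫ 𝟙 _)

/-- The braiding `M ⊗_A N ⟶ N ⊗_A M`, as a morphism of the underlying objects. -/
noncomputable def braid : (M.M ⊗ N.M).X ⟶ (N.M ⊗ M.M).X :=
  𝔸.A.incl M.M N.M ≫ M.insR ▷ N.M.X ≫ M.braidBalanced N ≫ N.insR ▷ M.M.X ≫ relProj N.M M.M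

/-- The twist of `M`, as an endomorphism of the underlying object: the right partial trace over
`M`, relative to `A`, of the braiding of `M` with itself. -/
noncomputable def relTwist : M.M.X ⟶ M.M.X :=
  rightTrace M.M.X (M.M.X ◁ M.insR ≫ M.braidBalanced M)

end PreObj

section Dual

variable (A : FrobeniusAlgebra C) (M : Bimod A.toMon A.toMon)

/-- The evaluation `M* ⊗ M ⟶ A` relative to `A`, as a balanced map. -/
def FrobeniusAlgebra.relEv : M.Xᘁ ⊗ M.X ⟶ A.X :=
  M.Xᘁ ◁ A.coactR M.actRight ⊗≫ ev M.X ▷ A.X ⊗≫ 𝟙 _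

/-- The second evaluation `M ⊗ M* ⟶ A` relative to `A`, as a balanced map. -/
def FrobeniusAlgebra.relEv' : M.X ⊗ M.Xᘁ ⟶ A.X :=
  A.coactL M.actLeft ▷ M.Xᘁ ⊗≫ A.X ◁ ev' M.X ⊗≫ 𝟙 _

end Dual

end Crossings

/-! ### Transport along a ribbon Frobenius functor -/

section Transport

variable {k : Type w} {C : Type u₁} [Category.{v₁} C] [MonoidalCategory C]
  {D : Type u₂} [Category.{v₂} D] [MonoidalCategory D]

open Functor.LaxMonoidal Functor.OplaxMonoidal

variable {F : C ⥤ D} [F.LaxMonoidal] [F.OplaxMonoidal]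

/-- The transport `(F(A), F(T), α^F, ᾱ^F, ψ', φ')` of `𝔸` along `F`. -/
@[reducible]
def OrbData.transport (𝔸 : OrbData k C) (hF : IsFrobenius F)
    (ψ' : 𝟙_ D ⟶ F.obj 𝔸.A.X) (φ' : k) : OrbData k D where
  A := hF.mapAlgebra 𝔸.A
  T := F.obj 𝔸.T
  act₀ := μ F 𝔸.A.X 𝔸.T ≫ F.map 𝔸.act₀
  act i := μ F 𝔸.T 𝔸.A.X ≫ F.map (𝔸.act i)
  α := μ F 𝔸.T 𝔸.T ≫ F.map 𝔸.α ≫ δ F 𝔸.T 𝔸.T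
  αbar := μ F 𝔸.T 𝔸.T ≫ F.map 𝔸.αbar ≫ δ F 𝔸.T 𝔸.T
  ψ := ψ'
  φ := φ'

/-- The functor `M ↦ (F(M), τ^F, τbar^F)` on bimodules with (not necessarily well-behaved)
crossings, given on morphisms by `F`. -/
def PreObj.transport (𝔸 : OrbData k C) (J : Set Leg) (hF : IsFrobenius F)
    (ψ' : 𝟙_ D ⟶ F.obj 𝔸.A.X) (φ' : k) :
    PreObj 𝔸 J ⥤ PreObj (𝔸.transport hF ψ' φ') J where
  obj M :=
    { M := (mapBimod F 𝔸.A.toMon).obj M.M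
      τ := fun i => μ F M.M.X 𝔸.T ≫ F.map (M.τ i) ≫ δ F 𝔸.T M.M.X
      τbar := fun i => μ F 𝔸.T M.M.X ≫ F.map (M.τbar i) ≫ δ F M.M.X 𝔸.T }
  map f :=
    { hom := (mapBimod F 𝔸.A.toMon).map f.hom
      comm := fun i => by
        change F.map f.hom.hom ▷ F.obj 𝔸.T ≫ μ F _ 𝔸.T ≫ F.map _ ≫ δ F 𝔸.T _ =
          (μ F _ 𝔸.T ≫ F.map _ ≫ δ F 𝔸.T _) ≫ F.obj 𝔸.T ◁ F.map f.hom.hom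
        rw [μ_natural_left_assoc, ← F.map_comp_assoc, f.comm i, Category.assoc, Category.assoc,
          δ_natural_right, F.map_comp, Category.assoc] }
  map_id M := PreObj.Hom.ext ((mapBimod F 𝔸.A.toMon).map_id M.M)
  map_comp f g := PreObj.Hom.ext ((mapBimod F 𝔸.A.toMon).map_comp f.hom g.hom)

/-- A ribbon Frobenius functor: a braided lax monoidal functor with an oplax monoidal structure
which satisfies the Frobenius relations and preserves the twists. -/
structure IsRibbonFrobenius [BraidedCategory C] [BraidedCategory D]
    [RightRigidCategory C] [PivotalCategory C] [RightRigidCategory D] [PivotalCategory D]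
    (F : C ⥤ D) [F.LaxBraided] [F.OplaxMonoidal] : Prop where
  frobenius : IsFrobenius F
  twist_map (X : C) : F.map (twist X) = twist (F.obj X)

variable [RightRigidCategory C] [PivotalCategory C] [HasCoequalizers C]

/-- `F` is strongly separable with respect to `A` with section `ψ'`: for all `A`-`A`-bimodules
`M`, `N` the composition
`F(M ⊗_A N) ⟶ F(M ⊗ N) ⟶ F(M) ⊗ F(N) ⟶ F(M) ⊗ F(N) ⟶ F(M ⊗ N) ⟶ F(M ⊗_A N)`,
whose middle morphism is the insertion of `ψ'²`, is the identity. -/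
def IsStronglySeparable (hF : IsFrobenius F) (A : FrobeniusAlgebra C)
    (ψ' : 𝟙_ D ⟶ F.obj A.X) : Prop :=
  ∀ M N : Bimod A.toMon A.toMon,
    F.map (A.incl M N) ≫ δ F M.X N.X ≫
      (hF.mapAlgebra A).insR ((hF.mapAlgebra A).sq ψ') ((mapBimod F A.toMon).obj M).actRight ▷
        F.obj N.X ≫
      μ F M.X N.X ≫ F.map (relProj M N) = 𝟙 (F.obj (M ⊗ N).X)

/-- `F` is compatible with the orbifold datum `𝔸`, with invertible section `ψ'` and scalar
`φ'`. -/
structure IsCompatible [RightRigidCategory D] [PivotalCategory D] [Field k] [Preadditive D]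
    [Linear k D] (hF : IsFrobenius F) (𝔸 : OrbData k C) (ψ' : 𝟙_ D ⟶ F.obj 𝔸.A.X) (φ' : k) :
    Prop where
  stronglySeparable : IsStronglySeparable hF 𝔸.A ψ'
  invertible : (hF.mapAlgebra 𝔸.A).IsInvertible ψ'
  φ_ne_zero : φ' ≠ 0
  loopCondition : (𝔸.transport hF ψ' φ').LoopCondition

/-- The functor between the categories of bimodules with `T`-crossings induced by `F`, once it is
known that transported crossings satisfy the defining conditions. -/
def crossingFunctor [BraidedCategory C] [RightRigidCategory D] [PivotalCategory D]
    [BraidedCategory D] (𝔸 : OrbData k C) (J : Set Leg) (hF : IsFrobenius F)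
    (ψ' : 𝟙_ D ⟶ F.obj 𝔸.A.X) (φ' : k)
    (h : ∀ M : PreObj 𝔸 J, M.IsCrossing → ((PreObj.transport 𝔸 J hF ψ' φ').obj M).IsCrossing) :
    CrossingCat 𝔸 J ⥤ CrossingCat (𝔸.transport hF ψ' φ') J :=
  ObjectProperty.lift _ (ObjectProperty.ι _ ⋙ PreObj.transport 𝔸 J hF ψ' φ')
    fun M => h M.obj M.property

/-- The isomorphism `e : F(M*) ≅ F(M)*` is an isomorphism of bimodules, commutes with the crossings
of the duals, and is compatible with both evaluations of the duality of bimodules. -/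
structure IsDualityIso [RightRigidCategory D] [PivotalCategory D] {𝔸 : OrbData k C} {J : Set Leg}
    (hF : IsFrobenius F) (ψ' : 𝟙_ D ⟶ F.obj 𝔸.A.X) (φ' : k) (M : PreObj 𝔸 J)
    (e : F.obj M.M.Xᘁ ≅ (F.obj M.M.X)ᘁ) : Prop where
  left : (μ F 𝔸.A.X M.M.Xᘁ ≫ F.map (𝔸.A.dualL M.M.actRight)) ≫ e.hom =
    F.obj 𝔸.A.X ◁ e.hom ≫
      (hF.mapAlgebra 𝔸.A).dualL ((mapBimod F 𝔸.A.toMon).obj M.M).actRight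
  right : (μ F M.M.Xᘁ 𝔸.A.X ≫ F.map (𝔸.A.dualR M.M.actLeft)) ≫ e.hom =
    e.hom ▷ F.obj 𝔸.A.X ≫
      (hF.mapAlgebra 𝔸.A).dualR ((mapBimod F 𝔸.A.toMon).obj M.M).actLeft
  crossing (i : J) :
    (μ F M.M.Xᘁ 𝔸.T ≫ F.map (M.dualτ i) ≫ δ F 𝔸.T M.M.Xᘁ) ≫ F.obj 𝔸.T ◁ e.hom =
      e.hom ▷ F.obj 𝔸.T ≫ ((PreObj.transport 𝔸 J hF ψ' φ').obj M).dualτ i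
  ev : e.hom ▷ F.obj M.M.X ≫ (hF.mapAlgebra 𝔸.A).relEv ((mapBimod F 𝔸.A.toMon).obj M.M) =
    μ F M.M.Xᘁ M.M.X ≫ F.map (𝔸.A.relEv M.M)
  ev' : F.obj M.M.X ◁ e.hom ≫ (hF.mapAlgebra 𝔸.A).relEv' ((mapBimod F 𝔸.A.toMon).obj M.M) =
    μ F M.M.X M.M.Xᘁ ≫ F.map (𝔸.A.relEv' M.M)

end Transport

end FrobTransport

open FrobTransport

namespace FrobTransport

open Functor.LaxMonoidal Functor.OplaxMonoidal

-- Actions, coactions and balanced maps over a Frobenius algebra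

namespace FrobeniusAlgebra

variable {C : Type u₁} [Category.{v₁} C] [MonoidalCategory C] (A : FrobeniusAlgebra C)

section Actions

variable {M N X Y : C}

-- All morphisms between relative tensor products are encoded by boxes `X ⊗ Y ⟶ Z ⊗ W` between
-- ordinary tensor products, and a box `f` is transported to `bmap F f`, that is `μ`, then `F f`,
-- then `δ`. The theorem therefore comes down to the question which diagrams of such boxes are
-- carried by `F` to the same diagrams.
--
-- Two consecutive boxes that share one strand can always be merged: the `δ` of the first meets the
-- `μ` of the second across a single strand, and the Frobenius relations apply
-- (`IsFrobenius.whiskerLeft_bmap_bmap`, `IsFrobenius.bmap_whiskerLeft_bmap`, and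
-- `IsFrobenius.bmap_exch_bmap` if a braiding stands in between). When a box takes both of its
-- strands from what precedes it, the composite of `δ` and `μ` is not the identity. There the axioms
-- provide an insertion of `ψ²`, if necessary after sliding it through a linear box. What precedes
-- is cobalanced and the box is balanced, so both absorb the idempotent of the relative tensor
-- product, and strong separability says exactly that between two such idempotents the insertion of
-- `ψ_F²` is the image of the insertion of `ψ²` (`SplitsImage.bmap_bmap`,
-- `SplitsImage.tmap_whiskerLeft`, `SplitsImage.tmap_whiskerRight`).
--
-- The conditions with bent strands need duals. A Frobenius functor carries dual pairs to dual
-- pairs, whence `F(X*) ≅ F(X)*`. The two evaluations of `X` differ by the braiding and the twist,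
-- so a functor preserving both respects the second evaluation as well (`IsFrobenius.dualIso_ev'`);
-- bending a strand then shows that `δ` too is compatible with the braiding
-- (`IsFrobenius.oplaxBraided`). Rotated and bent boxes are again balanced and cobalanced because
-- `A` is symmetric. In this way each of O1–O7 and T1–T7 is transported, while O8 is part of
-- compatibility.
--
-- The braiding is a partial trace over `T`, normalised by a scalar unrelated to the one upstairs,
-- so it is not transported directly. It is characterised instead: attaching a `T`-strand to the
-- right of the braiding gives the morphism that takes the strand across `M` and `N` and back
-- (`PreObj.braidBalanced_bridge`), and by the loop condition nothing is lost by attaching the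
-- strand (`PreObj.eq_of_whiskerRight_bridge`). This equation involves neither trace nor scalar and
-- is transported by merging. The first assertion is the geometric core: a box through which `α` can
-- be pulled has its closed `T`-loop absorbed by a neighbouring `T`-strand
-- (`OrbData.IsOrbifoldDatum.rightTrace_whiskerRight_bridge`). The twist is a trace relative to `A`,
-- and such traces of right-linear maps are preserved (`SplitsImage.rightTrace_bmap`).
--
-- For the last claim, a right-linear map `f : M ⟶ N` is determined by the element `𝟙_ C ⟶ N ⊗ M*`
-- obtained by bending, which lies in the image of the idempotent. A nonzero morphism out of the
-- simple unit is split by a simple summand, so it is not killed by `F` if `F(𝟙) ≠ 0`. This yields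
-- faithfulness. Applied to the difference of the two sides of the crossing condition it shows that
-- `F` reflects that condition, so fullness is inherited from `F^A`.

theorem insR_eq (a : 𝟙_ C ⟶ A.X) (r : M ⊗ A.X ⟶ M) :
    A.insR a r = (ρ_ M).inv ≫ M ◁ a ≫ r := by
  simp [insR, monoidalComp]

theorem coactR_eq (r : M ⊗ A.X ⟶ M) :
    A.coactR r = (ρ_ M).inv ≫ M ◁ A.copairing ≫ (α_ _ _ _).inv ≫ r ▷ A.X := by
  simp [coactR, monoidalComp]

theorem coactL_eq (l : A.X ⊗ M ⟶ M) :
    A.coactL l = (λ_ M).inv ≫ A.copairing ▷ M ≫ (α_ _ _ _).hom ≫ A.X ◁ l := by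
  simp [coactL, monoidalComp]

theorem bridge_eq_coactR (r : M ⊗ A.X ⟶ M) (l : A.X ⊗ N ⟶ N) :
    A.bridge r l = A.coactR r ▷ N ≫ (α_ _ _ _).hom ≫ M ◁ l := by
  rw [bridge, coactR, MonoidalCategory.tensorHom_def]; monoidal

theorem bridge_eq_coactL (r : M ⊗ A.X ⟶ M) (l : A.X ⊗ N ⟶ N) :
    A.bridge r l = M ◁ A.coactL l ≫ (α_ _ _ _).inv ≫ r ▷ N := by
  rw [bridge, coactL, MonoidalCategory.tensorHom_def']; monoidal

/-- `b` coequalizes the actions `r` and `l`. -/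
def Balanced (r : M ⊗ A.X ⟶ M) (l : A.X ⊗ N ⟶ N) (b : M ⊗ N ⟶ Y) : Prop :=
  r ▷ N ≫ b = (α_ _ _ _).hom ≫ M ◁ l ≫ b

/-- `g` equalizes the coactions induced by `r` and `l`. -/
def Cobalanced (r : M ⊗ A.X ⟶ M) (l : A.X ⊗ N ⟶ N) (g : X ⟶ M ⊗ N) : Prop :=
  g ≫ A.coactR r ▷ N ≫ (α_ _ _ _).hom = g ≫ M ◁ A.coactL l

end Actions

/-- `a` splits the multiplication, in the sense that `μ ∘ (id ⊗ a ⊗ id) ∘ Δ = id`. -/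
def Splits (a : 𝟙_ C ⟶ A.X) : Prop :=
  A.comul ⊗≫ A.X ◁ a ▷ A.X ⊗≫ A.mul ▷ A.X ≫ A.mul = 𝟙 A.X

section Bimodules

variable {A} (M N : Bimod A.toMon A.toMon)

/-- Since `(m·e₁)·a·e₂ = m·(e₁ a e₂)` for the copairing `e₁ ⊗ e₂`, the product can be formed inside
`A`, where `Splits` applied to the unit reduces it to the unit. -/
theorem Splits.coactR_insR {a : 𝟙_ C ⟶ A.X} (h : A.Splits a) :
    A.coactR M.actRight ≫ A.insR a M.actRight ▷ A.X ≫ M.actRight = 𝟙 M.X := by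
  have e1 : M.actRight ▷ A.X ≫ M.actRight = (α_ _ _ _).hom ≫ M.X ◁ A.mul ≫ M.actRight := by
    rw [Bimod.right_assoc, Iso.hom_inv_id_assoc]
  have e3 : M.X ◁ A.one ≫ M.actRight = (ρ_ _).hom := M.actRight_one
  calc
    _ = 𝟙 _ ⊗≫ M.X ◁ A.copairing ⊗≫ (M.actRight ▷ 𝟙_ C ≫ M.X ◁ a) ▷ A.X ⊗≫
        (M.actRight ▷ A.X ≫ M.actRight) := by
      rw [coactR, insR]; monoidal
    _ = 𝟙 _ ⊗≫ M.X ◁ A.copairing ⊗≫ M.X ◁ A.X ◁ a ▷ A.X ⊗≫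
        (M.actRight ▷ A.X ≫ M.actRight) ▷ A.X ⊗≫ M.actRight := by
      rw [← whisker_exchange]; monoidal
    _ = 𝟙 _ ⊗≫ M.X ◁ A.copairing ⊗≫ M.X ◁ A.X ◁ a ▷ A.X ⊗≫ M.X ◁ A.mul ▷ A.X ⊗≫
        (M.actRight ▷ A.X ≫ M.actRight) := by
      conv_lhs => rw [e1]
      monoidal
    _ = 𝟙 _ ⊗≫ M.X ◁ A.one ≫
         M.X ◁ (A.comul ⊗≫ A.X ◁ a ▷ A.X ⊗≫ A.mul ▷ A.X ≫ A.mul) ≫ M.actRight := by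
      rw [e1, copairing]; monoidal
    _ = _ := by
      rw [h, MonoidalCategory.whiskerLeft_id, Category.id_comp, e3]; monoidal

variable {M N}

/-- The leg of the copairing that acts on `N` is moved across to `M` by balancedness; there it meets
`a` and the other leg, and all three cancel. -/
theorem Balanced.bridge_insR {a : 𝟙_ C ⟶ A.X} (h : A.Splits a) {Y : C} {b : M.X ⊗ N.X ⟶ Y}
    (hb : A.Balanced M.actRight N.actLeft b) :
    A.bridge M.actRight N.actLeft ≫ A.insR a M.actRight ▷ N.X ≫ b = b := by
  calc
    _ = 𝟙 _ ⊗≫ A.coactR M.actRight ▷ N.X ⊗≫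
        (M.X ◁ N.actLeft ≫ A.insR a M.actRight ▷ N.X) ≫ b := by
      rw [bridge_eq_coactR]; monoidal
    _ = 𝟙 _ ⊗≫ A.coactR M.actRight ▷ N.X ⊗≫ A.insR a M.actRight ▷ A.X ▷ N.X ⊗≫
        ((α_ _ _ _).hom ≫ M.X ◁ N.actLeft ≫ b) := by
      rw [whisker_exchange]; monoidal
    _ = 𝟙 _ ⊗≫ (A.coactR M.actRight ≫ A.insR a M.actRight ▷ A.X ≫ M.actRight) ▷ N.X ≫ b := by
      rw [← hb]; monoidal
    _ = _ := by
      rw [h.coactR_insR]; monoidal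

/-- Mirror image: cobalancedness moves the copairing to the other side of the insertion, and
`Splits.coactR_insR` cancels it. -/
theorem Cobalanced.insR_bridge {a : 𝟙_ C ⟶ A.X} (h : A.Splits a) {X : C} {g : X ⟶ M.X ⊗ N.X}
    (hg : A.Cobalanced M.actRight N.actLeft g) :
    g ≫ A.insR a M.actRight ▷ N.X ≫ A.bridge M.actRight N.actLeft = g := by
  calc
    _ = g ≫ (A.insR a M.actRight ▷ N.X ≫ M.X ◁ A.coactL N.actLeft) ⊗≫ M.actRight ▷ N.X := by
      rw [bridge_eq_coactL]; monoidal
    _ = (g ≫ M.X ◁ A.coactL N.actLeft) ⊗≫ A.insR a M.actRight ▷ (A.X ⊗ N.X) ⊗≫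
        M.actRight ▷ N.X := by
      rw [← whisker_exchange]; monoidal
    _ = g ⊗≫ (A.coactR M.actRight ≫ A.insR a M.actRight ▷ A.X ≫ M.actRight) ▷ N.X := by
      rw [← hg]; monoidal
    _ = _ := by
      rw [h.coactR_insR]; monoidal

theorem insR_balanced {a : 𝟙_ C ⟶ A.X} {Y : C} {b : M.X ⊗ N.X ⟶ Y}
    (hb : A.Balanced M.actRight N.actLeft b) :
    A.insR a M.actRight ▷ N.X ≫ b = M.X ◁ A.insL a N.actLeft ≫ b := by
  calc
    _ = 𝟙 _ ⊗≫ M.X ◁ a ▷ N.X ⊗≫ (M.actRight ▷ N.X ≫ b) := by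
      rw [insR]; monoidal
    _ = _ := by
      rw [hb, insL]; monoidal

variable (M N)

theorem bridge_isBalanced : A.Balanced M.actRight N.actLeft (A.bridge M.actRight N.actLeft) := by
  rw [Balanced, A.bridge_balanced, Category.assoc]

end Bimodules
end FrobeniusAlgebra

-- Zigzags, and the agreement of the two transposes

section Duality

variable {C : Type u₁} [Category.{v₁} C] [MonoidalCategory C] [RightRigidCategory C]

theorem coev_ev (X : C) : coev X ▷ X ≫ (α_ _ _ _).hom ≫ X ◁ ev X = (λ_ X).hom ≫ (ρ_ X).inv :=
  ExactPairing.evaluation_coevaluation _ _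

theorem ev_coev (X : C) : Xᘁ ◁ coev X ≫ (α_ _ _ _).inv ≫ ev X ▷ Xᘁ = (ρ_ Xᘁ).hom ≫ (λ_ Xᘁ).inv :=
  ExactPairing.coevaluation_evaluation _ _

section

variable {U V W : C}

theorem eq_of_ev_right {f g : U ⟶ V ⊗ Wᘁ}
    (h : f ▷ W ≫ (α_ _ _ _).hom ≫ V ◁ ev W = g ▷ W ≫ (α_ _ _ _).hom ≫ V ◁ ev W) : f = g := by
  have key (f : U ⟶ V ⊗ Wᘁ) : f = 𝟙 U ⊗≫ U ◁ coev W ⊗≫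
      (f ▷ W ≫ (α_ _ _ _).hom ≫ V ◁ ev W) ▷ Wᘁ ⊗≫ 𝟙 _ := by
    symm
    calc
      _ = 𝟙 U ⊗≫ (U ◁ coev W ≫ f ▷ (W ⊗ Wᘁ)) ⊗≫ V ◁ ev W ▷ Wᘁ ⊗≫ 𝟙 _ := by monoidal
      _ = f ⊗≫ V ◁ (Wᘁ ◁ coev W ≫ (α_ _ _ _).inv ≫ ev W ▷ Wᘁ) ⊗≫ 𝟙 _ := by
        rw [whisker_exchange]; monoidal
      _ = _ := by rw [ev_coev]; monoidal
  rw [key f, key g, h]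

theorem eq_of_coev_right {f g : U ⊗ W ⟶ V}
    (h : U ◁ coev W ≫ (α_ _ _ _).inv ≫ f ▷ Wᘁ = U ◁ coev W ≫ (α_ _ _ _).inv ≫ g ▷ Wᘁ) : f = g := by
  have key (f : U ⊗ W ⟶ V) : f = 𝟙 _ ⊗≫
      (U ◁ coev W ≫ (α_ _ _ _).inv ≫ f ▷ Wᘁ) ▷ W ⊗≫ V ◁ ev W ⊗≫ 𝟙 _ := by
    symm
    calc
      _ = 𝟙 _ ⊗≫ U ◁ coev W ▷ W ⊗≫ (f ▷ (Wᘁ ⊗ W) ≫ V ◁ ev W) ⊗≫ 𝟙 _ := by monoidal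
      _ = 𝟙 _ ⊗≫ U ◁ (coev W ▷ W ≫ (α_ _ _ _).hom ≫ W ◁ ev W) ⊗≫ f ⊗≫ 𝟙 _ := by
        rw [← whisker_exchange]; monoidal
      _ = _ := by rw [coev_ev]; monoidal
  rw [key f, key g, h]

end

/-- Every copairing of `U` with some object factors through the chosen one by a zigzag. It is
applied to nested coevaluations of `X ⊗ Y`. -/
theorem coev_comp_evaluation {U V : C} (k : 𝟙_ C ⟶ U ⊗ V) :
    coev U ≫ U ◁ ((ρ_ _).inv ≫ (Uᘁ : C) ◁ k ≫ (α_ _ _ _).inv ≫ ev U ▷ V ≫ (λ_ _).hom) = k := by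
  calc
    _ = 𝟙 _ ⊗≫ (coev U ▷ 𝟙_ C ≫ (U ⊗ (Uᘁ : C)) ◁ k) ⊗≫ U ◁ ev U ▷ V ⊗≫ 𝟙 _ := by monoidal
    _ = k ⊗≫ (coev U ▷ U ≫ (α_ _ _ _).hom ≫ U ◁ ev U) ▷ V ⊗≫ 𝟙 _ := by
      rw [← whisker_exchange]; monoidal
    _ = _ := by rw [coev_ev]; monoidal

variable [PivotalCategory C]

theorem coev'_ev' (X : C) :
    coev' X ▷ Xᘁ ≫ (α_ _ _ _).hom ≫ Xᘁ ◁ ev' X = (λ_ Xᘁ).hom ≫ (ρ_ Xᘁ).inv :=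
  (PivotalCategory.pairing X).evaluation_coevaluation'

theorem ev'_coev' (X : C) :
    X ◁ coev' X ≫ (α_ _ _ _).inv ≫ ev' X ▷ X = (ρ_ X).hom ≫ (λ_ X).inv :=
  (PivotalCategory.pairing X).coevaluation_evaluation'

section

variable {U V W : C}

theorem eq_of_ev'_right {f g : U ⟶ V ⊗ W}
    (h : f ▷ Wᘁ ≫ (α_ _ _ _).hom ≫ V ◁ ev' W = g ▷ Wᘁ ≫ (α_ _ _ _).hom ≫ V ◁ ev' W) : f = g := by
  have key (f : U ⟶ V ⊗ W) : f = 𝟙 U ⊗≫ U ◁ coev' W ⊗≫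
      (f ▷ Wᘁ ≫ (α_ _ _ _).hom ≫ V ◁ ev' W) ▷ W ⊗≫ 𝟙 _ := by
    symm
    calc
      _ = 𝟙 U ⊗≫ (U ◁ coev' W ≫ f ▷ (Wᘁ ⊗ W)) ⊗≫ V ◁ ev' W ▷ W ⊗≫ 𝟙 _ := by monoidal
      _ = f ⊗≫ V ◁ (W ◁ coev' W ≫ (α_ _ _ _).inv ≫ ev' W ▷ W) ⊗≫ 𝟙 _ := by
        rw [whisker_exchange]; monoidal
      _ = _ := by rw [ev'_coev']; monoidal
  rw [key f, key g, h]

end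

theorem coev'_comp_evaluation {U V : C} (k : 𝟙_ C ⟶ V ⊗ U) :
    coev' U ≫ ((λ_ _).inv ≫ k ▷ (Uᘁ : C) ≫ (α_ _ _ _).hom ≫ V ◁ ev' U ≫ (ρ_ _).hom) ▷ U = k := by
  calc
    _ = 𝟙 _ ⊗≫ (𝟙_ C ◁ coev' U ≫ k ▷ ((Uᘁ : C) ⊗ U)) ⊗≫ V ◁ ev' U ▷ U ⊗≫ 𝟙 _ := by monoidal
    _ = k ⊗≫ V ◁ (U ◁ coev' U ≫ (α_ _ _ _).inv ≫ ev' U ▷ U) ⊗≫ 𝟙 _ := by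
      rw [whisker_exchange]; monoidal
    _ = _ := by rw [ev'_coev']; monoidal

/-- The two transposes of a morphism `X ⊗ Y ⟶ Z` agree. -/
theorem transpose_tensor_eq {X Y Z : C} (f : X ⊗ Y ⟶ Z) :
    (𝟙 (Zᘁ : C) ⊗≫ (Zᘁ : C) ◁ coev X ⊗≫ (Zᘁ : C) ◁ X ◁ coev Y ▷ (Xᘁ : C) ⊗≫
      (Zᘁ : C) ◁ f ▷ ((Yᘁ : C) ⊗ (Xᘁ : C)) ⊗≫ ev Z ▷ ((Yᘁ : C) ⊗ (Xᘁ : C)) ⊗≫ 𝟙 _ :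
        (Zᘁ : C) ⟶ (Yᘁ : C) ⊗ (Xᘁ : C)) =
    𝟙 _ ⊗≫ coev' Y ▷ (Zᘁ : C) ⊗≫ (Yᘁ : C) ◁ coev' X ▷ Y ▷ (Zᘁ : C) ⊗≫
      ((Yᘁ : C) ⊗ (Xᘁ : C)) ◁ f ▷ (Zᘁ : C) ⊗≫ ((Yᘁ : C) ⊗ (Xᘁ : C)) ◁ ev' Z ⊗≫ 𝟙 _ := by
  have e1 := PivotalCategory.transpose_eq f
  have e2 := PivotalCategory.tensor_eq X Y
  change (𝟙 _ ⊗≫ (Zᘁ : C) ◁ coev (X ⊗ Y) ⊗≫ (Zᘁ : C) ◁ f ▷ ((X ⊗ Y)ᘁ : C) ⊗≫ ev Z ▷ ((X ⊗ Y)ᘁ : C) ⊗≫ 𝟙 _) =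
    𝟙 _ ⊗≫ coev' (X ⊗ Y) ▷ (Zᘁ : C) ⊗≫ ((X ⊗ Y)ᘁ : C) ◁ f ▷ (Zᘁ : C) ⊗≫ ((X ⊗ Y)ᘁ : C) ◁ ev' Z ⊗≫ 𝟙 _ at e1
  change (𝟙 _ ⊗≫ ((X ⊗ Y)ᘁ : C) ◁ coev X ⊗≫ ((X ⊗ Y)ᘁ : C) ◁ X ◁ coev Y ▷ (Xᘁ : C) ⊗≫
      ev (X ⊗ Y) ▷ ((Yᘁ : C) ⊗ (Xᘁ : C)) ⊗≫ 𝟙 _) =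
    𝟙 _ ⊗≫ coev' Y ▷ ((X ⊗ Y)ᘁ : C) ⊗≫ (Yᘁ : C) ◁ coev' X ▷ Y ▷ ((X ⊗ Y)ᘁ : C) ⊗≫
      ((Yᘁ : C) ⊗ (Xᘁ : C)) ◁ ev' (X ⊗ Y) ⊗≫ 𝟙 _ at e2
  -- Each side splits as a transpose of `f` into `(X ⊗ Y)*` followed by the canonical morphism to
  -- `Y* ⊗ X*`; the nested (co)evaluations `k`, `k'` are what this comparison starts from. The two
  -- pivotal axioms then exchange the two factors separately.
  let k : 𝟙_ C ⟶ (X ⊗ Y) ⊗ ((Yᘁ : C) ⊗ (Xᘁ : C)) := 𝟙 _ ⊗≫ coev X ⊗≫ X ◁ coev Y ▷ (Xᘁ : C) ⊗≫ 𝟙 _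
  let k' : 𝟙_ C ⟶ ((Yᘁ : C) ⊗ (Xᘁ : C)) ⊗ (X ⊗ Y) := 𝟙 _ ⊗≫ coev' Y ⊗≫ (Yᘁ : C) ◁ coev' X ▷ Y ⊗≫ 𝟙 _
  calc
    _ = 𝟙 _ ⊗≫ (Zᘁ : C) ◁ k ⊗≫ (Zᘁ : C) ◁ f ▷ ((Yᘁ : C) ⊗ (Xᘁ : C)) ⊗≫
        ev Z ▷ ((Yᘁ : C) ⊗ (Xᘁ : C)) ⊗≫ 𝟙 _ := by
      dsimp only [k]; monoidal
    _ = (𝟙 _ ⊗≫ (Zᘁ : C) ◁ coev (X ⊗ Y) ⊗≫ (Zᘁ : C) ◁ f ▷ ((X ⊗ Y)ᘁ : C) ⊗≫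
          ev Z ▷ ((X ⊗ Y)ᘁ : C) ⊗≫ 𝟙 ((X ⊗ Y)ᘁ : C)) ≫ (𝟙 ((X ⊗ Y)ᘁ : C) ⊗≫ ((X ⊗ Y)ᘁ : C) ◁ coev X ⊗≫
          ((X ⊗ Y)ᘁ : C) ◁ X ◁ coev Y ▷ (Xᘁ : C) ⊗≫ ev (X ⊗ Y) ▷ ((Yᘁ : C) ⊗ (Xᘁ : C)) ⊗≫ 𝟙 _) := by
      let j : ((X ⊗ Y)ᘁ : C) ⟶ (Yᘁ : C) ⊗ (Xᘁ : C) := (ρ_ _).inv ≫ ((X ⊗ Y)ᘁ : C) ◁ k ≫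
        (α_ _ _ _).inv ≫ ev (X ⊗ Y) ▷ ((Yᘁ : C) ⊗ (Xᘁ : C)) ≫ (λ_ _).hom
      have hj : coev (X ⊗ Y) ≫ (X ⊗ Y) ◁ j = k := coev_comp_evaluation k
      calc
        _ = 𝟙 (Zᘁ : C) ⊗≫ (Zᘁ : C) ◁ coev (X ⊗ Y) ⊗≫ (((Zᘁ : C) ⊗ (X ⊗ Y)) ◁ j ≫
            ((Zᘁ : C) ◁ f ≫ ev Z) ▷ ((Yᘁ : C) ⊗ (Xᘁ : C))) ⊗≫ 𝟙 ((Yᘁ : C) ⊗ (Xᘁ : C)) := by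
          rw [← hj]; monoidal
        _ = _ := by
          rw [whisker_exchange]; dsimp only [j, k]; monoidal
    _ = (𝟙 _ ⊗≫ coev' (X ⊗ Y) ▷ (Zᘁ : C) ⊗≫ ((X ⊗ Y)ᘁ : C) ◁ f ▷ (Zᘁ : C) ⊗≫
          ((X ⊗ Y)ᘁ : C) ◁ ev' Z ⊗≫ 𝟙 ((X ⊗ Y)ᘁ : C)) ≫ (𝟙 ((X ⊗ Y)ᘁ : C) ⊗≫ coev' Y ▷ ((X ⊗ Y)ᘁ : C) ⊗≫
          (Yᘁ : C) ◁ coev' X ▷ Y ▷ ((X ⊗ Y)ᘁ : C) ⊗≫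
          ((Yᘁ : C) ⊗ (Xᘁ : C)) ◁ ev' (X ⊗ Y) ⊗≫ 𝟙 _) := by
      rw [e1, e2]
    _ = 𝟙 _ ⊗≫ k' ▷ (Zᘁ : C) ⊗≫ ((Yᘁ : C) ⊗ (Xᘁ : C)) ◁ f ▷ (Zᘁ : C) ⊗≫
        ((Yᘁ : C) ⊗ (Xᘁ : C)) ◁ ev' Z ⊗≫ 𝟙 _ := by
      let j : ((X ⊗ Y)ᘁ : C) ⟶ (Yᘁ : C) ⊗ (Xᘁ : C) := (λ_ _).inv ≫ k' ▷ ((X ⊗ Y)ᘁ : C) ≫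
        (α_ _ _ _).hom ≫ ((Yᘁ : C) ⊗ (Xᘁ : C)) ◁ ev' (X ⊗ Y) ≫ (ρ_ _).hom
      have hj : coev' (X ⊗ Y) ≫ j ▷ (X ⊗ Y) = k' := coev'_comp_evaluation k'
      symm
      calc
        _ = 𝟙 (Zᘁ : C) ⊗≫ coev' (X ⊗ Y) ▷ (Zᘁ : C) ⊗≫ (j ▷ ((X ⊗ Y) ⊗ (Zᘁ : C)) ≫
            ((Yᘁ : C) ⊗ (Xᘁ : C)) ◁ (f ▷ (Zᘁ : C) ≫ ev' Z)) ⊗≫ 𝟙 ((Yᘁ : C) ⊗ (Xᘁ : C)) := by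
          rw [← hj]; monoidal
        _ = _ := by
          rw [← whisker_exchange]; dsimp only [j, k']; monoidal
    _ = _ := by dsimp only [k']; monoidal

end Duality

-- Symmetric Frobenius algebras and dual actions

namespace FrobeniusAlgebra

variable {C : Type u₁} [Category.{v₁} C] [MonoidalCategory C] (A : FrobeniusAlgebra C)

theorem copairing_counit_right :
    A.copairing ▷ A.X ≫ (α_ _ _ _).hom ≫ A.X ◁ (A.mul ≫ A.counit) = (λ_ _).hom ≫ (ρ_ _).inv := by
  rw [MonoidalCategory.whiskerLeft_comp, ← Category.assoc (α_ _ _ _).hom, ← Category.assoc (_ ▷ _),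
    A.copairing_mul_right, Category.assoc, A.comul_counit]

variable [RightRigidCategory C]

/-- The morphism `A ⟶ A*` given by the pairing `ε ∘ μ`. -/
def toDual : A.X ⟶ A.Xᘁ := 𝟙 A.X ⊗≫ A.X ◁ coev A.X ⊗≫ (A.mul ≫ A.counit) ▷ A.Xᘁ ⊗≫ 𝟙 A.Xᘁ

/-- The morphism `A* ⟶ A` given by the copairing. -/
def ofDual : A.Xᘁ ⟶ A.X := 𝟙 (A.Xᘁ : C) ⊗≫ (A.Xᘁ : C) ◁ A.copairing ⊗≫ ev A.X ▷ A.X ⊗≫ 𝟙 _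

theorem ofDual_toDual : A.ofDual ≫ A.toDual = 𝟙 _ := by
  calc
    _ = 𝟙 _ ⊗≫ (A.Xᘁ : C) ◁ A.copairing ⊗≫ (ev A.X ▷ (A.X ⊗ 𝟙_ C) ≫ 𝟙_ C ◁ A.X ◁ coev A.X) ⊗≫
        (A.mul ≫ A.counit) ▷ (A.Xᘁ : C) ⊗≫ 𝟙 _ := by
      rw [ofDual, toDual]; monoidal
    _ = 𝟙 _ ⊗≫ (A.Xᘁ : C) ◁ (A.copairing ▷ 𝟙_ C ≫ (A.X ⊗ A.X) ◁ coev A.X) ⊗≫ ev A.X ▷ (A.X ⊗ A.X) ▷ (A.Xᘁ : C) ⊗≫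
        (A.mul ≫ A.counit) ▷ (A.Xᘁ : C) ⊗≫ 𝟙 _ := by
      rw [← whisker_exchange]; monoidal
    _ = 𝟙 _ ⊗≫ (A.Xᘁ : C) ◁ coev A.X ⊗≫ (A.Xᘁ : C) ◁ A.copairing ▷ A.X ▷ (A.Xᘁ : C) ⊗≫
       (ev A.X ▷ (A.X ⊗ A.X) ≫ 𝟙_ C ◁ (A.mul ≫ A.counit)) ▷ (A.Xᘁ : C) ⊗≫ 𝟙 _ := by
      rw [← whisker_exchange]; monoidal
    _ = 𝟙 _ ⊗≫ (A.Xᘁ : C) ◁ coev A.X ⊗≫ (A.Xᘁ : C) ◁ (A.copairing ▷ A.X ≫ (α_ _ _ _).hom ≫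
        A.X ◁ (A.mul ≫ A.counit)) ▷ (A.Xᘁ : C) ⊗≫ ev A.X ▷ (A.Xᘁ : C) ⊗≫ 𝟙 _ := by
      rw [← whisker_exchange]; monoidal
    _ = 𝟙 _ ⊗≫ ((A.Xᘁ : C) ◁ coev A.X ≫ (α_ _ _ _).inv ≫ ev A.X ▷ (A.Xᘁ : C)) ⊗≫ 𝟙 _ := by
      rw [copairing_counit_right]; monoidal
    _ = _ := by rw [ev_coev]; monoidal

theorem coev_ofDual : coev A.X ≫ A.X ◁ A.ofDual = A.copairing := by
  calc
    _ = 𝟙 _ ⊗≫ (coev A.X ▷ 𝟙_ C ≫ (A.X ⊗ (A.Xᘁ : C)) ◁ A.copairing) ⊗≫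
        A.X ◁ ev A.X ▷ A.X ⊗≫ 𝟙 _ := by
      rw [ofDual]; monoidal
    _ = A.copairing ⊗≫ (coev A.X ▷ A.X ≫ (α_ _ _ _).hom ≫ A.X ◁ ev A.X) ▷ A.X ⊗≫ 𝟙 _ := by
      rw [← whisker_exchange]; monoidal
    _ = _ := by rw [coev_ev]; monoidal

section

variable {M : C}

/-- Together with `eq_of_ev` this relation characterises the dual action. -/
theorem dualR_ev (l : A.X ⊗ M ⟶ M) :
    A.dualR l ▷ M ≫ ev M = (α_ _ _ _).hom ≫ (Mᘁ : C) ◁ l ≫ ev M := by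
  calc
    _ = 𝟙 _ ⊗≫ ((Mᘁ : C) ⊗ A.X) ◁ coev M ▷ M ⊗≫ (((Mᘁ : C) ◁ l ≫ ev M) ▷ ((Mᘁ : C) ⊗ M) ≫
        𝟙_ C ◁ ev M) ⊗≫ 𝟙 _ := by
      rw [dualR]; monoidal
    _ = 𝟙 _ ⊗≫ ((Mᘁ : C) ⊗ A.X) ◁ (coev M ▷ M ≫ (α_ _ _ _).hom ≫ M ◁ ev M) ⊗≫
        (Mᘁ : C) ◁ l ≫ ev M := by
      rw [← whisker_exchange]; monoidal
    _ = _ := by rw [coev_ev]; monoidal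

end

variable [PivotalCategory C]

/-- The second morphism `A ⟶ A*` given by the pairing `ε ∘ μ`. -/
def toDual' : A.X ⟶ A.Xᘁ := 𝟙 A.X ⊗≫ coev' A.X ▷ A.X ⊗≫ A.Xᘁ ◁ (A.mul ≫ A.counit) ⊗≫ 𝟙 A.Xᘁ

/-- The second morphism `A* ⟶ A` given by the copairing. -/
def ofDual' : A.Xᘁ ⟶ A.X := 𝟙 (A.Xᘁ : C) ⊗≫ A.copairing ▷ (A.Xᘁ : C) ⊗≫ A.X ◁ ev' A.X ⊗≫ 𝟙 _

theorem toDual'_ofDual' : A.toDual' ≫ A.ofDual' = 𝟙 _ := by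
  calc
    _ = 𝟙 _ ⊗≫ coev' A.X ▷ A.X ⊗≫ (𝟙_ C ◁ (A.Xᘁ : C) ◁ (A.mul ≫ A.counit) ≫
        A.copairing ▷ ((A.Xᘁ : C) ⊗ 𝟙_ C)) ⊗≫ A.X ◁ ev' A.X ⊗≫ 𝟙 _ := by
      rw [toDual', ofDual']; monoidal
    _ = 𝟙 _ ⊗≫ (𝟙_ C ◁ coev' A.X ≫ A.copairing ▷ ((A.Xᘁ : C) ⊗ A.X)) ▷ A.X ⊗≫
        A.X ◁ (A.X ⊗ (A.Xᘁ : C)) ◁ (A.mul ≫ A.counit) ⊗≫ A.X ◁ ev' A.X ⊗≫ 𝟙 _ := by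
      rw [whisker_exchange]; monoidal
    _ = 𝟙 _ ⊗≫ A.copairing ▷ A.X ⊗≫ A.X ◁ A.X ◁ coev' A.X ▷ A.X ⊗≫
        A.X ◁ ((A.X ⊗ (A.Xᘁ : C)) ◁ (A.mul ≫ A.counit) ≫ ev' A.X ▷ 𝟙_ C) ⊗≫ 𝟙 _ := by
      rw [whisker_exchange]; monoidal
    _ = 𝟙 _ ⊗≫ A.copairing ▷ A.X ⊗≫ A.X ◁ (A.X ◁ coev' A.X ≫ (α_ _ _ _).inv ≫
        ev' A.X ▷ A.X) ▷ A.X ⊗≫ A.X ◁ (A.mul ≫ A.counit) ⊗≫ 𝟙 _ := by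
      rw [whisker_exchange]; monoidal
    _ = 𝟙 _ ⊗≫ (A.copairing ▷ A.X ≫ (α_ _ _ _).hom ≫ A.X ◁ (A.mul ≫ A.counit)) ⊗≫ 𝟙 _ := by
      rw [ev'_coev']; monoidal
    _ = _ := by
      rw [copairing_counit_right]; monoidal

theorem coev'_ofDual' : coev' A.X ≫ A.ofDual' ▷ A.X = A.copairing := by
  calc
    _ = 𝟙 _ ⊗≫ (𝟙_ C ◁ coev' A.X ≫ A.copairing ▷ ((A.Xᘁ : C) ⊗ A.X)) ⊗≫
        A.X ◁ ev' A.X ▷ A.X ⊗≫ 𝟙 _ := by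
      rw [ofDual']; monoidal
    _ = A.copairing ⊗≫ A.X ◁ (A.X ◁ coev' A.X ≫ (α_ _ _ _).inv ≫ ev' A.X ▷ A.X) ⊗≫ 𝟙 _ := by
      rw [whisker_exchange]; monoidal
    _ = _ := by rw [ev'_coev']; monoidal

variable {A}

/-- `ofDual` and `ofDual'` are one-sided inverses, on opposite sides, of the two maps `A ⟶ A*`. If
these agree, so do their inverses, and the copairing is obtained from either coevaluation by one and
the same map. -/
theorem IsSymmetric.coev'_ofDual (h : A.IsSymmetric) :
    coev' A.X ≫ A.ofDual ▷ A.X = A.copairing := by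
  have h0 : A.toDual = A.toDual' := h
  have : A.ofDual = A.ofDual' := by
    rw [← Category.comp_id A.ofDual, ← A.toDual'_ofDual', ← h0, reassoc_of% A.ofDual_toDual]
  rw [this, A.coev'_ofDual']

/-- A converse phrased only by copairings, the form in which symmetry survives a Frobenius functor:
a zigzag identifies `u` with both candidate inverses, so the two maps `A ⟶ A*` have a common
inverse. -/
theorem isSymmetric_of_hom (u : A.Xᘁ ⟶ A.X) (h : coev A.X ≫ A.X ◁ u = A.copairing)
    (h' : coev' A.X ≫ u ▷ A.X = A.copairing) : A.IsSymmetric := by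
  have hu : A.ofDual = u := by
    calc
      _ = 𝟙 (A.Xᘁ : C) ⊗≫ (A.Xᘁ : C) ◁ coev A.X ⊗≫ (((A.Xᘁ : C) ⊗ A.X) ◁ u ≫ ev A.X ▷ A.X) ⊗≫ 𝟙 _ := by
        rw [ofDual, ← h]; monoidal
      _ = 𝟙 _ ⊗≫ ((A.Xᘁ : C) ◁ coev A.X ≫ (α_ _ _ _).inv ≫ ev A.X ▷ (A.Xᘁ : C)) ⊗≫ u := by
        rw [whisker_exchange]; monoidal
      _ = _ := by rw [ev_coev]; monoidal
  have hu' : A.ofDual' = u := by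
    calc
      _ = 𝟙 (A.Xᘁ : C) ⊗≫ coev' A.X ▷ (A.Xᘁ : C) ⊗≫ (u ▷ (A.X ⊗ (A.Xᘁ : C)) ≫ A.X ◁ ev' A.X) ⊗≫ 𝟙 _ := by
        rw [ofDual', ← h']; monoidal
      _ = 𝟙 _ ⊗≫ (coev' A.X ▷ (A.Xᘁ : C) ≫ (α_ _ _ _).hom ≫ (A.Xᘁ : C) ◁ ev' A.X) ⊗≫ u := by
        rw [← whisker_exchange]; monoidal
      _ = _ := by rw [coev'_ev']; monoidal
  change A.toDual = A.toDual'
  rw [← Category.id_comp A.toDual, ← A.toDual'_ofDual', hu', ← hu, Category.assoc,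
    A.ofDual_toDual, Category.comp_id]



section DualActions

variable (A) {M : C}

theorem dualL_ev' (r : M ⊗ A.X ⟶ M) :
    M ◁ A.dualL r ≫ ev' M = (α_ _ _ _).inv ≫ r ▷ (Mᘁ : C) ≫ ev' M := by
  calc
    _ = 𝟙 _ ⊗≫ M ◁ coev' M ▷ (A.X ⊗ (Mᘁ : C)) ⊗≫ ((M ⊗ (Mᘁ : C)) ◁ (r ▷ (Mᘁ : C) ≫ ev' M) ≫
        ev' M ▷ 𝟙_ C) ⊗≫ 𝟙 _ := by
      rw [dualL]; monoidal
    _ = 𝟙 _ ⊗≫ (M ◁ coev' M ≫ (α_ _ _ _).inv ≫ ev' M ▷ M) ▷ (A.X ⊗ (Mᘁ : C)) ⊗≫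
        r ▷ (Mᘁ : C) ≫ ev' M := by
      rw [whisker_exchange]; monoidal
    _ = _ := by rw [ev'_coev']; monoidal

variable {A}

/-- Cobalancedness of the coevaluation. Writing the copairing as a bent coevaluation of `A` turns
the left side into one transpose of the action `r`; `transpose_tensor_eq` replaces it by the other
transpose, and symmetry turns the second coevaluation of `A` back into the copairing. -/
theorem IsSymmetric.coev_coactR (h : A.IsSymmetric) (r : M ⊗ A.X ⟶ M) :
    coev M ≫ A.coactR r ▷ (Mᘁ : C) ≫ (α_ _ _ _).hom = coev M ≫ M ◁ A.coactL (A.dualL r) := by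
  calc
    _ = 𝟙 _ ⊗≫ coev M ⊗≫ M ◁ coev A.X ▷ (Mᘁ : C) ⊗≫ ((M ⊗ A.X) ◁ A.ofDual ≫ r ▷ A.X) ▷ (Mᘁ : C) ⊗≫ 𝟙 _ := by
      rw [coactR, ← A.coev_ofDual]; monoidal
    _ = 𝟙 _ ⊗≫ (coev M ⊗≫ M ◁ coev A.X ▷ (Mᘁ : C) ⊗≫ r ▷ ((A.Xᘁ : C) ⊗ (Mᘁ : C))) ⊗≫
        (coev M ▷ M ≫ (α_ _ _ _).hom ≫ M ◁ ev M) ▷ ((A.Xᘁ : C) ⊗ (Mᘁ : C)) ⊗≫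
        M ◁ A.ofDual ▷ (Mᘁ : C) := by
      rw [whisker_exchange, coev_ev]; monoidal
    _ = 𝟙 _ ⊗≫ (coev M ▷ 𝟙_ C ≫ (M ⊗ (Mᘁ : C)) ◁
          (coev M ⊗≫ M ◁ coev A.X ▷ (Mᘁ : C) ⊗≫ r ▷ ((A.Xᘁ : C) ⊗ (Mᘁ : C)))) ⊗≫
        M ◁ ev M ▷ ((A.Xᘁ : C) ⊗ (Mᘁ : C)) ⊗≫ M ◁ A.ofDual ▷ (Mᘁ : C) := by
      rw [← whisker_exchange]; monoidal
    _ = 𝟙 _ ⊗≫ coev M ⊗≫ M ◁ (𝟙 (Mᘁ : C) ⊗≫ (Mᘁ : C) ◁ coev M ⊗≫ (Mᘁ : C) ◁ M ◁ coev A.X ▷ (Mᘁ : C) ⊗≫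
          (Mᘁ : C) ◁ r ▷ ((A.Xᘁ : C) ⊗ (Mᘁ : C)) ⊗≫ ev M ▷ ((A.Xᘁ : C) ⊗ (Mᘁ : C)) ⊗≫ 𝟙 ((A.Xᘁ : C) ⊗ (Mᘁ : C))) ⊗≫
        M ◁ A.ofDual ▷ (Mᘁ : C) := by
      monoidal
    _ = 𝟙 _ ⊗≫ coev M ⊗≫ M ◁ coev' A.X ▷ (Mᘁ : C) ⊗≫ M ◁ ((A.Xᘁ : C) ◁
        (𝟙 (A.X ⊗ (Mᘁ : C)) ⊗≫ coev' M ▷ A.X ▷ (Mᘁ : C) ⊗≫ (Mᘁ : C) ◁ (r ▷ (Mᘁ : C) ≫ ev' M) ⊗≫ 𝟙 (Mᘁ : C)) ≫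
        A.ofDual ▷ (Mᘁ : C)) := by
      rw [transpose_tensor_eq]; monoidal
    _ = 𝟙 _ ⊗≫ coev M ⊗≫ M ◁ (coev' A.X ≫ A.ofDual ▷ A.X) ▷ (Mᘁ : C) ⊗≫
        M ◁ A.X ◁ (𝟙 (A.X ⊗ (Mᘁ : C)) ⊗≫ coev' M ▷ A.X ▷ (Mᘁ : C) ⊗≫
          (Mᘁ : C) ◁ (r ▷ (Mᘁ : C) ≫ ev' M) ⊗≫ 𝟙 (Mᘁ : C)) := by
      rw [whisker_exchange]; monoidal
    _ = _ := by
      rw [h.coev'_ofDual, coactL, dualL]; monoidal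

/-- Dually, the two coactions agree on the second coevaluation. -/
theorem IsSymmetric.coev'_coactL (h : A.IsSymmetric) (l : A.X ⊗ M ⟶ M) :
    coev' M ≫ A.coactR (A.dualR l) ▷ M ≫ (α_ _ _ _).hom = coev' M ≫ (Mᘁ : C) ◁ A.coactL l := by
  calc
    _ = 𝟙 _ ⊗≫ coev' M ⊗≫ (Mᘁ : C) ◁ coev A.X ▷ M ⊗≫ (((Mᘁ : C) ⊗ A.X) ◁ A.ofDual ≫
        (𝟙 ((Mᘁ : C) ⊗ A.X) ⊗≫ (Mᘁ : C) ◁ A.X ◁ coev M ⊗≫ (Mᘁ : C) ◁ l ▷ (Mᘁ : C) ⊗≫ ev M ▷ (Mᘁ : C) ⊗≫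
          𝟙 (Mᘁ : C)) ▷ A.X) ▷ M ⊗≫ 𝟙 _ := by
      rw [coactR, ← A.coev_ofDual, dualR]; monoidal
    _ = 𝟙 _ ⊗≫ coev' M ⊗≫ (𝟙 (Mᘁ : C) ⊗≫ (Mᘁ : C) ◁ coev A.X ⊗≫ (Mᘁ : C) ◁ A.X ◁ coev M ▷ (A.Xᘁ : C) ⊗≫
          (Mᘁ : C) ◁ l ▷ ((Mᘁ : C) ⊗ (A.Xᘁ : C)) ⊗≫ ev M ▷ ((Mᘁ : C) ⊗ (A.Xᘁ : C)) ⊗≫ 𝟙 ((Mᘁ : C) ⊗ (A.Xᘁ : C))) ▷ M ⊗≫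
          (Mᘁ : C) ◁ A.ofDual ▷ M := by
      rw [whisker_exchange]; monoidal
    _ = 𝟙 _ ⊗≫ (𝟙_ C ◁ coev' M ≫ (coev' M ⊗≫ (Mᘁ : C) ◁ coev' A.X ▷ M ⊗≫
        ((Mᘁ : C) ⊗ (A.Xᘁ : C)) ◁ l) ▷ ((Mᘁ : C) ⊗ M)) ⊗≫
          ((Mᘁ : C) ⊗ (A.Xᘁ : C)) ◁ ev' M ▷ M ⊗≫ (Mᘁ : C) ◁ A.ofDual ▷ M := by
      rw [transpose_tensor_eq]; monoidal
    _ = 𝟙 _ ⊗≫ coev' M ⊗≫ (Mᘁ : C) ◁ coev' A.X ▷ M ⊗≫ ((Mᘁ : C) ⊗ (A.Xᘁ : C)) ◁ l ⊗≫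
        ((Mᘁ : C) ⊗ (A.Xᘁ : C)) ◁ (M ◁ coev' M ≫ (α_ _ _ _).inv ≫ ev' M ▷ M) ⊗≫
          (Mᘁ : C) ◁ A.ofDual ▷ M := by
      rw [whisker_exchange]; monoidal
    _ = 𝟙 _ ⊗≫ coev' M ⊗≫ (Mᘁ : C) ◁ coev' A.X ▷ M ⊗≫
        (Mᘁ : C) ◁ ((A.Xᘁ : C) ◁ l ≫ A.ofDual ▷ M) := by
      rw [ev'_coev']; monoidal
    _ = _ := by
      rw [whisker_exchange, coactL, ← h.coev'_ofDual]; monoidal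

end DualActions

end FrobeniusAlgebra

-- The braiding and its inverse under one label

section Exchange

variable {C : Type u₁} [Category.{v₁} C] [MonoidalCategory C] [BraidedCategory C]

theorem exch_naturality_left (i : Leg) {X X' : C} (f : X ⟶ X') (Y : C) :
    f ▷ Y ≫ exch i X' Y = exch i X Y ≫ Y ◁ f := by
  cases i <;> simp [exch]

theorem exch_naturality_right (i : Leg) {Y Y' : C} (f : Y ⟶ Y') (X : C) :
    X ◁ f ≫ exch i X Y' = exch i X Y ≫ f ▷ X := by
  cases i <;> simp [exch]

@[simp]
theorem exch_exch (i : Leg) (X Y : C) : exch i X Y ≫ exch i.other Y X = 𝟙 _ := by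
  cases i <;> simp [exch, Leg.other]

@[simp]
theorem exch_other_exch (i : Leg) (X Y : C) : exch i.other X Y ≫ exch i Y X = 𝟙 _ := by
  cases i <;> simp [exch, Leg.other]

theorem exch_tensor_left (i : Leg) (X Y Z : C) :
    exch i (X ⊗ Y) Z = (α_ _ _ _).hom ≫ X ◁ exch i Y Z ≫ (α_ _ _ _).inv ≫ exch i X Z ▷ Y ≫
      (α_ _ _ _).hom := by
  cases i
  · simp only [exch, BraidedCategory.braiding_tensor_right_inv]
  · simp only [exch, BraidedCategory.braiding_tensor_left_hom]

theorem exch_tensor_right (i : Leg) (X Y Z : C) :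
    exch i X (Y ⊗ Z) = (α_ _ _ _).inv ≫ exch i X Y ▷ Z ≫ (α_ _ _ _).hom ≫ Y ◁ exch i X Z ≫
      (α_ _ _ _).inv := by
  cases i
  · simp only [exch, BraidedCategory.braiding_tensor_left_inv]
  · simp only [exch, BraidedCategory.braiding_tensor_right_hom]

theorem exch_unit_left (i : Leg) (X : C) : exch i (𝟙_ C) X = (λ_ X).hom ≫ (ρ_ X).inv := by
  cases i
  · have := braiding_tensorUnit_right X
    simp [exch]
  · simp [exch]

theorem exch_unit_right (i : Leg) (X : C) : exch i X (𝟙_ C) = (ρ_ X).hom ≫ (λ_ X).inv := by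
  cases i <;> simp [exch]

variable {D : Type u₂} [Category.{v₂} D] [MonoidalCategory D] [BraidedCategory D] (F : C ⥤ D)
  [F.LaxBraided]

/-- The lax braided square, read backwards, gives the square for the inverse braiding, so one
hypothesis serves both labels. -/
theorem exch_μ (i : Leg) (X Y : C) :
    exch i (F.obj X) (F.obj Y) ≫ μ F Y X = μ F X Y ≫ F.map (exch i X Y) := by
  cases i
  · have := Functor.LaxBraided.braided (F := F) Y X
    rw [exch, exch, Iso.inv_comp_eq, ← reassoc_of% this, ← F.map_comp, Iso.hom_inv_id, F.map_id,
      Category.comp_id]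
  · exact (Functor.LaxBraided.braided X Y).symm

end Exchange

-- Merging images of boxes that share one strand

section Merge

variable {C : Type u₁} [Category.{v₁} C] [MonoidalCategory C]
  {D : Type u₂} [Category.{v₂} D] [MonoidalCategory D] (F : C ⥤ D)
  [F.LaxMonoidal] [F.OplaxMonoidal]

/-- The image of a balanced map under a Frobenius functor. -/
def bmap {X Y Z W : C} (f : X ⊗ Y ⟶ Z ⊗ W) : F.obj X ⊗ F.obj Y ⟶ F.obj Z ⊗ F.obj W :=
  μ F X Y ≫ F.map f ≫ δ F Z W

/-- The analogue of `bmap` for three tensor factors. -/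
def tmap {X Y Z X' Y' Z' : C} (f : X ⊗ Y ⊗ Z ⟶ X' ⊗ Y' ⊗ Z') :
    F.obj X ⊗ F.obj Y ⊗ F.obj Z ⟶ F.obj X' ⊗ F.obj Y' ⊗ F.obj Z' :=
  F.obj X ◁ μ F Y Z ≫ μ F X (Y ⊗ Z) ≫ F.map f ≫ δ F X' (Y' ⊗ Z') ≫ F.obj X' ◁ δ F Y' Z'

variable {F}

theorem IsFrobenius.δ_μ (hF : IsFrobenius F) (X Y Z : C) :
    δ F X Y ▷ F.obj Z ≫ (α_ _ _ _).hom ≫ F.obj X ◁ μ F Y Z =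
      μ F (X ⊗ Y) Z ≫ F.map (α_ X Y Z).hom ≫ δ F X (Y ⊗ Z) := (hF.left X Y Z).symm

theorem IsFrobenius.δ_μ' (hF : IsFrobenius F) (X Y Z : C) :
    F.obj X ◁ δ F Y Z ≫ (α_ _ _ _).inv ≫ μ F X Y ▷ F.obj Z =
      μ F X (Y ⊗ Z) ≫ F.map (α_ X Y Z).inv ≫ δ F (X ⊗ Y) Z := (hF.right X Y Z).symm

variable (hF : IsFrobenius F) {X Y Z W X' Y' Z' Y'' : C}

/-- The boxes share only the strand `Y'`. There the `δ` of the first meets the `μ` of the second in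
the shape of a Frobenius relation, which reverses their order and lets both images be composed
inside `F`. -/
theorem IsFrobenius.whiskerLeft_bmap_bmap (hF : IsFrobenius F) (f : Y ⊗ Z ⟶ Y' ⊗ Z')
    (g : X ⊗ Y' ⟶ X' ⊗ Y'') :
    F.obj X ◁ bmap F f ≫ (α_ _ _ _).inv ≫ bmap F g ▷ F.obj Z' ≫ (α_ _ _ _).hom =
      tmap F (X ◁ f ≫ (α_ _ _ _).inv ≫ g ▷ Z' ≫ (α_ _ _ _).hom) := by
  simp only [bmap, tmap, MonoidalCategory.whiskerLeft_comp, comp_whiskerRight, Category.assoc,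
    F.map_comp]
  rw [reassoc_of% hF.δ_μ' X Y' Z', μ_natural_right_assoc, δ_natural_left_assoc,
    Functor.OplaxMonoidal.associativity]

theorem IsFrobenius.bmap_whiskerLeft_bmap (hF : IsFrobenius F) (g : X ⊗ Y ⟶ X' ⊗ Y')
    (f : Y' ⊗ Z ⟶ Y'' ⊗ Z') :
    (α_ _ _ _).inv ≫ bmap F g ▷ F.obj Z ≫ (α_ _ _ _).hom ≫ F.obj X' ◁ bmap F f =
      tmap F ((α_ _ _ _).inv ≫ g ▷ Z ≫ (α_ _ _ _).hom ≫ X' ◁ f) := by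
  simp only [bmap, tmap, MonoidalCategory.whiskerLeft_comp, comp_whiskerRight, Category.assoc,
    F.map_comp]
  rw [reassoc_of% hF.δ_μ X' Y' Z, μ_natural_left_assoc, δ_natural_right_assoc,
    Functor.LaxMonoidal.associativity_inv_assoc]

/-- Moving a strand across a box does not obstruct merging. -/
theorem IsFrobenius.δ_exch_μ [BraidedCategory C] [BraidedCategory D] {F : C ⥤ D}
    [F.LaxBraided] [F.OplaxMonoidal] (hF : IsFrobenius F) (i : Leg) (X Y Z : C) :
    δ F X Y ▷ F.obj Z ≫ (α_ _ _ _).hom ≫ F.obj X ◁ exch i (F.obj Y) (F.obj Z) ≫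
        (α_ _ _ _).inv ≫ μ F X Z ▷ F.obj Y =
      μ F (X ⊗ Y) Z ≫ F.map ((α_ _ _ _).hom ≫ X ◁ exch i Y Z ≫ (α_ _ _ _).inv) ≫
        δ F (X ⊗ Z) Y := by
  -- Only `μ` is known to respect the braiding. Rewriting `μ F X Z` through `μ F Z X` completes the
  -- braiding of `F Y` with `F Z` to one of `F X ⊗ F Y` with `F Z`, and this slides past `δ` by
  -- naturality.
  have h1 : μ F X Z = exch i (F.obj X) (F.obj Z) ≫ μ F Z X ≫ F.map (exch i.other Z X) := by
    rw [reassoc_of% exch_μ F i X Z, ← F.map_comp, exch_exch, F.map_id, Category.comp_id]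
  have h2 := exch_tensor_left i (F.obj X) (F.obj Y) (F.obj Z)
  have h3 : F.obj X ◁ exch i (F.obj Y) (F.obj Z) ≫ (α_ _ _ _).inv ≫
      exch i (F.obj X) (F.obj Z) ▷ F.obj Y =
      (α_ _ _ _).inv ≫ exch i (F.obj X ⊗ F.obj Y) (F.obj Z) ≫ (α_ _ _ _).inv := by
    rw [h2]; simp
  have h4 : (α_ _ _ _).hom ≫ X ◁ exch i Y Z ≫ (α_ _ _ _).inv = 
      exch i (X ⊗ Y) Z ≫ (α_ _ _ _).inv ≫ exch i.other Z X ▷ Y := by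
    rw [exch_tensor_left]; simp [← comp_whiskerRight]
  rw [h1, comp_whiskerRight, comp_whiskerRight, reassoc_of% h3, Iso.hom_inv_id_assoc,
    reassoc_of% exch_naturality_left, reassoc_of% hF.δ_μ' Z X Y, reassoc_of% exch_μ, h4,
    δ_natural_left]
  simp only [F.map_comp, Category.assoc]

theorem IsFrobenius.bmap_exch_bmap [BraidedCategory C] [BraidedCategory D] {F : C ⥤ D}
    [F.LaxBraided] [F.OplaxMonoidal] (hF : IsFrobenius F) (i : Leg) (g : X ⊗ Y ⟶ X' ⊗ Y')
    (g' : X' ⊗ Z ⟶ Y'' ⊗ Z') :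
    (α_ _ _ _).inv ≫ bmap F g ▷ F.obj Z ≫ (α_ _ _ _).hom ≫
        F.obj X' ◁ exch i (F.obj Y') (F.obj Z) ≫ (α_ _ _ _).inv ≫ bmap F g' ▷ F.obj Y' ≫
        (α_ _ _ _).hom =
      tmap F ((α_ _ _ _).inv ≫ g ▷ Z ≫ (α_ _ _ _).hom ≫ X' ◁ exch i Y' Z ≫ (α_ _ _ _).inv ≫
        g' ▷ Y' ≫ (α_ _ _ _).hom) := by
  have h := hF.δ_exch_μ i X' Y' Z
  simp only [bmap, tmap, comp_whiskerRight, Category.assoc, F.map_comp] at h ⊢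
  rw [reassoc_of% h, μ_natural_left_assoc, δ_natural_left_assoc,
    Functor.OplaxMonoidal.associativity, Functor.LaxMonoidal.associativity_inv_assoc]

/-- `F` is compatible with the braiding also as an oplax monoidal functor. -/
def OplaxBraided [BraidedCategory C] [BraidedCategory D] (F : C ⥤ D) [F.OplaxMonoidal] : Prop :=
  ∀ (i : Leg) (X Y : C), δ F X Y ≫ exch i (F.obj X) (F.obj Y) = F.map (exch i X Y) ≫ δ F Y X

/-- Here the braiding comes after the last `δ` with no `μ` behind it, so, unlike in
`IsFrobenius.bmap_exch_bmap`, compatibility of `δ` itself with the braiding is needed. -/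
theorem OplaxBraided.tmap_exch [BraidedCategory C] [BraidedCategory D] (h : OplaxBraided F)
    (i : Leg) (f : X ⊗ Y ⊗ Z ⟶ X' ⊗ Y' ⊗ Z') :
    tmap F f ≫ F.obj X' ◁ exch i (F.obj Y') (F.obj Z') = tmap F (f ≫ X' ◁ exch i Y' Z') := by
  simp only [tmap, F.map_comp, Category.assoc]
  rw [← MonoidalCategory.whiskerLeft_comp, h, MonoidalCategory.whiskerLeft_comp,
    δ_natural_right_assoc]

end Merge

-- Linearity of boxes and its transport

section Linear

variable {C : Type u₁} [Category.{v₁} C] [MonoidalCategory C] {P X Y Z W : C}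

/-- `f` commutes with left actions on the first tensor factors. -/
def LeftLinear (l : P ⊗ X ⟶ X) (l' : P ⊗ Z ⟶ Z) (f : X ⊗ Y ⟶ Z ⊗ W) : Prop :=
  l ▷ Y ≫ f = (α_ _ _ _).hom ≫ P ◁ f ≫ (α_ _ _ _).inv ≫ l' ▷ W

/-- `f` commutes with right actions on the second tensor factors. -/
def RightLinear (r : Y ⊗ P ⟶ Y) (r' : W ⊗ P ⟶ W) (f : X ⊗ Y ⟶ Z ⊗ W) : Prop :=
  X ◁ r ≫ f = (α_ _ _ _).inv ≫ f ▷ P ≫ (α_ _ _ _).hom ≫ Z ◁ r'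

/-- `f` takes an action on the second tensor factor to an action on the first one. -/
def ExchOut [BraidedCategory C] (i : Leg) (r : Y ⊗ P ⟶ Y) (r' : Z ⊗ P ⟶ Z)
    (f : X ⊗ Y ⟶ Z ⊗ W) : Prop :=
  X ◁ r ≫ f = (α_ _ _ _).inv ≫ f ▷ P ≫ (α_ _ _ _).hom ≫ Z ◁ exch i W P ≫ (α_ _ _ _).inv ≫ r' ▷ W

/-- `f` takes an action on the first tensor factor to an action on the second one. -/
def ExchIn [BraidedCategory C] (i : Leg) (r : X ⊗ P ⟶ X) (r' : W ⊗ P ⟶ W)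
    (f : X ⊗ Y ⟶ Z ⊗ W) : Prop :=
  X ◁ exch i Y P ≫ (α_ _ _ _).inv ≫ r ▷ Y ≫ f = (α_ _ _ _).inv ≫ f ▷ P ≫ (α_ _ _ _).hom ≫ Z ◁ r'

variable {D : Type u₂} [Category.{v₂} D] [MonoidalCategory D] {F : C ⥤ D}

theorem LeftLinear.map [F.LaxMonoidal] [F.OplaxMonoidal] (hF : IsFrobenius F) {l : P ⊗ X ⟶ X} {l' : P ⊗ Z ⟶ Z} {f : X ⊗ Y ⟶ Z ⊗ W}
    (h : LeftLinear l l' f) : LeftLinear (μ F P X ≫ F.map l) (μ F P Z ≫ F.map l') (bmap F f) := by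
  have h' := congrArg F.map h
  simp only [LeftLinear, bmap, comp_whiskerRight, Category.assoc, F.map_comp,
    MonoidalCategory.whiskerLeft_comp] at h' ⊢
  rw [reassoc_of% hF.δ_μ', μ_natural_right_assoc, μ_natural_left_assoc, δ_natural_left,
    ← Functor.LaxMonoidal.associativity_assoc, reassoc_of% h']

theorem RightLinear.map [F.LaxMonoidal] [F.OplaxMonoidal] (hF : IsFrobenius F) {r : Y ⊗ P ⟶ Y} {r' : W ⊗ P ⟶ W} {f : X ⊗ Y ⟶ Z ⊗ W}
    (h : RightLinear r r' f) :
    RightLinear (μ F Y P ≫ F.map r) (μ F W P ≫ F.map r') (bmap F f) := by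
  have h' := congrArg F.map h
  simp only [RightLinear, bmap, comp_whiskerRight, Category.assoc, F.map_comp,
    MonoidalCategory.whiskerLeft_comp] at h' ⊢
  rw [reassoc_of% hF.δ_μ, μ_natural_right_assoc, μ_natural_left_assoc, δ_natural_right,
    ← Functor.LaxMonoidal.associativity_inv_assoc, reassoc_of% h']

theorem ExchOut.map [BraidedCategory C] [BraidedCategory D] [F.LaxBraided] [F.OplaxMonoidal]
    (hF : IsFrobenius F) {i : Leg} {r : Y ⊗ P ⟶ Y} {r' : Z ⊗ P ⟶ Z} {f : X ⊗ Y ⟶ Z ⊗ W}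
    (h : ExchOut i r r' f) : ExchOut i (μ F Y P ≫ F.map r) (μ F Z P ≫ F.map r') (bmap F f) := by
  have h' := congrArg F.map h
  have e := hF.δ_exch_μ i Z W P
  simp only [ExchOut, bmap, comp_whiskerRight, Category.assoc, F.map_comp,
    MonoidalCategory.whiskerLeft_comp] at h' e ⊢
  rw [reassoc_of% e, μ_natural_right_assoc, μ_natural_left_assoc, δ_natural_left,
    ← Functor.LaxMonoidal.associativity_inv_assoc, reassoc_of% h']

theorem ExchIn.map [BraidedCategory C] [BraidedCategory D] [F.LaxBraided] [F.OplaxMonoidal]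
    (hF : IsFrobenius F) {i : Leg} {r : X ⊗ P ⟶ X} {r' : W ⊗ P ⟶ W} {f : X ⊗ Y ⟶ Z ⊗ W}
    (h : ExchIn i r r' f) : ExchIn i (μ F X P ≫ F.map r) (μ F W P ≫ F.map r') (bmap F f) := by
  have h' := congrArg F.map h
  simp only [ExchIn, bmap, comp_whiskerRight, Category.assoc, F.map_comp,
    MonoidalCategory.whiskerLeft_comp] at h' ⊢
  rw [reassoc_of% hF.δ_μ, μ_natural_left_assoc, μ_natural_left_assoc, δ_natural_right,
    ← Functor.LaxMonoidal.associativity_inv_assoc, ← MonoidalCategory.whiskerLeft_comp_assoc,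
    exch_μ, MonoidalCategory.whiskerLeft_comp_assoc, μ_natural_right_assoc,
    ← Functor.LaxMonoidal.associativity_inv_assoc, reassoc_of% h']

end Linear

-- Coactions and the bridge over the image algebra

section MapAlgebra

variable {C : Type u₁} [Category.{v₁} C] [MonoidalCategory C]
  {D : Type u₂} [Category.{v₂} D] [MonoidalCategory D] {F : C ⥤ D}
  [F.LaxMonoidal] [F.OplaxMonoidal] (hF : IsFrobenius F) (A : FrobeniusAlgebra C)

theorem IsFrobenius.copairing_eq :
    (hF.mapAlgebra A).copairing = ε F ≫ F.map A.copairing ≫ δ F A.X A.X := by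
  change (ε F ≫ F.map A.one) ≫ F.map A.comul ≫ δ F A.X A.X = _
  rw [FrobeniusAlgebra.copairing, F.map_comp, Category.assoc, Category.assoc]

variable {M N X Y : C}

/-- The copairing of `F(A)` ends in `δ`; a Frobenius relation exchanges it with the `μ` of the
action, and unitality absorbs the unit of `F`. -/
theorem IsFrobenius.coactR_eq (r : M ⊗ A.X ⟶ M) :
    (hF.mapAlgebra A).coactR (μ F M A.X ≫ F.map r) = F.map (A.coactR r) ≫ δ F M A.X := by
  rw [FrobeniusAlgebra.coactR_eq, FrobeniusAlgebra.coactR_eq, hF.copairing_eq]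
  change (ρ_ _).inv ≫ F.obj M ◁ (ε F ≫ F.map A.copairing ≫ δ F A.X A.X) ≫ (α_ _ _ _).inv ≫
    (μ F M A.X ≫ F.map r) ▷ F.obj A.X = _
  simp only [MonoidalCategory.whiskerLeft_comp, comp_whiskerRight, Category.assoc, F.map_comp]
  have e := hF.δ_μ' M A.X A.X
  rw [reassoc_of% e, μ_natural_right_assoc, right_unitality_inv_assoc, δ_natural_left]

theorem IsFrobenius.coactL_eq (l : A.X ⊗ M ⟶ M) :
    (hF.mapAlgebra A).coactL (μ F A.X M ≫ F.map l) = F.map (A.coactL l) ≫ δ F A.X M := by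
  rw [FrobeniusAlgebra.coactL_eq, FrobeniusAlgebra.coactL_eq, hF.copairing_eq]
  change (λ_ _).inv ≫ (ε F ≫ F.map A.copairing ≫ δ F A.X A.X) ▷ F.obj M ≫ (α_ _ _ _).hom ≫
    F.obj A.X ◁ (μ F A.X M ≫ F.map l) = _
  simp only [MonoidalCategory.whiskerLeft_comp, comp_whiskerRight, Category.assoc, F.map_comp]
  have e := hF.δ_μ A.X A.X M
  rw [reassoc_of% e, μ_natural_left_assoc, left_unitality_inv_assoc, δ_natural_right]

theorem IsFrobenius.bridge_eq (r : M ⊗ A.X ⟶ M) (l : A.X ⊗ N ⟶ N) :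
    (hF.mapAlgebra A).bridge (μ F M A.X ≫ F.map r) (μ F A.X N ≫ F.map l) =
      bmap F (A.bridge r l) := by
  rw [FrobeniusAlgebra.bridge_eq_coactR, hF.coactR_eq, FrobeniusAlgebra.bridge_eq_coactR, bmap]
  change (F.map (A.coactR r) ≫ δ F M A.X) ▷ F.obj N ≫ (α_ _ _ _).hom ≫
    F.obj M ◁ (μ F A.X N ≫ F.map l) = _
  simp only [MonoidalCategory.whiskerLeft_comp, comp_whiskerRight, Category.assoc, F.map_comp]
  have e := hF.δ_μ M A.X N
  rw [reassoc_of% e, μ_natural_left_assoc, δ_natural_right]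

variable {A}

theorem FrobeniusAlgebra.Balanced.map {r : M ⊗ A.X ⟶ M} {l : A.X ⊗ N ⟶ N} {b : M ⊗ N ⟶ Y}
    (h : A.Balanced r l b) :
    (hF.mapAlgebra A).Balanced (μ F M A.X ≫ F.map r) (μ F A.X N ≫ F.map l)
      (μ F M N ≫ F.map b) := by
  have h' := congrArg F.map h
  change (μ F M A.X ≫ F.map r) ▷ F.obj N ≫ μ F M N ≫ F.map b = (α_ _ _ _).hom ≫
    F.obj M ◁ (μ F A.X N ≫ F.map l) ≫ μ F M N ≫ F.map b
  simp only [MonoidalCategory.whiskerLeft_comp, comp_whiskerRight,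
    Category.assoc, F.map_comp] at h' ⊢
  rw [μ_natural_left_assoc, μ_natural_right_assoc, h', Functor.LaxMonoidal.associativity_assoc]

theorem FrobeniusAlgebra.Cobalanced.map {r : M ⊗ A.X ⟶ M} {l : A.X ⊗ N ⟶ N} {g : X ⟶ M ⊗ N}
    (h : A.Cobalanced r l g) :
    (hF.mapAlgebra A).Cobalanced (μ F M A.X ≫ F.map r) (μ F A.X N ≫ F.map l)
      (F.map g ≫ δ F M N) := by
  have h' := congrArg F.map h
  rw [FrobeniusAlgebra.Cobalanced, hF.coactR_eq, hF.coactL_eq]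
  change (F.map g ≫ δ F M N) ≫ (F.map (A.coactR r) ≫ δ F M A.X) ▷ F.obj N ≫ (α_ _ _ _).hom =
    (F.map g ≫ δ F M N) ≫ F.obj M ◁ (F.map (A.coactL l) ≫ δ F A.X N)
  simp only [MonoidalCategory.whiskerLeft_comp, comp_whiskerRight,
    Category.assoc, F.map_comp] at h' ⊢
  rw [δ_natural_left_assoc, δ_natural_right_assoc, Functor.OplaxMonoidal.associativity,
    reassoc_of% h']

theorem FrobeniusAlgebra.Balanced.comp {r : M ⊗ A.X ⟶ M} {l : A.X ⊗ N ⟶ N} {b : M ⊗ N ⟶ Y}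
    (h : A.Balanced r l b) {Z : C} (f : Y ⟶ Z) : A.Balanced r l (b ≫ f) := by
  rw [FrobeniusAlgebra.Balanced] at h ⊢
  rw [reassoc_of% h]

theorem FrobeniusAlgebra.Cobalanced.comp {r : M ⊗ A.X ⟶ M} {l : A.X ⊗ N ⟶ N} {g : X ⟶ M ⊗ N}
    (h : A.Cobalanced r l g) {Z : C} (f : Z ⟶ X) : A.Cobalanced r l (f ≫ g) := by
  rw [FrobeniusAlgebra.Cobalanced] at h ⊢
  rw [Category.assoc, Category.assoc, h]

end MapAlgebra

-- Idempotents of the relative tensor product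

namespace FrobeniusAlgebra

section Idempotents

variable {C : Type u₁} [Category.{v₁} C] [MonoidalCategory C]
  {A : FrobeniusAlgebra C} {M N : Bimod A.toMon A.toMon}
  {a : 𝟙_ C ⟶ A.X} {V : C}

/-- The idempotent `bridge ∘ a` on `M ⊗ N`. -/
def idemL (a : 𝟙_ C ⟶ A.X) (M N : Bimod A.toMon A.toMon) : M.X ⊗ N.X ⟶ M.X ⊗ N.X := A.insR a M.actRight ▷ N.X ≫ A.bridge M.actRight N.actLeft

/-- The idempotent `a ∘ bridge` on `M ⊗ N`. -/
def idemR (a : 𝟙_ C ⟶ A.X) (M N : Bimod A.toMon A.toMon) : M.X ⊗ N.X ⟶ M.X ⊗ N.X := A.bridge M.actRight N.actLeft ≫ A.insR a M.actRight ▷ N.X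

theorem Balanced.idemR_comp {b : M.X ⊗ N.X ⟶ V} (ha : A.Splits a)
    (hb : A.Balanced M.actRight N.actLeft b) : idemR a M N ≫ b = b := by
  rw [idemR, Category.assoc, hb.bridge_insR ha]

theorem Cobalanced.comp_idemL {g : V ⟶ M.X ⊗ N.X} (ha : A.Splits a)
    (hg : A.Cobalanced M.actRight N.actLeft g) : g ≫ idemL a M N = g :=
  hg.insR_bridge ha

end Idempotents

end FrobeniusAlgebra

-- Merging images along two shared strands

section Separable

variable {C : Type u₁} [Category.{v₁} C] [MonoidalCategory C]
  {D : Type u₂} [Category.{v₂} D] [MonoidalCategory D] {F : C ⥤ D}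
  [F.LaxMonoidal] [F.OplaxMonoidal]

open FrobeniusAlgebra

/-- The insertion of an element of `F(A)` along `F(M) ⊗ F(N)` followed by the structure morphism
splits the image of the bridge. -/
def SplitsImage (F : C ⥤ D) [F.LaxMonoidal] [F.OplaxMonoidal] (hF : IsFrobenius F)
    (A : FrobeniusAlgebra C) (a' : 𝟙_ D ⟶ F.obj A.X) : Prop :=
  ∀ M N : Bimod A.toMon A.toMon,
    F.map (A.bridge M.actRight N.actLeft) ≫ δ F M.X N.X ≫
      (hF.mapAlgebra A).insR a' (μ F M.X A.X ≫ F.map M.actRight) ▷ F.obj N.X ≫ μ F M.X N.X ≫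
      F.map (A.bridge M.actRight N.actLeft) = F.map (A.bridge M.actRight N.actLeft)

/-- The bridge factors as projection followed by inclusion, so sandwiching the identity of `F(M ⊗_A
N)` between these two gives a statement free of coequalizers. This is the form used for merging. -/
theorem IsStronglySeparable.splitsImage [RightRigidCategory C] [PivotalCategory C]
    [HasCoequalizers C] {hF : IsFrobenius F} {A : FrobeniusAlgebra C} {ψ' : 𝟙_ D ⟶ F.obj A.X}
    (h : IsStronglySeparable hF A ψ') : SplitsImage F hF A ((hF.mapAlgebra A).sq ψ') := by
  intro M N
  have e : relProj M N ≫ A.incl M N = A.bridge M.actRight N.actLeft := coequalizer.π_desc _ _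
  have h' : F.map (A.incl M N) ≫ δ F M.X N.X ≫ (hF.mapAlgebra A).insR ((hF.mapAlgebra A).sq ψ')
      (μ F M.X A.X ≫ F.map M.actRight) ▷ F.obj N.X ≫ μ F M.X N.X ≫ F.map (relProj M N) = 𝟙 _ :=
    h M N
  rw [← e, F.map_comp, Category.assoc, reassoc_of% h']

variable {hF : IsFrobenius F} {A : FrobeniusAlgebra C} {a' : 𝟙_ D ⟶ F.obj A.X}
  (h : SplitsImage F hF A a') {a : 𝟙_ C ⟶ A.X} {M N : Bimod A.toMon A.toMon}

variable (hF a' M N) in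
/-- The endomorphism of `F(M ⊗ N)` given by the insertion of an element of `F(A)`. -/
def midIns : F.obj (M.X ⊗ N.X) ⟶ F.obj (M.X ⊗ N.X) :=
  δ F M.X N.X ≫ (hF.mapAlgebra A).insR a' (μ F M.X A.X ≫ F.map M.actRight) ▷ F.obj N.X ≫
    μ F M.X N.X

include h

/-- The exchange on which merging rests: enclosed by the images of the idempotents, an insertion
over `F(A)` may be replaced by the image of an insertion over `A`. The element `a` is arbitrary
here; it only has to be the one absorbed by the neighbouring boxes. -/
theorem SplitsImage.map_idemL_idemR :
    F.map (idemL a M N) ≫ midIns hF a' M N ≫ F.map (idemR a M N) =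
      F.map (idemL a M N ≫ A.insR a M.actRight ▷ N.X) := by
  have := h M N
  simp only [idemL, idemR, midIns, F.map_comp, Category.assoc]
  rw [reassoc_of% this]

variable {X Y Z X' Y' Z' W : C}

/-- The boxes absorb the idempotents, so these can be created on both sides of the insertion, which
is then exchanged. -/
theorem SplitsImage.bmap_bmap {f : X ⊗ Y ⟶ M.X ⊗ N.X} {g : M.X ⊗ N.X ⟶ Z ⊗ W}
    (hf : f ≫ idemL a M N = f) (hg : idemR a M N ≫ g = g) :
    bmap F f ≫ (hF.mapAlgebra A).insR a' (μ F M.X A.X ≫ F.map M.actRight) ▷ F.obj N.X ≫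
      bmap F g = bmap F (f ≫ A.insR a M.actRight ▷ N.X ≫ g) := by
  have e := h.map_idemL_idemR (a := a) (M := M) (N := N)
  simp only [midIns, Category.assoc] at e
  simp only [bmap, Category.assoc]
  conv_lhs => rw [← hf, ← hg]
  simp only [F.map_comp, Category.assoc]
  rw [reassoc_of% e]
  simp only [← F.map_comp_assoc]
  conv_rhs => rw [← hf]
  simp only [Category.assoc]

/-- The same argument beside an idle strand `X'`, past which `δ` moves by naturality. -/
theorem SplitsImage.tmap_whiskerLeft {f : X ⊗ Y ⊗ Z ⟶ X' ⊗ M.X ⊗ N.X} {g : M.X ⊗ N.X ⟶ Y' ⊗ Z'}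
    (hf : f ≫ X' ◁ idemL a M N = f) (hg : idemR a M N ≫ g = g) :
    tmap F f ≫ F.obj X' ◁ ((hF.mapAlgebra A).insR a' (μ F M.X A.X ≫ F.map M.actRight) ▷ F.obj N.X ≫
      bmap F g) = tmap F (f ≫ X' ◁ (A.insR a M.actRight ▷ N.X ≫ g)) := by
  have e := congrArg (fun k => F.obj X' ◁ k) (h.map_idemL_idemR (a := a) (M := M) (N := N))
  simp only [midIns, Category.assoc, MonoidalCategory.whiskerLeft_comp] at e
  conv_lhs => rw [← hf, ← hg]
  simp only [tmap, bmap, F.map_comp, Category.assoc, MonoidalCategory.whiskerLeft_comp]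
  rw [← δ_natural_right_assoc, reassoc_of% e]
  simp only [δ_natural_right_assoc]
  simp only [← F.map_comp_assoc, ← MonoidalCategory.whiskerLeft_comp, Category.assoc]
  conv_rhs => rw [← hf]
  simp only [Category.assoc, MonoidalCategory.whiskerLeft_comp, F.map_comp]

theorem SplitsImage.tmap_whiskerRight {f : X ⊗ Y ⊗ Z ⟶ M.X ⊗ N.X ⊗ X'} {g : M.X ⊗ N.X ⟶ Y' ⊗ Z'}
    (hf : f ≫ (α_ _ _ _).inv ≫ idemL a M N ▷ X' ≫ (α_ _ _ _).hom = f)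
    (hg : idemR a M N ≫ g = g) :
    tmap F f ≫ (α_ _ _ _).inv ≫ ((hF.mapAlgebra A).insR a' (μ F M.X A.X ≫ F.map M.actRight) ▷
      F.obj N.X ≫ bmap F g) ▷ F.obj X' ≫ (α_ _ _ _).hom =
      tmap F (f ≫ (α_ _ _ _).inv ≫ (A.insR a M.actRight ▷ N.X ≫ g) ▷ X' ≫ (α_ _ _ _).hom) := by
  have e := congrArg (fun k => k ▷ F.obj X') (h.map_idemL_idemR (a := a) (M := M) (N := N))
  simp only [midIns, Category.assoc, comp_whiskerRight] at e
  conv_lhs => rw [← hf, ← hg]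
  simp only [tmap, bmap, F.map_comp, Category.assoc, comp_whiskerRight]
  have a1 {U V W : C} : δ F U (V ⊗ W) ≫ F.obj U ◁ δ F V W ≫ (α_ _ _ _).inv =
      F.map (α_ _ _ _).inv ≫ δ F (U ⊗ V) W ≫ δ F U V ▷ F.obj W := by
    rw [← Category.assoc, Iso.comp_inv_eq, Category.assoc, Category.assoc,
      Functor.OplaxMonoidal.associativity, ← F.map_comp_assoc, Iso.inv_hom_id, F.map_id,
      Category.id_comp]
  rw [reassoc_of% a1, ← F.map_comp_assoc (α_ _ _ _).hom, Iso.hom_inv_id, F.map_id,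
    Category.id_comp, ← δ_natural_left_assoc, reassoc_of% e]
  simp only [δ_natural_left_assoc]
  rw [Functor.OplaxMonoidal.associativity]
  simp only [← F.map_comp_assoc]
  conv_rhs => rw [← hf]
  simp only [Category.assoc, comp_whiskerRight, F.map_comp, Iso.hom_inv_id_assoc]

end Separable

-- Sliding insertions and bridges through linear boxes

section LinearInsertion

variable {C : Type u₁} [Category.{v₁} C] [MonoidalCategory C] {A : FrobeniusAlgebra C}
  {X Y Z W U : C} {f : X ⊗ Y ⟶ Z ⊗ W}

theorem RightLinear.insR {r : Y ⊗ A.X ⟶ Y} {r' : W ⊗ A.X ⟶ W} (h : RightLinear r r' f)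
    (a : 𝟙_ C ⟶ A.X) : X ◁ A.insR a r ≫ f = f ≫ Z ◁ A.insR a r' := by
  calc
    _ = 𝟙 _ ⊗≫ X ◁ Y ◁ a ⊗≫ (X ◁ r ≫ f) := by rw [FrobeniusAlgebra.insR]; monoidal
    _ = 𝟙 _ ⊗≫ ((X ⊗ Y) ◁ a ≫ f ▷ A.X) ⊗≫ Z ◁ r' := by rw [h]; monoidal
    _ = _ := by rw [whisker_exchange, FrobeniusAlgebra.insR]; monoidal

theorem RightLinear.bridge {r : Y ⊗ A.X ⟶ Y} {r' : W ⊗ A.X ⟶ W} (h : RightLinear r r' f)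
    (l : A.X ⊗ U ⟶ U) : X ◁ A.bridge r l ≫ (α_ _ _ _).inv ≫ f ▷ U ≫ (α_ _ _ _).hom =
      (α_ _ _ _).inv ≫ f ▷ U ≫ (α_ _ _ _).hom ≫ Z ◁ A.bridge r' l := by
  calc
    _ = 𝟙 _ ⊗≫ X ◁ Y ◁ A.coactL l ⊗≫ (X ◁ r ≫ f) ▷ U ⊗≫ 𝟙 _ := by
      rw [A.bridge_eq_coactL]; monoidal
    _ = 𝟙 _ ⊗≫ ((X ⊗ Y) ◁ A.coactL l ≫ f ▷ (A.X ⊗ U)) ⊗≫ Z ◁ r' ▷ U := by rw [h]; monoidal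
    _ = _ := by rw [whisker_exchange, A.bridge_eq_coactL]; monoidal

theorem LeftLinear.bridge {l : A.X ⊗ X ⟶ X} {l' : A.X ⊗ Z ⟶ Z} (h : LeftLinear l l' f)
    (r : U ⊗ A.X ⟶ U) : A.bridge r l ▷ Y ≫ (α_ _ _ _).hom ≫ U ◁ f ≫ (α_ _ _ _).inv =
      (α_ _ _ _).hom ≫ U ◁ f ≫ (α_ _ _ _).inv ≫ A.bridge r l' ▷ W := by
  calc
    _ = 𝟙 _ ⊗≫ A.coactR r ▷ X ▷ Y ⊗≫ U ◁ (l ▷ Y ≫ f) ⊗≫ 𝟙 ((U ⊗ Z) ⊗ W) := by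
      rw [A.bridge_eq_coactR]; monoidal
    _ = 𝟙 _ ⊗≫ (A.coactR r ▷ (X ⊗ Y) ≫ (U ⊗ A.X) ◁ f) ⊗≫ U ◁ l' ▷ W ⊗≫ 𝟙 ((U ⊗ Z) ⊗ W) := by rw [h]; monoidal
    _ = _ := by rw [← whisker_exchange, A.bridge_eq_coactR]; monoidal

end LinearInsertion

-- The two evaluations differ by the braiding and the twist

section Twist

variable {C : Type u₁} [Category.{v₁} C] [MonoidalCategory C] [RightRigidCategory C]
  [PivotalCategory C] [BraidedCategory C]

theorem exch_ev' (i : Leg) (X Y : C) :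
    exch i X Y ▷ (Xᘁ : C) ≫ (α_ _ _ _).hom ≫ Y ◁ ev' X = (α_ _ _ _).hom ≫
      X ◁ exch i.other Y Xᘁ ≫ (α_ _ _ _).inv ≫ ev' X ▷ Y ≫ (λ_ _).hom ≫ (ρ_ _).inv := by
  have h := exch_naturality_left i (ev' X) Y
  rw [exch_tensor_left, exch_unit_left] at h
  rw [h]
  have e : X ◁ exch i.other Y (Xᘁ : C) ≫ X ◁ exch i (Xᘁ : C) Y = 𝟙 _ := by
    rw [← MonoidalCategory.whiskerLeft_comp, exch_other_exch, MonoidalCategory.whiskerLeft_id]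
  simp only [Category.assoc, Iso.inv_hom_id_assoc]
  rw [reassoc_of% e, Iso.hom_inv_id_assoc]

omit [PivotalCategory C] in
theorem exch_ev (i : Leg) (X Y : C) :
    (Xᘁ : C) ◁ exch i Y X ≫ (α_ _ _ _).inv ≫ ev X ▷ Y = (α_ _ _ _).inv ≫
      exch i.other (Xᘁ : C) Y ▷ X ≫ (α_ _ _ _).hom ≫ Y ◁ ev X ≫ (ρ_ _).hom ≫ (λ_ _).inv := by
  have h := exch_naturality_right i (ev X) Y
  rw [exch_tensor_right, exch_unit_right] at h
  rw [h]
  have e : exch i.other (Xᘁ : C) Y ▷ X ≫ exch i Y (Xᘁ : C) ▷ X = 𝟙 _ := by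
    rw [← comp_whiskerRight, exch_other_exch, id_whiskerRight]
  simp only [Category.assoc, Iso.hom_inv_id_assoc]
  rw [reassoc_of% e, Iso.inv_hom_id_assoc]

theorem leftTwist_eq (X : C) :
    leftTwist X = 𝟙 X ⊗≫ (coev' X ≫ (β_ X (Xᘁ : C)).inv) ▷ X ⊗≫ X ◁ ev X ⊗≫ 𝟙 X := by
  have h := exch_ev .two X X
  calc
    _ = 𝟙 X ⊗≫ coev' X ▷ X ⊗≫ ((Xᘁ : C) ◁ (β_ X X).hom ≫ (α_ _ _ _).inv ≫ ev X ▷ X) ⊗≫ 𝟙 X := by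
      rw [leftTwist, leftTrace]; monoidal
    _ = _ := by
      rw [show (β_ X X).hom = exch .two X X from rfl, h]
      change 𝟙 X ⊗≫ coev' X ▷ X ⊗≫ ((α_ _ _ _).inv ≫ (β_ X (Xᘁ : C)).inv ▷ X ≫ _) ⊗≫ 𝟙 X = _
      monoidal

/-- Composing the second coevaluation with the inverse braiding gives a copairing of the same type
as `coev X`. Recovering it from its bent form by a zigzag, the endomorphism of `X` that appears is
the left twist. -/
theorem coev'_braiding_inv (X : C) :
    coev' X ≫ (β_ X (Xᘁ : C)).inv = coev X ≫ leftTwist X ▷ (Xᘁ : C) := by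
  rw [leftTwist_eq]
  symm
  set k := coev' X ≫ (β_ X (Xᘁ : C)).inv
  calc
    _ = 𝟙 _ ⊗≫ (𝟙_ C ◁ coev X ≫ k ▷ (X ⊗ (Xᘁ : C))) ⊗≫ X ◁ ev X ▷ (Xᘁ : C) ⊗≫ 𝟙 _ := by monoidal
    _ = k ⊗≫ X ◁ ((Xᘁ : C) ◁ coev X ≫ (α_ _ _ _).inv ≫ ev X ▷ (Xᘁ : C)) ⊗≫ 𝟙 _ := by
      rw [whisker_exchange]; monoidal
    _ = k := by rw [ev_coev]; monoidal

/-- This expresses `ev'`, up to the twist, by `ev` and the braiding. A functor that preserves these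
three things has no freedom left on `ev'`. -/
theorem braiding_inv_ev (X : C) :
    (β_ (Xᘁ : C) X).inv ≫ ev X = leftTwist X ▷ (Xᘁ : C) ≫ ev' X := by
  have h := exch_ev .two X X
  symm
  calc
    _ = 𝟙 _ ⊗≫ coev' X ▷ (X ⊗ (Xᘁ : C)) ⊗≫
        ((Xᘁ : C) ◁ exch .two X X ≫ (α_ _ _ _).inv ≫ ev X ▷ X) ▷ (Xᘁ : C) ⊗≫ ev' X := by
      rw [leftTwist, leftTrace]
      change _ = 𝟙 _ ⊗≫ coev' X ▷ (X ⊗ (Xᘁ : C)) ⊗≫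
        ((Xᘁ : C) ◁ (β_ X X).hom ≫ (α_ _ _ _).inv ≫ ev X ▷ X) ▷ (Xᘁ : C) ⊗≫ ev' X
      monoidal
    _ = 𝟙 _ ⊗≫ coev' X ▷ (X ⊗ (Xᘁ : C)) ⊗≫
        (Xᘁ : C) ◁ (exch .two X X ▷ (Xᘁ : C) ≫ (α_ _ _ _).hom ≫ X ◁ ev' X) ⊗≫ ev X := by
      calc
        _ = 𝟙 _ ⊗≫ coev' X ▷ (X ⊗ (Xᘁ : C)) ⊗≫ (Xᘁ : C) ◁ exch .two X X ▷ (Xᘁ : C) ⊗≫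
          (ev X ▷ (X ⊗ (Xᘁ : C)) ≫ 𝟙_ C ◁ ev' X) ⊗≫ 𝟙 _ := by monoidal
        _ = _ := by rw [← whisker_exchange]; monoidal
    _ = 𝟙 _ ⊗≫ (coev' X ▷ (X ⊗ (Xᘁ : C)) ≫ ((Xᘁ : C) ⊗ X) ◁ (β_ (Xᘁ : C) X).inv) ⊗≫
        (Xᘁ : C) ◁ ev' X ▷ X ⊗≫ ev X := by
      rw [exch_ev']
      change 𝟙 _ ⊗≫ coev' X ▷ (X ⊗ (Xᘁ : C)) ⊗≫
        (Xᘁ : C) ◁ ((α_ _ _ _).hom ≫ X ◁ (β_ (Xᘁ : C) X).inv ≫ _) ⊗≫ ev X = _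
      monoidal
    _ = 𝟙 _ ⊗≫ (β_ (Xᘁ : C) X).inv ⊗≫
        (coev' X ▷ (Xᘁ : C) ≫ (α_ _ _ _).hom ≫ (Xᘁ : C) ◁ ev' X) ▷ X ⊗≫ ev X := by
      rw [← whisker_exchange]; monoidal
    _ = _ := by rw [coev'_ev']; monoidal

/-- The left twist is a split epimorphism. -/
theorem exists_comp_leftTwist (X : C) : ∃ ξ : X ⟶ X, ξ ≫ leftTwist X = 𝟙 X := by
  -- Chosen so that the braiding turns `coev X` into `coev' X` followed by `ξ`. Since
  -- `coev'_braiding_inv` goes the opposite way with the left twist, the composite of both is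
  -- trivial on `coev' X`.
  let ξ : X ⟶ X := (ρ_ X).inv ≫ X ◁ (coev X ≫ (β_ X (Xᘁ : C)).hom) ≫ (α_ _ _ _).inv ≫
    ev' X ▷ X ≫ (λ_ X).hom
  have hξ : coev X ≫ (β_ X (Xᘁ : C)).hom = coev' X ≫ (Xᘁ : C) ◁ ξ := by
    symm
    set k := coev X ≫ (β_ X (Xᘁ : C)).hom with hk
    calc
      _ = 𝟙 _ ⊗≫ (coev' X ▷ 𝟙_ C ≫ ((Xᘁ : C) ⊗ X) ◁ k) ⊗≫ (Xᘁ : C) ◁ ev' X ▷ X ⊗≫ 𝟙 _ := by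
        simp only [ξ]; monoidal
      _ = k ⊗≫ (coev' X ▷ (Xᘁ : C) ≫ (α_ _ _ _).hom ≫ (Xᘁ : C) ◁ ev' X) ▷ X ⊗≫ 𝟙 _ := by
        rw [← whisker_exchange]; monoidal
      _ = k := by rw [coev'_ev']; monoidal
  refine ⟨ξ, ?_⟩
  have h : coev' X ≫ (Xᘁ : C) ◁ (ξ ≫ leftTwist X) = coev' X := by
    rw [MonoidalCategory.whiskerLeft_comp, ← reassoc_of% hξ,
      ← BraidedCategory.braiding_naturality_left, ← reassoc_of% coev'_braiding_inv,
      Iso.inv_hom_id, Category.comp_id]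
  have key (f : X ⟶ X) : (ρ_ X).inv ≫ X ◁ (coev' X ≫ (Xᘁ : C) ◁ f) ≫ (α_ _ _ _).inv ≫
      ev' X ▷ X ≫ (λ_ X).hom = f := by
    calc
      _ = 𝟙 _ ⊗≫ X ◁ coev' X ⊗≫ ((X ⊗ (Xᘁ : C)) ◁ f ≫ ev' X ▷ X) ⊗≫ 𝟙 _ := by monoidal
      _ = 𝟙 _ ⊗≫ (X ◁ coev' X ≫ (α_ _ _ _).inv ≫ ev' X ▷ X) ⊗≫ f := by
        rw [whisker_exchange]; monoidal
      _ = f := by rw [ev'_coev']; monoidal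
  rw [← key (ξ ≫ leftTwist X), h]
  have := key (𝟙 X)
  rwa [MonoidalCategory.whiskerLeft_id, Category.comp_id] at this

end Twist

-- Frobenius functors preserve duals

section FrobeniusDuality

variable {C : Type u₁} [Category.{v₁} C] [MonoidalCategory C]
  {D : Type u₂} [Category.{v₂} D] [MonoidalCategory D] (F : C ⥤ D)
  [F.LaxMonoidal] [F.OplaxMonoidal] {X Y : C}

/-- The image of a pairing. -/
def mapPairing (p : X ⊗ Y ⟶ 𝟙_ C) : F.obj X ⊗ F.obj Y ⟶ 𝟙_ D := μ F X Y ≫ F.map p ≫ η F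

/-- The image of a copairing. -/
def mapCopairing (c : 𝟙_ C ⟶ X ⊗ Y) : 𝟙_ D ⟶ F.obj X ⊗ F.obj Y := ε F ≫ F.map c ≫ δ F X Y

variable {F} (hF : IsFrobenius F)
include hF

/-- The `δ` of the copairing and the `μ` of the pairing meet on one strand, so a Frobenius relation
brings the whole zigzag inside `F`. Strong monoidality is not needed. -/
theorem IsFrobenius.zigzag_left {c : 𝟙_ C ⟶ X ⊗ Y} {p : Y ⊗ X ⟶ 𝟙_ C}
    (h : c ▷ X ≫ (α_ _ _ _).hom ≫ X ◁ p = (λ_ X).hom ≫ (ρ_ X).inv) :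
    mapCopairing F c ▷ F.obj X ≫ (α_ _ _ _).hom ≫ F.obj X ◁ mapPairing F p =
      (λ_ _).hom ≫ (ρ_ _).inv := by
  have h' := congrArg F.map h
  simp only [F.map_comp] at h'
  simp only [mapPairing, mapCopairing, comp_whiskerRight, MonoidalCategory.whiskerLeft_comp,
    Category.assoc]
  have e := hF.δ_μ X Y X
  rw [reassoc_of% e, μ_natural_left_assoc, δ_natural_right_assoc, reassoc_of% h',
    ← Functor.LaxMonoidal.left_unitality_assoc,
    ← Functor.OplaxMonoidal.right_unitality]

theorem IsFrobenius.zigzag_right {c : 𝟙_ C ⟶ X ⊗ Y} {p : Y ⊗ X ⟶ 𝟙_ C}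
    (h : Y ◁ c ≫ (α_ _ _ _).inv ≫ p ▷ Y = (ρ_ Y).hom ≫ (λ_ Y).inv) :
    F.obj Y ◁ mapCopairing F c ≫ (α_ _ _ _).inv ≫ mapPairing F p ▷ F.obj Y =
      (ρ_ _).hom ≫ (λ_ _).inv := by
  have h' := congrArg F.map h
  simp only [F.map_comp] at h'
  simp only [mapPairing, mapCopairing, comp_whiskerRight, MonoidalCategory.whiskerLeft_comp,
    Category.assoc]
  have e := hF.δ_μ' Y X Y
  rw [reassoc_of% e, μ_natural_right_assoc, δ_natural_left_assoc, reassoc_of% h',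
    ← Functor.LaxMonoidal.right_unitality_assoc,
    ← Functor.OplaxMonoidal.left_unitality]

/-- The image of a dual is a dual of the image. -/
@[reducible]
def IsFrobenius.exactPairing [RightRigidCategory C] (X : C) :
    ExactPairing (F.obj X) (F.obj (Xᘁ : C)) where
  coevaluation' := mapCopairing F (coev X)
  evaluation' := mapPairing F (ev X)
  coevaluation_evaluation' := hF.zigzag_right (ev_coev X)
  evaluation_coevaluation' := hF.zigzag_left (coev_ev X)

variable [RightRigidCategory C] [RightRigidCategory D]

/-- The isomorphism `F(X*) ≅ F(X)*`. -/
def IsFrobenius.dualIso (X : C) : F.obj (Xᘁ : C) ≅ ((F.obj X)ᘁ : D) :=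
  rightDualIso (hF.exactPairing X) inferInstance

theorem IsFrobenius.dualIso_ev (X : C) :
    (hF.dualIso X).hom ▷ F.obj X ≫ ev (F.obj X) = mapPairing F (ev X) := by
  have := @rightAdjointMate_comp_evaluation D _ _ (F.obj X) (F.obj X) (RightRigidCategory.rightDual _)
    (@HasRightDual.mk _ _ _ _ _ (hF.exactPairing X)) (𝟙 _)
  exact this.trans (by rw [MonoidalCategory.whiskerLeft_id, Category.id_comp]; rfl)

theorem IsFrobenius.coev_dualIso (X : C) :
    mapCopairing F (coev X) ≫ F.obj X ◁ (hF.dualIso X).hom = coev (F.obj X) := by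
  have := @coevaluation_comp_rightAdjointMate D _ _ (F.obj X) (F.obj X) (RightRigidCategory.rightDual _)
    (@HasRightDual.mk _ _ _ _ _ (hF.exactPairing X)) (𝟙 _)
  exact this.trans (by rw [id_whiskerRight, Category.comp_id]; rfl)

end FrobeniusDuality

-- Consequences of preserving braiding and twist

section Ribbon

variable {C : Type u₁} [Category.{v₁} C] [MonoidalCategory C]
  {D : Type u₂} [Category.{v₂} D] [MonoidalCategory D] {F : C ⥤ D}
  [RightRigidCategory C] [RightRigidCategory D] [BraidedCategory C] [BraidedCategory D]
  [F.LaxBraided] [F.OplaxMonoidal] (hF : IsFrobenius F)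

include hF

/-- Tested by closing the strand `F X` with `ev'`. Sliding the pairing through the braiding replaces
the braiding behind `δ` by one standing between `δ` and `μ`, where `IsFrobenius.δ_exch_μ` applies
and only the lax structure has to be braided. -/
theorem IsFrobenius.oplaxBraided [PivotalCategory C] [PivotalCategory D]
    (h : ∀ X : C, F.obj X ◁ (hF.dualIso X).hom ≫ ev' (F.obj X) = mapPairing F (ev' X)) :
    OplaxBraided F := by
  intro i X Y
  refine eq_of_ev'_right ?_
  rw [← cancel_epi (F.obj (X ⊗ Y) ◁ (hF.dualIso X).hom)]
  have s {U : D} (f : F.obj (X ⊗ Y) ⟶ U ⊗ F.obj X) :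
      F.obj (X ⊗ Y) ◁ (hF.dualIso X).hom ≫ f ▷ ((F.obj X)ᘁ : D) ≫ (α_ _ _ _).hom ≫
        U ◁ ev' (F.obj X) = f ▷ F.obj (Xᘁ : C) ≫ (α_ _ _ _).hom ≫ U ◁ mapPairing F (ev' X) := by
    rw [whisker_exchange_assoc, ← h]; simp
  rw [s, s]
  have e1 : exch i (F.obj X) (F.obj Y) ▷ F.obj (Xᘁ : C) ≫ (α_ _ _ _).hom ≫
      F.obj Y ◁ mapPairing F (ev' X) = (α_ _ _ _).hom ≫
      F.obj X ◁ exch i.other (F.obj Y) (F.obj (Xᘁ : C)) ≫ (α_ _ _ _).inv ≫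
        mapPairing F (ev' X) ▷ F.obj Y ≫ (λ_ _).hom ≫ (ρ_ _).inv := by
    have h1 := exch_naturality_left i (mapPairing F (ev' X)) (F.obj Y)
    rw [exch_tensor_left, exch_unit_left] at h1
    rw [h1]
    have e : F.obj X ◁ exch i.other (F.obj Y) (F.obj (Xᘁ : C)) ≫
        F.obj X ◁ exch i (F.obj (Xᘁ : C)) (F.obj Y) = 𝟙 _ := by
      rw [← MonoidalCategory.whiskerLeft_comp, exch_other_exch, MonoidalCategory.whiskerLeft_id]
    simp only [Category.assoc, Iso.inv_hom_id_assoc]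
    rw [reassoc_of% e, Iso.hom_inv_id_assoc]
  have e2 := exch_ev' i X Y
  have e3 := hF.δ_exch_μ i.other X Y (Xᘁ : C)
  have e4 : δ F (𝟙_ C) Y ≫ η F ▷ F.obj Y ≫ (λ_ _).hom ≫ (ρ_ _).inv =
      F.map ((λ_ _).hom ≫ (ρ_ _).inv) ≫ δ F Y (𝟙_ C) ≫ F.obj Y ◁ η F := by
    rw [F.map_comp, Category.assoc, ← Functor.OplaxMonoidal.right_unitality,
      Functor.OplaxMonoidal.left_unitality_hom_assoc]
  have e5 := hF.δ_μ Y X (Xᘁ : C)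
  simp only [comp_whiskerRight, Category.assoc, e1]
  simp only [mapPairing, comp_whiskerRight, MonoidalCategory.whiskerLeft_comp, Category.assoc]
  rw [reassoc_of% e3, reassoc_of% e5, δ_natural_left_assoc, e4, μ_natural_left_assoc,
    δ_natural_right_assoc]
  simp only [← F.map_comp_assoc, Category.assoc] at e2 ⊢
  rw [e2]

variable [PivotalCategory C] [PivotalCategory D] (hD : IsRibbon D) (hC : IsRibbon C)
  (hθ : ∀ X : C, F.map (twist X) = twist (F.obj X))
include hD hC hθ

/-- After composition with the left twist both sides can be written with the first evaluation and
the inverse braiding, which `F` preserves; the ribbon property identifies the left twists with the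
preserved ones. The left twist is cancelled because it has a right-sided splitting `ξ`. -/
theorem IsFrobenius.dualIso_ev' (X : C) :
    F.obj X ◁ (hF.dualIso X).hom ≫ ev' (F.obj X) = mapPairing F (ev' X) := by
  obtain ⟨ξ, hξ⟩ := exists_comp_leftTwist (F.obj X)
  have e : leftTwist (F.obj X) ▷ F.obj (Xᘁ : C) ≫ F.obj X ◁ (hF.dualIso X).hom ≫ ev' (F.obj X) =
      leftTwist (F.obj X) ▷ F.obj (Xᘁ : C) ≫ mapPairing F (ev' X) := by
    have h1 := exch_μ F .one (X) (Xᘁ : C)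
    have h2 : (β_ (F.obj (Xᘁ : C)) (F.obj X)).inv ≫ (hF.dualIso X).hom ▷ F.obj X =
        F.obj X ◁ (hF.dualIso X).hom ≫ (β_ ((F.obj X)ᘁ : D) (F.obj X)).inv :=
      (exch_naturality_right .one (hF.dualIso X).hom (F.obj X)).symm
    rw [← whisker_exchange_assoc, ← braiding_inv_ev, ← reassoc_of% h2, hF.dualIso_ev, mapPairing,
      mapPairing, hD, ← hθ, μ_natural_left_assoc, ← hC, ← F.map_comp_assoc, ← braiding_inv_ev,
      F.map_comp_assoc]
    exact (reassoc_of% h1) _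
  have e' := congrArg (fun f => ξ ▷ F.obj (Xᘁ : C) ≫ f) e
  simpa only [← comp_whiskerRight_assoc, hξ, id_whiskerRight, Category.id_comp] using e'

/-- A copairing that satisfies a zigzag with `ev'` is forced to be `coev'`. -/
theorem IsFrobenius.coev'_dualIso (X : C) :
    mapCopairing F (coev' X) ≫ (hF.dualIso X).hom ▷ F.obj X = coev' (F.obj X) := by
  have h := hF.zigzag_right (ev'_coev' X)
  rw [← hF.dualIso_ev' hD hC hθ] at h
  set c := mapCopairing F (coev' X) ≫ (hF.dualIso X).hom ▷ F.obj X with hc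
  have h' : F.obj X ◁ c ≫ (α_ _ _ _).inv ≫ ev' (F.obj X) ▷ F.obj X = (ρ_ _).hom ≫ (λ_ _).inv := by
    rw [← h, hc]; simp
  calc
    c = c ⊗≫ (coev' (F.obj X) ▷ ((F.obj X)ᘁ : D) ≫ (α_ _ _ _).hom ≫
        ((F.obj X)ᘁ : D) ◁ ev' (F.obj X)) ▷ F.obj X ⊗≫ 𝟙 _ := by rw [coev'_ev']; monoidal
    _ = 𝟙 _ ⊗≫ (𝟙_ D ◁ c ≫ coev' (F.obj X) ▷ (((F.obj X)ᘁ : D) ⊗ F.obj X)) ⊗≫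
        ((F.obj X)ᘁ : D) ◁ ev' (F.obj X) ▷ F.obj X ⊗≫ 𝟙 _ := by monoidal
    _ = 𝟙 _ ⊗≫ coev' (F.obj X) ⊗≫ ((F.obj X)ᘁ : D) ◁ (F.obj X ◁ c ≫ (α_ _ _ _).inv ≫
        ev' (F.obj X) ▷ F.obj X) ⊗≫ 𝟙 _ := by rw [whisker_exchange]; monoidal
    _ = _ := by rw [h']; monoidal

/-- `isSymmetric_of_hom` applies with the image of `ofDual`, because both coevaluations of `A` and
the copairing are transported. -/
theorem FrobeniusAlgebra.IsSymmetric.map {A : FrobeniusAlgebra C} (h : A.IsSymmetric) :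
    (hF.mapAlgebra A).IsSymmetric := by
  refine FrobeniusAlgebra.isSymmetric_of_hom ((hF.dualIso A.X).inv ≫ F.map A.ofDual) ?_ ?_
  · change coev (F.obj A.X) ≫ F.obj A.X ◁ ((hF.dualIso A.X).inv ≫ F.map A.ofDual) = _
    rw [hF.copairing_eq, ← hF.coev_dualIso, ← A.coev_ofDual, Category.assoc,
      ← MonoidalCategory.whiskerLeft_comp, Iso.hom_inv_id_assoc, mapCopairing]
    simp
  · change coev' (F.obj A.X) ≫ ((hF.dualIso A.X).inv ≫ F.map A.ofDual) ▷ F.obj A.X = _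
    rw [hF.copairing_eq, ← hF.coev'_dualIso hD hC hθ, ← h.coev'_ofDual, Category.assoc,
      ← comp_whiskerRight, Iso.hom_inv_id_assoc, mapCopairing]
    simp

end Ribbon

-- Rotated and bent boxes under a Frobenius functor

section Rotations

variable {C : Type u₁} [Category.{v₁} C] [MonoidalCategory C] {X X' Y Y' Z W W' : C}

/-- Rotation of `f` by means of a copairing on its left and a pairing on its right. -/
def rotL (c : 𝟙_ C ⟶ X' ⊗ X) (p : W ⊗ W' ⟶ 𝟙_ C) (f : X ⊗ Y ⟶ Z ⊗ W) : Y ⊗ W' ⟶ X' ⊗ Z :=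
  𝟙 _ ⊗≫ c ▷ Y ▷ W' ⊗≫ X' ◁ f ▷ W' ⊗≫ (X' ⊗ Z) ◁ p ⊗≫ 𝟙 _

/-- Rotation of `f` by means of a copairing on its right and a pairing on its left. -/
def rotR (c : 𝟙_ C ⟶ X ⊗ X') (p : W' ⊗ W ⟶ 𝟙_ C) (f : Y ⊗ X ⟶ W ⊗ Z) : W' ⊗ Y ⟶ Z ⊗ X' :=
  𝟙 _ ⊗≫ (W' ⊗ Y) ◁ c ⊗≫ W' ◁ f ▷ X' ⊗≫ p ▷ Z ▷ X' ⊗≫ 𝟙 _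

/-- Bending the second tensor factors of `f`. -/
def bend [BraidedCategory C] (i : Leg) (c : 𝟙_ C ⟶ Y ⊗ Y') (p : W ⊗ W' ⟶ 𝟙_ C)
    (f : X ⊗ Y ⟶ Z ⊗ W) : X ⊗ W' ⟶ Z ⊗ Y' :=
  𝟙 _ ⊗≫ (X ⊗ W') ◁ c ⊗≫ X ◁ exch i W' Y ▷ Y' ⊗≫ f ▷ (W' ⊗ Y') ⊗≫ Z ◁ p ▷ Y' ⊗≫ 𝟙 _

/-- Sliding the copairing through the braiding moves the braiding behind `f`. It then sits between
the `δ` coming from the copairing and the `μ` belonging to the pairing, as `IsFrobenius.δ_exch_μ`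
requires. -/
theorem bend_eq [BraidedCategory C] (i : Leg) (c : 𝟙_ C ⟶ Y ⊗ Y') (p : W ⊗ W' ⟶ 𝟙_ C)
    (f : X ⊗ Y ⟶ Z ⊗ W) : bend i c p f =
      ((ρ_ X).inv ≫ X ◁ c ≫ (α_ _ _ _).inv ≫ f ▷ Y') ▷ W' ≫ (α_ _ _ _).hom ≫
        (Z ⊗ W) ◁ exch i.other Y' W' ≫ (α_ _ _ _).inv ≫
          ((α_ _ _ _).hom ≫ Z ◁ p ≫ (ρ_ Z).hom) ▷ Y' := by
  have h := exch_naturality_right i c W'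
  rw [exch_unit_right, exch_tensor_right] at h
  have e : Y ◁ exch i W' Y' ≫ Y ◁ exch i.other Y' W' = 𝟙 _ := by
    rw [← MonoidalCategory.whiskerLeft_comp, exch_exch, MonoidalCategory.whiskerLeft_id]
  have h' : W' ◁ c ≫ (α_ _ _ _).inv ≫ exch i W' Y ▷ Y' =
      ((ρ_ W').hom ≫ (λ_ W').inv) ≫ c ▷ W' ≫ (α_ _ _ _).hom ≫ Y ◁ exch i.other Y' W' ≫
        (α_ _ _ _).inv := by
    rw [← Category.assoc ((ρ_ W').hom ≫ _), ← h]
    simp only [Category.assoc, Iso.inv_hom_id_assoc, reassoc_of% e, Iso.hom_inv_id, Category.comp_id]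
  calc
    _ = 𝟙 _ ⊗≫ X ◁ (W' ◁ c ≫ (α_ _ _ _).inv ≫ exch i W' Y ▷ Y') ⊗≫ f ▷ (W' ⊗ Y') ⊗≫
        Z ◁ p ▷ Y' ⊗≫ 𝟙 _ := by rw [bend]; monoidal
    _ = 𝟙 _ ⊗≫ X ◁ c ▷ W' ⊗≫ ((X ⊗ Y) ◁ exch i.other Y' W' ≫ f ▷ (W' ⊗ Y')) ⊗≫
        Z ◁ p ▷ Y' ⊗≫ 𝟙 _ := by rw [h']; monoidal
    _ = _ := by rw [whisker_exchange]; monoidal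

variable {D : Type u₂} [Category.{v₂} D] [MonoidalCategory D] {F : C ⥤ D}

section

variable [F.LaxMonoidal] [F.OplaxMonoidal] (hF : IsFrobenius F) {U V : C}

include hF

/-- A box with one leg bent by a copairing is merged by one Frobenius relation. A rotation is built
from this lemma and its variants for the other side and for pairings. -/
theorem IsFrobenius.mapCopairing_left (c : 𝟙_ C ⟶ X' ⊗ X) (f : X ⊗ Y ⟶ V) :
    (λ_ _).inv ≫ mapCopairing F c ▷ F.obj Y ≫ (α_ _ _ _).hom ≫ F.obj X' ◁ (μ F X Y ≫ F.map f) =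
      F.map ((λ_ _).inv ≫ c ▷ Y ≫ (α_ _ _ _).hom ≫ X' ◁ f) ≫ δ F X' V := by
  have e := hF.δ_μ X' X Y
  simp only [mapCopairing, comp_whiskerRight, MonoidalCategory.whiskerLeft_comp, Category.assoc,
    F.map_comp]
  rw [reassoc_of% e, μ_natural_left_assoc, left_unitality_inv_assoc, δ_natural_right]

theorem IsFrobenius.mapCopairing_right (c : 𝟙_ C ⟶ X ⊗ X') (f : Y ⊗ X ⟶ V) :
    (ρ_ _).inv ≫ F.obj Y ◁ mapCopairing F c ≫ (α_ _ _ _).inv ≫ (μ F Y X ≫ F.map f) ▷ F.obj X' =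
      F.map ((ρ_ _).inv ≫ Y ◁ c ≫ (α_ _ _ _).inv ≫ f ▷ X') ≫ δ F V X' := by
  have e := hF.δ_μ' Y X X'
  simp only [mapCopairing, comp_whiskerRight, MonoidalCategory.whiskerLeft_comp, Category.assoc,
    F.map_comp]
  rw [reassoc_of% e, μ_natural_right_assoc, right_unitality_inv_assoc, δ_natural_left]

theorem IsFrobenius.mapPairing_right (p : W ⊗ W' ⟶ 𝟙_ C) (f : V ⟶ Z ⊗ W) :
    (F.map f ≫ δ F Z W) ▷ F.obj W' ≫ (α_ _ _ _).hom ≫ F.obj Z ◁ mapPairing F p ≫ (ρ_ _).hom =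
      μ F V W' ≫ F.map (f ▷ W' ≫ (α_ _ _ _).hom ≫ Z ◁ p ≫ (ρ_ _).hom) := by
  have e := hF.δ_μ Z W W'
  simp only [mapPairing, comp_whiskerRight, MonoidalCategory.whiskerLeft_comp, Category.assoc,
    F.map_comp]
  rw [reassoc_of% e, μ_natural_left_assoc, δ_natural_right_assoc,
    Functor.OplaxMonoidal.right_unitality_hom]

theorem IsFrobenius.mapPairing_left (p : W' ⊗ W ⟶ 𝟙_ C) (f : V ⟶ W ⊗ Z) :
    F.obj W' ◁ (F.map f ≫ δ F W Z) ≫ (α_ _ _ _).inv ≫ mapPairing F p ▷ F.obj Z ≫ (λ_ _).hom =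
      μ F W' V ≫ F.map (W' ◁ f ≫ (α_ _ _ _).inv ≫ p ▷ Z ≫ (λ_ _).hom) := by
  have e := hF.δ_μ' W' W Z
  simp only [mapPairing, comp_whiskerRight, MonoidalCategory.whiskerLeft_comp, Category.assoc,
    F.map_comp]
  rw [reassoc_of% e, μ_natural_right_assoc, δ_natural_left_assoc,
    Functor.OplaxMonoidal.left_unitality_hom]

theorem IsFrobenius.rotL_map (c : 𝟙_ C ⟶ X' ⊗ X) (p : W ⊗ W' ⟶ 𝟙_ C) (f : X ⊗ Y ⟶ Z ⊗ W) :
    rotL (mapCopairing F c) (mapPairing F p) (bmap F f) = bmap F (rotL c p f) := by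
  have a1 : δ F X' (Z ⊗ W) ≫ F.obj X' ◁ δ F Z W ≫ (α_ _ _ _).inv =
      F.map (α_ _ _ _).inv ≫ δ F (X' ⊗ Z) W ≫ δ F X' Z ▷ F.obj W := by
    rw [← Category.assoc, Iso.comp_inv_eq, Category.assoc, Category.assoc,
      Functor.OplaxMonoidal.associativity, ← F.map_comp_assoc, Iso.inv_hom_id, F.map_id,
      Category.id_comp]
  set k := (λ_ _).inv ≫ c ▷ Y ≫ (α_ _ _ _).hom ≫ X' ◁ f with hk
  calc
    _ = ((λ_ _).inv ≫ mapCopairing F c ▷ F.obj Y ≫ (α_ _ _ _).hom ≫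
          F.obj X' ◁ (μ F X Y ≫ F.map f)) ▷ F.obj W' ⊗≫ (F.obj X' ◁ δ F Z W ≫ (α_ _ _ _).inv) ▷ F.obj W' ⊗≫
          (F.obj X' ⊗ F.obj Z) ◁ mapPairing F p ⊗≫ 𝟙 _ := by
      rw [rotL, bmap]; monoidal
    _ = F.map k ▷ F.obj W' ⊗≫ (δ F X' (Z ⊗ W) ≫ F.obj X' ◁ δ F Z W ≫ (α_ _ _ _).inv) ▷ F.obj W' ⊗≫
          (F.obj X' ⊗ F.obj Z) ◁ mapPairing F p ⊗≫ 𝟙 _ := by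
      rw [hF.mapCopairing_left]; monoidal
    _ = 𝟙 _ ⊗≫ (F.map (k ≫ (α_ _ _ _).inv) ≫ δ F (X' ⊗ Z) W) ▷ F.obj W' ⊗≫
          (δ F X' Z ▷ (F.obj W ⊗ F.obj W') ≫ (F.obj X' ⊗ F.obj Z) ◁ mapPairing F p) ⊗≫ 𝟙 _ := by
      rw [a1, F.map_comp k]; monoidal
    _ = ((F.map (k ≫ (α_ _ _ _).inv) ≫ δ F (X' ⊗ Z) W) ▷ F.obj W' ≫ (α_ _ _ _).hom ≫
          F.obj (X' ⊗ Z) ◁ mapPairing F p ≫ (ρ_ _).hom) ≫ δ F X' Z := by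
      rw [← whisker_exchange]; monoidal
    _ = _ := by
      rw [hF.mapPairing_right, bmap, Category.assoc]
      congr 3
      rw [hk, rotL]; monoidal

theorem IsFrobenius.rotR_map (c : 𝟙_ C ⟶ X ⊗ X') (p : W' ⊗ W ⟶ 𝟙_ C) (f : Y ⊗ X ⟶ W ⊗ Z) :
    rotR (mapCopairing F c) (mapPairing F p) (bmap F f) = bmap F (rotR c p f) := by
  set k := (ρ_ _).inv ≫ Y ◁ c ≫ (α_ _ _ _).inv ≫ f ▷ X' with hk
  calc
    _ = F.obj W' ◁ ((ρ_ _).inv ≫ F.obj Y ◁ mapCopairing F c ≫ (α_ _ _ _).inv ≫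
          (μ F Y X ≫ F.map f) ▷ F.obj X') ⊗≫ F.obj W' ◁ (δ F W Z ▷ F.obj X' ≫ (α_ _ _ _).hom) ⊗≫
          mapPairing F p ▷ (F.obj Z ⊗ F.obj X') ⊗≫ 𝟙 _ := by
      rw [rotR, bmap]; monoidal
    _ = F.obj W' ◁ F.map k ⊗≫ F.obj W' ◁ (δ F (W ⊗ Z) X' ≫ δ F W Z ▷ F.obj X' ≫
          (α_ _ _ _).hom) ⊗≫ mapPairing F p ▷ (F.obj Z ⊗ F.obj X') ⊗≫ 𝟙 _ := by
      rw [hF.mapCopairing_right]; monoidal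
    _ = 𝟙 _ ⊗≫ F.obj W' ◁ (F.map (k ≫ (α_ _ _ _).hom) ≫ δ F W (Z ⊗ X')) ⊗≫
          ((F.obj W' ⊗ F.obj W) ◁ δ F Z X' ≫ mapPairing F p ▷ (F.obj Z ⊗ F.obj X')) ⊗≫ 𝟙 _ := by
      rw [Functor.OplaxMonoidal.associativity, F.map_comp k]; monoidal
    _ = (F.obj W' ◁ (F.map (k ≫ (α_ _ _ _).hom) ≫ δ F W (Z ⊗ X')) ≫ (α_ _ _ _).inv ≫
          mapPairing F p ▷ F.obj (Z ⊗ X') ≫ (λ_ _).hom) ≫ δ F Z X' := by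
      rw [whisker_exchange]; monoidal
    _ = _ := by
      rw [hF.mapPairing_left, bmap, Category.assoc]
      congr 3
      rw [hk, rotR]; monoidal

end

theorem IsFrobenius.bend_map [BraidedCategory C] [BraidedCategory D] [F.LaxBraided]
    [F.OplaxMonoidal] (hF : IsFrobenius F) (i : Leg) (c : 𝟙_ C ⟶ Y ⊗ Y') (p : W ⊗ W' ⟶ 𝟙_ C)
    (f : X ⊗ Y ⟶ Z ⊗ W) :
    bend i (mapCopairing F c) (mapPairing F p) (bmap F f) = bmap F (bend i c p f) := by
  have h1 := hF.mapPairing_right p (𝟙 (Z ⊗ W))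
  have h2 := hF.δ_exch_μ i.other (Z ⊗ W) Y' W'
  have h3 := hF.mapCopairing_right c f
  rw [F.map_id, Category.id_comp, id_whiskerRight, Category.id_comp] at h1
  rw [bend_eq, bend_eq]
  set k := (ρ_ _).inv ≫ X ◁ c ≫ (α_ _ _ _).inv ≫ f ▷ Y' with hk
  calc
    _ = ((ρ_ _).inv ≫ F.obj X ◁ mapCopairing F c ≫ (α_ _ _ _).inv ≫
        (μ F X Y ≫ F.map f) ▷ F.obj Y') ▷ F.obj W' ⊗≫ (δ F Z W ▷ (F.obj Y' ⊗ F.obj W') ≫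
        (F.obj Z ⊗ F.obj W) ◁ exch i.other (F.obj Y') (F.obj W')) ⊗≫
        ((α_ _ _ _).hom ≫ F.obj Z ◁ mapPairing F p ≫ (ρ_ _).hom) ▷ F.obj Y' := by
      rw [bmap]; monoidal
    _ = F.map k ▷ F.obj W' ≫ δ F (Z ⊗ W) Y' ▷ F.obj W' ≫ (α_ _ _ _).hom ≫
        F.obj (Z ⊗ W) ◁ exch i.other (F.obj Y') (F.obj W') ≫ (α_ _ _ _).inv ≫
        (δ F Z W ▷ F.obj W' ≫ (α_ _ _ _).hom ≫ F.obj Z ◁ mapPairing F p ≫ (ρ_ _).hom) ▷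
          F.obj Y' := by
      rw [h3, ← whisker_exchange]; monoidal
    _ = _ := by
      rw [h1, comp_whiskerRight, reassoc_of% h2, μ_natural_left_assoc, δ_natural_left, bmap]
      simp only [F.map_comp, Category.assoc]

end Rotations

-- Rotated and bent boxes are balanced and cobalanced

section RotationLinear

open FrobeniusAlgebra

variable {C : Type u₁} [Category.{v₁} C] [MonoidalCategory C] [RightRigidCategory C]
  [PivotalCategory C] {A : FrobeniusAlgebra C} {X Y Z W U : C}

/-- Right-linearity carries the action through `f` to the pairing, which converts it into the dual
action on the other leg. -/
theorem rotL_balanced {f : X ⊗ Y ⟶ Z ⊗ W} {r : Y ⊗ A.X ⟶ Y} {r' : W ⊗ A.X ⟶ W}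
    (h : RightLinear r r' f) : A.Balanced r (A.dualL r') (rotL (coev' X) (ev' W) f) := by
  calc
    _ = 𝟙 _ ⊗≫ (coev' X ▷ (Y ⊗ A.X) ≫ ((Xᘁ : C) ⊗ X) ◁ r) ▷ (Wᘁ : C) ⊗≫
        (Xᘁ : C) ◁ f ▷ (Wᘁ : C) ⊗≫ ((Xᘁ : C) ⊗ Z) ◁ ev' W ⊗≫ 𝟙 _ := by
      rw [← whisker_exchange, rotL]; monoidal
    _ = 𝟙 _ ⊗≫ coev' X ▷ (Y ⊗ A.X) ▷ (Wᘁ : C) ⊗≫ (Xᘁ : C) ◁ (X ◁ r ≫ f) ▷ (Wᘁ : C) ⊗≫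
        ((Xᘁ : C) ⊗ Z) ◁ ev' W ⊗≫ 𝟙 _ := by monoidal
    _ = 𝟙 _ ⊗≫ coev' X ▷ (Y ⊗ A.X) ▷ (Wᘁ : C) ⊗≫ (Xᘁ : C) ◁ f ▷ A.X ▷ (Wᘁ : C) ⊗≫
        ((Xᘁ : C) ⊗ Z) ◁ ((α_ _ _ _).inv ≫ r' ▷ (Wᘁ : C) ≫ ev' W) ⊗≫ 𝟙 _ := by
      rw [h]; monoidal
    _ = 𝟙 _ ⊗≫ coev' X ▷ (Y ⊗ A.X) ▷ (Wᘁ : C) ⊗≫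
        (Xᘁ : C) ◁ (f ▷ (A.X ⊗ (Wᘁ : C)) ≫ (Z ⊗ W) ◁ A.dualL r') ⊗≫
        ((Xᘁ : C) ⊗ Z) ◁ ev' W ⊗≫ 𝟙 _ := by
      rw [← dualL_ev']; monoidal
    _ = 𝟙 _ ⊗≫ (coev' X ▷ (Y ⊗ (A.X ⊗ (Wᘁ : C))) ≫ ((Xᘁ : C) ⊗ X) ◁ (Y ◁ A.dualL r')) ⊗≫
        (Xᘁ : C) ◁ f ▷ (Wᘁ : C) ⊗≫ ((Xᘁ : C) ⊗ Z) ◁ ev' W ⊗≫ 𝟙 _ := by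
      rw [← whisker_exchange]; monoidal
    _ = _ := by rw [← whisker_exchange, rotL]; monoidal

omit [PivotalCategory C] in
theorem rotR_balanced {f : Y ⊗ X ⟶ W ⊗ Z} {l : A.X ⊗ Y ⟶ Y} {l' : A.X ⊗ W ⟶ W}
    (h : LeftLinear l l' f) : A.Balanced (A.dualR l') l (rotR (coev X) (ev W) f) := by
  rw [FrobeniusAlgebra.Balanced]
  symm
  calc
    _ = 𝟙 _ ⊗≫ (Wᘁ : C) ◁ (l ▷ 𝟙_ C ≫ Y ◁ coev X) ⊗≫
        (Wᘁ : C) ◁ f ▷ (Xᘁ : C) ⊗≫ ev W ▷ Z ▷ (Xᘁ : C) ⊗≫ 𝟙 _ := by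
      rw [rotR]; monoidal
    _ = 𝟙 _ ⊗≫ (Wᘁ : C) ◁ (A.X ⊗ Y) ◁ coev X ⊗≫ (Wᘁ : C) ◁ (l ▷ X ≫ f) ▷ (Xᘁ : C) ⊗≫
        ev W ▷ Z ▷ (Xᘁ : C) ⊗≫ 𝟙 _ := by rw [← whisker_exchange]; monoidal
    _ = 𝟙 _ ⊗≫ (Wᘁ : C) ◁ (A.X ⊗ Y) ◁ coev X ⊗≫ (Wᘁ : C) ◁ A.X ◁ f ▷ (Xᘁ : C) ⊗≫
        ((α_ _ _ _).hom ≫ (Wᘁ : C) ◁ l' ≫ ev W) ▷ Z ▷ (Xᘁ : C) ⊗≫ 𝟙 _ := by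
      rw [h]; monoidal
    _ = 𝟙 _ ⊗≫ (Wᘁ : C) ◁ (A.X ⊗ Y) ◁ coev X ⊗≫ (((Wᘁ : C) ⊗ A.X) ◁ f ≫
        A.dualR l' ▷ (W ⊗ Z)) ▷ (Xᘁ : C) ⊗≫ ev W ▷ Z ▷ (Xᘁ : C) ⊗≫ 𝟙 _ := by
      rw [← dualR_ev]; monoidal
    _ = 𝟙 _ ⊗≫ (((Wᘁ : C) ⊗ A.X) ◁ (Y ◁ coev X) ≫ A.dualR l' ▷ (Y ⊗ (X ⊗ (Xᘁ : C)))) ⊗≫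
        (Wᘁ : C) ◁ f ▷ (Xᘁ : C) ⊗≫ ev W ▷ Z ▷ (Xᘁ : C) ⊗≫ 𝟙 _ := by
      rw [whisker_exchange]; monoidal
    _ = _ := by rw [whisker_exchange, rotR]; monoidal

/-- Left-linearity carries the coaction back through `f` to the coevaluation. Passing it from `X` to
`X*` there is the point at which symmetry of `A` enters. -/
theorem rotL_cobalanced (hA : A.IsSymmetric) {f : X ⊗ Y ⟶ Z ⊗ W} {l : A.X ⊗ X ⟶ X}
    {l' : A.X ⊗ Z ⟶ Z} (h : LeftLinear l l' f) :
    A.Cobalanced (A.dualR l) l' (rotL (coev' X) (ev' W) f) := by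
  have hc := hA.coev'_coactL l
  have h1 : A.coactL l ▷ Y ≫ (α_ _ _ _).hom ≫ A.X ◁ f =
      f ≫ A.coactL l' ▷ W ≫ (α_ _ _ _).hom := by
    symm
    calc
      _ = 𝟙 _ ⊗≫ (𝟙_ C ◁ f ≫ A.copairing ▷ (Z ⊗ W)) ⊗≫ A.X ◁ l' ▷ W ⊗≫ 𝟙 _ := by
        rw [coactL]; monoidal
      _ = 𝟙 _ ⊗≫ A.copairing ▷ (X ⊗ Y) ⊗≫
          A.X ◁ ((α_ _ _ _).hom ≫ A.X ◁ f ≫ (α_ _ _ _).inv ≫ l' ▷ W) := by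
        rw [whisker_exchange]; monoidal
      _ = _ := by rw [← h, coactL]; monoidal
  rw [Cobalanced]
  symm
  calc
    _ = 𝟙 _ ⊗≫ coev' X ▷ Y ▷ (Wᘁ : C) ⊗≫ (Xᘁ : C) ◁ f ▷ (Wᘁ : C) ⊗≫
        (Xᘁ : C) ◁ (Z ◁ ev' W ≫ A.coactL l' ▷ 𝟙_ C) ⊗≫ 𝟙 _ := by
      rw [rotL]; monoidal
    _ = 𝟙 _ ⊗≫ coev' X ▷ Y ▷ (Wᘁ : C) ⊗≫ (Xᘁ : C) ◁
        (f ≫ A.coactL l' ▷ W ≫ (α_ _ _ _).hom) ▷ (Wᘁ : C) ⊗≫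
        (Xᘁ : C) ◁ A.X ◁ Z ◁ ev' W ⊗≫ 𝟙 _ := by
      rw [whisker_exchange]; monoidal
    _ = 𝟙 _ ⊗≫ (coev' X ≫ (Xᘁ : C) ◁ A.coactL l) ▷ Y ▷ (Wᘁ : C) ⊗≫
        (Xᘁ : C) ◁ A.X ◁ f ▷ (Wᘁ : C) ⊗≫
        (Xᘁ : C) ◁ A.X ◁ Z ◁ ev' W ⊗≫ 𝟙 _ := by
      rw [← h1]; monoidal
    _ = 𝟙 _ ⊗≫ coev' X ▷ Y ▷ (Wᘁ : C) ⊗≫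
        (A.coactR (A.dualR l) ▷ (X ⊗ Y) ≫ ((Xᘁ : C) ⊗ A.X) ◁ f) ▷ (Wᘁ : C) ⊗≫
        (Xᘁ : C) ◁ A.X ◁ Z ◁ ev' W ⊗≫ 𝟙 _ := by
      rw [← hc]; monoidal
    _ = 𝟙 _ ⊗≫ coev' X ▷ Y ▷ (Wᘁ : C) ⊗≫ (Xᘁ : C) ◁ f ▷ (Wᘁ : C) ⊗≫
        (A.coactR (A.dualR l) ▷ (Z ⊗ (W ⊗ (Wᘁ : C))) ≫ ((Xᘁ : C) ⊗ A.X) ◁ (Z ◁ ev' W)) ⊗≫ 𝟙 _ := by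
      rw [← whisker_exchange]; monoidal
    _ = _ := by
      rw [← whisker_exchange, rotL]; monoidal

omit [RightRigidCategory C] [PivotalCategory C] in
theorem RightLinear.coactR {f : X ⊗ Y ⟶ Z ⊗ W} {r : Y ⊗ A.X ⟶ Y} {r' : W ⊗ A.X ⟶ W}
    (h : RightLinear r r' f) : X ◁ A.coactR r ≫ (α_ _ _ _).inv ≫ f ▷ A.X =
      f ≫ Z ◁ A.coactR r' ≫ (α_ _ _ _).inv := by
  symm
  calc
    _ = 𝟙 _ ⊗≫ (f ▷ 𝟙_ C ≫ (Z ⊗ W) ◁ A.copairing) ⊗≫ Z ◁ r' ▷ A.X ⊗≫ 𝟙 _ := by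
      rw [FrobeniusAlgebra.coactR]; monoidal
    _ = 𝟙 _ ⊗≫ (X ⊗ Y) ◁ A.copairing ⊗≫
        ((α_ _ _ _).inv ≫ f ▷ A.X ≫ (α_ _ _ _).hom ≫ Z ◁ r') ▷ A.X := by
      rw [← whisker_exchange]; monoidal
    _ = _ := by rw [← h, FrobeniusAlgebra.coactR]; monoidal

theorem rotR_cobalanced (hA : A.IsSymmetric) {f : Y ⊗ X ⟶ W ⊗ Z} {r : X ⊗ A.X ⟶ X}
    {r' : Z ⊗ A.X ⟶ Z} (h : RightLinear r r' f) :
    A.Cobalanced r' (A.dualL r) (rotR (coev X) (ev W) f) := by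
  have hc := hA.coev_coactR r
  have h1 := h.coactR
  calc
    _ = 𝟙 _ ⊗≫ ((Wᘁ : C) ⊗ Y) ◁ coev X ⊗≫ (Wᘁ : C) ◁ f ▷ (Xᘁ : C) ⊗≫
        (ev W ▷ Z ≫ 𝟙_ C ◁ A.coactR r') ▷ (Xᘁ : C) ⊗≫ 𝟙 _ := by
      rw [rotR]; monoidal
    _ = 𝟙 _ ⊗≫ ((Wᘁ : C) ⊗ Y) ◁ coev X ⊗≫ (Wᘁ : C) ◁ (f ≫ W ◁ A.coactR r' ≫ (α_ _ _ _).inv) ▷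
        (Xᘁ : C) ⊗≫ ev W ▷ Z ▷ A.X ▷ (Xᘁ : C) ⊗≫ 𝟙 _ := by
      rw [← whisker_exchange]; monoidal
    _ = 𝟙 _ ⊗≫ ((Wᘁ : C) ⊗ Y) ◁ (coev X ≫ A.coactR r ▷ (Xᘁ : C) ≫ (α_ _ _ _).hom) ⊗≫
        (Wᘁ : C) ◁ f ▷ A.X ▷ (Xᘁ : C) ⊗≫ ev W ▷ Z ▷ A.X ▷ (Xᘁ : C) ⊗≫ 𝟙 _ := by
      rw [← h1]; monoidal
    _ = 𝟙 _ ⊗≫ ((Wᘁ : C) ⊗ Y) ◁ coev X ⊗≫ (Wᘁ : C) ◁ ((Y ⊗ X) ◁ A.coactL (A.dualL r) ≫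
        f ▷ (A.X ⊗ (Xᘁ : C))) ⊗≫ ev W ▷ Z ▷ A.X ▷ (Xᘁ : C) ⊗≫ 𝟙 _ := by
      rw [hc]; monoidal
    _ = 𝟙 _ ⊗≫ ((Wᘁ : C) ⊗ Y) ◁ coev X ⊗≫ (Wᘁ : C) ◁ f ▷ (Xᘁ : C) ⊗≫
        (((Wᘁ : C) ⊗ W) ◁ (Z ◁ A.coactL (A.dualL r)) ≫ ev W ▷ (Z ⊗ (A.X ⊗ (Xᘁ : C)))) ⊗≫ 𝟙 _ := by
      rw [whisker_exchange]; monoidal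
    _ = _ := by rw [whisker_exchange, rotR]; monoidal

variable [BraidedCategory C]

/-- The braiding that takes `W*` past `Y` also takes the acting strand past `Y`. This cancels the
opposite braiding in `ExchIn`, whence the label `i.other`. -/
theorem bend_balanced {i : Leg} {f : X ⊗ Y ⟶ Z ⊗ W} {r : X ⊗ A.X ⟶ X} {r' : W ⊗ A.X ⟶ W}
    (h : ExchIn i.other r r' f) : A.Balanced r (A.dualL r') (bend i (coev Y) (ev' W) f) := by
  have h1 : X ◁ exch i A.X Y ≫ (α_ _ _ _).inv ≫ f ▷ A.X ≫ (α_ _ _ _).hom ≫ Z ◁ r' =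
      (α_ _ _ _).inv ≫ r ▷ Y ≫ f := by
    have e : X ◁ exch i A.X Y ≫ X ◁ exch i.other Y A.X = 𝟙 _ := by
      rw [← MonoidalCategory.whiskerLeft_comp, exch_exch, MonoidalCategory.whiskerLeft_id]
    rw [← h, reassoc_of% e]
  rw [FrobeniusAlgebra.Balanced]
  symm
  calc
    _ = 𝟙 _ ⊗≫ X ◁ (A.dualL r' ▷ 𝟙_ C ≫ (Wᘁ : C) ◁ coev Y) ⊗≫ X ◁ exch i (Wᘁ : C) Y ▷ (Yᘁ : C) ⊗≫
        f ▷ ((Wᘁ : C) ⊗ (Yᘁ : C)) ⊗≫ Z ◁ ev' W ▷ (Yᘁ : C) ⊗≫ 𝟙 _ := by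
      rw [bend]; monoidal
    _ = 𝟙 _ ⊗≫ X ◁ (A.X ⊗ (Wᘁ : C)) ◁ coev Y ⊗≫
        X ◁ (A.dualL r' ▷ Y ≫ exch i (Wᘁ : C) Y) ▷ (Yᘁ : C) ⊗≫
        f ▷ ((Wᘁ : C) ⊗ (Yᘁ : C)) ⊗≫ Z ◁ ev' W ▷ (Yᘁ : C) ⊗≫ 𝟙 _ := by
      rw [← whisker_exchange]; monoidal
    _ = 𝟙 _ ⊗≫ X ◁ (A.X ⊗ (Wᘁ : C)) ◁ coev Y ⊗≫ X ◁ A.X ◁ exch i (Wᘁ : C) Y ▷ (Yᘁ : C) ⊗≫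
        X ◁ exch i A.X Y ▷ ((Wᘁ : C) ⊗ (Yᘁ : C)) ⊗≫
        ((X ⊗ Y) ◁ A.dualL r' ≫ f ▷ (Wᘁ : C)) ▷ (Yᘁ : C) ⊗≫ Z ◁ ev' W ▷ (Yᘁ : C) ⊗≫ 𝟙 _ := by
      rw [exch_naturality_left, exch_tensor_left]; monoidal
    _ = 𝟙 _ ⊗≫ X ◁ (A.X ⊗ (Wᘁ : C)) ◁ coev Y ⊗≫ X ◁ A.X ◁ exch i (Wᘁ : C) Y ▷ (Yᘁ : C) ⊗≫
        X ◁ exch i A.X Y ▷ ((Wᘁ : C) ⊗ (Yᘁ : C)) ⊗≫ f ▷ A.X ▷ (Wᘁ : C) ▷ (Yᘁ : C) ⊗≫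
        Z ◁ (W ◁ A.dualL r' ≫ ev' W) ▷ (Yᘁ : C) ⊗≫ 𝟙 _ := by
      rw [whisker_exchange]; monoidal
    _ = 𝟙 _ ⊗≫ X ◁ (A.X ⊗ (Wᘁ : C)) ◁ coev Y ⊗≫ X ◁ A.X ◁ exch i (Wᘁ : C) Y ▷ (Yᘁ : C) ⊗≫
        (X ◁ exch i A.X Y ≫ (α_ _ _ _).inv ≫ f ▷ A.X ≫ (α_ _ _ _).hom ≫ Z ◁ r') ▷
          ((Wᘁ : C) ⊗ (Yᘁ : C)) ⊗≫ Z ◁ ev' W ▷ (Yᘁ : C) ⊗≫ 𝟙 _ := by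
      rw [dualL_ev']; monoidal
    _ = 𝟙 _ ⊗≫ (X ⊗ A.X) ◁ (Wᘁ : C) ◁ coev Y ⊗≫ ((X ⊗ A.X) ◁ (exch i (Wᘁ : C) Y ▷ (Yᘁ : C)) ≫
        r ▷ ((Y ⊗ (Wᘁ : C)) ⊗ (Yᘁ : C))) ⊗≫ f ▷ ((Wᘁ : C) ⊗ (Yᘁ : C)) ⊗≫
        Z ◁ ev' W ▷ (Yᘁ : C) ⊗≫ 𝟙 _ := by
      rw [h1]; monoidal
    _ = 𝟙 _ ⊗≫ ((X ⊗ A.X) ◁ ((Wᘁ : C) ◁ coev Y) ≫ r ▷ ((Wᘁ : C) ⊗ (Y ⊗ (Yᘁ : C)))) ⊗≫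
        X ◁ exch i (Wᘁ : C) Y ▷ (Yᘁ : C) ⊗≫ f ▷ ((Wᘁ : C) ⊗ (Yᘁ : C)) ⊗≫
        Z ◁ ev' W ▷ (Yᘁ : C) ⊗≫ 𝟙 _ := by
      rw [whisker_exchange]; monoidal
    _ = _ := by rw [whisker_exchange, bend]; monoidal

/-- On the coevaluation the coaction is moved from `Y*` to `Y`, by symmetry of `A`. Its strand then
passes `W*` by the bending and `W` by `ExchOut`, with equal labels, hence the whole pairing of `W`
with `W*`, off which it slides. -/
theorem bend_cobalanced (hA : A.IsSymmetric) {i : Leg} {f : X ⊗ Y ⟶ Z ⊗ W} {r : Y ⊗ A.X ⟶ Y}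
    {r' : Z ⊗ A.X ⟶ Z} (h : ExchOut i r r' f) :
    A.Cobalanced r' (A.dualL r) (bend i (coev Y) (ev' W) f) := by
  have hc := hA.coev_coactR r
  have hn := exch_naturality_left i (ev' W) A.X
  rw [exch_tensor_left, exch_unit_left] at hn
  have hn' : W ◁ exch i (Wᘁ : C) A.X ≫ (α_ _ _ _).inv ≫ exch i W A.X ▷ (Wᘁ : C) ≫ (α_ _ _ _).hom ≫
      A.X ◁ ev' W = (α_ _ _ _).inv ≫ ev' W ▷ A.X ≫ (λ_ _).hom ≫ (ρ_ _).inv := by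
    rw [hn]; simp
  rw [Cobalanced]
  symm
  calc
    _ = 𝟙 _ ⊗≫ (X ⊗ (Wᘁ : C)) ◁ coev Y ⊗≫ X ◁ exch i (Wᘁ : C) Y ▷ (Yᘁ : C) ⊗≫
        f ▷ ((Wᘁ : C) ⊗ (Yᘁ : C)) ⊗≫ Z ◁ (ev' W ▷ (Yᘁ : C) ≫ 𝟙_ C ◁ A.coactL (A.dualL r)) ⊗≫
        𝟙 _ := by
      rw [bend]; monoidal
    _ = 𝟙 _ ⊗≫ (X ⊗ (Wᘁ : C)) ◁ coev Y ⊗≫ X ◁ exch i (Wᘁ : C) Y ▷ (Yᘁ : C) ⊗≫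
        (f ▷ ((Wᘁ : C) ⊗ (Yᘁ : C)) ≫ (Z ⊗ W) ◁ ((Wᘁ : C) ◁ A.coactL (A.dualL r))) ⊗≫
        Z ◁ ev' W ▷ (A.X ⊗ (Yᘁ : C)) ⊗≫ 𝟙 _ := by
      rw [← whisker_exchange]; monoidal
    _ = 𝟙 _ ⊗≫ (X ⊗ (Wᘁ : C)) ◁ coev Y ⊗≫ X ◁ (exch i (Wᘁ : C) Y ▷ (Yᘁ : C) ≫
        (Y ⊗ (Wᘁ : C)) ◁ A.coactL (A.dualL r)) ⊗≫ f ▷ ((Wᘁ : C) ⊗ (A.X ⊗ (Yᘁ : C))) ⊗≫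
        Z ◁ ev' W ▷ (A.X ⊗ (Yᘁ : C)) ⊗≫ 𝟙 _ := by
      rw [← whisker_exchange]; monoidal
    _ = 𝟙 _ ⊗≫ (X ⊗ (Wᘁ : C)) ◁ (coev Y ≫ Y ◁ A.coactL (A.dualL r)) ⊗≫
        X ◁ exch i (Wᘁ : C) Y ▷ (A.X ⊗ (Yᘁ : C)) ⊗≫ f ▷ ((Wᘁ : C) ⊗ (A.X ⊗ (Yᘁ : C))) ⊗≫
        Z ◁ ev' W ▷ (A.X ⊗ (Yᘁ : C)) ⊗≫ 𝟙 _ := by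
      rw [← whisker_exchange]; monoidal
    _ = 𝟙 _ ⊗≫ (X ⊗ (Wᘁ : C)) ◁ coev Y ⊗≫ (X ⊗ (Wᘁ : C)) ◁ Y ◁ A.copairing ▷ (Yᘁ : C) ⊗≫
        X ◁ ((Wᘁ : C) ◁ r ≫ exch i (Wᘁ : C) Y) ▷ (A.X ⊗ (Yᘁ : C)) ⊗≫
        f ▷ ((Wᘁ : C) ⊗ (A.X ⊗ (Yᘁ : C))) ⊗≫ Z ◁ ev' W ▷ (A.X ⊗ (Yᘁ : C)) ⊗≫ 𝟙 _ := by
      rw [← hc, coactR]; monoidal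
    _ = 𝟙 _ ⊗≫ (X ⊗ (Wᘁ : C)) ◁ coev Y ⊗≫ (X ⊗ (Wᘁ : C)) ◁ Y ◁ A.copairing ▷ (Yᘁ : C) ⊗≫
        X ◁ exch i (Wᘁ : C) Y ▷ (A.X ⊗ (A.X ⊗ (Yᘁ : C))) ⊗≫
        X ◁ Y ◁ exch i (Wᘁ : C) A.X ▷ (A.X ⊗ (Yᘁ : C)) ⊗≫
        (X ◁ r ≫ f) ▷ ((Wᘁ : C) ⊗ (A.X ⊗ (Yᘁ : C))) ⊗≫
        Z ◁ ev' W ▷ (A.X ⊗ (Yᘁ : C)) ⊗≫ 𝟙 _ := by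
      rw [exch_naturality_right, exch_tensor_right]; monoidal
    _ = 𝟙 _ ⊗≫ (X ⊗ (Wᘁ : C)) ◁ coev Y ⊗≫ (X ⊗ (Wᘁ : C)) ◁ Y ◁ A.copairing ▷ (Yᘁ : C) ⊗≫
        X ◁ exch i (Wᘁ : C) Y ▷ (A.X ⊗ (A.X ⊗ (Yᘁ : C))) ⊗≫
        ((X ⊗ Y) ◁ exch i (Wᘁ : C) A.X ≫ f ▷ (A.X ⊗ (Wᘁ : C))) ▷ (A.X ⊗ (Yᘁ : C)) ⊗≫
        Z ◁ exch i W A.X ▷ (Wᘁ : C) ▷ (A.X ⊗ (Yᘁ : C)) ⊗≫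
        (r' ▷ (W ⊗ (Wᘁ : C)) ≫ Z ◁ ev' W) ▷ (A.X ⊗ (Yᘁ : C)) ⊗≫ 𝟙 _ := by
      rw [h]; monoidal
    _ = 𝟙 _ ⊗≫ (X ⊗ (Wᘁ : C)) ◁ coev Y ⊗≫ (X ⊗ (Wᘁ : C)) ◁ Y ◁ A.copairing ▷ (Yᘁ : C) ⊗≫
        X ◁ exch i (Wᘁ : C) Y ▷ (A.X ⊗ (A.X ⊗ (Yᘁ : C))) ⊗≫
        f ▷ (((Wᘁ : C) ⊗ A.X) ⊗ (A.X ⊗ (Yᘁ : C))) ⊗≫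
        Z ◁ (W ◁ exch i (Wᘁ : C) A.X ≫ (α_ _ _ _).inv ≫ exch i W A.X ▷ (Wᘁ : C) ≫
          (α_ _ _ _).hom ≫ A.X ◁ ev' W) ▷ (A.X ⊗ (Yᘁ : C)) ⊗≫
        r' ▷ (A.X ⊗ (Yᘁ : C)) ⊗≫ 𝟙 _ := by
      rw [whisker_exchange f (exch i _ _), ← whisker_exchange r' (ev' W)]; monoidal
    _ = 𝟙 _ ⊗≫ (X ⊗ (Wᘁ : C)) ◁ coev Y ⊗≫ X ◁ ((Wᘁ : C) ⊗ Y) ◁ (A.copairing ▷ (Yᘁ : C)) ⊗≫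
        X ◁ exch i (Wᘁ : C) Y ▷ ((A.X ⊗ A.X) ⊗ (Yᘁ : C)) ⊗≫
        f ▷ ((Wᘁ : C) ⊗ ((A.X ⊗ A.X) ⊗ (Yᘁ : C))) ⊗≫
        Z ◁ ev' W ▷ ((A.X ⊗ A.X) ⊗ (Yᘁ : C)) ⊗≫ r' ▷ (A.X ⊗ (Yᘁ : C)) ⊗≫ 𝟙 _ := by
      rw [hn']; monoidal
    _ = 𝟙 _ ⊗≫ (X ⊗ (Wᘁ : C)) ◁ coev Y ⊗≫ X ◁ exch i (Wᘁ : C) Y ▷ (Yᘁ : C) ⊗≫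
        f ▷ ((Wᘁ : C) ⊗ (Yᘁ : C)) ⊗≫ Z ◁ ev' W ▷ (Yᘁ : C) ⊗≫
        Z ◁ (A.copairing ▷ (Yᘁ : C)) ⊗≫ r' ▷ (A.X ⊗ (Yᘁ : C)) ⊗≫ 𝟙 _ := by
      set γ : (Yᘁ : C) ⟶ (A.X ⊗ A.X) ⊗ (Yᘁ : C) := (λ_ _).inv ≫ A.copairing ▷ (Yᘁ : C)
      calc
        _ = 𝟙 _ ⊗≫ (X ⊗ (Wᘁ : C)) ◁ coev Y ⊗≫ X ◁ (((Wᘁ : C) ⊗ Y) ◁ γ ≫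
            exch i (Wᘁ : C) Y ▷ ((A.X ⊗ A.X) ⊗ (Yᘁ : C))) ⊗≫
            f ▷ ((Wᘁ : C) ⊗ ((A.X ⊗ A.X) ⊗ (Yᘁ : C))) ⊗≫
            Z ◁ ev' W ▷ ((A.X ⊗ A.X) ⊗ (Yᘁ : C)) ⊗≫ r' ▷ (A.X ⊗ (Yᘁ : C)) ⊗≫ 𝟙 _ := by
          simp only [γ]; monoidal
        _ = 𝟙 _ ⊗≫ (X ⊗ (Wᘁ : C)) ◁ coev Y ⊗≫ X ◁ exch i (Wᘁ : C) Y ▷ (Yᘁ : C) ⊗≫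
            ((X ⊗ Y) ◁ ((Wᘁ : C) ◁ γ) ≫ f ▷ ((Wᘁ : C) ⊗ ((A.X ⊗ A.X) ⊗ (Yᘁ : C)))) ⊗≫
            Z ◁ ev' W ▷ ((A.X ⊗ A.X) ⊗ (Yᘁ : C)) ⊗≫ r' ▷ (A.X ⊗ (Yᘁ : C)) ⊗≫ 𝟙 _ := by
          rw [whisker_exchange]; monoidal
        _ = 𝟙 _ ⊗≫ (X ⊗ (Wᘁ : C)) ◁ coev Y ⊗≫ X ◁ exch i (Wᘁ : C) Y ▷ (Yᘁ : C) ⊗≫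
            f ▷ ((Wᘁ : C) ⊗ (Yᘁ : C)) ⊗≫ Z ◁ ((W ⊗ (Wᘁ : C)) ◁ γ ≫
            ev' W ▷ ((A.X ⊗ A.X) ⊗ (Yᘁ : C))) ⊗≫ r' ▷ (A.X ⊗ (Yᘁ : C)) ⊗≫ 𝟙 _ := by
          rw [whisker_exchange]; monoidal
        _ = _ := by
          rw [whisker_exchange]; simp only [γ]; monoidal
    _ = _ := by rw [coactR, bend]; monoidal

end RotationLinear

-- Testing morphisms into a dual by evaluation

section Cancellation

variable {C : Type u₁} [Category.{v₁} C] [MonoidalCategory C] [RightRigidCategory C] {U V W : C}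

theorem eq_of_ev {f g : U ⟶ Wᘁ} (h : f ▷ W ≫ ev W = g ▷ W ≫ ev W) : f = g := by
  rw [← cancel_mono (λ_ (Wᘁ : C)).inv]
  refine eq_of_ev_right ?_
  have e (f : U ⟶ Wᘁ) : (f ≫ (λ_ (Wᘁ : C)).inv) ▷ W ≫ (α_ _ _ _).hom ≫ 𝟙_ C ◁ ev W =
      (f ▷ W ≫ ev W) ≫ (λ_ _).inv := by monoidal
  rw [e, e, h]

variable [PivotalCategory C]

theorem eq_of_ev'_left {f g : U ⟶ Wᘁ ⊗ V}
    (h : W ◁ f ≫ (α_ _ _ _).inv ≫ ev' W ▷ V = W ◁ g ≫ (α_ _ _ _).inv ≫ ev' W ▷ V) : f = g := by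
  have key (f : U ⟶ (Wᘁ : C) ⊗ V) : f = 𝟙 U ⊗≫ coev' W ▷ U ⊗≫
      (Wᘁ : C) ◁ (W ◁ f ≫ (α_ _ _ _).inv ≫ ev' W ▷ V) ⊗≫ 𝟙 _ := by
    symm
    calc
      _ = 𝟙 U ⊗≫ (coev' W ▷ U ≫ ((Wᘁ : C) ⊗ W) ◁ f) ⊗≫ (Wᘁ : C) ◁ ev' W ▷ V ⊗≫ 𝟙 _ := by monoidal
      _ = f ⊗≫ (coev' W ▷ (Wᘁ : C) ≫ (α_ _ _ _).hom ≫ (Wᘁ : C) ◁ ev' W) ▷ V ⊗≫ 𝟙 _ := by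
        rw [← whisker_exchange]; monoidal
      _ = _ := by rw [coev'_ev']; monoidal
  rw [key f, key g, h]

theorem eq_of_ev' {f g : U ⟶ Wᘁ} (h : W ◁ f ≫ ev' W = W ◁ g ≫ ev' W) : f = g := by
  rw [← cancel_mono (ρ_ (Wᘁ : C)).inv]
  refine eq_of_ev'_left ?_
  have e (f : U ⟶ Wᘁ) : W ◁ (f ≫ (ρ_ (Wᘁ : C)).inv) ≫ (α_ _ _ _).inv ≫ ev' W ▷ 𝟙_ C =
      (W ◁ f ≫ ev' W) ≫ (ρ_ _).inv := by monoidal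
  rw [e, e, h]

end Cancellation

-- Outer and dual bimodules

namespace FrobeniusAlgebra

variable {C : Type u₁} [Category.{v₁} C] [MonoidalCategory C]

section Outer

variable {A : FrobeniusAlgebra C}

/-- The tensor product `M ⊗ N` in the ambient category, with the left action on `M` and the right
action on `N`. -/
@[reducible]
def outer (M N : Bimod A.toMon A.toMon) : Bimod A.toMon A.toMon where
  X := M.X ⊗ N.X
  actLeft := (α_ _ _ _).inv ≫ M.actLeft ▷ N.X
  actRight := (α_ _ _ _).hom ≫ M.X ◁ N.actRight
  one_actLeft := by
    have := M.one_actLeft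
    rw [associator_inv_naturality_left_assoc, ← comp_whiskerRight, this]; monoidal
  left_assoc := by
    have := M.left_assoc
    rw [associator_inv_naturality_left_assoc, ← comp_whiskerRight, this]; monoidal
  actRight_one := by
    have := N.actRight_one
    rw [associator_naturality_right_assoc, ← MonoidalCategory.whiskerLeft_comp, this]; monoidal
  right_assoc := by
    have := N.right_assoc
    rw [associator_naturality_right_assoc, ← MonoidalCategory.whiskerLeft_comp, this]; monoidal
  middle_assoc := by
    calc
      _ = 𝟙 _ ⊗≫ (M.actLeft ▷ (N.X ⊗ A.X) ≫ M.X ◁ N.actRight) := by monoidal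
      _ = _ := by rw [← whisker_exchange]; monoidal

end Outer

variable [RightRigidCategory C] [PivotalCategory C] {A : FrobeniusAlgebra C}

/-- The dual bimodule. -/
@[reducible]
def dual (M : Bimod A.toMon A.toMon) : Bimod A.toMon A.toMon where
  X := M.Xᘁ
  actLeft := A.dualL M.actRight
  actRight := A.dualR M.actLeft
  one_actLeft := by
    refine eq_of_ev' ?_
    have e : M.X ◁ A.one ≫ M.actRight = (ρ_ M.X).hom := M.actRight_one
    calc
      _ = M.X ◁ A.one ▷ (M.Xᘁ : C) ≫ (M.X ◁ A.dualL M.actRight ≫ ev' M.X) := by monoidal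
      _ = 𝟙 _ ⊗≫ (M.X ◁ A.one ≫ M.actRight) ▷ (M.Xᘁ : C) ≫ ev' M.X := by
        rw [dualL_ev']; monoidal
      _ = _ := by rw [e]; monoidal
  left_assoc := by
    refine eq_of_ev' ?_
    have e : M.X ◁ A.mul ≫ M.actRight = _ := M.right_assoc
    calc
      _ = M.X ◁ A.mul ▷ (M.Xᘁ : C) ≫ (M.X ◁ A.dualL M.actRight ≫ ev' M.X) := by monoidal
      _ = 𝟙 _ ⊗≫ (M.X ◁ A.mul ≫ M.actRight) ▷ (M.Xᘁ : C) ≫ ev' M.X := by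
        rw [dualL_ev']; monoidal
      _ = 𝟙 _ ⊗≫ M.actRight ▷ A.X ▷ (M.Xᘁ : C) ⊗≫
          ((α_ _ _ _).inv ≫ M.actRight ▷ (M.Xᘁ : C) ≫ ev' M.X) := by rw [e]; monoidal
      _ = 𝟙 _ ⊗≫ (M.actRight ▷ (A.X ⊗ (M.Xᘁ : C)) ≫ M.X ◁ A.dualL M.actRight) ≫ ev' M.X := by
        rw [← dualL_ev']; monoidal
      _ = 𝟙 _ ⊗≫ M.X ◁ A.X ◁ A.dualL M.actRight ⊗≫
          ((α_ _ _ _).inv ≫ M.actRight ▷ (M.Xᘁ : C) ≫ ev' M.X) := by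
        rw [← whisker_exchange]; monoidal
      _ = _ := by rw [← dualL_ev']; monoidal
  actRight_one := by
    refine eq_of_ev ?_
    have e : A.one ▷ M.X ≫ M.actLeft = (λ_ M.X).hom := M.one_actLeft
    calc
      _ = ((M.Xᘁ : C) ◁ A.one) ▷ M.X ≫ (A.dualR M.actLeft ▷ M.X ≫ ev M.X) := by monoidal
      _ = 𝟙 _ ⊗≫ (M.Xᘁ : C) ◁ (A.one ▷ M.X ≫ M.actLeft) ≫ ev M.X := by
        rw [dualR_ev]; monoidal
      _ = _ := by rw [e]; monoidal
  right_assoc := by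
    refine eq_of_ev ?_
    have e : A.mul ▷ M.X ≫ M.actLeft = _ := M.left_assoc
    calc
      _ = ((M.Xᘁ : C) ◁ A.mul) ▷ M.X ≫ (A.dualR M.actLeft ▷ M.X ≫ ev M.X) := by monoidal
      _ = 𝟙 _ ⊗≫ (M.Xᘁ : C) ◁ (A.mul ▷ M.X ≫ M.actLeft) ≫ ev M.X := by
        rw [dualR_ev]; monoidal
      _ = 𝟙 _ ⊗≫ (M.Xᘁ : C) ◁ A.X ◁ M.actLeft ⊗≫
          ((α_ _ _ _).hom ≫ (M.Xᘁ : C) ◁ M.actLeft ≫ ev M.X) := by rw [e]; monoidal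
      _ = 𝟙 _ ⊗≫ (((M.Xᘁ : C) ⊗ A.X) ◁ M.actLeft ≫ A.dualR M.actLeft ▷ M.X) ≫ ev M.X := by
        rw [← dualR_ev]; monoidal
      _ = 𝟙 _ ⊗≫ A.dualR M.actLeft ▷ A.X ▷ M.X ⊗≫
          ((α_ _ _ _).hom ≫ (M.Xᘁ : C) ◁ M.actLeft ≫ ev M.X) := by
        rw [whisker_exchange]; monoidal
      _ = _ := by rw [← dualR_ev]; monoidal
  middle_assoc := by
    refine eq_of_coev_right ?_
    -- The left dual action is governed by `ev'` and the right one by `ev`, so they cannot be tested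
    -- with the same evaluation directly. Bending the acting strand makes the right action a
    -- transpose of `actLeft`, and `transpose_tensor_eq` rewrites it by the second duality; `hR`
    -- records its pairing with `ev'`.
    let R : (M.Xᘁ : C) ⟶ (M.Xᘁ : C) ⊗ (A.Xᘁ : C) :=
      𝟙 _ ⊗≫ (M.Xᘁ : C) ◁ coev A.X ⊗≫ A.dualR M.actLeft ▷ (A.Xᘁ : C)
    have hR : M.X ◁ R ≫ (α_ _ _ _).inv ≫ ev' M.X ▷ (A.Xᘁ : C) =
        𝟙 _ ⊗≫ coev' A.X ▷ (M.X ⊗ (M.Xᘁ : C)) ⊗≫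
          (A.Xᘁ : C) ◁ (M.actLeft ▷ (M.Xᘁ : C) ≫ ev' M.X) ⊗≫ 𝟙 _ := by
      have e : R = 𝟙 _ ⊗≫ coev' M.X ▷ (M.Xᘁ : C) ⊗≫ (M.Xᘁ : C) ◁ coev' A.X ▷ M.X ▷ (M.Xᘁ : C) ⊗≫
          ((M.Xᘁ : C) ⊗ (A.Xᘁ : C)) ◁ M.actLeft ▷ (M.Xᘁ : C) ⊗≫
          ((M.Xᘁ : C) ⊗ (A.Xᘁ : C)) ◁ ev' M.X ⊗≫ 𝟙 _ := by
        rw [← transpose_tensor_eq]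
        simp only [R, dualR]
        monoidal
      let K : M.X ⊗ (M.Xᘁ : C) ⟶ (A.Xᘁ : C) := 𝟙 _ ⊗≫ coev' A.X ▷ (M.X ⊗ (M.Xᘁ : C)) ⊗≫
          (A.Xᘁ : C) ◁ (M.actLeft ▷ (M.Xᘁ : C) ≫ ev' M.X) ⊗≫ 𝟙 _
      rw [e]
      calc
        _ = 𝟙 _ ⊗≫ M.X ◁ coev' M.X ▷ (M.Xᘁ : C) ⊗≫ ((M.X ⊗ (M.Xᘁ : C)) ◁ K ≫
            ev' M.X ▷ (A.Xᘁ : C)) ⊗≫ 𝟙 _ := by simp only [K]; monoidal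
        _ = 𝟙 _ ⊗≫ (M.X ◁ coev' M.X ≫ (α_ _ _ _).inv ≫ ev' M.X ▷ M.X) ▷ (M.Xᘁ : C) ⊗≫ K ≫ (λ_ _).inv := by
          rw [whisker_exchange]; monoidal
        _ = K ≫ (λ_ _).inv := by rw [ev'_coev']; monoidal
        _ = _ := by simp only [K]; monoidal
    have h1 : (A.X ⊗ (M.Xᘁ : C)) ◁ coev A.X ≫ (α_ _ _ _).inv ≫
        (A.dualL M.actRight ▷ A.X ≫ A.dualR M.actLeft) ▷ (A.Xᘁ : C) =
        (ρ_ _).hom ≫ A.dualL M.actRight ≫ R := by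
      calc
        _ = 𝟙 _ ⊗≫ ((A.X ⊗ (M.Xᘁ : C)) ◁ coev A.X ≫ A.dualL M.actRight ▷ (A.X ⊗ (A.Xᘁ : C))) ⊗≫
          A.dualR M.actLeft ▷ (A.Xᘁ : C) := by monoidal
        _ = _ := by rw [whisker_exchange]; simp only [R]; monoidal
    have h2 : (A.X ⊗ (M.Xᘁ : C)) ◁ coev A.X ≫ (α_ _ _ _).inv ≫
        ((α_ _ _ _).hom ≫ A.X ◁ A.dualR M.actLeft ≫ A.dualL M.actRight) ▷ (A.Xᘁ : C) =
        (ρ_ _).hom ≫ A.X ◁ R ≫ (α_ _ _ _).inv ≫ A.dualL M.actRight ▷ (A.Xᘁ : C) := by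
      simp only [R]; monoidal
    change (A.X ⊗ (M.Xᘁ : C)) ◁ coev A.X ≫ (α_ _ _ _).inv ≫
        (A.dualL M.actRight ▷ A.X ≫ A.dualR M.actLeft) ▷ (A.Xᘁ : C) =
      (A.X ⊗ (M.Xᘁ : C)) ◁ coev A.X ≫ (α_ _ _ _).inv ≫
        ((α_ _ _ _).hom ≫ A.X ◁ A.dualR M.actLeft ≫ A.dualL M.actRight) ▷ (A.Xᘁ : C)
    rw [h1, h2, cancel_epi]
    refine eq_of_ev'_left ?_
    have e : M.actLeft ▷ A.X ≫ M.actRight = _ := M.middle_assoc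
    calc
      _ = M.X ◁ A.dualL M.actRight ≫ (M.X ◁ R ≫ (α_ _ _ _).inv ≫ ev' M.X ▷ (A.Xᘁ : C)) := by
        monoidal
      _ = 𝟙 _ ⊗≫ (𝟙_ C ◁ (M.X ◁ A.dualL M.actRight) ≫ coev' A.X ▷ (M.X ⊗ (M.Xᘁ : C))) ⊗≫
          (A.Xᘁ : C) ◁ (M.actLeft ▷ (M.Xᘁ : C) ≫ ev' M.X) ⊗≫ 𝟙 _ := by rw [hR]; monoidal
      _ = 𝟙 _ ⊗≫ coev' A.X ▷ (M.X ⊗ (A.X ⊗ (M.Xᘁ : C))) ⊗≫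
          (A.Xᘁ : C) ◁ ((A.X ⊗ M.X) ◁ A.dualL M.actRight ≫ M.actLeft ▷ (M.Xᘁ : C)) ⊗≫
          (A.Xᘁ : C) ◁ ev' M.X ⊗≫ 𝟙 _ := by rw [whisker_exchange]; monoidal
      _ = 𝟙 _ ⊗≫ coev' A.X ▷ (M.X ⊗ (A.X ⊗ (M.Xᘁ : C))) ⊗≫
          (A.Xᘁ : C) ◁ (M.actLeft ▷ (A.X ⊗ (M.Xᘁ : C)) ≫ (M.X ◁ A.dualL M.actRight ≫ ev' M.X)) ⊗≫
          𝟙 _ := by rw [whisker_exchange]; monoidal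
      _ = 𝟙 _ ⊗≫ coev' A.X ▷ (M.X ⊗ (A.X ⊗ (M.Xᘁ : C))) ⊗≫
          (A.Xᘁ : C) ◁ (M.actLeft ▷ A.X ≫ M.actRight) ▷ (M.Xᘁ : C) ⊗≫ (A.Xᘁ : C) ◁ ev' M.X ⊗≫
          𝟙 _ := by rw [dualL_ev']; monoidal
      _ = 𝟙 _ ⊗≫ (coev' A.X ▷ ((M.X ⊗ A.X) ⊗ (M.Xᘁ : C)) ≫
          ((A.Xᘁ : C) ⊗ A.X) ◁ (M.actRight ▷ (M.Xᘁ : C))) ⊗≫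
          (A.Xᘁ : C) ◁ (M.actLeft ▷ (M.Xᘁ : C) ≫ ev' M.X) ⊗≫ 𝟙 _ := by rw [e]; monoidal
      _ = 𝟙 _ ⊗≫ M.actRight ▷ (M.Xᘁ : C) ⊗≫ (M.X ◁ R ≫ (α_ _ _ _).inv ≫ ev' M.X ▷ (A.Xᘁ : C)) := by
        rw [← whisker_exchange, hR]; monoidal
      _ = 𝟙 _ ⊗≫ (M.actRight ▷ (M.Xᘁ : C) ≫ M.X ◁ R) ⊗≫ ev' M.X ▷ (A.Xᘁ : C) := by monoidal
      _ = 𝟙 _ ⊗≫ (M.X ⊗ A.X) ◁ R ⊗≫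
          ((α_ _ _ _).inv ≫ M.actRight ▷ (M.Xᘁ : C) ≫ ev' M.X) ▷ (A.Xᘁ : C) := by
        rw [← whisker_exchange]; monoidal
      _ = _ := by rw [← dualL_ev']; monoidal

end FrobeniusAlgebra

namespace OrbData

variable {k : Type w} {C : Type u₁} [Category.{v₁} C] [MonoidalCategory C] [RightRigidCategory C]
  [PivotalCategory C] [BraidedCategory C] [Field k] [Preadditive C] [Linear k C] {𝔸 : OrbData k C}

/-- The bimodule `T` with the right action `i`. -/
@[reducible]
def IsOrbifoldDatum.bimod (h : 𝔸.IsOrbifoldDatum) (i : Leg) : Bimod 𝔸.A.toMon 𝔸.A.toMon where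
  X := 𝔸.T
  actLeft := 𝔸.act₀
  actRight := 𝔸.act i
  one_actLeft := h.act₀_one
  left_assoc := h.act₀_mul.trans (by monoidal)
  actRight_one := h.act_one i
  right_assoc := (h.act_mul i).trans (by monoidal)
  middle_assoc := (h.act₀_act i).trans (by monoidal)

theorem IsOrbifoldDatum.splits (h : 𝔸.IsOrbifoldDatum) : 𝔸.A.Splits (𝔸.A.sq 𝔸.ψ) := h.isSection

end OrbData

-- Axioms with implicit coherence rewritten with explicit associators

section Coherence

variable {C : Type u₁} [Category.{v₁} C] [MonoidalCategory C] {P X Y Z W V : C}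

theorem id_comp_eq_hom (f : X ⊗ Y ⊗ Z ⟶ W) :
    𝟙 ((X ⊗ Y) ⊗ Z) ⊗≫ f = (α_ X Y Z).hom ≫ f := by monoidal

theorem id_comp_eq_inv (f : (X ⊗ Y) ⊗ Z ⟶ W) :
    𝟙 (X ⊗ Y ⊗ Z) ⊗≫ f = (α_ X Y Z).inv ≫ f := by monoidal

theorem leftLinear_iff {l : P ⊗ X ⟶ X} {l' : P ⊗ Z ⟶ Z} {f : X ⊗ Y ⟶ Z ⊗ W} :
    LeftLinear l l' f ↔ l ▷ Y ≫ f = 𝟙 _ ⊗≫ P ◁ f ⊗≫ l' ▷ W := by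
  rw [LeftLinear]; exact Eq.congr_right (by monoidal)

theorem rightLinear_iff {r : Y ⊗ P ⟶ Y} {r' : W ⊗ P ⟶ W} {f : X ⊗ Y ⟶ Z ⊗ W} :
    RightLinear r r' f ↔ X ◁ r ≫ f = 𝟙 _ ⊗≫ f ▷ P ⊗≫ Z ◁ r' := by
  rw [RightLinear]; exact Eq.congr_right (by monoidal)

theorem exchOut_iff [BraidedCategory C] {i : Leg} {r : Y ⊗ P ⟶ Y} {r' : Z ⊗ P ⟶ Z}
    {f : X ⊗ Y ⟶ Z ⊗ W} : ExchOut i r r' f ↔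
      X ◁ r ≫ f = 𝟙 _ ⊗≫ f ▷ P ⊗≫ Z ◁ exch i W P ⊗≫ r' ▷ W := by
  rw [ExchOut]; exact Eq.congr_right (by monoidal)

theorem exchIn_iff [BraidedCategory C] {i : Leg} {r : X ⊗ P ⟶ X} {r' : W ⊗ P ⟶ W}
    {f : X ⊗ Y ⟶ Z ⊗ W} : ExchIn i r r' f ↔
      X ◁ exch i Y P ⊗≫ r ▷ Y ≫ f = 𝟙 _ ⊗≫ f ▷ P ⊗≫ Z ◁ r' := by
  have e1 : X ◁ exch i Y P ≫ (α_ _ _ _).inv ≫ r ▷ Y ≫ f = X ◁ exch i Y P ⊗≫ r ▷ Y ≫ f := by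
    monoidal
  rw [ExchIn, e1]; exact Eq.congr_right (by monoidal)

variable {A : FrobeniusAlgebra C}

theorem FrobeniusAlgebra.balanced_iff {r : X ⊗ A.X ⟶ X} {l : A.X ⊗ Y ⟶ Y} {b : X ⊗ Y ⟶ V} :
    A.Balanced r l b ↔ r ▷ Y ≫ b = 𝟙 _ ⊗≫ X ◁ l ≫ b := by
  rw [FrobeniusAlgebra.Balanced, id_comp_eq_hom]

theorem FrobeniusAlgebra.cobalanced_iff {r : X ⊗ A.X ⟶ X} {l : A.X ⊗ Y ⟶ Y} {g : V ⟶ X ⊗ Y} :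
    A.Cobalanced r l g ↔ g ≫ A.coactR r ▷ Y = g ≫ X ◁ A.coactL l ⊗≫ 𝟙 _ := by
  rw [FrobeniusAlgebra.Cobalanced]
  have e : g ≫ X ◁ A.coactL l ⊗≫ 𝟙 ((X ⊗ A.X) ⊗ Y) = (g ≫ X ◁ A.coactL l) ≫ (α_ _ _ _).inv := by
    monoidal
  rw [e, ← Category.assoc, Iso.eq_comp_inv]

end Coherence

-- Changing the dual used in a rotation

section Conjugation

variable {C : Type u₁} [Category.{v₁} C] [MonoidalCategory C] {X X' X'' Y Y' Y'' Z W W' W'' : C}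

/-- Used with `u`, `v` the isomorphisms `F(X*) ≅ F(X)*`: the image of a rotated box is rotated by
images of dualities, whereas the conditions in the target use the chosen duals. -/
theorem rotL_conj {c : 𝟙_ C ⟶ X' ⊗ X} {c' : 𝟙_ C ⟶ X'' ⊗ X} {p : W ⊗ W' ⟶ 𝟙_ C}
    {p' : W ⊗ W'' ⟶ 𝟙_ C} {u : X' ⟶ X''} {v : W' ⟶ W''} (hc : c ≫ u ▷ X = c')
    (hp : W ◁ v ≫ p' = p) (f : X ⊗ Y ⟶ Z ⊗ W) :
    Y ◁ v ≫ rotL c' p' f = rotL c p f ≫ u ▷ Z := by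
  subst hc hp
  calc
    _ = 𝟙 _ ⊗≫ (𝟙_ C ◁ (Y ◁ v) ≫ c ▷ (Y ⊗ W'')) ⊗≫ u ▷ X ▷ Y ▷ W'' ⊗≫ X'' ◁ f ▷ W'' ⊗≫
        (X'' ⊗ Z) ◁ p' ⊗≫ 𝟙 _ := by rw [rotL]; monoidal
    _ = 𝟙 _ ⊗≫ c ▷ (Y ⊗ W') ⊗≫ ((X' ⊗ X) ◁ (Y ◁ v) ≫ (u ▷ X) ▷ (Y ⊗ W'')) ⊗≫ X'' ◁ f ▷ W'' ⊗≫
        (X'' ⊗ Z) ◁ p' ⊗≫ 𝟙 _ := by rw [whisker_exchange]; monoidal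
    _ = 𝟙 _ ⊗≫ c ▷ (Y ⊗ W') ⊗≫ u ▷ (X ⊗ (Y ⊗ W')) ⊗≫ X'' ◁ ((X ⊗ Y) ◁ v ≫ f ▷ W'') ⊗≫
        (X'' ⊗ Z) ◁ p' ⊗≫ 𝟙 _ := by rw [whisker_exchange]; monoidal
    _ = 𝟙 _ ⊗≫ c ▷ (Y ⊗ W') ⊗≫ (u ▷ ((X ⊗ Y) ⊗ W') ≫ X'' ◁ (f ▷ W')) ⊗≫
        (X'' ⊗ Z) ◁ (W ◁ v ≫ p') ⊗≫ 𝟙 _ := by rw [whisker_exchange]; monoidal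
    _ = 𝟙 _ ⊗≫ c ▷ (Y ⊗ W') ⊗≫ X' ◁ (f ▷ W') ⊗≫ (u ▷ (Z ⊗ (W ⊗ W')) ≫
        X'' ◁ (Z ◁ (W ◁ v ≫ p'))) ⊗≫ 𝟙 _ := by rw [← whisker_exchange]; monoidal
    _ = _ := by rw [← whisker_exchange, rotL]; monoidal

theorem rotR_conj {c : 𝟙_ C ⟶ X ⊗ X'} {c' : 𝟙_ C ⟶ X ⊗ X''} {p : W' ⊗ W ⟶ 𝟙_ C}
    {p' : W'' ⊗ W ⟶ 𝟙_ C} {u : X' ⟶ X''} {v : W' ⟶ W''} (hc : c ≫ X ◁ u = c')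
    (hp : v ▷ W ≫ p' = p) (f : Y ⊗ X ⟶ W ⊗ Z) :
    v ▷ Y ≫ rotR c' p' f = rotR c p f ≫ Z ◁ u := by
  subst hc hp
  calc
    _ = 𝟙 _ ⊗≫ (v ▷ (Y ⊗ 𝟙_ C) ≫ W'' ◁ (Y ◁ (c ≫ X ◁ u))) ⊗≫ W'' ◁ f ▷ X'' ⊗≫
        p' ▷ Z ▷ X'' ⊗≫ 𝟙 _ := by rw [rotR]; monoidal
    _ = 𝟙 _ ⊗≫ W' ◁ Y ◁ c ⊗≫ W' ◁ Y ◁ X ◁ u ⊗≫ (v ▷ ((Y ⊗ X) ⊗ X'') ≫ W'' ◁ (f ▷ X'')) ⊗≫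
        p' ▷ Z ▷ X'' ⊗≫ 𝟙 _ := by rw [← whisker_exchange]; monoidal
    _ = 𝟙 _ ⊗≫ W' ◁ Y ◁ c ⊗≫ W' ◁ ((Y ⊗ X) ◁ u ≫ f ▷ X'') ⊗≫
        (v ▷ W ≫ p') ▷ Z ▷ X'' ⊗≫ 𝟙 _ := by rw [← whisker_exchange]; monoidal
    _ = 𝟙 _ ⊗≫ W' ◁ Y ◁ c ⊗≫ W' ◁ f ▷ X' ⊗≫ ((W' ⊗ W) ◁ (Z ◁ u) ≫
        (v ▷ W ≫ p') ▷ (Z ⊗ X'')) ⊗≫ 𝟙 _ := by rw [whisker_exchange]; monoidal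
    _ = _ := by rw [whisker_exchange, rotR]; monoidal

theorem bend_conj [BraidedCategory C] (i : Leg) {c : 𝟙_ C ⟶ Y ⊗ Y'} {c' : 𝟙_ C ⟶ Y ⊗ Y''}
    {p : W ⊗ W' ⟶ 𝟙_ C} {p' : W ⊗ W'' ⟶ 𝟙_ C} {u : Y' ⟶ Y''} {v : W' ⟶ W''}
    (hc : c ≫ Y ◁ u = c') (hp : W ◁ v ≫ p' = p) (f : X ⊗ Y ⟶ Z ⊗ W) :
    X ◁ v ≫ bend i c' p' f = bend i c p f ≫ Z ◁ u := by
  subst hc hp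
  calc
    _ = 𝟙 _ ⊗≫ X ◁ (v ▷ 𝟙_ C ≫ W'' ◁ (c ≫ Y ◁ u)) ⊗≫ X ◁ exch i W'' Y ▷ Y'' ⊗≫
        f ▷ (W'' ⊗ Y'') ⊗≫ Z ◁ p' ▷ Y'' ⊗≫ 𝟙 _ := by rw [bend]; monoidal
    _ = 𝟙 _ ⊗≫ (X ⊗ W') ◁ c ⊗≫ (X ⊗ W') ◁ Y ◁ u ⊗≫ X ◁ (v ▷ Y ≫ exch i W'' Y) ▷ Y'' ⊗≫
        f ▷ (W'' ⊗ Y'') ⊗≫ Z ◁ p' ▷ Y'' ⊗≫ 𝟙 _ := by rw [← whisker_exchange]; monoidal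
    _ = 𝟙 _ ⊗≫ (X ⊗ W') ◁ c ⊗≫ X ◁ ((W' ⊗ Y) ◁ u ≫ exch i W' Y ▷ Y'') ⊗≫
        ((X ⊗ Y) ◁ v ≫ f ▷ W'') ▷ Y'' ⊗≫ Z ◁ p' ▷ Y'' ⊗≫ 𝟙 _ := by
      rw [exch_naturality_left]; monoidal
    _ = 𝟙 _ ⊗≫ (X ⊗ W') ◁ c ⊗≫ X ◁ exch i W' Y ▷ Y' ⊗≫ ((X ⊗ Y) ◁ (W' ◁ u) ≫ f ▷ (W' ⊗ Y'')) ⊗≫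
        Z ◁ (W ◁ v ≫ p') ▷ Y'' ⊗≫ 𝟙 _ := by
      rw [whisker_exchange, whisker_exchange f v]; monoidal
    _ = 𝟙 _ ⊗≫ (X ⊗ W') ◁ c ⊗≫ X ◁ exch i W' Y ▷ Y' ⊗≫ f ▷ (W' ⊗ Y') ⊗≫
        Z ◁ ((W ⊗ W') ◁ u ≫ (W ◁ v ≫ p') ▷ Y'') ⊗≫ 𝟙 _ := by
      rw [whisker_exchange]; monoidal
    _ = _ := by rw [whisker_exchange, bend]; monoidal

theorem FrobeniusAlgebra.bridge_conj_right {A : FrobeniusAlgebra C} (r : X ⊗ A.X ⟶ X)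
    {l : A.X ⊗ Y ⟶ Y} {l' : A.X ⊗ Y' ⟶ Y'} {u : Y ⟶ Y'} (h : l ≫ u = A.X ◁ u ≫ l') :
    A.bridge r l ≫ X ◁ u = X ◁ u ≫ A.bridge r l' := by
  rw [A.bridge_eq_coactR, A.bridge_eq_coactR, Category.assoc, Category.assoc,
    ← MonoidalCategory.whiskerLeft_comp, h, MonoidalCategory.whiskerLeft_comp,
    ← associator_naturality_right_assoc, ← whisker_exchange_assoc]

theorem FrobeniusAlgebra.bridge_conj_left {A : FrobeniusAlgebra C} {r : X ⊗ A.X ⟶ X}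
    {r' : X' ⊗ A.X ⟶ X'} (l : A.X ⊗ Y ⟶ Y) {u : X ⟶ X'} (h : r ≫ u = u ▷ A.X ≫ r') :
    A.bridge r l ≫ u ▷ Y = u ▷ Y ≫ A.bridge r' l := by
  rw [A.bridge_eq_coactL, A.bridge_eq_coactL, Category.assoc, Category.assoc,
    ← comp_whiskerRight, h, comp_whiskerRight, ← associator_inv_naturality_left_assoc,
    whisker_exchange_assoc]

end Conjugation

-- Transport of relations between mutually inverse boxes

section Inverse

variable {C : Type u₁} [Category.{v₁} C] [MonoidalCategory C]
  {D : Type u₂} [Category.{v₂} D] [MonoidalCategory D] {F : C ⥤ D}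
  [F.LaxMonoidal] [F.OplaxMonoidal] {hF : IsFrobenius F} {A : FrobeniusAlgebra C}
  {a' : 𝟙_ D ⟶ F.obj A.X} (h : SplitsImage F hF A a') {a : 𝟙_ C ⟶ A.X} (ha : A.Splits a)
  {M N : Bimod A.toMon A.toMon} {X Y : C}

open FrobeniusAlgebra
include h ha

theorem SplitsImage.bmap_bmap_of_balanced {Z W : C} {f : X ⊗ Y ⟶ M.X ⊗ N.X} {g : M.X ⊗ N.X ⟶ Z ⊗ W}
    (hf : A.Cobalanced M.actRight N.actLeft f) (hg : A.Balanced M.actRight N.actLeft g) :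
    bmap F f ≫ (hF.mapAlgebra A).insR a' (μ F M.X A.X ≫ F.map M.actRight) ▷ F.obj N.X ≫
      bmap F g = bmap F (f ≫ A.insR a M.actRight ▷ N.X ≫ g) :=
  h.bmap_bmap (hf.comp_idemL ha) (hg.idemR_comp ha)

/-- The common pattern of O2–O5, O7 and T4–T6: the composite of a cobalanced box, an insertion and a
balanced box is a bridge, and bridges are carried to bridges. -/
theorem SplitsImage.inverse {f : X ⊗ Y ⟶ M.X ⊗ N.X} {g : M.X ⊗ N.X ⟶ X ⊗ Y}
    (hf : A.Cobalanced M.actRight N.actLeft f) (hg : A.Balanced M.actRight N.actLeft g)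
    {r : X ⊗ A.X ⟶ X} {l : A.X ⊗ Y ⟶ Y} (e : f ≫ A.insR a M.actRight ▷ N.X ≫ g = A.bridge r l) :
    bmap F f ≫ (hF.mapAlgebra A).insR a' (μ F M.X A.X ≫ F.map M.actRight) ▷ F.obj N.X ≫
      bmap F g = (hF.mapAlgebra A).bridge (μ F X A.X ≫ F.map r) (μ F A.X Y ≫ F.map l) := by
  rw [h.bmap_bmap_of_balanced ha hf hg, e, hF.bridge_eq]

/-- For O6 and T7 the insertion sits on the left action of the second strand; balancedness moves it
to the right action of the first. -/
theorem SplitsImage.inverse' {f : X ⊗ Y ⟶ M.X ⊗ N.X} {g : M.X ⊗ N.X ⟶ X ⊗ Y}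
    (hf : A.Cobalanced M.actRight N.actLeft f) (hg : A.Balanced M.actRight N.actLeft g)
    {r : X ⊗ A.X ⟶ X} {l : A.X ⊗ Y ⟶ Y} (e : f ≫ M.X ◁ A.insL a N.actLeft ≫ g = A.bridge r l) :
    bmap F f ≫ F.obj M.X ◁ (hF.mapAlgebra A).insL a' (μ F A.X N.X ≫ F.map N.actLeft) ≫
      bmap F g = (hF.mapAlgebra A).bridge (μ F X A.X ≫ F.map r) (μ F A.X Y ≫ F.map l) := by
  rw [← insR_balanced hg] at e
  rw [← h.inverse ha hf hg e]
  have hg'' := (hg.map hF).comp (δ F X Y)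
  rw [Category.assoc] at hg''
  have e' := insR_balanced (A := hF.mapAlgebra A) (M := (mapBimod F A.toMon).obj M)
    (N := (mapBimod F A.toMon).obj N) (a := a') hg''
  exact congrArg (fun q => bmap F f ≫ q) e'.symm

end Inverse

-- Dual actions under `F(X*) ≅ F(X)*`

section DualActions

variable {C : Type u₁} [Category.{v₁} C] [MonoidalCategory C]
  {D : Type u₂} [Category.{v₂} D] [MonoidalCategory D] {F : C ⥤ D}
  [RightRigidCategory C] [RightRigidCategory D] [PivotalCategory C] [PivotalCategory D]
  [F.LaxMonoidal] [F.OplaxMonoidal] (hF : IsFrobenius F) {A : FrobeniusAlgebra C} {M : C}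

theorem IsFrobenius.dualIso_dualL
    (h : F.obj M ◁ (hF.dualIso M).hom ≫ ev' (F.obj M) = mapPairing F (ev' M))
    (r : M ⊗ A.X ⟶ M) :
    (μ F A.X (Mᘁ : C) ≫ F.map (A.dualL r)) ≫ (hF.dualIso M).hom =
      F.obj A.X ◁ (hF.dualIso M).hom ≫ (hF.mapAlgebra A).dualL (μ F M A.X ≫ F.map r) := by
  have h1 := (hF.mapAlgebra A).dualL_ev' (μ F M A.X ≫ F.map r)
  let d : F.obj A.X ⊗ ((F.obj M)ᘁ : D) ⟶ ((F.obj M)ᘁ : D) :=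
    (hF.mapAlgebra A).dualL (μ F M A.X ≫ F.map r)
  change F.obj M ◁ d ≫ ev' (F.obj M) = (α_ (F.obj M) (F.obj A.X) ((F.obj M)ᘁ : D)).inv ≫
    (μ F M A.X ≫ F.map r) ▷ ((F.obj M)ᘁ : D) ≫ ev' (F.obj M) at h1
  change _ = F.obj A.X ◁ (hF.dualIso M).hom ≫ d
  clear_value d
  refine eq_of_ev' ?_
  have h2 := congrArg F.map (A.dualL_ev' r)
  simp only [F.map_comp] at h2
  simp only [MonoidalCategory.whiskerLeft_comp, Category.assoc]
  rw [h, h1, associator_inv_naturality_right_assoc, whisker_exchange_assoc, h]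
  simp only [mapPairing, comp_whiskerRight, Category.assoc]
  rw [μ_natural_right_assoc, reassoc_of% h2, μ_natural_left_assoc,
    Functor.LaxMonoidal.associativity_inv_assoc]

omit [PivotalCategory C] [PivotalCategory D] in
theorem IsFrobenius.dualIso_dualR (l : A.X ⊗ M ⟶ M) :
    (μ F (Mᘁ : C) A.X ≫ F.map (A.dualR l)) ≫ (hF.dualIso M).hom =
      (hF.dualIso M).hom ▷ F.obj A.X ≫ (hF.mapAlgebra A).dualR (μ F A.X M ≫ F.map l) := by
  have h1 := (hF.mapAlgebra A).dualR_ev (μ F A.X M ≫ F.map l)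
  let d : ((F.obj M)ᘁ : D) ⊗ F.obj A.X ⟶ ((F.obj M)ᘁ : D) :=
    (hF.mapAlgebra A).dualR (μ F A.X M ≫ F.map l)
  change d ▷ F.obj M ≫ ev (F.obj M) = (α_ ((F.obj M)ᘁ : D) (F.obj A.X) (F.obj M)).hom ≫
    ((F.obj M)ᘁ : D) ◁ (μ F A.X M ≫ F.map l) ≫ ev (F.obj M) at h1
  change _ = (hF.dualIso M).hom ▷ F.obj A.X ≫ d
  clear_value d
  refine eq_of_ev ?_
  have h2 := congrArg F.map (A.dualR_ev l)
  simp only [F.map_comp] at h2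
  simp only [comp_whiskerRight, Category.assoc]
  rw [hF.dualIso_ev, h1, associator_naturality_left_assoc, ← whisker_exchange_assoc, hF.dualIso_ev]
  simp only [mapPairing, MonoidalCategory.whiskerLeft_comp, Category.assoc]
  rw [μ_natural_left_assoc, reassoc_of% h2, μ_natural_right_assoc,
    Functor.LaxMonoidal.associativity_assoc]

end DualActions

-- The new section

section Section

variable {C : Type u₁} [Category.{v₁} C] [MonoidalCategory C]
  {D : Type u₂} [Category.{v₂} D] [MonoidalCategory D] {F : C ⥤ D}
  [F.LaxMonoidal] [F.OplaxMonoidal] {hF : IsFrobenius F} {A : FrobeniusAlgebra C}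

theorem FrobeniusAlgebra.bridge_mul (A : FrobeniusAlgebra C) :
    A.bridge A.mul A.mul = A.mul ≫ A.comul := by
  rw [A.bridge_eq_coactR, FrobeniusAlgebra.coactR_eq, A.copairing_mul_left, ← A.frobenius_left]
  monoidal

/-- Compatibility asks only for invertibility of the new element; that it is a section follows by
evaluating strong separability at the regular bimodule. Its bridge is multiplication followed by
comultiplication, and the unit on one end and the counit on the other remove the superfluous
factors. -/
theorem SplitsImage.splits {a' : 𝟙_ D ⟶ F.obj A.X} (h : SplitsImage F hF A a') :
    (hF.mapAlgebra A).Splits a' := by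
  have h1 : F.map (A.bridge A.mul A.mul) ≫ δ F A.X A.X ≫
      (hF.mapAlgebra A).insR a' (μ F A.X A.X ≫ F.map A.mul) ▷ F.obj A.X ≫ μ F A.X A.X ≫
      F.map (A.bridge A.mul A.mul) = F.map (A.bridge A.mul A.mul) :=
    h (Bimod.regular A.toMon) (Bimod.regular A.toMon)
  rw [A.bridge_mul] at h1
  have h2 := congrArg (fun f => F.map ((λ_ _).inv ≫ A.one ▷ A.X) ≫ f ≫
    F.map (A.counit ▷ A.X ≫ (λ_ _).hom)) h1
  have e1 : ((λ_ _).inv ≫ A.one ▷ A.X) ≫ A.mul = 𝟙 A.X := by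
    rw [Category.assoc, MonObj.one_mul, Iso.inv_hom_id]
  have e2 : A.comul ≫ (A.counit ▷ A.X ≫ (λ_ _).hom) = 𝟙 A.X := by
    rw [← Category.assoc, A.counit_comul, Iso.inv_hom_id]
  simp only [F.map_comp, Category.assoc] at h2 e1 e2
  simp only [← F.map_comp_assoc, ← F.map_comp, e2] at h2
  simp only [Category.comp_id, e1, reassoc_of% e1, F.map_id] at h2
  refine Eq.trans ?_ h2
  change (F.map A.comul ≫ δ F A.X A.X) ⊗≫ F.obj A.X ◁ a' ▷ F.obj A.X ⊗≫
    (μ F A.X A.X ≫ F.map A.mul) ▷ F.obj A.X ≫ μ F A.X A.X ≫ F.map A.mul =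
    F.map A.comul ≫ δ F A.X A.X ≫ (𝟙 (F.obj A.X) ⊗≫ F.obj A.X ◁ a' ⊗≫
      μ F A.X A.X ≫ F.map A.mul) ▷ F.obj A.X ≫ μ F A.X A.X ≫ F.map A.mul
  monoidal

end Section

-- Rotations expressed with the chosen duals

section Rotate

variable {C : Type u₁} [Category.{v₁} C] [MonoidalCategory C]
    [RightRigidCategory C] [PivotalCategory C] [BraidedCategory C]
    {D : Type u₂} [Category.{v₂} D] [MonoidalCategory D]
    [RightRigidCategory D] [PivotalCategory D] [BraidedCategory D]
    (hC : IsRibbon C) (hD : IsRibbon D)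
    {F : C ⥤ D} [F.LaxBraided] [F.OplaxMonoidal] (hF : IsRibbonFrobenius F)

include hC hD hF in
theorem IsRibbonFrobenius.dualIso_ev' (X : C) :
    F.obj X ◁ (hF.frobenius.dualIso X).hom ≫ ev' (F.obj X) = mapPairing F (ev' X) :=
  hF.frobenius.dualIso_ev' hD hC hF.twist_map X

include hC hD hF in
theorem IsRibbonFrobenius.coev'_dualIso (X : C) :
    mapCopairing F (coev' X) ≫ (hF.frobenius.dualIso X).hom ▷ F.obj X = coev' (F.obj X) :=
  hF.frobenius.coev'_dualIso hD hC hF.twist_map X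

include hC hD hF in
theorem IsRibbonFrobenius.rotL {X Y Z W : C} (f : X ⊗ Y ⟶ Z ⊗ W) :
    F.obj Y ◁ (hF.frobenius.dualIso W).hom ≫
      rotL (coev' (F.obj X)) (ev' (F.obj W)) (bmap F f) =
      bmap F (rotL (coev' X) (ev' W) f) ≫ (hF.frobenius.dualIso X).hom ▷ F.obj Z := by
  rw [← hF.frobenius.rotL_map]
  exact rotL_conj (hF.coev'_dualIso hC hD X) (hF.dualIso_ev' hC hD W) _

omit [PivotalCategory C] [PivotalCategory D] [BraidedCategory C] [BraidedCategory D]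
  [F.LaxBraided] in
theorem IsFrobenius.rotR [F.LaxMonoidal] (hF : IsFrobenius F) {X Y Z W : C}
    (f : Y ⊗ X ⟶ W ⊗ Z) :
    (hF.dualIso W).hom ▷ F.obj Y ≫ rotR (coev (F.obj X)) (ev (F.obj W)) (bmap F f) =
      bmap F (rotR (coev X) (ev W) f) ≫ F.obj Z ◁ (hF.dualIso X).hom := by
  rw [← hF.rotR_map]
  exact rotR_conj (hF.coev_dualIso X) (hF.dualIso_ev W) _

include hC hD hF in
theorem IsRibbonFrobenius.bend (i : Leg) {X Y Z W : C} (f : X ⊗ Y ⟶ Z ⊗ W) :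
    F.obj X ◁ (hF.frobenius.dualIso W).hom ≫
      bend i (coev (F.obj Y)) (ev' (F.obj W)) (bmap F f) =
      bmap F (bend i (coev Y) (ev' W) f) ≫ F.obj Z ◁ (hF.frobenius.dualIso Y).hom := by
  rw [← hF.frobenius.bend_map]
  exact bend_conj i (hF.frobenius.coev_dualIso Y) (hF.dualIso_ev' hC hD W) _

end Rotate

-- Transport of the orbifold datum

namespace OrbData

section Base

variable {k : Type w} {C : Type u₁} [Category.{v₁} C] [MonoidalCategory C] [RightRigidCategory C]
  [PivotalCategory C] [BraidedCategory C] [Field k] [Preadditive C] [Linear k C] {𝔸 : OrbData k C}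
  (h : 𝔸.IsOrbifoldDatum)

open Leg

namespace IsOrbifoldDatum

include h

theorem balanced : 𝔸.A.Balanced (𝔸.act two) 𝔸.act₀ 𝔸.α :=
  FrobeniusAlgebra.balanced_iff.2 h.α_balanced

theorem cobalanced : 𝔸.A.Cobalanced (𝔸.act one) 𝔸.act₀ 𝔸.α :=
  FrobeniusAlgebra.cobalanced_iff.2 h.α_cobalanced

theorem leftLinear : LeftLinear 𝔸.act₀ 𝔸.act₀ 𝔸.α := leftLinear_iff.2 h.α_act₀

theorem exchIn : ExchIn two (𝔸.act one) (𝔸.act one) 𝔸.α := exchIn_iff.2 h.α_act_first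

theorem rightLinear : RightLinear (𝔸.act one) (𝔸.act two) 𝔸.α := rightLinear_iff.2 h.α_act_second

theorem exchOut : ExchOut one (𝔸.act two) (𝔸.act two) 𝔸.α := exchOut_iff.2 h.α_act_third

theorem bar_balanced : 𝔸.A.Balanced (𝔸.act one) 𝔸.act₀ 𝔸.αbar :=
  FrobeniusAlgebra.balanced_iff.2 h.αbar_balanced

theorem bar_cobalanced : 𝔸.A.Cobalanced (𝔸.act two) 𝔸.act₀ 𝔸.αbar :=
  FrobeniusAlgebra.cobalanced_iff.2 h.αbar_cobalanced

theorem bar_leftLinear : LeftLinear 𝔸.act₀ 𝔸.act₀ 𝔸.αbar := leftLinear_iff.2 h.αbar_act₀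

theorem bar_exchOut : ExchOut two (𝔸.act one) (𝔸.act one) 𝔸.αbar :=
  exchOut_iff.2 h.αbar_act_first

theorem bar_rightLinear : RightLinear (𝔸.act two) (𝔸.act one) 𝔸.αbar :=
  rightLinear_iff.2 h.αbar_act_second

theorem bar_exchIn : ExchIn one (𝔸.act two) (𝔸.act two) 𝔸.αbar := exchIn_iff.2 h.αbar_act_third

end IsOrbifoldDatum

end Base

section Transport

variable {k : Type w} [Field k]
    {C : Type u₁} [Category.{v₁} C] [Preadditive C] [Linear k C] [MonoidalCategory C]
    [RightRigidCategory C] [PivotalCategory C] [BraidedCategory C] [HasCoequalizers C]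
    {D : Type u₂} [Category.{v₂} D] [Preadditive D] [Linear k D] [MonoidalCategory D]
    [RightRigidCategory D] [PivotalCategory D] [BraidedCategory D]
    {F : C ⥤ D} [F.LaxBraided] [F.OplaxMonoidal]
    (hF : IsRibbonFrobenius F) {𝔸 : OrbData k C} (h : 𝔸.IsOrbifoldDatum)
    {ψF : 𝟙_ D ⟶ F.obj 𝔸.A.X} {φF : k} (hcomp : IsCompatible hF.frobenius 𝔸 ψF φF)

open Leg FrobeniusAlgebra

include h hcomp

/-- The first two boxes share one strand and the third takes one strand from each. The insertion of
`ψ₁²` is slid through the second box, becoming `ψ₂²` directly before the third, where two strands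
are to be merged. On the other side the boxes share one strand and the braiding is harmless. -/
theorem IsOrbifoldDatum.transport_O1 :
    F.obj 𝔸.T ◁ bmap F 𝔸.α ⊗≫ F.obj 𝔸.T ◁ (hF.frobenius.mapAlgebra 𝔸.A).insR
      ((hF.frobenius.mapAlgebra 𝔸.A).sq ψF) (μ F 𝔸.T 𝔸.A.X ≫ F.map (𝔸.act one)) ▷ F.obj 𝔸.T ⊗≫
      bmap F 𝔸.α ▷ F.obj 𝔸.T ⊗≫ F.obj 𝔸.T ◁ bmap F 𝔸.α =
    𝟙 _ ⊗≫ bmap F 𝔸.α ▷ F.obj 𝔸.T ⊗≫ F.obj 𝔸.T ◁ exch one (F.obj 𝔸.T) (F.obj 𝔸.T) ⊗≫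
      bmap F 𝔸.α ▷ F.obj 𝔸.T ⊗≫ 𝟙 _ := by
  have hs := hcomp.stronglySeparable.splitsImage
  have r1 := h.rightLinear.insR (𝔸.A.sq 𝔸.ψ)
  have r2 : F.obj 𝔸.T ◁ (hF.frobenius.mapAlgebra 𝔸.A).insR
      ((hF.frobenius.mapAlgebra 𝔸.A).sq ψF) (μ F 𝔸.T 𝔸.A.X ≫ F.map (𝔸.act one)) ≫ bmap F 𝔸.α =
      bmap F 𝔸.α ≫ F.obj 𝔸.T ◁ (hF.frobenius.mapAlgebra 𝔸.A).insR
      ((hF.frobenius.mapAlgebra 𝔸.A).sq ψF) (μ F 𝔸.T 𝔸.A.X ≫ F.map (𝔸.act two)) :=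
    (h.rightLinear.map hF.frobenius).insR (A := hF.frobenius.mapAlgebra 𝔸.A) _
  set x1 := 𝔸.A.insR (𝔸.A.sq 𝔸.ψ) (𝔸.act one) with hx1
  set x2 := 𝔸.A.insR (𝔸.A.sq 𝔸.ψ) (𝔸.act two) with hx2
  set y1 := (hF.frobenius.mapAlgebra 𝔸.A).insR
      ((hF.frobenius.mapAlgebra 𝔸.A).sq ψF) (μ F 𝔸.T 𝔸.A.X ≫ F.map (𝔸.act one))
  set y2 := (hF.frobenius.mapAlgebra 𝔸.A).insR
      ((hF.frobenius.mapAlgebra 𝔸.A).sq ψF) (μ F 𝔸.T 𝔸.A.X ≫ F.map (𝔸.act two)) with hy2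
  change F.obj 𝔸.T ⟶ F.obj 𝔸.T at y1
  change F.obj 𝔸.T ⟶ F.obj 𝔸.T at y2
  -- The idempotent slides back through the second box, which takes `ρ₁` to `ρ₂`, and becomes the
  -- one of `T ⊗₁ T`; the first box absorbs that by cobalancedness.
  have hf : (𝔸.T ◁ 𝔸.α ≫ (α_ _ _ _).inv ≫ 𝔸.α ▷ 𝔸.T ≫ (α_ _ _ _).hom) ≫
      𝔸.T ◁ idemL (𝔸.A.sq 𝔸.ψ) (h.bimod two) (h.bimod one) =
      𝔸.T ◁ 𝔸.α ≫ (α_ _ _ _).inv ≫ 𝔸.α ▷ 𝔸.T ≫ (α_ _ _ _).hom := by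
    have b1 := h.rightLinear.bridge 𝔸.act₀
    have b2 : 𝔸.α ≫ x1 ▷ 𝔸.T ≫ 𝔸.A.bridge (𝔸.act one) 𝔸.act₀ = 𝔸.α :=
      Cobalanced.insR_bridge (M := h.bimod one) (N := h.bimod one) h.splits h.cobalanced
    change _ ≫ 𝔸.T ◁ (x2 ▷ 𝔸.T ≫ 𝔸.A.bridge (𝔸.act two) 𝔸.act₀) = _
    calc
      _ = 𝔸.T ◁ 𝔸.α ⊗≫ (𝔸.α ≫ 𝔸.T ◁ x2) ▷ 𝔸.T ⊗≫ 𝔸.T ◁ 𝔸.A.bridge (𝔸.act two) 𝔸.act₀ := by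
        monoidal
      _ = 𝔸.T ◁ (𝔸.α ≫ x1 ▷ 𝔸.T) ⊗≫
          ((α_ _ _ _).inv ≫ 𝔸.α ▷ 𝔸.T ≫ (α_ _ _ _).hom ≫ 𝔸.T ◁ 𝔸.A.bridge (𝔸.act two) 𝔸.act₀) := by
        rw [← r1]; monoidal
      _ = 𝔸.T ◁ (𝔸.α ≫ x1 ▷ 𝔸.T ≫ 𝔸.A.bridge (𝔸.act one) 𝔸.act₀) ≫
          (α_ _ _ _).inv ≫ 𝔸.α ▷ 𝔸.T ≫ (α_ _ _ _).hom := by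
        rw [← b1]; monoidal
      _ = _ := by rw [b2]
  have hg := h.balanced.idemR_comp (M := h.bimod two) (N := h.bimod one) h.splits
  calc
    _ = F.obj 𝔸.T ◁ bmap F 𝔸.α ⊗≫ (F.obj 𝔸.T ◁ y1 ≫ bmap F 𝔸.α) ▷ F.obj 𝔸.T ⊗≫
        F.obj 𝔸.T ◁ bmap F 𝔸.α := by monoidal
    _ = (F.obj 𝔸.T ◁ bmap F 𝔸.α ≫ (α_ _ _ _).inv ≫ bmap F 𝔸.α ▷ F.obj 𝔸.T ≫ (α_ _ _ _).hom) ≫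
        F.obj 𝔸.T ◁ (y2 ▷ F.obj 𝔸.T ≫ bmap F 𝔸.α) := by rw [r2]; monoidal
    _ = tmap F ((𝔸.T ◁ 𝔸.α ≫ (α_ _ _ _).inv ≫ 𝔸.α ▷ 𝔸.T ≫ (α_ _ _ _).hom) ≫
        𝔸.T ◁ (x2 ▷ 𝔸.T ≫ 𝔸.α)) := by
      rw [hF.frobenius.whiskerLeft_bmap_bmap]
      exact hs.tmap_whiskerLeft hf hg
    _ = tmap F ((α_ _ _ _).inv ≫ 𝔸.α ▷ 𝔸.T ≫ (α_ _ _ _).hom ≫ 𝔸.T ◁ exch one 𝔸.T 𝔸.T ≫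
        (α_ _ _ _).inv ≫ 𝔸.α ▷ 𝔸.T ≫ (α_ _ _ _).hom) := by
      congr 1
      calc
        _ = 𝔸.T ◁ 𝔸.α ⊗≫ (𝔸.α ≫ 𝔸.T ◁ x2) ▷ 𝔸.T ⊗≫ 𝔸.T ◁ 𝔸.α := by monoidal
        _ = 𝔸.T ◁ 𝔸.α ⊗≫ 𝔸.T ◁ x1 ▷ 𝔸.T ⊗≫ 𝔸.α ▷ 𝔸.T ⊗≫ 𝔸.T ◁ 𝔸.α := by rw [← r1]; monoidal
        _ = _ := h.O1
        _ = _ := by monoidal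
    _ = _ := by
      rw [← hF.frobenius.bmap_exch_bmap]; monoidal

end Transport

end OrbData

/-- Carries an inverse relation from objects built with `F(X*)` to those built with `F(X)*`: all
ingredients are conjugate along `u` and `v`, and `u` is cancelled as an epimorphism. -/
theorem eq_of_conj {V : Type u₁} [Category.{v₁} V] {P Q P' Q' : V} {u : P ⟶ P'} [Epi u]
    {v : Q ⟶ Q'} {f : P ⟶ Q} {f' : P' ⟶ Q'} {i : Q ⟶ Q} {i' : Q' ⟶ Q'} {g : Q ⟶ P} {g' : Q' ⟶ P'}
    {b : P ⟶ P} {b' : P' ⟶ P'} (hf : u ≫ f' = f ≫ v) (hi : i ≫ v = v ≫ i')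
    (hg : v ≫ g' = g ≫ u) (h : f ≫ i ≫ g = b) (hb : b ≫ u = u ≫ b') : f' ≫ i' ≫ g' = b' := by
  rw [← cancel_epi u, ← hb, ← h, reassoc_of% hf, ← reassoc_of% hi, hg, Category.assoc,
    Category.assoc]

theorem FrobeniusAlgebra.Balanced.bmap {C : Type u₁} [Category.{v₁} C] [MonoidalCategory C]
    {D : Type u₂} [Category.{v₂} D] [MonoidalCategory D] {F : C ⥤ D} [F.LaxMonoidal]
    [F.OplaxMonoidal] (hF : IsFrobenius F) {A : FrobeniusAlgebra C} {X Y Z W : C}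
    {r : X ⊗ A.X ⟶ X} {l : A.X ⊗ Y ⟶ Y} {b : X ⊗ Y ⟶ Z ⊗ W} (h : A.Balanced r l b) :
    (hF.mapAlgebra A).Balanced (μ F X A.X ≫ F.map r) (μ F A.X Y ≫ F.map l) (bmap F b) := by
  have := (h.map hF).comp (δ F Z W)
  rwa [Category.assoc] at this

namespace OrbData

section Transport

variable {k : Type w} [Field k]
    {C : Type u₁} [Category.{v₁} C] [Preadditive C] [Linear k C] [MonoidalCategory C]
    [RightRigidCategory C] [PivotalCategory C] [BraidedCategory C] [HasCoequalizers C]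
    {D : Type u₂} [Category.{v₂} D] [Preadditive D] [Linear k D] [MonoidalCategory D]
    [RightRigidCategory D] [PivotalCategory D] [BraidedCategory D]
    (hC : IsRibbon C) (hD : IsRibbon D)
    {F : C ⥤ D} [F.LaxBraided] [F.OplaxMonoidal]
    (hF : IsRibbonFrobenius F) {𝔸 : OrbData k C} (h : 𝔸.IsOrbifoldDatum)
    {ψF : 𝟙_ D ⟶ F.obj 𝔸.A.X} {φF : k} (hcomp : IsCompatible hF.frobenius 𝔸 ψF φF)

open Leg FrobeniusAlgebra

namespace IsOrbifoldDatum

include h hcomp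

theorem transport_O2 :
    bmap F 𝔸.αbar ≫ (𝔸.transport hF.frobenius ψF φF).ins two ▷ F.obj 𝔸.T ≫ bmap F 𝔸.α =
      (hF.frobenius.mapAlgebra 𝔸.A).bridge (μ F 𝔸.T 𝔸.A.X ≫ F.map (𝔸.act one))
        (μ F 𝔸.A.X 𝔸.T ≫ F.map 𝔸.act₀) :=
  hcomp.stronglySeparable.splitsImage.inverse h.splits (M := h.bimod two) (N := h.bimod one)
    h.bar_cobalanced h.balanced h.O2

theorem transport_O3 :
    bmap F 𝔸.α ≫ (𝔸.transport hF.frobenius ψF φF).ins one ▷ F.obj 𝔸.T ≫ bmap F 𝔸.αbar =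
      (hF.frobenius.mapAlgebra 𝔸.A).bridge (μ F 𝔸.T 𝔸.A.X ≫ F.map (𝔸.act two))
        (μ F 𝔸.A.X 𝔸.T ≫ F.map 𝔸.act₀) :=
  hcomp.stronglySeparable.splitsImage.inverse h.splits (M := h.bimod one) (N := h.bimod one)
    h.cobalanced h.bar_balanced h.O3

include hC hD

/-- `α` turns `ρ₂` of its second factor into `ρ₂` of the first, so its bent version is cobalanced
over `ρ₂`; `ᾱ` does the reverse, so its bent version is balanced. The relation is merged over
`F(T*)` and then conjugated to `F(T)*`. -/
theorem transport_O4 :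
    (𝔸.transport hF.frobenius ψF φF).bendα ≫ (𝔸.transport hF.frobenius ψF φF).ins two ▷
        (F.obj 𝔸.T)ᘁ ≫ (𝔸.transport hF.frobenius ψF φF).bendαbar =
      (hF.frobenius.mapAlgebra 𝔸.A).bridge (μ F 𝔸.T 𝔸.A.X ≫ F.map (𝔸.act one))
        ((hF.frobenius.mapAlgebra 𝔸.A).dualL (μ F 𝔸.T 𝔸.A.X ≫ F.map (𝔸.act one))) := by
  have e1 := hF.bend hC hD one 𝔸.α
  have e2 := hF.bend hC hD two 𝔸.αbar
  have e3 : _ ≫ (𝔸.transport hF.frobenius ψF φF).ins two ▷ _ ≫ _ = _ :=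
    hcomp.stronglySeparable.splitsImage.inverse h.splits (M := h.bimod two)
    (N := dual (h.bimod two)) (bend_cobalanced h.symmetric h.exchOut)
    (bend_balanced (i := two) h.bar_exchIn) h.O4
  have e4 := bridge_conj_right (A := hF.frobenius.mapAlgebra 𝔸.A)
    (μ F 𝔸.T 𝔸.A.X ≫ F.map (𝔸.act one))
    (hF.frobenius.dualIso_dualL (hF.dualIso_ev' hC hD 𝔸.T) (𝔸.act one))
  exact eq_of_conj e1 (whisker_exchange _ _).symm e2 e3 e4

theorem transport_O5 :
    (𝔸.transport hF.frobenius ψF φF).bendαbar ≫ (𝔸.transport hF.frobenius ψF φF).ins one ▷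
        (F.obj 𝔸.T)ᘁ ≫ (𝔸.transport hF.frobenius ψF φF).bendα =
      (hF.frobenius.mapAlgebra 𝔸.A).bridge (μ F 𝔸.T 𝔸.A.X ≫ F.map (𝔸.act two))
        ((hF.frobenius.mapAlgebra 𝔸.A).dualL (μ F 𝔸.T 𝔸.A.X ≫ F.map (𝔸.act two))) := by
  have e1 := hF.bend hC hD one 𝔸.α
  have e2 := hF.bend hC hD two 𝔸.αbar
  have e3 : _ ≫ (𝔸.transport hF.frobenius ψF φF).ins one ▷ _ ≫ _ = _ :=
    hcomp.stronglySeparable.splitsImage.inverse h.splits (M := h.bimod one)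
    (N := dual (h.bimod one)) (bend_cobalanced h.symmetric h.bar_exchOut)
    (bend_balanced (i := one) h.exchIn) h.O5
  have e4 := bridge_conj_right (A := hF.frobenius.mapAlgebra 𝔸.A)
    (μ F 𝔸.T 𝔸.A.X ≫ F.map (𝔸.act two))
    (hF.frobenius.dualIso_dualL (hF.dualIso_ev' hC hD 𝔸.T) (𝔸.act two))
  exact eq_of_conj e2 (whisker_exchange _ _).symm e1 e3 e4

theorem transport_O6 :
    (𝔸.transport hF.frobenius ψF φF).rotα ≫ (F.obj 𝔸.T)ᘁ ◁
        (𝔸.transport hF.frobenius ψF φF).ins₀ ≫ (𝔸.transport hF.frobenius ψF φF).rotαbar =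
      (hF.frobenius.mapAlgebra 𝔸.A).bridge (μ F 𝔸.T 𝔸.A.X ≫ F.map (𝔸.act one))
        ((hF.frobenius.mapAlgebra 𝔸.A).dualL (μ F 𝔸.T 𝔸.A.X ≫ F.map (𝔸.act two))) := by
  have e1 := hF.rotL hC hD 𝔸.α
  have e2 := hF.frobenius.rotR 𝔸.αbar
  have e3 : _ ≫ _ ◁ (𝔸.transport hF.frobenius ψF φF).ins₀ ≫ _ = _ :=
    hcomp.stronglySeparable.splitsImage.inverse' h.splits (M := dual (h.bimod two))
    (N := h.bimod two) (rotL_cobalanced h.symmetric h.leftLinear)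
    (rotR_balanced h.bar_leftLinear) h.O6
  have e4 := bridge_conj_right (A := hF.frobenius.mapAlgebra 𝔸.A)
    (μ F 𝔸.T 𝔸.A.X ≫ F.map (𝔸.act one))
    (hF.frobenius.dualIso_dualL (hF.dualIso_ev' hC hD 𝔸.T) (𝔸.act two))
  exact eq_of_conj e1 (whisker_exchange _ _) e2 e3 e4

theorem transport_O7 :
    (𝔸.transport hF.frobenius ψF φF).rotαbar ≫ (𝔸.transport hF.frobenius ψF φF).ins one ▷
        (F.obj 𝔸.T)ᘁ ≫ (𝔸.transport hF.frobenius ψF φF).rotα =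
      (hF.frobenius.mapAlgebra 𝔸.A).bridge
        ((hF.frobenius.mapAlgebra 𝔸.A).dualR (μ F 𝔸.A.X 𝔸.T ≫ F.map 𝔸.act₀))
        (μ F 𝔸.A.X 𝔸.T ≫ F.map 𝔸.act₀) := by
  have e1 := hF.rotL hC hD 𝔸.α
  have e2 := hF.frobenius.rotR 𝔸.αbar
  have e3 : _ ≫ (𝔸.transport hF.frobenius ψF φF).ins one ▷ _ ≫ _ = _ :=
    hcomp.stronglySeparable.splitsImage.inverse h.splits (M := h.bimod one)
    (N := dual (h.bimod two)) (rotR_cobalanced h.symmetric h.bar_rightLinear)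
    (rotL_balanced h.rightLinear) h.O7
  have e4 := bridge_conj_left (A := hF.frobenius.mapAlgebra 𝔸.A)
    (μ F 𝔸.A.X 𝔸.T ≫ F.map 𝔸.act₀) (hF.frobenius.dualIso_dualR 𝔸.act₀)
  exact eq_of_conj e2 (whisker_exchange _ _).symm e1 e3 e4

omit hC hD hcomp [HasCoequalizers C] [Preadditive D] [RightRigidCategory D]
  [PivotalCategory D] [F.OplaxMonoidal] in
theorem transport_act_act :
    (μ F 𝔸.T 𝔸.A.X ≫ F.map (𝔸.act two)) ▷ F.obj 𝔸.A.X ≫ μ F 𝔸.T 𝔸.A.X ≫ F.map (𝔸.act one) =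
      𝟙 _ ⊗≫ F.obj 𝔸.T ◁ exch two (F.obj 𝔸.A.X) (F.obj 𝔸.A.X) ⊗≫
        (μ F 𝔸.T 𝔸.A.X ≫ F.map (𝔸.act one)) ▷ F.obj 𝔸.A.X ≫
        μ F 𝔸.T 𝔸.A.X ≫ F.map (𝔸.act two) := by
  have key (i j : Leg) : (μ F 𝔸.T 𝔸.A.X ≫ F.map (𝔸.act i)) ▷ F.obj 𝔸.A.X ≫ μ F 𝔸.T 𝔸.A.X ≫
      F.map (𝔸.act j) = (α_ _ _ _).hom ≫ F.obj 𝔸.T ◁ μ F 𝔸.A.X 𝔸.A.X ≫ μ F 𝔸.T (𝔸.A.X ⊗ 𝔸.A.X) ≫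
        F.map ((α_ _ _ _).inv ≫ 𝔸.act i ▷ 𝔸.A.X ≫ 𝔸.act j) := by
    rw [comp_whiskerRight, Category.assoc, μ_natural_left_assoc, F.map_comp, F.map_comp,
      ← Functor.LaxMonoidal.associativity_assoc, ← F.map_comp_assoc (α_ _ _ _).hom, Iso.hom_inv_id, F.map_id,
      Category.id_comp]
  have e : (α_ _ _ _).inv ≫ 𝔸.act two ▷ 𝔸.A.X ≫ 𝔸.act one = 𝔸.T ◁ exch two 𝔸.A.X 𝔸.A.X ≫
      (α_ _ _ _).inv ≫ 𝔸.act one ▷ 𝔸.A.X ≫ 𝔸.act two := by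
    rw [h.act_act]; monoidal
  rw [key, key, e, F.map_comp, ← μ_natural_right_assoc, ← whiskerLeft_comp_assoc, ← exch_μ]
  monoidal

theorem transport : (𝔸.transport hF.frobenius ψF φF).IsOrbifoldDatum where
  symmetric := h.symmetric.map hF.frobenius hD hC hF.twist_map
  isSection := hcomp.stronglySeparable.splitsImage.splits
  invertible := hcomp.invertible
  act₀_one := ((mapBimod F _).obj (h.bimod one)).one_actLeft
  act₀_mul := ((mapBimod F _).obj (h.bimod one)).left_assoc.trans (id_comp_eq_hom _).symm
  act_one i := ((mapBimod F _).obj (h.bimod i)).actRight_one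
  act_mul i := ((mapBimod F _).obj (h.bimod i)).right_assoc.trans (id_comp_eq_inv _).symm
  act₀_act i := ((mapBimod F _).obj (h.bimod i)).middle_assoc.trans (id_comp_eq_hom _).symm
  act_act := h.transport_act_act
  α_balanced := balanced_iff.1 (h.balanced.bmap hF.frobenius)
  α_cobalanced := cobalanced_iff.1 ((h.cobalanced.map hF.frobenius).comp _)
  α_act₀ := leftLinear_iff.1 (h.leftLinear.map hF.frobenius)
  α_act_first := exchIn_iff.1 (h.exchIn.map hF.frobenius)
  α_act_second := rightLinear_iff.1 (h.rightLinear.map hF.frobenius)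
  α_act_third := exchOut_iff.1 (h.exchOut.map hF.frobenius)
  αbar_balanced := balanced_iff.1 (h.bar_balanced.bmap hF.frobenius)
  αbar_cobalanced := cobalanced_iff.1 ((h.bar_cobalanced.map hF.frobenius).comp _)
  αbar_act₀ := leftLinear_iff.1 (h.bar_leftLinear.map hF.frobenius)
  αbar_act_first := exchOut_iff.1 (h.bar_exchOut.map hF.frobenius)
  αbar_act_second := rightLinear_iff.1 (h.bar_rightLinear.map hF.frobenius)
  αbar_act_third := exchIn_iff.1 (h.bar_exchIn.map hF.frobenius)
  O1 := h.transport_O1 hF hcomp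
  O2 := h.transport_O2 hF hcomp
  O3 := h.transport_O3 hF hcomp
  O4 := h.transport_O4 hC hD hF hcomp
  O5 := h.transport_O5 hC hD hF hcomp
  O6 := h.transport_O6 hC hD hF hcomp
  O7 := h.transport_O7 hC hD hF hcomp
  φ_ne_zero := hcomp.φ_ne_zero
  O8 := hcomp.loopCondition

end IsOrbifoldDatum

end Transport

end OrbData

-- Absorption of idempotents by pairs of boxes

section Absorption

variable {C : Type u₁} [Category.{v₁} C] [MonoidalCategory C] {A : FrobeniusAlgebra C}
  {M M' N N' : Bimod A.toMon A.toMon} {a : 𝟙_ C ⟶ A.X} {X Z P Q R W : C}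

open FrobeniusAlgebra

/-- Right-linearity slides the insertion and the bridge back through `f`, so that the idempotent now
follows `g` and disappears there. -/
theorem RightLinear.comp_idemL (ha : A.Splits a) {g : P ⊗ Q ⟶ M.X ⊗ N.X}
    (hg : A.Cobalanced M.actRight N.actLeft g) {f : X ⊗ M.X ⟶ Z ⊗ M'.X}
    (hf : RightLinear M.actRight M'.actRight f) :
    (X ◁ g ≫ (α_ _ _ _).inv ≫ f ▷ N.X ≫ (α_ _ _ _).hom) ≫ Z ◁ idemL a M' N =
      X ◁ g ≫ (α_ _ _ _).inv ≫ f ▷ N.X ≫ (α_ _ _ _).hom := by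
  have b1 := hf.bridge N.actLeft
  have b2 := hf.insR a
  have b3 := hg.comp_idemL ha
  rw [idemL] at b3 ⊢
  set x := A.insR a M.actRight
  set x' := A.insR a M'.actRight
  calc
    _ = X ◁ g ⊗≫ (f ≫ Z ◁ x') ▷ N.X ⊗≫ Z ◁ A.bridge M'.actRight N.actLeft := by monoidal
    _ = X ◁ (g ≫ x ▷ N.X) ⊗≫ ((α_ _ _ _).inv ≫ f ▷ N.X ≫ (α_ _ _ _).hom ≫
        Z ◁ A.bridge M'.actRight N.actLeft) := by
      rw [← b2]; monoidal
    _ = X ◁ (g ≫ x ▷ N.X ≫ A.bridge M.actRight N.actLeft) ≫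
        (α_ _ _ _).inv ≫ f ▷ N.X ≫ (α_ _ _ _).hom := by
      rw [← b1]; monoidal
    _ = _ := by rw [b3]

theorem LeftLinear.comp_idemL (ha : A.Splits a) {g : P ⊗ Q ⟶ M.X ⊗ N.X}
    (hg : A.Cobalanced M.actRight N.actLeft g) {f : N.X ⊗ R ⟶ N'.X ⊗ W}
    (hf : LeftLinear N.actLeft N'.actLeft f) :
    ((α_ _ _ _).inv ≫ g ▷ R ≫ (α_ _ _ _).hom ≫ M.X ◁ f) ≫ (α_ _ _ _).inv ≫ idemL a M N' ▷ W ≫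
      (α_ _ _ _).hom = (α_ _ _ _).inv ≫ g ▷ R ≫ (α_ _ _ _).hom ≫ M.X ◁ f := by
  have b1 := hf.bridge M.actRight
  have b3 := hg.comp_idemL ha
  rw [idemL] at b3 ⊢
  set x := A.insR a M.actRight
  calc
    _ = 𝟙 _ ⊗≫ g ▷ R ⊗≫ (M.X ◁ f ≫ x ▷ (N'.X ⊗ W)) ⊗≫
        A.bridge M.actRight N'.actLeft ▷ W ⊗≫ 𝟙 _ := by monoidal
    _ = 𝟙 _ ⊗≫ g ▷ R ⊗≫ x ▷ N.X ▷ R ⊗≫ ((α_ _ _ _).hom ≫ M.X ◁ f ≫ (α_ _ _ _).inv ≫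
        A.bridge M.actRight N'.actLeft ▷ W) ⊗≫ 𝟙 _ := by rw [whisker_exchange]; monoidal
    _ = 𝟙 _ ⊗≫ (g ≫ x ▷ N.X ≫ A.bridge M.actRight N.actLeft) ▷ R ⊗≫ M.X ◁ f ⊗≫ 𝟙 _ := by
      rw [← b1]; monoidal
    _ = _ := by rw [b3]; monoidal

end Absorption

-- Transport of the crossings

namespace PreObj.IsCrossing

section Base

variable {k : Type w} {C : Type u₁} [Category.{v₁} C] [MonoidalCategory C] [RightRigidCategory C]
  [PivotalCategory C] [BraidedCategory C] {𝔸 : OrbData k C} {J : Set Leg} {M : PreObj 𝔸 J}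
  (h : M.IsCrossing) (i : J)

include h

theorem balanced : 𝔸.A.Balanced M.M.actRight 𝔸.act₀ (M.τ i) :=
  FrobeniusAlgebra.balanced_iff.2 (h.τ_balanced i)

theorem cobalanced : 𝔸.A.Cobalanced (𝔸.act i) M.M.actLeft (M.τ i) :=
  FrobeniusAlgebra.cobalanced_iff.2 (h.τ_cobalanced i)

theorem leftLinear : LeftLinear M.M.actLeft 𝔸.act₀ (M.τ i) := leftLinear_iff.2 (h.τ_left i)

theorem rightLinear : RightLinear (𝔸.act i) M.M.actRight (M.τ i) :=
  rightLinear_iff.2 (h.τ_right i)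

theorem exchOut : ExchOut i (𝔸.act (Leg.other i)) (𝔸.act (Leg.other i)) (M.τ i) :=
  exchOut_iff.2 (h.τ_right_other i)

theorem bar_balanced : 𝔸.A.Balanced (𝔸.act i) M.M.actLeft (M.τbar i) :=
  FrobeniusAlgebra.balanced_iff.2 (h.τbar_balanced i)

theorem bar_cobalanced : 𝔸.A.Cobalanced M.M.actRight 𝔸.act₀ (M.τbar i) :=
  FrobeniusAlgebra.cobalanced_iff.2 (h.τbar_cobalanced i)

theorem bar_leftLinear : LeftLinear 𝔸.act₀ M.M.actLeft (M.τbar i) :=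
  leftLinear_iff.2 (h.τbar_left i)

theorem bar_rightLinear : RightLinear M.M.actRight (𝔸.act i) (M.τbar i) :=
  rightLinear_iff.2 (h.τbar_right i)

theorem bar_exchIn : ExchIn i (𝔸.act (Leg.other i)) (𝔸.act (Leg.other i)) (M.τbar i) :=
  exchIn_iff.2 (h.τbar_right_other i)

end Base

section Transport

variable {k : Type w} [Field k]
    {C : Type u₁} [Category.{v₁} C] [Preadditive C] [Linear k C] [MonoidalCategory C]
    [RightRigidCategory C] [PivotalCategory C] [BraidedCategory C] [HasCoequalizers C]
    {D : Type u₂} [Category.{v₂} D] [Preadditive D] [Linear k D] [MonoidalCategory D]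
    [RightRigidCategory D] [PivotalCategory D] [BraidedCategory D]
    (hC : IsRibbon C) (hD : IsRibbon D)
    {F : C ⥤ D} [F.LaxBraided] [F.OplaxMonoidal]
    (hF : IsRibbonFrobenius F) {𝔸 : OrbData k C} (h : 𝔸.IsOrbifoldDatum)
    {ψF : 𝟙_ D ⟶ F.obj 𝔸.A.X} {φF : k} (hcomp : IsCompatible hF.frobenius 𝔸 ψF φF)
    {J : Set Leg} {M : PreObj 𝔸 J} (hM : M.IsCrossing)

open Leg FrobeniusAlgebra

include h hcomp hM

/-- The second crossing takes one strand from each of the two boxes before it. Label `one` is forced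
on the first crossing: `α` takes values in `T ⊗₁ T`, and `τ₁` is linear for precisely that action,
so the composite absorbs the idempotent on `M ⊗ T`. -/
theorem transport_comp_τ (i j : J) (hi : i.1 = one) :
    F.obj M.M.X ◁ bmap F 𝔸.α ⊗≫ bmap F (M.τ i) ▷ F.obj 𝔸.T ⊗≫
      F.obj 𝔸.T ◁ (hF.frobenius.mapAlgebra 𝔸.A).insR ((hF.frobenius.mapAlgebra 𝔸.A).sq ψF)
        (μ F M.M.X 𝔸.A.X ≫ F.map M.M.actRight) ▷ F.obj 𝔸.T ⊗≫ F.obj 𝔸.T ◁ bmap F (M.τ j) =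
    tmap F (M.M.X ◁ 𝔸.α ⊗≫ M.τ i ▷ 𝔸.T ⊗≫ 𝔸.T ◁ M.insR ▷ 𝔸.T ⊗≫ 𝔸.T ◁ M.τ j) := by
  have hr := hM.rightLinear i
  rw [hi] at hr
  set d : F.obj M.M.X ⟶ F.obj M.M.X := (hF.frobenius.mapAlgebra 𝔸.A).insR
    ((hF.frobenius.mapAlgebra 𝔸.A).sq ψF) (μ F M.M.X 𝔸.A.X ≫ F.map M.M.actRight) with hd
  calc
    _ = (F.obj M.M.X ◁ bmap F 𝔸.α ≫ (α_ _ _ _).inv ≫ bmap F (M.τ i) ▷ F.obj 𝔸.T ≫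
        (α_ _ _ _).hom) ≫ F.obj 𝔸.T ◁ (d ▷ F.obj 𝔸.T ≫ bmap F (M.τ j)) := by monoidal
    _ = tmap F ((M.M.X ◁ 𝔸.α ≫ (α_ _ _ _).inv ≫ M.τ i ▷ 𝔸.T ≫ (α_ _ _ _).hom) ≫
        𝔸.T ◁ (M.insR ▷ 𝔸.T ≫ M.τ j)) := by
      rw [hF.frobenius.whiskerLeft_bmap_bmap]
      exact hcomp.stronglySeparable.splitsImage.tmap_whiskerLeft (M := M.M) (N := h.bimod one)
        (RightLinear.comp_idemL (M := h.bimod one) (N := h.bimod one) (M' := M.M) h.splits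
          h.cobalanced hr)
        ((hM.balanced j).idemR_comp (M := M.M) (N := h.bimod one) h.splits)
    _ = _ := by congr 1; monoidal

/-- Here label `two` matches the source `T ⊗₂ T` of `α`: the first crossing lands in `T ⊗₂ M`, and
left-linearity of the second carries the idempotent over to `T ⊗₂ T`. -/
theorem transport_τ_comp (i j : J) (hi : i.1 = two) :
    𝟙 _ ⊗≫ bmap F (M.τ i) ▷ F.obj 𝔸.T ⊗≫ F.obj 𝔸.T ◁ bmap F (M.τ j) ⊗≫
      (hF.frobenius.mapAlgebra 𝔸.A).insR ((hF.frobenius.mapAlgebra 𝔸.A).sq ψF)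
        (μ F 𝔸.T 𝔸.A.X ≫ F.map (𝔸.act two)) ▷ F.obj 𝔸.T ▷ F.obj M.M.X ⊗≫
        bmap F 𝔸.α ▷ F.obj M.M.X ⊗≫ 𝟙 _ =
    tmap F (𝟙 (M.M.X ⊗ 𝔸.T ⊗ 𝔸.T) ⊗≫ M.τ i ▷ 𝔸.T ⊗≫ 𝔸.T ◁ M.τ j ⊗≫ 𝔸.ins two ▷ 𝔸.T ▷ M.M.X ⊗≫
        𝔸.α ▷ M.M.X ⊗≫ 𝟙 (𝔸.T ⊗ 𝔸.T ⊗ M.M.X)) := by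
  have hr := hM.cobalanced i
  rw [hi] at hr
  set d : F.obj 𝔸.T ⟶ F.obj 𝔸.T := (hF.frobenius.mapAlgebra 𝔸.A).insR
    ((hF.frobenius.mapAlgebra 𝔸.A).sq ψF) (μ F 𝔸.T 𝔸.A.X ≫ F.map (𝔸.act two)) with hd
  calc
    _ = ((α_ _ _ _).inv ≫ bmap F (M.τ i) ▷ F.obj 𝔸.T ≫ (α_ _ _ _).hom ≫
        F.obj 𝔸.T ◁ bmap F (M.τ j)) ≫ (α_ _ _ _).inv ≫
        (d ▷ F.obj 𝔸.T ≫ bmap F 𝔸.α) ▷ F.obj M.M.X ≫ (α_ _ _ _).hom := by monoidal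
    _ = tmap F (((α_ _ _ _).inv ≫ M.τ i ▷ 𝔸.T ≫ (α_ _ _ _).hom ≫ 𝔸.T ◁ M.τ j) ≫
        (α_ _ _ _).inv ≫ (𝔸.ins two ▷ 𝔸.T ≫ 𝔸.α) ▷ M.M.X ≫ (α_ _ _ _).hom) := by
      rw [hF.frobenius.bmap_whiskerLeft_bmap]
      exact hcomp.stronglySeparable.splitsImage.tmap_whiskerRight (M := h.bimod two)
        (N := h.bimod two)
        (LeftLinear.comp_idemL (M := h.bimod two) (N := M.M) (N' := h.bimod two) h.splits
          hr (hM.leftLinear j))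
        (h.balanced.idemR_comp (M := h.bimod two) (N := h.bimod two) h.splits)
    _ = _ := by congr 1; monoidal

theorem transport_T4 (i : J) :
    bmap F (M.τbar i) ≫ ((PreObj.transport 𝔸 J hF.frobenius ψF φF).obj M).insR ▷ F.obj 𝔸.T ≫
        bmap F (M.τ i) =
      (hF.frobenius.mapAlgebra 𝔸.A).bridge (μ F 𝔸.T 𝔸.A.X ≫ F.map (𝔸.act i))
        (μ F 𝔸.A.X M.M.X ≫ F.map M.M.actLeft) :=
  hcomp.stronglySeparable.splitsImage.inverse h.splits (M := M.M) (N := h.bimod one)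
    (hM.bar_cobalanced i) (hM.balanced i) (hM.T4 i)

theorem transport_T5 (i : J) :
    bmap F (M.τ i) ≫ (𝔸.transport hF.frobenius ψF φF).ins i ▷ F.obj M.M.X ≫
        bmap F (M.τbar i) =
      (hF.frobenius.mapAlgebra 𝔸.A).bridge (μ F M.M.X 𝔸.A.X ≫ F.map M.M.actRight)
        (μ F 𝔸.A.X 𝔸.T ≫ F.map 𝔸.act₀) :=
  hcomp.stronglySeparable.splitsImage.inverse h.splits (M := h.bimod i) (N := M.M)
    (hM.cobalanced i) (hM.bar_balanced i) (hM.T5 i)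

include hC hD

theorem transport_T6 (i : J) :
    ((PreObj.transport 𝔸 J hF.frobenius ψF φF).obj M).dualτ i ≫
        (𝔸.transport hF.frobenius ψF φF).ins i ▷ (F.obj M.M.X)ᘁ ≫
        ((PreObj.transport 𝔸 J hF.frobenius ψF φF).obj M).dualτbar i =
      (hF.frobenius.mapAlgebra 𝔸.A).bridge
        ((hF.frobenius.mapAlgebra 𝔸.A).dualR (μ F 𝔸.A.X M.M.X ≫ F.map M.M.actLeft))
        (μ F 𝔸.A.X 𝔸.T ≫ F.map 𝔸.act₀) := by
  have e1 := hF.rotL hC hD (M.τ i)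
  have e2 := hF.frobenius.rotR (M.τbar i)
  have e3 : _ ≫ (𝔸.transport hF.frobenius ψF φF).ins i ▷ _ ≫ _ = _ :=
    hcomp.stronglySeparable.splitsImage.inverse h.splits (M := h.bimod i)
    (N := dual M.M) (rotR_cobalanced h.symmetric (hM.bar_rightLinear i))
    (rotL_balanced (hM.rightLinear i)) (hM.T6 i)
  have e4 := bridge_conj_left (A := hF.frobenius.mapAlgebra 𝔸.A)
    (μ F 𝔸.A.X 𝔸.T ≫ F.map 𝔸.act₀) (hF.frobenius.dualIso_dualR M.M.actLeft)
  have := eq_of_conj e2 (whisker_exchange _ _).symm e1 e3 e4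
  exact this

theorem transport_T7 (i : J) :
    ((PreObj.transport 𝔸 J hF.frobenius ψF φF).obj M).dualτbar i ≫ (F.obj M.M.X)ᘁ ◁
        (𝔸.transport hF.frobenius ψF φF).ins₀ ≫
        ((PreObj.transport 𝔸 J hF.frobenius ψF φF).obj M).dualτ i =
      (hF.frobenius.mapAlgebra 𝔸.A).bridge (μ F 𝔸.T 𝔸.A.X ≫ F.map (𝔸.act i))
        ((hF.frobenius.mapAlgebra 𝔸.A).dualL (μ F M.M.X 𝔸.A.X ≫ F.map M.M.actRight)) := by
  have e1 := hF.rotL hC hD (M.τ i)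
  have e2 := hF.frobenius.rotR (M.τbar i)
  have e3 : _ ≫ _ ◁ (𝔸.transport hF.frobenius ψF φF).ins₀ ≫ _ = _ :=
    hcomp.stronglySeparable.splitsImage.inverse' h.splits (M := dual M.M)
    (N := h.bimod i) (rotL_cobalanced h.symmetric (hM.leftLinear i))
    (rotR_balanced (hM.bar_leftLinear i)) (hM.T7 i)
  have e4 := bridge_conj_right (A := hF.frobenius.mapAlgebra 𝔸.A)
    (μ F 𝔸.T 𝔸.A.X ≫ F.map (𝔸.act i))
    (hF.frobenius.dualIso_dualL (hF.dualIso_ev' hC hD M.M.X) M.M.actRight)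
  have := eq_of_conj e1 (whisker_exchange _ _) e2 e3 e4
  exact this

omit hC hD in
theorem transport_T1 (h₁ : one ∈ J) :
    F.obj M.M.X ◁ bmap F 𝔸.α ⊗≫ bmap F (M.τ ⟨one, h₁⟩) ▷ F.obj 𝔸.T ⊗≫
      F.obj 𝔸.T ◁ (hF.frobenius.mapAlgebra 𝔸.A).insR ((hF.frobenius.mapAlgebra 𝔸.A).sq ψF)
        (μ F M.M.X 𝔸.A.X ≫ F.map M.M.actRight) ▷ F.obj 𝔸.T ⊗≫
      F.obj 𝔸.T ◁ bmap F (M.τ ⟨one, h₁⟩) =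
      𝟙 _ ⊗≫ bmap F (M.τ ⟨one, h₁⟩) ▷ F.obj 𝔸.T ⊗≫
        F.obj 𝔸.T ◁ exch one (F.obj M.M.X) (F.obj 𝔸.T) ⊗≫ bmap F 𝔸.α ▷ F.obj M.M.X ⊗≫ 𝟙 _ := by
  rw [transport_comp_τ hF h hcomp hM _ _ rfl, hM.T1 h₁]
  have := hF.frobenius.bmap_exch_bmap one (M.τ ⟨one, h₁⟩) 𝔸.α
  calc
    _ = tmap F ((α_ _ _ _).inv ≫ M.τ ⟨one, h₁⟩ ▷ 𝔸.T ≫ (α_ _ _ _).hom ≫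
        𝔸.T ◁ exch one M.M.X 𝔸.T ≫ (α_ _ _ _).inv ≫ 𝔸.α ▷ M.M.X ≫ (α_ _ _ _).hom) := by
      congr 1; monoidal
    _ = _ := by rw [← this]; monoidal

omit hC hD in
theorem transport_T2 (h₁ : one ∈ J) (h₂ : two ∈ J) :
    F.obj M.M.X ◁ bmap F 𝔸.α ⊗≫ bmap F (M.τ ⟨one, h₁⟩) ▷ F.obj 𝔸.T ⊗≫
      F.obj 𝔸.T ◁ (hF.frobenius.mapAlgebra 𝔸.A).insR ((hF.frobenius.mapAlgebra 𝔸.A).sq ψF)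
        (μ F M.M.X 𝔸.A.X ≫ F.map M.M.actRight) ▷ F.obj 𝔸.T ⊗≫
      F.obj 𝔸.T ◁ bmap F (M.τ ⟨two, h₂⟩) =
      𝟙 _ ⊗≫ bmap F (M.τ ⟨two, h₂⟩) ▷ F.obj 𝔸.T ⊗≫ F.obj 𝔸.T ◁ bmap F (M.τ ⟨one, h₁⟩) ⊗≫
      (hF.frobenius.mapAlgebra 𝔸.A).insR ((hF.frobenius.mapAlgebra 𝔸.A).sq ψF)
        (μ F 𝔸.T 𝔸.A.X ≫ F.map (𝔸.act two)) ▷ F.obj 𝔸.T ▷ F.obj M.M.X ⊗≫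
        bmap F 𝔸.α ▷ F.obj M.M.X ⊗≫ 𝟙 _ := by
  rw [transport_comp_τ hF h hcomp hM _ _ rfl, transport_τ_comp hF h hcomp hM _ _ rfl, hM.T2 h₁ h₂]

/-- The left side ends with a braiding behind the last `δ`; this is where oplax compatibility with
the braiding is needed. -/
theorem transport_T3 (h₂ : two ∈ J) :
    F.obj M.M.X ◁ bmap F 𝔸.α ⊗≫ bmap F (M.τ ⟨two, h₂⟩) ▷ F.obj 𝔸.T ⊗≫
      F.obj 𝔸.T ◁ exch two (F.obj M.M.X) (F.obj 𝔸.T) =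
      𝟙 _ ⊗≫ bmap F (M.τ ⟨two, h₂⟩) ▷ F.obj 𝔸.T ⊗≫ F.obj 𝔸.T ◁ bmap F (M.τ ⟨two, h₂⟩) ⊗≫
      (hF.frobenius.mapAlgebra 𝔸.A).insR ((hF.frobenius.mapAlgebra 𝔸.A).sq ψF)
        (μ F 𝔸.T 𝔸.A.X ≫ F.map (𝔸.act two)) ▷ F.obj 𝔸.T ▷ F.obj M.M.X ⊗≫
        bmap F 𝔸.α ▷ F.obj M.M.X ⊗≫ 𝟙 _ := by
  rw [transport_τ_comp hF h hcomp hM _ _ rfl, ← hM.T3 h₂]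
  calc
    _ = (F.obj M.M.X ◁ bmap F 𝔸.α ≫ (α_ _ _ _).inv ≫ bmap F (M.τ ⟨two, h₂⟩) ▷ F.obj 𝔸.T ≫
      (α_ _ _ _).hom) ≫ F.obj 𝔸.T ◁ exch two (F.obj M.M.X) (F.obj 𝔸.T) := by monoidal
    _ = tmap F ((M.M.X ◁ 𝔸.α ≫ (α_ _ _ _).inv ≫ M.τ ⟨two, h₂⟩ ▷ 𝔸.T ≫
      (α_ _ _ _).hom) ≫ 𝔸.T ◁ exch two M.M.X 𝔸.T) := by
      rw [hF.frobenius.whiskerLeft_bmap_bmap,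
        (hF.frobenius.oplaxBraided (hF.dualIso_ev' hC hD)).tmap_exch]
    _ = _ := by congr 1; monoidal

theorem transport : ((PreObj.transport 𝔸 J hF.frobenius ψF φF).obj M).IsCrossing where
  τ_balanced i := balanced_iff.1 ((hM.balanced i).bmap hF.frobenius)
  τ_cobalanced i := cobalanced_iff.1 (((hM.cobalanced i).map hF.frobenius).comp _)
  τ_left i := leftLinear_iff.1 ((hM.leftLinear i).map hF.frobenius)
  τ_right i := rightLinear_iff.1 ((hM.rightLinear i).map hF.frobenius)
  τ_right_other i := exchOut_iff.1 ((hM.exchOut i).map hF.frobenius)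
  τbar_balanced i := balanced_iff.1 ((hM.bar_balanced i).bmap hF.frobenius)
  τbar_cobalanced i := cobalanced_iff.1 (((hM.bar_cobalanced i).map hF.frobenius).comp _)
  τbar_left i := leftLinear_iff.1 ((hM.bar_leftLinear i).map hF.frobenius)
  τbar_right i := rightLinear_iff.1 ((hM.bar_rightLinear i).map hF.frobenius)
  τbar_right_other i := exchIn_iff.1 ((hM.bar_exchIn i).map hF.frobenius)
  T1 h₁ := transport_T1 hF h hcomp hM h₁
  T2 h₁ h₂ := transport_T2 hF h hcomp hM h₁ h₂
  T3 h₂ := transport_T3 hC hD hF h hcomp hM h₂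
  T4 i := transport_T4 hF h hcomp hM i
  T5 i := transport_T5 hF h hcomp hM i
  T6 i := transport_T6 hC hD hF h hcomp hM i
  T7 i := transport_T7 hC hD hF h hcomp hM i

end Transport

end PreObj.IsCrossing

-- Relative tensor products through their projections

section RelTensor

variable {C : Type u₁} [Category.{v₁} C] [MonoidalCategory C] [RightRigidCategory C]
  [PivotalCategory C] [HasCoequalizers C]

section

variable {A : Mon C} (M N L : Bimod A A)

theorem whiskerLeft_relProj_actLeft : A.X ◁ relProj M N ≫ (M ⊗ N).actLeft =
    (α_ _ _ _).inv ≫ M.actLeft ▷ N.X ≫ relProj M N :=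
  Bimod.TensorBimod.whiskerLeft_π_actLeft M N

theorem relProj_whiskerRight_actRight : relProj M N ▷ A.X ≫ (M ⊗ N).actRight =
    (α_ _ _ _).hom ≫ M.X ◁ N.actRight ≫ relProj M N :=
  Bimod.TensorBimod.π_tensor_id_actRight M N

theorem relProj_condition :
    M.actRight ▷ N.X ≫ relProj M N = (α_ _ _ _).hom ≫ M.X ◁ N.actLeft ≫ relProj M N :=
  (coequalizer.condition _ _).trans (Category.assoc _ _ _)

instance : Epi (relProj M N) :=
  inferInstanceAs (Epi (coequalizer.π _ _))

instance (X : C) : Epi (X ◁ relProj M N) :=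
  inferInstanceAs (Epi ((tensorLeft X).map (coequalizer.π _ _)))

instance epi_relProj_whiskerRight (X : C) : Epi (relProj M N ▷ X) :=
  inferInstanceAs (Epi ((tensorRight X).map (coequalizer.π _ _)))

variable {M N}

/-- The morphism out of `M ⊗_A N` induced by a balanced morphism. -/
noncomputable def relDesc {X : C} (b : M.X ⊗ N.X ⟶ X)
    (hb : M.actRight ▷ N.X ≫ b = (α_ _ _ _).hom ≫ M.X ◁ N.actLeft ≫ b) : (M ⊗ N).X ⟶ X :=
  coequalizer.desc b (hb.trans (Category.assoc _ _ _).symm)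

theorem relProj_relDesc {X : C} (b : M.X ⊗ N.X ⟶ X)
    (hb : M.actRight ▷ N.X ≫ b = (α_ _ _ _).hom ≫ M.X ◁ N.actLeft ≫ b) :
    relProj M N ≫ relDesc b hb = b :=
  coequalizer.π_desc _ _

theorem relProj_whiskerLeft {N' : Bimod A A} (f : N ⟶ N') :
    relProj M N ≫ (M ◁ f).hom = M.X ◁ f.hom ≫ relProj M N' :=
  (ι_colimMap _ _)

theorem relProj_whiskerRight {M' : Bimod A A} (f : M ⟶ M') :
    relProj M N ≫ (f ▷ N).hom = f.hom ▷ N.X ≫ relProj M' N :=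
  (ι_colimMap _ _)

variable (M N)

theorem relProj_associator : relProj M N ▷ L.X ≫ relProj (M ⊗ N) L ≫ (α_ M N L).hom.hom =
    (α_ _ _ _).hom ≫ M.X ◁ relProj N L ≫ relProj M (N ⊗ L) := by
  have e : relProj (M ⊗ N) L ≫ (α_ M N L).hom.hom = Bimod.AssociatorBimod.homAux M N L :=
    coequalizer.π_desc _ _
  rw [e]
  exact π_tensor_id_preserves_coequalizer_inv_desc _ _ _ _

theorem relProj_leftUnitor : relProj (𝟙_ (Bimod A A)) M ≫ (λ_ M).hom.hom = M.actLeft :=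
  coequalizer.π_desc _ _

theorem relProj_rightUnitor : relProj M (𝟙_ (Bimod A A)) ≫ (ρ_ M).hom.hom = M.actRight :=
  coequalizer.π_desc _ _

end

section Hom

variable {A : Mon C} {P Q R S : Bimod A A}

theorem relProj_hom_ext {f g : P ⊗ Q ⟶ R} (h : relProj P Q ≫ f.hom = relProj P Q ≫ g.hom) :
    f = g :=
  Bimod.hom_ext _ _ ((cancel_epi _).1 h)

theorem relProj_relProj_hom_ext {f g : (P ⊗ Q) ⊗ R ⟶ S}
    (h : relProj P Q ▷ R.X ≫ relProj (P ⊗ Q) R ≫ f.hom =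
      relProj P Q ▷ R.X ≫ relProj (P ⊗ Q) R ≫ g.hom) : f = g :=
  relProj_hom_ext ((cancel_epi _).1 h)

/-- The isomorphism out of `P ⊗_A Q` induced by a balanced bimodule morphism `m` which has an
inverse relative to `A`. -/
noncomputable def relIso (m : P.X ⊗ Q.X ⟶ R.X)
    (hb : P.actRight ▷ Q.X ≫ m = (α_ _ _ _).hom ≫ P.X ◁ Q.actLeft ≫ m)
    (hl : A.X ◁ m ≫ R.actLeft = (α_ _ _ _).inv ≫ P.actLeft ▷ Q.X ≫ m)
    (hr : m ▷ A.X ≫ R.actRight = (α_ _ _ _).hom ≫ P.X ◁ Q.actRight ≫ m)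
    (g : R.X ⟶ P.X ⊗ Q.X) (h₁ : m ≫ g ≫ relProj P Q = relProj P Q) (h₂ : g ≫ m = 𝟙 R.X) :
    P ⊗ Q ≅ R :=
  Bimod.isoOfIso (P := P ⊗ Q) (Q := R)
    { hom := relDesc m hb
      inv := g ≫ relProj P Q
      hom_inv_id := by
        rw [← cancel_epi (relProj P Q), ← Category.assoc, relProj_relDesc, h₁, Category.comp_id]
      inv_hom_id := by rw [Category.assoc, relProj_relDesc, h₂] }
    (by
      rw [← cancel_epi (A.X ◁ relProj P Q), reassoc_of% (whiskerLeft_relProj_actLeft P Q)]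
      change (α_ _ _ _).inv ≫ P.actLeft ▷ Q.X ≫ relProj P Q ≫ relDesc m hb =
        A.X ◁ relProj P Q ≫ A.X ◁ relDesc m hb ≫ R.actLeft
      rw [relProj_relDesc, ← whiskerLeft_comp_assoc, relProj_relDesc, hl])
    (by
      rw [← cancel_epi (relProj P Q ▷ A.X), reassoc_of% (relProj_whiskerRight_actRight P Q)]
      change (α_ _ _ _).hom ≫ P.X ◁ Q.actRight ≫ relProj P Q ≫ relDesc m hb =
        relProj P Q ▷ A.X ≫ relDesc m hb ▷ A.X ≫ R.actRight
      rw [relProj_relDesc, ← comp_whiskerRight_assoc, relProj_relDesc, hr])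

theorem relProj_relIso (m : P.X ⊗ Q.X ⟶ R.X)
    (hb : P.actRight ▷ Q.X ≫ m = (α_ _ _ _).hom ≫ P.X ◁ Q.actLeft ≫ m)
    (hl : A.X ◁ m ≫ R.actLeft = (α_ _ _ _).inv ≫ P.actLeft ▷ Q.X ≫ m)
    (hr : m ▷ A.X ≫ R.actRight = (α_ _ _ _).hom ≫ P.X ◁ Q.actRight ≫ m)
    (g : R.X ⟶ P.X ⊗ Q.X) (h₁ : m ≫ g ≫ relProj P Q = relProj P Q) (h₂ : g ≫ m = 𝟙 R.X) :
    relProj P Q ≫ (relIso m hb hl hr g h₁ h₂).hom.hom = m :=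
  relProj_relDesc m hb

theorem relProj_comp_left {U V : Bimod A A} {f : P ⊗ Q ⟶ S} {g : S ⊗ R ⟶ U}
    {m : P.X ⊗ Q.X ⟶ S.X} {n : S.X ⊗ R.X ⟶ U.X} (hm : relProj P Q ≫ f.hom = m)
    (hn : relProj S R ≫ g.hom = n) (t : U ⟶ V) :
    relProj P Q ▷ R.X ≫ relProj (P ⊗ Q) R ≫ (f ▷ R ≫ g ≫ t).hom = m ▷ R.X ≫ n ≫ t.hom := by
  subst hm hn
  rw [Bimod.comp_hom', Bimod.comp_hom', reassoc_of% (relProj_whiskerRight (N := R) f),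
    comp_whiskerRight_assoc, Category.assoc]

theorem relProj_comp_right {U : Bimod A A} {f : Q ⊗ R ⟶ S} {g : P ⊗ S ⟶ U}
    {m : Q.X ⊗ R.X ⟶ S.X} {n : P.X ⊗ S.X ⟶ U.X} (hm : relProj Q R ≫ f.hom = m)
    (hn : relProj P S ≫ g.hom = n) :
    relProj P Q ▷ R.X ≫ relProj (P ⊗ Q) R ≫ ((α_ P Q R).hom ≫ P ◁ f ≫ g).hom =
      (α_ _ _ _).hom ≫ P.X ◁ m ≫ n := by
  subst hm hn
  rw [Bimod.comp_hom', Bimod.comp_hom', reassoc_of% (relProj_associator P Q R),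
    reassoc_of% (relProj_whiskerLeft (M := P) f), MonoidalCategory.whiskerLeft_comp_assoc]

end Hom

variable {A : FrobeniusAlgebra C} (M N : Bimod A.toMon A.toMon)

theorem relProj_incl : relProj M N ≫ A.incl M N = A.bridge M.actRight N.actLeft :=
  coequalizer.π_desc _ _

end RelTensor

-- The strong monoidal structure on bimodules

section Monoidal

variable {C : Type u₁} [Category.{v₁} C] [MonoidalCategory C] [RightRigidCategory C]
  [PivotalCategory C] [HasCoequalizers C] {D : Type u₂} [Category.{v₂} D] [MonoidalCategory D]
  [RightRigidCategory D] [PivotalCategory D] [HasCoequalizers D] {F : C ⥤ D}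
  [F.LaxMonoidal] [F.OplaxMonoidal] {hF : IsFrobenius F} {A : FrobeniusAlgebra C}
  {ψ' : 𝟙_ D ⟶ F.obj A.X} (h : IsStronglySeparable hF A ψ')

/-- The isomorphism of bimodules `F(M) ⊗_{F(A)} F(N) ≅ F(M ⊗_A N)`. -/
noncomputable def IsStronglySeparable.μIso (M N : Bimod A.toMon A.toMon) :
    (mapBimod F A.toMon).obj M ⊗ (mapBimod F A.toMon).obj N ≅ (mapBimod F A.toMon).obj (M ⊗ N) :=
  relIso (P := (mapBimod F A.toMon).obj M) (Q := (mapBimod F A.toMon).obj N)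
    (R := (mapBimod F A.toMon).obj (M ⊗ N)) (μ F M.X N.X ≫ F.map (relProj M N))
    (by
      change (μ F M.X A.X ≫ F.map M.actRight) ▷ F.obj N.X ≫ μ F M.X N.X ≫ F.map (relProj M N) =
        (α_ _ _ _).hom ≫ F.obj M.X ◁ (μ F A.X N.X ≫ F.map N.actLeft) ≫ μ F M.X N.X ≫
          F.map (relProj M N)
      rw [comp_whiskerRight, Category.assoc, μ_natural_left_assoc, ← F.map_comp, relProj_condition,
        F.map_comp, F.map_comp, MonoidalCategory.whiskerLeft_comp, Category.assoc,
        μ_natural_right_assoc, Functor.LaxMonoidal.associativity_assoc])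
    (by
      change F.obj A.X ◁ (μ F M.X N.X ≫ F.map (relProj M N)) ≫ μ F A.X (M ⊗ N).X ≫
        F.map (M ⊗ N).actLeft = (α_ _ _ _).inv ≫ (μ F A.X M.X ≫ F.map M.actLeft) ▷ F.obj N.X ≫
          μ F M.X N.X ≫ F.map (relProj M N)
      have e' := whiskerLeft_relProj_actLeft M N
      rw [comp_whiskerRight, Category.assoc, μ_natural_left_assoc,
        MonoidalCategory.whiskerLeft_comp, Category.assoc, μ_natural_right_assoc, ← F.map_comp,
        ← F.map_comp, e', F.map_comp, Functor.LaxMonoidal.associativity_inv_assoc])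
    (by
      change (μ F M.X N.X ≫ F.map (relProj M N)) ▷ F.obj A.X ≫ μ F (M ⊗ N).X A.X ≫
        F.map (M ⊗ N).actRight = (α_ _ _ _).hom ≫
          F.obj M.X ◁ (μ F N.X A.X ≫ F.map N.actRight) ≫ μ F M.X N.X ≫ F.map (relProj M N)
      have e' := relProj_whiskerRight_actRight M N
      rw [comp_whiskerRight, Category.assoc, μ_natural_left_assoc,
        MonoidalCategory.whiskerLeft_comp, Category.assoc, μ_natural_right_assoc, ← F.map_comp,
        ← F.map_comp, e', F.map_comp, Functor.LaxMonoidal.associativity_assoc])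
    -- A representative of the inverse before projection. Composed with the multiplication it is the
    -- identity by strong separability itself; in the other order it is the bridge over `F(A)`
    -- followed by an insertion, which the projection absorbs because it is balanced.
    (F.map (A.incl M N) ≫ δ F M.X N.X ≫
      (hF.mapAlgebra A).insR ((hF.mapAlgebra A).sq ψ') ((mapBimod F A.toMon).obj M).actRight ▷
          F.obj N.X)
    (by
      have e := FrobeniusAlgebra.Balanced.bridge_insR h.splitsImage.splits
        (relProj_condition ((mapBimod F A.toMon).obj M) ((mapBimod F A.toMon).obj N))
      refine Eq.trans ?_ e
      have e2 := hF.bridge_eq (A := A) M.actRight N.actLeft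
      refine Eq.trans ?_ (congrArg (fun t => t ≫ _) e2.symm)
      rw [bmap, ← relProj_incl, F.map_comp]
      have gen {Z : D} (p : F.obj M.X ⊗ F.obj N.X ⟶ Z) (d : F.obj M.X ⟶ F.obj M.X) :
          (μ F M.X N.X ≫ F.map (relProj M N)) ≫ (F.map (A.incl M N) ≫ δ F M.X N.X ≫
            d ▷ F.obj N.X) ≫ p = (μ F M.X N.X ≫ (F.map (relProj M N) ≫ F.map (A.incl M N)) ≫
              δ F M.X N.X) ≫ d ▷ F.obj N.X ≫ p := by simp
      exact gen _ _)
    (by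
      have gen {Z : D} (p : F.obj M.X ⊗ F.obj N.X ⟶ Z) (d : F.obj M.X ⟶ F.obj M.X) :
          (F.map (A.incl M N) ≫ δ F M.X N.X ≫ d ▷ F.obj N.X) ≫ p =
            F.map (A.incl M N) ≫ δ F M.X N.X ≫ d ▷ F.obj N.X ≫ p := by simp
      exact (gen _ _).trans (h M N))

theorem IsStronglySeparable.relProj_μIso (M N : Bimod A.toMon A.toMon) :
    relProj ((mapBimod F A.toMon).obj M) ((mapBimod F A.toMon).obj N) ≫ (h.μIso M N).hom.hom =
      μ F M.X N.X ≫ F.map (relProj M N) :=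
  relProj_relIso (P := (mapBimod F A.toMon).obj M) (Q := (mapBimod F A.toMon).obj N) _ _ _ _ _ _ _

/-- The strong monoidal structure on the functor induced on bimodules. -/
@[reducible]
noncomputable def IsStronglySeparable.coreMonoidal : (mapBimod F A.toMon).CoreMonoidal where
  εIso := Iso.refl (𝟙_ (Bimod (F.mapMon.obj A.toMon) (F.mapMon.obj A.toMon)))
  μIso := h.μIso
  μIso_hom_natural_left {M M'} f N := by
    refine relProj_hom_ext ?_
    have e1 := relProj_whiskerRight (N := (mapBimod F A.toMon).obj N) ((mapBimod F A.toMon).map f)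
    refine ((reassoc_of% e1) _).trans ?_
    refine Eq.trans ?_ ((reassoc_of% (h.relProj_μIso M N)) _).symm
    rw [h.relProj_μIso]
    change F.map f.hom ▷ F.obj N.X ≫ μ F M'.X N.X ≫ F.map (relProj M' N) = (μ F M.X N.X ≫
      F.map (relProj M N)) ≫ F.map (f ▷ N).hom
    rw [Category.assoc, ← F.map_comp, relProj_whiskerRight, F.map_comp, μ_natural_left_assoc]
  μIso_hom_natural_right {N N'} M f := by
    refine relProj_hom_ext ?_
    have e1 := relProj_whiskerLeft (M := (mapBimod F A.toMon).obj M) ((mapBimod F A.toMon).map f)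
    refine ((reassoc_of% e1) _).trans ?_
    refine Eq.trans ?_ ((reassoc_of% (h.relProj_μIso M N)) _).symm
    rw [h.relProj_μIso]
    change F.obj M.X ◁ F.map f.hom ≫ μ F M.X N'.X ≫ F.map (relProj M N') = (μ F M.X N.X ≫
      F.map (relProj M N)) ≫ F.map (M ◁ f).hom
    rw [Category.assoc, ← F.map_comp, relProj_whiskerLeft, F.map_comp, μ_natural_right_assoc]
  associativity M N L := by
    refine relProj_relProj_hom_ext ?_
    refine (relProj_comp_left (h.relProj_μIso M N) (h.relProj_μIso (M ⊗ N) L) _).trans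
      (Eq.trans ?_ (relProj_comp_right (h.relProj_μIso N L) (h.relProj_μIso M (N ⊗ L))).symm)
    change (μ F M.X N.X ≫ F.map (relProj M N)) ▷ F.obj L.X ≫ (μ F (M ⊗ N).X L.X ≫
      F.map (relProj (M ⊗ N) L)) ≫ F.map (α_ M N L).hom.hom = (α_ _ _ _).hom ≫
        F.obj M.X ◁ (μ F N.X L.X ≫ F.map (relProj N L)) ≫ μ F M.X (N ⊗ L).X ≫
          F.map (relProj M (N ⊗ L))
    rw [comp_whiskerRight, Category.assoc, Category.assoc, μ_natural_left_assoc, ← F.map_comp,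
      ← F.map_comp, relProj_associator, MonoidalCategory.whiskerLeft_comp, Category.assoc,
      μ_natural_right_assoc, F.map_comp, F.map_comp, Functor.LaxMonoidal.associativity_assoc]
  left_unitality M := by
    refine relProj_hom_ext ((relProj_leftUnitor _).trans ?_)
    have e1 := relProj_whiskerRight (N := (mapBimod F A.toMon).obj M)
      (𝟙 (𝟙_ (Bimod (F.mapMon.obj A.toMon) (F.mapMon.obj A.toMon))))
    have e2 := h.relProj_μIso (𝟙_ _) M
    have e3 := relProj_leftUnitor M
    refine Eq.trans ?_ ((reassoc_of% e1) _).symm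
    refine Eq.trans ?_ (congrArg (fun t => _ ≫ t) ((reassoc_of% e2) (F.map (λ_ M).hom.hom)).symm)
    have gen {X Y Z W : C} (q : X ⊗ Y ⟶ Z) (t : Z ⟶ W) (l : X ⊗ Y ⟶ W) (hq : q ≫ t = l) :
        μ F X Y ≫ F.map l = 𝟙 (F.obj X) ▷ F.obj Y ≫ (μ F X Y ≫ F.map q) ≫ F.map t := by
      rw [← hq]; simp
    exact gen _ _ _ e3
  right_unitality M := by
    refine relProj_hom_ext ((relProj_rightUnitor _).trans ?_)
    have e1 := relProj_whiskerLeft (M := (mapBimod F A.toMon).obj M)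
      (𝟙 (𝟙_ (Bimod (F.mapMon.obj A.toMon) (F.mapMon.obj A.toMon))))
    have e2 := h.relProj_μIso M (𝟙_ _)
    have e3 := relProj_rightUnitor M
    refine Eq.trans ?_ ((reassoc_of% e1) _).symm
    refine Eq.trans ?_ (congrArg (fun t => _ ≫ t) ((reassoc_of% e2) (F.map (ρ_ M).hom.hom)).symm)
    have gen {X Y Z W : C} (q : X ⊗ Y ⟶ Z) (t : Z ⟶ W) (l : X ⊗ Y ⟶ W) (hq : q ≫ t = l) :
        μ F X Y ≫ F.map l = F.obj X ◁ 𝟙 (F.obj Y) ≫ (μ F X Y ≫ F.map q) ≫ F.map t := by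
      rw [← hq]; simp
    exact gen _ _ _ e3

end Monoidal

/-- A variant for a final morphism, such as a projection, that does not end in a tensor product, so
that no `δ` follows it. -/
theorem SplitsImage.tmap_map {C : Type u₁} [Category.{v₁} C] [MonoidalCategory C]
    {D : Type u₂} [Category.{v₂} D] [MonoidalCategory D] {F : C ⥤ D} [F.LaxMonoidal]
    [F.OplaxMonoidal] {hF : IsFrobenius F} {A : FrobeniusAlgebra C} {a' : 𝟙_ D ⟶ F.obj A.X}
    (h : SplitsImage F hF A a') {a : 𝟙_ C ⟶ A.X} {M N : Bimod A.toMon A.toMon}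
    {X Y Z X' V : C} {f : X ⊗ Y ⊗ Z ⟶ X' ⊗ M.X ⊗ N.X} {g : M.X ⊗ N.X ⟶ V}
    (hf : f ≫ X' ◁ FrobeniusAlgebra.idemL a M N = f)
    (hg : FrobeniusAlgebra.idemR a M N ≫ g = g) :
    tmap F f ≫ F.obj X' ◁ ((hF.mapAlgebra A).insR a' (μ F M.X A.X ≫ F.map M.actRight) ▷ F.obj N.X ≫
      μ F M.X N.X ≫ F.map g) =
    F.obj X ◁ μ F Y Z ≫ μ F X (Y ⊗ Z) ≫ F.map (f ≫ X' ◁ (A.insR a M.actRight ▷ N.X ≫ g)) ≫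
      δ F X' V := by
  have e := congrArg (fun k => F.obj X' ◁ k) (h.map_idemL_idemR (a := a) (M := M) (N := N))
  simp only [midIns, Category.assoc, MonoidalCategory.whiskerLeft_comp] at e
  conv_lhs => rw [← hf, ← hg]
  simp only [tmap, F.map_comp, Category.assoc, MonoidalCategory.whiskerLeft_comp]
  rw [← δ_natural_right_assoc, reassoc_of% e]
  simp only [δ_natural_right, δ_natural_right_assoc]
  simp only [← F.map_comp_assoc, ← MonoidalCategory.whiskerLeft_comp, Category.assoc]
  conv_rhs => rw [← hf]
  simp only [Category.assoc, MonoidalCategory.whiskerLeft_comp, F.map_comp]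

theorem whiskerRight_comm_of_epi {V : Type u₁} [Category.{v₁} V] [MonoidalCategory V]
    {P Q R S T : V} {r : P ⊗ Q ⟶ R} {u : R ⟶ S} {m : P ⊗ Q ⟶ S} (hr : Epi (r ▷ T))
    {t : R ⊗ T ⟶ T ⊗ R} {t' : S ⊗ T ⟶ T ⊗ S} {x : P ⊗ Q ⊗ T ⟶ T ⊗ P ⊗ Q} {d : P ⟶ P}
    (ht : r ▷ T ≫ t = (α_ _ _ _).hom ≫ x ≫ T ◁ (d ▷ Q ≫ r)) (hu : r ≫ u = m)
    (ht' : m ▷ T ≫ t' = (α_ _ _ _).hom ≫ x ≫ T ◁ (d ▷ Q ≫ m)) :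
    u ▷ T ≫ t' = t ≫ T ◁ u := by
  rw [← cancel_epi (r ▷ T), ← comp_whiskerRight_assoc, hu, ht', reassoc_of% ht, ← hu]
  simp only [MonoidalCategory.whiskerLeft_comp, Category.assoc]

-- Crossings on tensor products and on the unit

namespace PreObj

section Iso

variable {k : Type w} {C : Type u₁} [Category.{v₁} C] [MonoidalCategory C] {𝔸 : OrbData k C}
  {J : Set Leg}

/-- An isomorphism of bimodules which commutes with the crossings is an isomorphism. -/
def isoMk {M N : PreObj 𝔸 J} (e : M.M ≅ N.M)
    (h : ∀ i, e.hom.hom ▷ 𝔸.T ≫ N.τ i = M.τ i ≫ 𝔸.T ◁ e.hom.hom) : M ≅ N where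
  hom := { hom := e.hom, comm := h }
  inv :=
    { hom := e.inv
      comm := fun i => by
        have e1 : e.inv.hom ≫ e.hom.hom = 𝟙 _ := congrArg Bimod.Hom.hom e.inv_hom_id
        have e2 : e.hom.hom ≫ e.inv.hom = 𝟙 _ := congrArg Bimod.Hom.hom e.hom_inv_id
        calc
          _ = e.inv.hom ▷ 𝔸.T ≫ (M.τ i ≫ 𝔸.T ◁ e.hom.hom) ≫ 𝔸.T ◁ e.inv.hom := by
            rw [Category.assoc, ← MonoidalCategory.whiskerLeft_comp, e2,
              MonoidalCategory.whiskerLeft_id, Category.comp_id]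
          _ = (e.inv.hom ≫ e.hom.hom) ▷ 𝔸.T ≫ N.τ i ≫ 𝔸.T ◁ e.inv.hom := by
            rw [← h, comp_whiskerRight]; simp only [Category.assoc]
          _ = _ := by rw [e1, id_whiskerRight, Category.id_comp] }
  hom_inv_id := Hom.ext e.hom_inv_id
  inv_hom_id := Hom.ext e.inv_hom_id

end Iso

namespace IsCrossing

variable {k : Type w} [Field k] {C : Type u₁} [Category.{v₁} C] [Preadditive C] [Linear k C]
  [MonoidalCategory C] [RightRigidCategory C] [PivotalCategory C] [BraidedCategory C]
  [HasCoequalizers C] {𝔸 : OrbData k C} (h : 𝔸.IsOrbifoldDatum) {J : Set Leg} {M N : PreObj 𝔸 J}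
  (hM : M.IsCrossing) (hN : N.IsCrossing)

open FrobeniusAlgebra

include h hM hN

omit [HasCoequalizers C] in
theorem comp_idemL (i : J) :
    (M.M.X ◁ N.τ i ≫ (α_ _ _ _).inv ≫ M.τ i ▷ N.M.X ≫ (α_ _ _ _).hom) ≫
      𝔸.T ◁ idemL (𝔸.A.sq 𝔸.ψ) M.M N.M =
    M.M.X ◁ N.τ i ≫ (α_ _ _ _).inv ≫ M.τ i ▷ N.M.X ≫ (α_ _ _ _).hom :=
  RightLinear.comp_idemL (M := h.bimod i) h.splits (hN.cobalanced i) (hM.rightLinear i)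

/-- Precomposition with the projection makes a bridge of the inclusion. Left-linearity of the
crossing of `N` carries the bridge over to `M ⊗ T`, where it meets the insertion and the resulting
idempotent is absorbed by the crossing of `M`. -/
theorem relProj_tensor_τ (i : J) : relProj M.M N.M ▷ 𝔸.T ≫ (M.tensor N).τ i =
    (α_ _ _ _).hom ≫ (M.M.X ◁ N.τ i ≫ (α_ _ _ _).inv ≫ M.τ i ▷ N.M.X ≫ (α_ _ _ _).hom) ≫
      𝔸.T ◁ (M.insR ▷ N.M.X ≫ relProj M.M N.M) := by
  have e1 := relProj_incl M.M N.M
  have e2 := (hN.leftLinear i).bridge M.M.actRight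
  have e3 := (hM.balanced i).idemR_comp (M := M.M) (N := h.bimod i) h.splits
  rw [idemR] at e3
  calc
    _ = ((relProj M.M N.M ≫ 𝔸.A.incl M.M N.M) ≫ M.insR ▷ N.M.X) ▷ 𝔸.T ⊗≫ M.M.X ◁ N.τ i ⊗≫
        M.τ i ▷ N.M.X ⊗≫ 𝔸.T ◁ (M.insR ▷ N.M.X ≫ relProj M.M N.M) := by
      dsimp only [tensor]; monoidal
    _ = 𝔸.A.bridge M.M.actRight N.M.actLeft ▷ 𝔸.T ⊗≫
        (M.insR ▷ (N.M.X ⊗ 𝔸.T) ≫ M.M.X ◁ N.τ i) ⊗≫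
        M.τ i ▷ N.M.X ⊗≫ 𝔸.T ◁ (M.insR ▷ N.M.X ≫ relProj M.M N.M) := by
      rw [e1]; monoidal
    _ = 𝟙 _ ⊗≫ (𝔸.A.bridge M.M.actRight N.M.actLeft ▷ 𝔸.T ≫ (α_ _ _ _).hom ≫ M.M.X ◁ N.τ i ≫
        (α_ _ _ _).inv) ⊗≫ (M.insR ▷ 𝔸.T ≫ M.τ i) ▷ N.M.X ⊗≫
        𝔸.T ◁ (M.insR ▷ N.M.X ≫ relProj M.M N.M) := by
      rw [← whisker_exchange]; monoidal
    _ = 𝟙 _ ⊗≫ M.M.X ◁ N.τ i ⊗≫ ((𝔸.A.bridge M.M.actRight 𝔸.act₀ ≫ M.insR ▷ 𝔸.T) ≫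
        M.τ i) ▷ N.M.X ⊗≫ 𝔸.T ◁ (M.insR ▷ N.M.X ≫ relProj M.M N.M) := by
      rw [e2]; monoidal
    _ = _ := by
      dsimp only [insR]
      rw [e3]; monoidal

end IsCrossing

section Transport

variable {k : Type w} [Field k]
    {C : Type u₁} [Category.{v₁} C] [Preadditive C] [Linear k C] [MonoidalCategory C]
    [RightRigidCategory C] [PivotalCategory C] [BraidedCategory C] [HasCoequalizers C]
    {D : Type u₂} [Category.{v₂} D] [Preadditive D] [Linear k D] [MonoidalCategory D]
    [RightRigidCategory D] [PivotalCategory D] [BraidedCategory D] [HasCoequalizers D]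
    (hC : IsRibbon C) (hD : IsRibbon D)
    {F : C ⥤ D} [F.LaxBraided] [F.OplaxMonoidal]
    (hF : IsRibbonFrobenius F) {𝔸 : OrbData k C} (h : 𝔸.IsOrbifoldDatum)
    {ψF : 𝟙_ D ⟶ F.obj 𝔸.A.X} {φF : k} (hcomp : IsCompatible hF.frobenius 𝔸 ψF φF)
    {J : Set Leg} {M N : PreObj 𝔸 J} (hM : M.IsCrossing) (hN : N.IsCrossing)

open FrobeniusAlgebra

include hC hD h hcomp hM hN

/-- It suffices to test on the projection. There both tensor crossings have the simple form of
`relProj_tensor_τ`: the two crossings merge along one strand, and `SplitsImage.tmap_map` merges the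
final projection. -/
theorem μIso_τ (i : J) :
    (hcomp.stronglySeparable.μIso M.M N.M).hom.hom ▷ F.obj 𝔸.T ≫
      bmap F ((M.tensor N).τ i) =
    (((PreObj.transport 𝔸 J hF.frobenius ψF φF).obj M).tensor
      ((PreObj.transport 𝔸 J hF.frobenius ψF φF).obj N)).τ i ≫
      F.obj 𝔸.T ◁ (hcomp.stronglySeparable.μIso M.M N.M).hom.hom := by
  have e1 := IsCrossing.relProj_tensor_τ h hM hN i
  have e2 := IsCrossing.relProj_tensor_τ (h.transport hC hD hF hcomp)
    (hM.transport hC hD hF h hcomp) (hN.transport hC hD hF h hcomp) i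
  have e3 := hcomp.stronglySeparable.relProj_μIso M.M N.M
  refine whiskerRight_comm_of_epi (epi_relProj_whiskerRight _ _ _) e2 e3 ?_
  have e4 := hF.frobenius.whiskerLeft_bmap_bmap (N.τ i) (M.τ i)
  have e5 := hcomp.stronglySeparable.splitsImage.tmap_map (IsCrossing.comp_idemL h hM hN i)
    (g := relProj M.M N.M)
    (Balanced.idemR_comp (M := M.M) (N := N.M) h.splits (relProj_condition M.M N.M))
  refine Eq.trans ?_ (congrArg (fun t => (α_ _ _ _).hom ≫ t)
    (Eq.trans e5.symm (congrArg (fun t => t ≫ _) e4.symm)))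
  have gen {X Y Q T : C} {q : X ⊗ Y ⟶ Q} {t : Q ⊗ T ⟶ T ⊗ Q} {x : X ⊗ Y ⊗ T ⟶ T ⊗ Q}
      (e : q ▷ T ≫ t = (α_ _ _ _).hom ≫ x) : (μ F X Y ≫ F.map q) ▷ F.obj T ≫ bmap F t =
        (α_ _ _ _).hom ≫ F.obj X ◁ μ F Y T ≫ μ F X (Y ⊗ T) ≫ F.map x ≫ δ F T Q := by
    rw [bmap, comp_whiskerRight, Category.assoc, μ_natural_left_assoc, ← F.map_comp_assoc, e,
      F.map_comp, Category.assoc, Functor.LaxMonoidal.associativity_assoc]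
  exact gen e1

/-- The isomorphism `F(M) ⊗ F(N) ≅ F(M ⊗ N)` of bimodules with crossings. -/
noncomputable def tensorIso :
    ((PreObj.transport 𝔸 J hF.frobenius ψF φF).obj M).tensor
      ((PreObj.transport 𝔸 J hF.frobenius ψF φF).obj N) ≅
    (PreObj.transport 𝔸 J hF.frobenius ψF φF).obj (M.tensor N) :=
  isoMk (hcomp.stronglySeparable.μIso M.M N.M) (μIso_τ hC hD hF h hcomp hM hN)

omit hC hD h hcomp hM hN in
/-- The isomorphism between the tensor unit and its image. -/
noncomputable def unitIso (ψF : 𝟙_ D ⟶ F.obj 𝔸.A.X) (φF : k) :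
    PreObj.unit (𝔸.transport hF.frobenius ψF φF) J ≅
      (PreObj.transport 𝔸 J hF.frobenius ψF φF).obj (PreObj.unit 𝔸 J) :=
  isoMk (Iso.refl (𝟙_ (Bimod (F.mapMon.obj 𝔸.A.toMon) (F.mapMon.obj 𝔸.A.toMon)))) fun i => by
    have e := hF.frobenius.coactR_eq 𝔸.A (𝔸.act i)
    have gen {X : D} (f : X ⊗ F.obj 𝔸.T ⟶ F.obj 𝔸.T ⊗ X) :
        𝟙 X ▷ F.obj 𝔸.T ≫ f = f ≫ F.obj 𝔸.T ◁ 𝟙 X := by simp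
    refine Eq.trans (gen _) (congrArg (fun t => t ≫ F.obj 𝔸.T ◁ 𝟙 (F.obj 𝔸.A.X)) ?_)
    refine Eq.trans ?_ (congrArg (fun t => (μ F 𝔸.A.X 𝔸.T ≫ F.map 𝔸.act₀) ≫ t) e.symm)
    change μ F 𝔸.A.X 𝔸.T ≫ F.map (𝔸.act₀ ≫ 𝔸.coact i) ≫ δ F 𝔸.T 𝔸.A.X = _
    rw [F.map_comp]
    simp only [Category.assoc]
    rfl

end Transport

end PreObj

-- Compatibility with duals of bimodules

section Duality

variable {k : Type w}
    {C : Type u₁} [Category.{v₁} C] [MonoidalCategory C]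
    [RightRigidCategory C] [PivotalCategory C] [BraidedCategory C]
    {D : Type u₂} [Category.{v₂} D] [MonoidalCategory D]
    [RightRigidCategory D] [PivotalCategory D] [BraidedCategory D]
    (hC : IsRibbon C) (hD : IsRibbon D)
    {F : C ⥤ D} [F.LaxBraided] [F.OplaxMonoidal]
    (hF : IsRibbonFrobenius F)

include hC hD in
-- The dual crossing is a rotation by the first duality, so `IsFrobenius.rotR` covers it. The ribbon
-- hypotheses enter through the second evaluation, in the left dual action and in `ev'`.
theorem IsRibbonFrobenius.isDualityIso {𝔸 : OrbData k C}
    (ψF : 𝟙_ D ⟶ F.obj 𝔸.A.X) (φF : k) {J : Set Leg} (M : PreObj 𝔸 J) :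
    IsDualityIso hF.frobenius ψF φF M (hF.frobenius.dualIso M.M.X) where
  left := hF.frobenius.dualIso_dualL (hF.dualIso_ev' hC hD M.M.X) M.M.actRight
  right := hF.frobenius.dualIso_dualR M.M.actLeft
  crossing i := (hF.frobenius.rotR (M.τbar i)).symm
  ev := by
    have e1 := hF.frobenius.mapPairing_left (ev M.M.X) (𝔸.A.coactR M.M.actRight)
    have e2 := hF.frobenius.coactR_eq 𝔸.A M.M.actRight
    have e3 := hF.frobenius.dualIso_ev M.M.X
    have gen {X X' Y B : D} (u : X' ⟶ X) (g : Y ⟶ Y ⊗ B) (p : X ⊗ Y ⟶ 𝟙_ D) :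
        u ▷ Y ≫ (X ◁ g ⊗≫ p ▷ B ⊗≫ 𝟙 B) =
          X' ◁ g ≫ (α_ _ _ _).inv ≫ (u ▷ Y ≫ p) ▷ B ≫ (λ_ _).hom := by
      calc
        _ = (u ▷ Y ≫ X ◁ g) ⊗≫ p ▷ B ⊗≫ 𝟙 B := by monoidal
        _ = _ := by rw [← whisker_exchange]; monoidal
    refine (gen _ _ _).trans ?_
    refine Eq.trans ?_ (e1.trans (congrArg (fun t => μ F _ _ ≫ F.map t) ?_))
    · rw [← e3]
      exact congrArg (fun t => F.obj (M.M.Xᘁ : C) ◁ t ≫ _) e2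
    · rw [FrobeniusAlgebra.relEv]; monoidal
  ev' := by
    have e1 := hF.frobenius.mapPairing_right (ev' M.M.X) (𝔸.A.coactL M.M.actLeft)
    have e2 := hF.frobenius.coactL_eq 𝔸.A M.M.actLeft
    have e3 := hF.dualIso_ev' hC hD M.M.X
    have gen {X X' Y B : D} (u : X' ⟶ X) (g : Y ⟶ B ⊗ Y) (p : Y ⊗ X ⟶ 𝟙_ D) :
        Y ◁ u ≫ (g ▷ X ⊗≫ B ◁ p ⊗≫ 𝟙 B) =
          g ▷ X' ≫ (α_ _ _ _).hom ≫ B ◁ (Y ◁ u ≫ p) ≫ (ρ_ _).hom := by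
      calc
        _ = (Y ◁ u ≫ g ▷ X) ⊗≫ B ◁ p ⊗≫ 𝟙 B := by monoidal
        _ = _ := by rw [whisker_exchange]; monoidal
    refine (gen _ _ _).trans ?_
    refine Eq.trans ?_ (e1.trans (congrArg (fun t => μ F _ _ ≫ F.map t) ?_))
    · rw [← e3]
      exact congrArg (fun t => t ▷ F.obj (M.M.Xᘁ : C) ≫ _) e2
    · rw [FrobeniusAlgebra.relEv']; monoidal

end Duality

-- Faithfulness and fullness

open Functor.LaxMonoidal Functor.OplaxMonoidal FrobeniusAlgebra

attribute [local instance] Abelian.hasFiniteBiproducts in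
-- A nonzero `z` has a nonzero component in some simple summand. By Schur's lemma this component is
-- an isomorphism, hence so is its image; if `F z` vanished, that image would vanish and `F(𝟙)`
-- would be zero.
theorem eq_zero_of_map_unit_eq_zero {k : Type w} [Field k]
    {C : Type u₁} [Category.{v₁} C] [Abelian C] [Linear k C] [MonoidalCategory C]
    [MonoidalPreadditive C] [MonoidalLinear k C] [RightRigidCategory C] [PivotalCategory C]
    [BraidedCategory C] (hC : IsModularFusion k C) {D : Type u₂} [Category.{v₂} D] [Abelian D]
    (F : C ⥤ D) [F.Additive] (h1 : ¬ IsZero (F.obj (𝟙_ C))) {Z : C} {z : 𝟙_ C ⟶ Z}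
    (hz : F.map z = 0) : z = 0 := by
  by_contra hne
  obtain ⟨n, S, hS, ⟨e⟩⟩ := hC.semisimple.semisimple Z
  have := hC.simple_unit
  obtain ⟨i, hi⟩ : ∃ i, (z ≫ e.hom) ≫ biproduct.π S i ≠ 0 := by
    by_contra! hc
    refine hne ?_
    have : z ≫ e.hom = 0 := biproduct.hom_ext _ _ fun i => by rw [hc i, zero_comp]
    rwa [← cancel_mono e.hom, zero_comp]
  have := hS i
  have := isIso_of_hom_simple hi
  have hF : IsIso (F.map ((z ≫ e.hom) ≫ biproduct.π S i)) := inferInstance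
  have h0 : F.map ((z ≫ e.hom) ≫ biproduct.π S i) = 0 := by
    rw [F.map_comp, F.map_comp, hz, zero_comp, zero_comp]
  refine h1 ((IsZero.iff_id_eq_zero _).2 ?_)
  rw [← cancel_mono (F.map ((z ≫ e.hom) ≫ biproduct.π S i)), h0, comp_zero, comp_zero]

theorem FrobeniusAlgebra.whiskerRight_bridge {C : Type u₁} [Category.{v₁} C] [MonoidalCategory C]
    {A : FrobeniusAlgebra C} {X Y Z : C} {r : X ⊗ A.X ⟶ X} {r' : Y ⊗ A.X ⟶ Y} {f : X ⟶ Y}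
    (hf : r ≫ f = f ▷ A.X ≫ r') (l : A.X ⊗ Z ⟶ Z) :
    f ▷ Z ≫ A.bridge r' l = A.bridge r l ≫ f ▷ Z := by
  rw [bridge_eq_coactL, bridge_eq_coactL, ← whisker_exchange_assoc]
  calc
    _ = X ◁ A.coactL l ≫ (α_ _ _ _).inv ≫ (f ▷ A.X ≫ r') ▷ Z := by monoidal
    _ = _ := by rw [← hf]; monoidal

section Sub

variable {C : Type u₁} [Category.{v₁} C] [Preadditive C] [MonoidalCategory C]
  [MonoidalPreadditive C]

theorem sub_whiskerRight {X Y : C} (f g : X ⟶ Y) (Z : C) : (f - g) ▷ Z = f ▷ Z - g ▷ Z :=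
  (tensorRight Z).map_sub

variable {P X Y Z W : C}

theorem RightLinear.sub {r : Y ⊗ P ⟶ Y} {r' : W ⊗ P ⟶ W} {f g : X ⊗ Y ⟶ Z ⊗ W}
    (hf : RightLinear r r' f) (hg : RightLinear r r' g) : RightLinear r r' (f - g) := by
  rw [RightLinear, Preadditive.comp_sub, hf, hg, sub_whiskerRight]
  simp only [Preadditive.sub_comp, Preadditive.comp_sub]

variable {A : FrobeniusAlgebra C}

omit [MonoidalPreadditive C] in
theorem FrobeniusAlgebra.Balanced.sub {r : X ⊗ A.X ⟶ X} {l : A.X ⊗ Y ⟶ Y} {f g : X ⊗ Y ⟶ W}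
    (hf : A.Balanced r l f) (hg : A.Balanced r l g) : A.Balanced r l (f - g) := by
  rw [Balanced, Preadditive.comp_sub, hf, hg]
  simp only [Preadditive.comp_sub]

omit [MonoidalPreadditive C] in
theorem FrobeniusAlgebra.Cobalanced.sub {r : X ⊗ A.X ⟶ X} {l : A.X ⊗ Y ⟶ Y} {f g : W ⟶ X ⊗ Y}
    (hf : A.Cobalanced r l f) (hg : A.Cobalanced r l g) : A.Cobalanced r l (f - g) := by
  rw [Cobalanced, Preadditive.sub_comp, hf, hg, Preadditive.sub_comp]

end Sub

theorem FrobeniusAlgebra.Balanced.whiskerRight {C : Type u₁} [Category.{v₁} C] [MonoidalCategory C]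
    {A : FrobeniusAlgebra C} {X X' Y Z : C} {r : X ⊗ A.X ⟶ X} {r' : X' ⊗ A.X ⟶ X'}
    {l : A.X ⊗ Y ⟶ Y} {b : X' ⊗ Y ⟶ Z} (hb : A.Balanced r' l b) {f : X ⟶ X'}
    (hf : r ≫ f = f ▷ A.X ≫ r') : A.Balanced r l (f ▷ Y ≫ b) := by
  have e : r' ▷ Y ≫ b = (α_ _ _ _).hom ≫ X' ◁ l ≫ b := hb
  change r ▷ Y ≫ f ▷ Y ≫ b = (α_ _ _ _).hom ≫ X ◁ l ≫ f ▷ Y ≫ b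
  calc
    _ = f ▷ A.X ▷ Y ≫ (r' ▷ Y ≫ b) := by rw [← comp_whiskerRight_assoc, hf]; monoidal
    _ = (α_ _ _ _).hom ≫ (f ▷ (A.X ⊗ Y) ≫ X' ◁ l) ≫ b := by rw [e]; monoidal
    _ = _ := by rw [← whisker_exchange]; monoidal

theorem FrobeniusAlgebra.Cobalanced.whiskerLeft {C : Type u₁} [Category.{v₁} C] [MonoidalCategory C]
    {A : FrobeniusAlgebra C} {X Y Y' Z : C} {r : X ⊗ A.X ⟶ X} {l : A.X ⊗ Y ⟶ Y}
    {l' : A.X ⊗ Y' ⟶ Y'} {g : Z ⟶ X ⊗ Y} (hg : A.Cobalanced r l g) {f : Y ⟶ Y'}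
    (hf : l ≫ f = A.X ◁ f ≫ l') : A.Cobalanced r l' (g ≫ X ◁ f) := by
  have e : g ≫ A.coactR r ▷ Y ≫ (α_ _ _ _).hom = g ≫ X ◁ A.coactL l := hg
  have e2 : A.coactL l ≫ A.X ◁ f = f ≫ A.coactL l' := by
    rw [coactL, coactL]
    calc
      _ = 𝟙 _ ⊗≫ A.copairing ▷ Y ⊗≫ A.X ◁ (l ≫ f) := by monoidal
      _ = 𝟙 _ ⊗≫ (A.copairing ▷ Y ≫ (A.X ⊗ A.X) ◁ f) ⊗≫ A.X ◁ l' := by rw [hf]; monoidal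
      _ = _ := by rw [← whisker_exchange]; monoidal
  change (g ≫ X ◁ f) ≫ A.coactR r ▷ Y' ≫ (α_ _ _ _).hom = (g ≫ X ◁ f) ≫ X ◁ A.coactL l'
  calc
    _ = g ≫ (X ◁ f ≫ A.coactR r ▷ Y') ≫ (α_ _ _ _).hom := by monoidal
    _ = (g ≫ A.coactR r ▷ Y ≫ (α_ _ _ _).hom) ≫ X ◁ A.X ◁ f := by
      rw [whisker_exchange]; monoidal
    _ = g ≫ X ◁ (A.coactL l ≫ A.X ◁ f) := by rw [e]; monoidal
    _ = _ := by rw [e2]; monoidal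

section Faithful

variable {k : Type w} [Field k]
    {C : Type u₁} [Category.{v₁} C] [Abelian C] [Linear k C] [MonoidalCategory C]
    [MonoidalPreadditive C] [MonoidalLinear k C] [RightRigidCategory C] [PivotalCategory C]
    [BraidedCategory C] (hC : IsModularFusion k C)
    {D : Type u₂} [Category.{v₂} D] [Abelian D] [MonoidalCategory D] [MonoidalPreadditive D]
    {F : C ⥤ D} [F.Additive] [F.LaxMonoidal] [F.OplaxMonoidal]
    (h1 : ¬ IsZero (F.obj (𝟙_ C))) {hF : IsFrobenius F} {A : FrobeniusAlgebra C}
    {a : 𝟙_ C ⟶ A.X} {a' : 𝟙_ D ⟶ F.obj A.X} (h : SplitsImage F hF A a')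

include hC h1 h

/-- On right-linear morphisms a separable Frobenius functor is faithful. -/
theorem SplitsImage.eq_zero_of_map_eq_zero (hA : A.IsSymmetric) (ha : A.Splits a)
    {M N : Bimod A.toMon A.toMon} {f : M.X ⟶ N.X}
    (hf : M.actRight ≫ f = f ▷ A.X ≫ N.actRight) (h0 : F.map f = 0) : f = 0 := by
  have c0 : A.Cobalanced M.actRight (dual M).actLeft (coev M.X) := hA.coev_coactR M.actRight
  have c1 := c0.insR_bridge (N := dual M) ha
  have hb : f ▷ (M.Xᘁ : C) ≫ A.bridge N.actRight (dual M).actLeft =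
      A.bridge M.actRight (dual M).actLeft ≫ f ▷ (M.Xᘁ : C) :=
    whiskerRight_bridge hf (A.dualL M.actRight)
  -- Vanishing of `F f` does not by itself kill `F(f ▷ M*)`, but it does after `δ`. Strong
  -- separability produces a `δ` behind the bridge, and by right-linearity `f` can be moved in front
  -- of it.
  have hz : F.map (f ▷ (M.Xᘁ : C) ≫ A.bridge N.actRight (dual M).actLeft) = 0 := by
    have e := h N (dual M)
    have e3 : F.map (f ▷ (M.Xᘁ : C)) ≫ δ F N.X (M.Xᘁ : C) = 0 := by
      rw [← δ_natural_left, h0, MonoidalPreadditive.zero_whiskerRight, comp_zero]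
    rw [F.map_comp, ← e, ← F.map_comp_assoc, hb, F.map_comp, Category.assoc, reassoc_of% e3,
      zero_comp, comp_zero]
  -- The coevaluation is in the image of the idempotent, so the bridge can be introduced for free;
  -- what remains is a morphism out of the unit.
  have hx : coev M.X ≫ f ▷ (M.Xᘁ : C) = 0 := by
    rw [← c1, Category.assoc, Category.assoc, ← hb, ← Category.assoc]
    refine eq_zero_of_map_unit_eq_zero hC F h1 ?_
    rw [F.map_comp, hz, comp_zero]
  calc
    f = (λ_ _).inv ≫ (coev M.X ▷ M.X ≫ (α_ _ _ _).hom ≫ M.X ◁ ev M.X) ≫ (ρ_ _).hom ≫ f := by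
      rw [coev_ev]; simp
    _ = (λ_ _).inv ≫ coev M.X ▷ M.X ⊗≫ (M.X ◁ ev M.X ≫ f ▷ 𝟙_ C) ⊗≫ 𝟙 _ := by monoidal
    _ = (λ_ _).inv ≫ (coev M.X ≫ f ▷ (M.Xᘁ : C)) ▷ M.X ⊗≫ N.X ◁ ev M.X ⊗≫ 𝟙 _ := by
      rw [whisker_exchange]; monoidal
    _ = 0 := by
      rw [hx, MonoidalPreadditive.zero_whiskerRight]
      simp [monoidalComp]

/-- On right-linear balanced and cobalanced maps a separable Frobenius functor is faithful. -/
theorem SplitsImage.eq_zero_of_bmap_eq_zero (hA : A.IsSymmetric) (ha : A.Splits a)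
    {M N M' N' : Bimod A.toMon A.toMon} {f : M.X ⊗ N.X ⟶ M'.X ⊗ N'.X}
    (hf : RightLinear N.actRight N'.actRight f)
    (hb : A.Balanced M.actRight N.actLeft f) (hc : A.Cobalanced M'.actRight N'.actLeft f)
    (h0 : bmap F f = 0) : f = 0 := by
  -- The box is regarded as a right-linear map between the outer bimodules `M ⊗ N` and `M' ⊗ N'`. To
  -- see that `F f` vanishes, `δ` and `μ` are created on both sides, by balancedness and by
  -- cobalancedness, and enclose a copy of `bmap F f`.
  refine h.eq_zero_of_map_eq_zero hC h1 hA ha (M := outer M N) (N := outer M' N') ?_ ?_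
  · change ((α_ _ _ _).hom ≫ M.X ◁ N.actRight) ≫ f = f ▷ A.X ≫ (α_ _ _ _).hom ≫ M'.X ◁ N'.actRight
    rw [Category.assoc, hf, Iso.hom_inv_id_assoc]
  · have e := h M N
    have e' := h M' N'
    have h0' : μ F M.X N.X ≫ F.map f ≫ δ F M'.X N'.X = 0 := h0
    have e1 : F.map f = F.map (A.bridge M.actRight N.actLeft) ≫ δ F M.X N.X ≫
        (hF.mapAlgebra A).insR a' (μ F M.X A.X ≫ F.map M.actRight) ▷ F.obj N.X ≫ μ F M.X N.X ≫
        F.map f := by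
      conv_lhs => rw [← hb.bridge_insR ha, F.map_comp, ← e]
      simp only [Category.assoc, ← F.map_comp]
      rw [hb.bridge_insR ha]
    have e2 : F.map f = F.map f ≫ δ F M'.X N'.X ≫
        (hF.mapAlgebra A).insR a' (μ F M'.X A.X ≫ F.map M'.actRight) ▷ F.obj N'.X ≫
        μ F M'.X N'.X ≫ F.map (A.bridge M'.actRight N'.actLeft) := by
      conv_lhs => rw [← hc.insR_bridge ha, ← Category.assoc, F.map_comp, ← e']
      simp only [← F.map_comp_assoc, Category.assoc]
      rw [hc.insR_bridge ha]
    rw [e1, e2, reassoc_of% h0']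
    simp

end Faithful

namespace PreObj

variable {k : Type w} [Field k]
    {C : Type u₁} [Category.{v₁} C] [Abelian C] [Linear k C] [MonoidalCategory C]
    [MonoidalPreadditive C] [MonoidalLinear k C] [RightRigidCategory C] [PivotalCategory C]
    [BraidedCategory C] (hC : IsModularFusion k C)
    {D : Type u₂} [Category.{v₂} D] [Abelian D] [MonoidalCategory D]
    [MonoidalPreadditive D] [RightRigidCategory D] [PivotalCategory D] [BraidedCategory D]
    {F : C ⥤ D} [F.Additive] [F.LaxMonoidal] [F.OplaxMonoidal] {hF : IsFrobenius F}
    (h1 : ¬ IsZero (F.obj (𝟙_ C))) {𝔸 : OrbData k C} (h𝔸 : 𝔸.IsOrbifoldDatum)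
    {ψF : 𝟙_ D ⟶ F.obj 𝔸.A.X} {φF : k} {J : Set Leg}
    (hs : IsStronglySeparable hF 𝔸.A ψF)
    (h : ∀ M : PreObj 𝔸 J, M.IsCrossing → ((transport 𝔸 J hF ψF φF).obj M).IsCrossing)

include hC h1 h𝔸 hs

theorem crossingFunctor_faithful : (crossingFunctor 𝔸 J hF ψF φF h).Faithful where
  map_injective {M N} f g e := by
    have e1 : F.map f.hom.hom.hom = F.map g.hom.hom.hom :=
      congrArg (fun t => t.hom.hom.hom) e
    have e2 : f.hom.hom.hom - g.hom.hom.hom = 0 := by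
      refine hs.splitsImage.eq_zero_of_map_eq_zero hC h1 h𝔸.symmetric h𝔸.splits
        (M := M.obj.M) (N := N.obj.M) ?_ (by rw [F.map_sub, e1, sub_self])
      have a1 := f.hom.hom.right_act_hom
      have a2 := g.hom.hom.right_act_hom
      rw [Preadditive.comp_sub, sub_whiskerRight, Preadditive.sub_comp]
      rw [a1, a2]
    exact ObjectProperty.hom_ext _ (Hom.ext (Bimod.Hom.ext (sub_eq_zero.1 e2)))

omit [RightRigidCategory D] [PivotalCategory D] [BraidedCategory D] in
-- Both sides of the crossing condition are right-linear, balanced and cobalanced, so faithfulness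
-- on such boxes applies to their difference.
theorem map_comm {M N : PreObj 𝔸 J} (hM : M.IsCrossing) (hN : N.IsCrossing) (f : M.M ⟶ N.M) (i : J)
    (hf : F.map f.hom ▷ F.obj 𝔸.T ≫ bmap F (N.τ i) = bmap F (M.τ i) ≫ F.obj 𝔸.T ◁ F.map f.hom) :
    f.hom ▷ 𝔸.T ≫ N.τ i = M.τ i ≫ 𝔸.T ◁ f.hom := by
  rw [← sub_eq_zero]
  have a1 : M.M.actRight ≫ f.hom = f.hom ▷ 𝔸.A.X ≫ N.M.actRight := f.right_act_hom
  have a2 : M.M.actLeft ≫ f.hom = 𝔸.A.X ◁ f.hom ≫ N.M.actLeft := f.left_act_hom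
  refine hs.splitsImage.eq_zero_of_bmap_eq_zero hC h1 h𝔸.symmetric h𝔸.splits
    (M := M.M) (N := h𝔸.bimod i) (M' := h𝔸.bimod i) (N' := N.M) ?_ ?_ ?_ ?_
  · refine RightLinear.sub ?_ ?_
    · have e : M.M.X ◁ 𝔸.act i ≫ f.hom ▷ 𝔸.T ≫ N.τ i =
          f.hom ▷ (𝔸.T ⊗ 𝔸.A.X) ≫ N.M.X ◁ 𝔸.act i ≫ N.τ i := by rw [whisker_exchange_assoc]
      exact (e.trans (congrArg (fun t => _ ≫ t) (hN.rightLinear i))).trans (by monoidal)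
    · have e : M.M.X ◁ 𝔸.act i ≫ M.τ i = _ := hM.rightLinear i
      have e' : M.M.X ◁ 𝔸.act i ≫ M.τ i ≫ 𝔸.T ◁ f.hom = _ := (reassoc_of% e) _
      refine e'.trans ?_
      rw [← MonoidalCategory.whiskerLeft_comp, a1]
      change _ = (α_ M.M.X 𝔸.T 𝔸.A.X).inv ≫ (M.τ i ≫ 𝔸.T ◁ f.hom) ▷ 𝔸.A.X ≫
        (α_ 𝔸.T N.M.X 𝔸.A.X).hom ≫ 𝔸.T ◁ N.M.actRight
      monoidal
  · exact ((hN.balanced i).whiskerRight a1).sub ((hM.balanced i).comp _)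
  · exact ((hN.cobalanced i).comp _).sub ((hM.cobalanced i).whiskerLeft a2)
  · have e1 : bmap F (f.hom ▷ 𝔸.T ≫ N.τ i) = F.map f.hom ▷ F.obj 𝔸.T ≫ bmap F (N.τ i) := by
      simp [bmap]
    have e2 : bmap F (M.τ i ≫ 𝔸.T ◁ f.hom) = bmap F (M.τ i) ≫ F.obj 𝔸.T ◁ F.map f.hom := by
      simp [bmap]
    have e3 : bmap F (f.hom ▷ 𝔸.T ≫ N.τ i - M.τ i ≫ 𝔸.T ◁ f.hom) =
        bmap F (f.hom ▷ 𝔸.T ≫ N.τ i) - bmap F (M.τ i ≫ 𝔸.T ◁ f.hom) := by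
      simp only [bmap, F.map_sub, Preadditive.comp_sub, Preadditive.sub_comp]
    exact e3.trans (by rw [e1, e2, hf, sub_self])

theorem crossingFunctor_full [hfull : (mapBimod F 𝔸.A.toMon).Full] :
    (crossingFunctor 𝔸 J hF ψF φF h).Full where
  map_surjective {M N} g := by
    obtain ⟨f, hf⟩ := (mapBimod F 𝔸.A.toMon).map_surjective (X := M.obj.M) (Y := N.obj.M) g.hom.hom
    have hf' : F.map f.hom = g.hom.hom.hom := congrArg Bimod.Hom.hom hf
    refine ⟨ObjectProperty.homMk { hom := f, comm := fun i => ?_ },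
      ObjectProperty.hom_ext _ (Hom.ext hf)⟩
    refine map_comm hC h1 h𝔸 hs M.property N.property f i ?_
    rw [hf']
    exact g.hom.comm i

end PreObj

open FrobeniusAlgebra

-- Naturality of coactions and of insertions

section Coaction

variable {C : Type u₁} [Category.{v₁} C] [MonoidalCategory C] {A : FrobeniusAlgebra C}

theorem FrobeniusAlgebra.coactL_natural {X Y : C} {l : A.X ⊗ X ⟶ X} {l' : A.X ⊗ Y ⟶ Y} {f : X ⟶ Y}
    (hf : l ≫ f = A.X ◁ f ≫ l') : A.coactL l ≫ A.X ◁ f = f ≫ A.coactL l' := by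
  rw [coactL, coactL]
  calc
    _ = 𝟙 _ ⊗≫ A.copairing ▷ X ⊗≫ A.X ◁ (l ≫ f) := by monoidal
    _ = 𝟙 _ ⊗≫ (A.copairing ▷ X ≫ (A.X ⊗ A.X) ◁ f) ⊗≫ A.X ◁ l' := by rw [hf]; monoidal
    _ = _ := by rw [← whisker_exchange]; monoidal

theorem FrobeniusAlgebra.whiskerLeft_bridge {X Y Z : C} {l : A.X ⊗ X ⟶ X} {l' : A.X ⊗ Y ⟶ Y}
    {f : X ⟶ Y} (hf : l ≫ f = A.X ◁ f ≫ l') (r : Z ⊗ A.X ⟶ Z) :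
    Z ◁ f ≫ A.bridge r l' = A.bridge r l ≫ Z ◁ f := by
  have e := A.coactL_natural hf
  rw [bridge_eq_coactL, bridge_eq_coactL]
  calc
    _ = Z ◁ (A.coactL l ≫ A.X ◁ f) ⊗≫ r ▷ Y := by rw [e]; monoidal
    _ = Z ◁ A.coactL l ⊗≫ ((Z ⊗ A.X) ◁ f ≫ r ▷ Y) := by monoidal
    _ = _ := by rw [whisker_exchange]; monoidal

theorem FrobeniusAlgebra.act_insR {X : C} {l : A.X ⊗ X ⟶ X} {r : X ⊗ A.X ⟶ X} (a : 𝟙_ C ⟶ A.X)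
    (h : l ▷ A.X ≫ r = (α_ _ _ _).hom ≫ A.X ◁ r ≫ l) : l ≫ A.insR a r = A.X ◁ A.insR a r ≫ l := by
  calc
    _ = 𝟙 _ ⊗≫ (l ▷ 𝟙_ C ≫ X ◁ a) ≫ r := by rw [insR]; monoidal
    _ = 𝟙 _ ⊗≫ (A.X ⊗ X) ◁ a ≫ (l ▷ A.X ≫ r) := by rw [← whisker_exchange]; monoidal
    _ = _ := by rw [h, insR]; monoidal

variable [RightRigidCategory C] [PivotalCategory C]

/-- Bent form of `IsSymmetric.coev'_coactL`: a zigzag creates a `coev'`, on which the coaction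
changes sides. -/
theorem FrobeniusAlgebra.IsSymmetric.coactL_ev' (h : A.IsSymmetric) {X : C} (l : A.X ⊗ X ⟶ X) :
    A.coactL l ▷ (Xᘁ : C) ⊗≫ A.X ◁ ev' X ⊗≫ 𝟙 A.X =
      X ◁ A.coactR (A.dualR l) ⊗≫ ev' X ▷ A.X ⊗≫ 𝟙 A.X := by
  symm
  calc
    _ = X ◁ ((λ_ _).inv ≫ (coev' X ▷ (Xᘁ : C) ≫ (α_ _ _ _).hom ≫ (Xᘁ : C) ◁ ev' X) ≫ (ρ_ _).hom) ≫
        X ◁ A.coactR (A.dualR l) ⊗≫ ev' X ▷ A.X ⊗≫ 𝟙 A.X := by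
      rw [coev'_ev']; simp
    _ = 𝟙 _ ⊗≫ X ◁ coev' X ▷ (Xᘁ : C) ⊗≫ X ◁ ((Xᘁ : C) ◁ ev' X ≫ A.coactR (A.dualR l) ▷ 𝟙_ C) ⊗≫
        ev' X ▷ A.X ⊗≫ 𝟙 A.X := by monoidal
    _ = 𝟙 _ ⊗≫ X ◁ (coev' X ≫ A.coactR (A.dualR l) ▷ X ≫ (α_ _ _ _).hom) ▷ (Xᘁ : C) ⊗≫
        (X ⊗ (Xᘁ : C) ⊗ A.X) ◁ ev' X ⊗≫ ev' X ▷ A.X ⊗≫ 𝟙 A.X := by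
      rw [whisker_exchange]; monoidal
    _ = 𝟙 _ ⊗≫ X ◁ coev' X ▷ (Xᘁ : C) ⊗≫ ((X ⊗ (Xᘁ : C)) ◁ (A.coactL l ▷ (Xᘁ : C) ⊗≫ A.X ◁ ev' X) ≫
        ev' X ▷ (A.X ⊗ 𝟙_ C)) ⊗≫ 𝟙 A.X := by
      rw [h.coev'_coactL]; monoidal
    _ = 𝟙 _ ⊗≫ (X ◁ coev' X ≫ (α_ _ _ _).inv ≫ ev' X ▷ X) ▷ (Xᘁ : C) ⊗≫
        A.coactL l ▷ (Xᘁ : C) ⊗≫ A.X ◁ ev' X ⊗≫ 𝟙 A.X := by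
      rw [whisker_exchange]; monoidal
    _ = _ := by rw [ev'_coev']; monoidal

end Coaction

-- Insertions and bridges through boxes that exchange strands

section Exchange

variable {C : Type u₁} [Category.{v₁} C] [MonoidalCategory C] [BraidedCategory C]
  {A : FrobeniusAlgebra C} {X Y Z W U : C} {f : X ⊗ Y ⟶ Z ⊗ W} {i : Leg}

theorem ExchOut.insR {r : Y ⊗ A.X ⟶ Y} {r' : Z ⊗ A.X ⟶ Z} (h : ExchOut i r r' f)
    (a : 𝟙_ C ⟶ A.X) : X ◁ A.insR a r ≫ f = f ≫ A.insR a r' ▷ W := by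
  rw [ExchOut] at h
  calc
    _ = 𝟙 _ ⊗≫ X ◁ Y ◁ a ⊗≫ (X ◁ r ≫ f) := by rw [FrobeniusAlgebra.insR]; monoidal
    _ = 𝟙 _ ⊗≫ ((X ⊗ Y) ◁ a ≫ f ▷ A.X) ⊗≫ Z ◁ exch i W A.X ⊗≫ r' ▷ W := by rw [h]; monoidal
    _ = 𝟙 _ ⊗≫ f ⊗≫ Z ◁ (W ◁ a ≫ exch i W A.X) ⊗≫ r' ▷ W := by
      rw [whisker_exchange]; monoidal
    _ = _ := by
      rw [exch_naturality_right, exch_unit_right, FrobeniusAlgebra.insR]; monoidal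

theorem ExchIn.insR {r : X ⊗ A.X ⟶ X} {r' : W ⊗ A.X ⟶ W} (h : ExchIn i r r' f)
    (a : 𝟙_ C ⟶ A.X) : A.insR a r ▷ Y ≫ f = f ≫ Z ◁ A.insR a r' := by
  rw [ExchIn] at h
  have e : Y ◁ a ≫ exch i Y A.X = (ρ_ _).hom ≫ (λ_ _).inv ≫ a ▷ Y := by
    rw [exch_naturality_right, exch_unit_right, Category.assoc]
  calc
    _ = 𝟙 _ ⊗≫ X ◁ ((ρ_ Y).hom ≫ (λ_ Y).inv ≫ a ▷ Y) ⊗≫ r ▷ Y ≫ f := by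
      rw [FrobeniusAlgebra.insR]; monoidal
    _ = 𝟙 _ ⊗≫ (X ⊗ Y) ◁ a ⊗≫ (X ◁ exch i Y A.X ≫ (α_ _ _ _).inv ≫ r ▷ Y ≫ f) := by
      rw [← e]; monoidal
    _ = 𝟙 _ ⊗≫ ((X ⊗ Y) ◁ a ≫ f ▷ A.X) ⊗≫ Z ◁ r' := by rw [h]; monoidal
    _ = _ := by rw [whisker_exchange, FrobeniusAlgebra.insR]; monoidal

theorem ExchOut.bridge {r : Y ⊗ A.X ⟶ Y} {r' : Z ⊗ A.X ⟶ Z} (h : ExchOut i r r' f)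
    (l : A.X ⊗ U ⟶ U) :
    X ◁ A.bridge r l ≫ (α_ _ _ _).inv ≫ f ▷ U ≫ (α_ _ _ _).hom ≫ Z ◁ exch i W U =
      (α_ _ _ _).inv ≫ f ▷ U ≫ (α_ _ _ _).hom ≫ Z ◁ exch i W U ≫ (α_ _ _ _).inv ≫
        A.bridge r' l ▷ W ≫ (α_ _ _ _).hom := by
  rw [ExchOut] at h
  have e : W ◁ A.coactL l ≫ exch i W (A.X ⊗ U) = exch i W U ≫ A.coactL l ▷ W :=
    exch_naturality_right _ _ _
  rw [exch_tensor_right] at e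
  rw [A.bridge_eq_coactL, A.bridge_eq_coactL]
  set c := A.coactL l
  calc
    _ = 𝟙 _ ⊗≫ (X ⊗ Y) ◁ c ⊗≫ (X ◁ r ≫ f) ▷ U ⊗≫ Z ◁ exch i W U := by monoidal
    _ = 𝟙 _ ⊗≫ ((X ⊗ Y) ◁ c ≫ f ▷ (A.X ⊗ U)) ⊗≫ Z ◁ exch i W A.X ▷ U ⊗≫
        (r' ▷ (W ⊗ U) ≫ Z ◁ exch i W U) := by rw [h]; monoidal
    _ = 𝟙 _ ⊗≫ f ▷ U ⊗≫ Z ◁ (W ◁ c ≫ (α_ _ _ _).inv ≫ exch i W A.X ▷ U ≫ (α_ _ _ _).hom ≫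
        A.X ◁ exch i W U ≫ (α_ _ _ _).inv) ⊗≫ r' ▷ U ▷ W ⊗≫ 𝟙 _ := by
      rw [whisker_exchange, ← whisker_exchange r' (exch i W U)]; monoidal
    _ = _ := by rw [e]; monoidal

theorem ExchIn.bridge {r : X ⊗ A.X ⟶ X} {r' : W ⊗ A.X ⟶ W} (h : ExchIn i r r' f)
    (l : A.X ⊗ U ⟶ U) :
    (α_ _ _ _).inv ≫ A.bridge r l ▷ Y ≫ (α_ _ _ _).hom ≫ X ◁ exch i.other U Y ≫ (α_ _ _ _).inv ≫
        f ▷ U ≫ (α_ _ _ _).hom =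
      X ◁ exch i.other U Y ≫ (α_ _ _ _).inv ≫ f ▷ U ≫ (α_ _ _ _).hom ≫ Z ◁ A.bridge r' l := by
  rw [ExchIn] at h
  have e : A.coactL l ▷ Y ≫ exch i.other (A.X ⊗ U) Y = exch i.other U Y ≫ Y ◁ A.coactL l :=
    exch_naturality_left _ _ _
  rw [exch_tensor_left] at e
  rw [A.bridge_eq_coactL, A.bridge_eq_coactL]
  set c := A.coactL l
  symm
  calc
    _ = X ◁ exch i.other U Y ⊗≫ ((X ⊗ Y) ◁ c ≫ f ▷ (A.X ⊗ U)) ⊗≫ Z ◁ r' ▷ U := by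
      rw [whisker_exchange]; monoidal
    _ = 𝟙 _ ⊗≫ X ◁ (exch i.other U Y ≫ Y ◁ c) ⊗≫ ((α_ _ _ _).inv ≫ f ▷ A.X ≫ (α_ _ _ _).hom ≫
        Z ◁ r') ▷ U ⊗≫ 𝟙 _ := by monoidal
    _ = 𝟙 _ ⊗≫ X ◁ c ▷ Y ⊗≫ X ◁ A.X ◁ exch i.other U Y ⊗≫
        X ◁ (exch i.other A.X Y ≫ exch i Y A.X) ▷ U ⊗≫ (r ▷ Y ≫ f) ▷ U ⊗≫ 𝟙 _ := by
      rw [← h, ← e]; monoidal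
    _ = 𝟙 _ ⊗≫ X ◁ c ▷ Y ⊗≫ ((X ⊗ A.X) ◁ exch i.other U Y ≫ r ▷ (Y ⊗ U)) ⊗≫
        f ▷ U ⊗≫ 𝟙 _ := by rw [exch_other_exch]; monoidal
    _ = _ := by rw [whisker_exchange]; monoidal

end Exchange

-- Opening and closing `T`-loops

namespace OrbData

section Rotations

variable {k : Type w} {C : Type u₁} [Category.{v₁} C] [MonoidalCategory C] [RightRigidCategory C]
  (𝔸 : OrbData k C)

theorem coev_rotαbar : coev 𝔸.T ▷ 𝔸.T ⊗≫ 𝔸.T ◁ 𝔸.rotαbar =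
    𝟙 _ ⊗≫ 𝔸.T ◁ coev 𝔸.T ⊗≫ 𝔸.αbar ▷ (𝔸.Tᘁ : C) ⊗≫ 𝟙 _ := by
  rw [rotαbar]
  calc
    _ = 𝟙 _ ⊗≫ (coev 𝔸.T ▷ (𝔸.T ⊗ 𝟙_ C) ≫ (𝔸.T ⊗ (𝔸.Tᘁ : C)) ◁
        (𝔸.T ◁ coev 𝔸.T ⊗≫ 𝔸.αbar ▷ (𝔸.Tᘁ : C))) ⊗≫
        𝔸.T ◁ ev 𝔸.T ▷ 𝔸.T ▷ (𝔸.Tᘁ : C) ⊗≫ 𝟙 _ := by monoidal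
    _ = 𝟙 _ ⊗≫ 𝔸.T ◁ coev 𝔸.T ⊗≫ 𝔸.αbar ▷ (𝔸.Tᘁ : C) ⊗≫
        (coev 𝔸.T ▷ 𝔸.T ≫ (α_ _ _ _).hom ≫ 𝔸.T ◁ ev 𝔸.T) ▷ 𝔸.T ▷ (𝔸.Tᘁ : C) ⊗≫ 𝟙 _ := by
      rw [← whisker_exchange]; monoidal
    _ = _ := by rw [coev_ev]; monoidal

theorem rotα_ev' [PivotalCategory C] : 𝔸.T ◁ 𝔸.rotα ⊗≫ ev' 𝔸.T ▷ 𝔸.T ⊗≫ 𝟙 𝔸.T =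
    𝟙 _ ⊗≫ 𝔸.α ▷ (𝔸.Tᘁ : C) ⊗≫ 𝔸.T ◁ ev' 𝔸.T ⊗≫ 𝟙 𝔸.T := by
  rw [rotα]
  calc
    _ = 𝟙 _ ⊗≫ 𝔸.T ◁ coev' 𝔸.T ▷ 𝔸.T ▷ (𝔸.Tᘁ : C) ⊗≫ ((𝔸.T ⊗ (𝔸.Tᘁ : C)) ◁
        (𝔸.α ▷ (𝔸.Tᘁ : C) ⊗≫ 𝔸.T ◁ ev' 𝔸.T) ≫ ev' 𝔸.T ▷ (𝔸.T ⊗ 𝟙_ C)) ⊗≫ 𝟙 _ := by monoidal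
    _ = 𝟙 _ ⊗≫ (𝔸.T ◁ coev' 𝔸.T ≫ (α_ _ _ _).inv ≫ ev' 𝔸.T ▷ 𝔸.T) ▷ 𝔸.T ▷ (𝔸.Tᘁ : C) ⊗≫
        𝔸.α ▷ (𝔸.Tᘁ : C) ⊗≫ 𝔸.T ◁ ev' 𝔸.T ⊗≫ 𝟙 𝔸.T := by
      rw [whisker_exchange]; monoidal
    _ = _ := by rw [ev'_coev']; monoidal

end Rotations

namespace IsOrbifoldDatum

variable {k : Type w} [Field k] {C : Type u₁} [Category.{v₁} C] [Preadditive C] [Linear k C]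
  [MonoidalCategory C] [MonoidalPreadditive C] [MonoidalLinear k C] [RightRigidCategory C]
  [PivotalCategory C] [BraidedCategory C] {𝔸 : OrbData k C} (h : 𝔸.IsOrbifoldDatum)

open Leg

include h

theorem act₀_ins (i : Leg) : 𝔸.act₀ ≫ 𝔸.ins i = 𝔸.A.X ◁ 𝔸.ins i ≫ 𝔸.act₀ :=
  act_insR _ (h.bimod i).middle_assoc

/-- One leg of the copairing acts on `Y` and the other on the loop, so the loop contributes the
element of `A` obtained by applying `loop₀` to the unit. By O8 this is a multiple of the unit, which
acts trivially on `Y`. -/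
theorem rightTrace_bridge (Y : Bimod 𝔸.A.toMon 𝔸.A.toMon) :
    rightTrace 𝔸.T (Y.X ◁ (𝔸.ins one ≫ 𝔸.ins two) ≫ 𝔸.A.bridge Y.actRight 𝔸.act₀) =
      (𝔸.φ ^ 2)⁻¹ • 𝟙 Y.X := by
  have hu : Y.X ◁ 𝔸.A.one ≫ Y.actRight = (ρ_ Y.X).hom := Y.actRight_one
  have h0 : 𝔸.A.one ≫ 𝔸.loop₀ = 𝟙 _ ⊗≫ coev 𝔸.T ⊗≫
      (𝔸.ins one ≫ 𝔸.ins two ≫ 𝔸.coact₀) ▷ (𝔸.Tᘁ : C) ⊗≫ 𝔸.A.X ◁ ev' 𝔸.T ⊗≫ 𝟙 _ := by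
    rw [loop₀, rightTrace]
    calc
      _ = 𝟙 _ ⊗≫ (𝔸.A.one ▷ 𝟙_ C ≫ 𝔸.A.X ◁ coev 𝔸.T) ⊗≫ (𝔸.act₀ ≫ 𝔸.ins one ≫ 𝔸.ins two ≫
          𝔸.coact₀) ▷ (𝔸.Tᘁ : C) ⊗≫ 𝔸.A.X ◁ ev' 𝔸.T ⊗≫ 𝟙 _ := by monoidal
      _ = 𝟙 _ ⊗≫ coev 𝔸.T ⊗≫ (𝔸.A.one ▷ 𝔸.T ≫ 𝔸.act₀) ▷ (𝔸.Tᘁ : C) ⊗≫ (𝔸.ins one ≫ 𝔸.ins two ≫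
          𝔸.coact₀) ▷ (𝔸.Tᘁ : C) ⊗≫ 𝔸.A.X ◁ ev' 𝔸.T ⊗≫ 𝟙 _ := by
        rw [← whisker_exchange]; monoidal
      _ = _ := by rw [h.act₀_one]; monoidal
  calc
    _ = 𝟙 _ ⊗≫ Y.X ◁ (coev 𝔸.T ⊗≫ (𝔸.ins one ≫ 𝔸.ins two ≫ 𝔸.coact₀) ▷ (𝔸.Tᘁ : C)) ⊗≫
        (Y.actRight ▷ (𝔸.T ⊗ (𝔸.Tᘁ : C)) ≫ Y.X ◁ ev' 𝔸.T) ⊗≫ 𝟙 _ := by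
      rw [rightTrace, bridge_eq_coactL, OrbData.coact₀]; monoidal
    _ = 𝟙 _ ⊗≫ Y.X ◁ (𝟙 (𝟙_ C) ⊗≫ coev 𝔸.T ⊗≫ (𝔸.ins one ≫ 𝔸.ins two ≫ 𝔸.coact₀) ▷ (𝔸.Tᘁ : C) ⊗≫
        𝔸.A.X ◁ ev' 𝔸.T ⊗≫ 𝟙 𝔸.A.X) ⊗≫ Y.actRight := by
      rw [← whisker_exchange]; monoidal
    _ = (ρ_ _).inv ≫ Y.X ◁ (𝔸.A.one ≫ 𝔸.loop₀) ≫ Y.actRight := by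
      rw [h0]; monoidal
    _ = (𝔸.φ ^ 2)⁻¹ • ((ρ_ _).inv ≫ Y.X ◁ 𝔸.A.one ≫ Y.actRight) := by
      rw [h.O8.1, Linear.comp_smul, Category.comp_id, MonoidalLinear.whiskerLeft_smul,
        Linear.smul_comp, Linear.comp_smul]
    _ = _ := by rw [hu, Iso.inv_hom_id]

theorem act_two_ins_one : 𝔸.act two ≫ 𝔸.ins one = 𝔸.ins one ▷ 𝔸.A.X ≫ 𝔸.act two := by
  set a := 𝔸.A.sq 𝔸.ψ
  calc
    _ = 𝟙 _ ⊗≫ (𝔸.act two ▷ 𝟙_ C ≫ 𝔸.T ◁ a) ≫ 𝔸.act one := by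
      rw [OrbData.ins, insR]; monoidal
    _ = 𝟙 _ ⊗≫ 𝔸.T ◁ 𝔸.A.X ◁ a ⊗≫ (𝔸.act two ▷ 𝔸.A.X ≫ 𝔸.act one) := by
      rw [← whisker_exchange]; monoidal
    _ = 𝟙 _ ⊗≫ 𝔸.T ◁ (𝔸.A.X ◁ a ≫ exch two 𝔸.A.X 𝔸.A.X) ⊗≫
        𝔸.act one ▷ 𝔸.A.X ≫ 𝔸.act two := by rw [h.act_act]; monoidal
    _ = _ := by
      rw [exch_naturality_right, exch_unit_right, OrbData.ins, insR]; monoidal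

theorem act_one_ins_two : 𝔸.act one ≫ 𝔸.ins two = 𝔸.ins two ▷ 𝔸.A.X ≫ 𝔸.act one := by
  set a := 𝔸.A.sq 𝔸.ψ
  have e' : (λ_ 𝔸.A.X).inv ≫ a ▷ 𝔸.A.X ≫ exch two 𝔸.A.X 𝔸.A.X =
      (ρ_ 𝔸.A.X).inv ≫ 𝔸.A.X ◁ a := by
    rw [exch_naturality_left, exch_unit_left]; simp
  calc
    _ = 𝟙 _ ⊗≫ (𝔸.act one ▷ 𝟙_ C ≫ 𝔸.T ◁ a) ≫ 𝔸.act two := by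
      rw [OrbData.ins, insR]; monoidal
    _ = 𝟙 _ ⊗≫ 𝔸.T ◁ ((ρ_ 𝔸.A.X).inv ≫ 𝔸.A.X ◁ a) ⊗≫ 𝔸.act one ▷ 𝔸.A.X ≫ 𝔸.act two := by
      rw [← whisker_exchange]; monoidal
    _ = 𝟙 _ ⊗≫ 𝔸.T ◁ a ▷ 𝔸.A.X ⊗≫ (𝟙 ((𝔸.T ⊗ 𝔸.A.X) ⊗ 𝔸.A.X) ⊗≫ 𝔸.T ◁ exch two 𝔸.A.X 𝔸.A.X ⊗≫
        𝔸.act one ▷ 𝔸.A.X ≫ 𝔸.act two) := by rw [← e']; monoidal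
    _ = _ := by rw [← h.act_act, OrbData.ins, insR]; monoidal

theorem ins_comm : 𝔸.ins one ≫ 𝔸.ins two = 𝔸.ins two ≫ 𝔸.ins one := by
  symm
  calc
    _ = (ρ_ _).inv ≫ 𝔸.T ◁ 𝔸.A.sq 𝔸.ψ ≫ 𝔸.act two ≫ 𝔸.ins one := by
      conv_lhs => rw [OrbData.ins, insR]
      monoidal
    _ = (ρ_ _).inv ≫ (𝔸.T ◁ 𝔸.A.sq 𝔸.ψ ≫ 𝔸.ins one ▷ 𝔸.A.X) ≫ 𝔸.act two := by
      rw [h.act_two_ins_one, Category.assoc]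
    _ = _ := by
      rw [whisker_exchange]
      conv_rhs => rw [OrbData.ins.eq_1 𝔸 two, insR]
      monoidal

/-- `α` takes `ψ₁²` of the first factor to `ψ₁²` of the second, and `ψ₁²` of the second to `ψ₂²` of
the second. Only `ψ₂²` of the first stays between the two boxes, where O2 consumes it. -/
theorem αbar_ins_α : 𝔸.αbar ≫ (𝔸.ins one ≫ 𝔸.ins two) ▷ 𝔸.T ≫ 𝔸.T ◁ 𝔸.ins one ≫ 𝔸.α =
    𝔸.T ◁ (𝔸.ins one ≫ 𝔸.ins two) ≫ 𝔸.A.bridge (𝔸.act one) 𝔸.act₀ := by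
  have e1 : 𝔸.T ◁ 𝔸.ins one ≫ 𝔸.α = 𝔸.α ≫ 𝔸.T ◁ 𝔸.ins two := h.rightLinear.insR _
  have e2 : 𝔸.act₀ ≫ (𝔸.ins one ≫ 𝔸.ins two) = 𝔸.A.X ◁ (𝔸.ins one ≫ 𝔸.ins two) ≫ 𝔸.act₀ := by
    rw [reassoc_of% h.act₀_ins, h.act₀_ins, MonoidalCategory.whiskerLeft_comp, Category.assoc]
  have e3 : 𝔸.ins one ▷ 𝔸.T ≫ 𝔸.α = 𝔸.α ≫ 𝔸.T ◁ 𝔸.ins one := h.exchIn.insR _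
  rw [whiskerLeft_bridge e2, ← h.O2, e1, h.ins_comm, comp_whiskerRight, Category.assoc,
    reassoc_of% e3, MonoidalCategory.whiskerLeft_comp, Category.assoc,
    Category.assoc, ← MonoidalCategory.whiskerLeft_comp, h.ins_comm,
    MonoidalCategory.whiskerLeft_comp]

/-- An endomorphism of `T`-strands which commutes with `α` is determined by its closure to a
`T`-loop. -/
theorem rightTrace_whiskerRight_bridge {X : C} {Y : Bimod 𝔸.A.toMon 𝔸.A.toMon}
    {P : X ⊗ 𝔸.T ⟶ Y.X ⊗ 𝔸.T} (hc : 𝔸.A.Cobalanced Y.actRight 𝔸.act₀ P)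
    (hα : X ◁ 𝔸.α ⊗≫ P ▷ 𝔸.T ⊗≫ 𝟙 _ = 𝟙 _ ⊗≫ P ▷ 𝔸.T ⊗≫ Y.X ◁ 𝔸.α) :
    rightTrace 𝔸.T (X ◁ (𝔸.ins one ≫ 𝔸.ins two) ≫ P) ▷ 𝔸.T ≫ 𝔸.A.bridge Y.actRight 𝔸.act₀ =
      (𝔸.φ ^ 2)⁻¹ • P := by
  set ω := 𝔸.ins one ≫ 𝔸.ins two with hω
  set Q := X ◁ ω ≫ P with hQ
  have hQc : Q ≫ 𝔸.A.coactR Y.actRight ▷ 𝔸.T ≫ (α_ _ _ _).hom = Q ≫ Y.X ◁ 𝔸.A.coactL 𝔸.act₀ :=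
    hc.comp _
  have s0 := h.symmetric.coactL_ev' 𝔸.act₀
  -- In pictures: a closed `T`-loop around `P` stands to the left of a `T`-strand to which it is
  -- joined by a bridge. Symmetry moves the bridge to the dual strand of the loop. By O7 it becomes
  -- `ᾱ`, `ψ₁²`, `α` in rotated form, and the zigzags `s5`, `s6` straighten the rotations: the
  -- strands recombine, so that `P` lies on the other strand. Now `hα` pulls `α` through `P`, `s3`
  -- cancels it against `ᾱ`, and the loop left over no longer meets `P` and is evaluated by `s4`.
  have s1 : rightTrace 𝔸.T Q ≫ 𝔸.A.coactR Y.actRight = 𝟙 _ ⊗≫ X ◁ coev 𝔸.T ⊗≫ Q ▷ (𝔸.Tᘁ : C) ⊗≫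
      Y.X ◁ 𝔸.T ◁ 𝔸.A.coactR (𝔸.A.dualR 𝔸.act₀) ⊗≫ Y.X ◁ ev' 𝔸.T ▷ 𝔸.A.X ⊗≫ 𝟙 _ := by
    rw [rightTrace]
    set c := 𝔸.A.coactR Y.actRight
    calc
      _ = 𝟙 _ ⊗≫ X ◁ coev 𝔸.T ⊗≫ Q ▷ (𝔸.Tᘁ : C) ⊗≫ (Y.X ◁ ev' 𝔸.T ≫ c ▷ 𝟙_ C) ⊗≫ 𝟙 _ := by
        monoidal
      _ = 𝟙 _ ⊗≫ X ◁ coev 𝔸.T ⊗≫ (Q ≫ c ▷ 𝔸.T ≫ (α_ _ _ _).hom) ▷ (𝔸.Tᘁ : C) ⊗≫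
          Y.X ◁ 𝔸.A.X ◁ ev' 𝔸.T ⊗≫ 𝟙 _ := by rw [whisker_exchange]; monoidal
      _ = 𝟙 _ ⊗≫ X ◁ coev 𝔸.T ⊗≫ Q ▷ (𝔸.Tᘁ : C) ⊗≫
          Y.X ◁ (𝔸.A.coactL 𝔸.act₀ ▷ (𝔸.Tᘁ : C) ⊗≫ 𝔸.A.X ◁ ev' 𝔸.T ⊗≫ 𝟙 𝔸.A.X) := by
        rw [hQc]; monoidal
      _ = _ := by rw [s0]; monoidal
  have s2 : 𝔸.A.coactR (𝔸.A.dualR 𝔸.act₀) ▷ 𝔸.T ≫ (α_ _ _ _).hom ≫ (𝔸.Tᘁ : C) ◁ 𝔸.act₀ =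
      𝔸.rotαbar ≫ 𝔸.ins one ▷ (𝔸.Tᘁ : C) ≫ 𝔸.rotα := by rw [← bridge_eq_coactR, h.O7]
  have s3 := h.αbar_ins_α
  have s4 := h.rightTrace_bridge (h.bimod one)
  change rightTrace 𝔸.T (𝔸.T ◁ ω ≫ 𝔸.A.bridge (𝔸.act one) 𝔸.act₀) = (𝔸.φ ^ 2)⁻¹ • 𝟙 𝔸.T at s4
  have s5 := 𝔸.coev_rotαbar
  have s6 := 𝔸.rotα_ev'
  rw [rightTrace] at s4
  calc
    _ = (rightTrace 𝔸.T Q ≫ 𝔸.A.coactR Y.actRight) ▷ 𝔸.T ⊗≫ Y.X ◁ 𝔸.act₀ := by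
      rw [bridge_eq_coactR]; monoidal
    _ = 𝟙 _ ⊗≫ X ◁ coev 𝔸.T ▷ 𝔸.T ⊗≫ Q ▷ (𝔸.Tᘁ : C) ▷ 𝔸.T ⊗≫
        Y.X ◁ 𝔸.T ◁ 𝔸.A.coactR (𝔸.A.dualR 𝔸.act₀) ▷ 𝔸.T ⊗≫
        Y.X ◁ (ev' 𝔸.T ▷ (𝔸.A.X ⊗ 𝔸.T) ≫ 𝟙_ C ◁ 𝔸.act₀) ⊗≫ 𝟙 _ := by rw [s1]; monoidal
    _ = 𝟙 _ ⊗≫ X ◁ coev 𝔸.T ▷ 𝔸.T ⊗≫ Q ▷ (𝔸.Tᘁ : C) ▷ 𝔸.T ⊗≫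
        Y.X ◁ 𝔸.T ◁ (𝔸.A.coactR (𝔸.A.dualR 𝔸.act₀) ▷ 𝔸.T ≫ (α_ _ _ _).hom ≫
          (𝔸.Tᘁ : C) ◁ 𝔸.act₀) ⊗≫ Y.X ◁ ev' 𝔸.T ▷ 𝔸.T ⊗≫ 𝟙 _ := by
      rw [← whisker_exchange]; monoidal
    _ = 𝟙 _ ⊗≫ X ◁ coev 𝔸.T ▷ 𝔸.T ⊗≫ (Q ▷ ((𝔸.Tᘁ : C) ⊗ 𝔸.T) ≫
        (Y.X ⊗ 𝔸.T) ◁ (𝔸.rotαbar ≫ 𝔸.ins one ▷ (𝔸.Tᘁ : C))) ⊗≫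
        Y.X ◁ (𝔸.T ◁ 𝔸.rotα ⊗≫ ev' 𝔸.T ▷ 𝔸.T ⊗≫ 𝟙 𝔸.T) := by rw [s2]; monoidal
    _ = 𝟙 _ ⊗≫ X ◁ (coev 𝔸.T ▷ 𝔸.T ⊗≫ 𝔸.T ◁ 𝔸.rotαbar) ⊗≫
        ((X ⊗ 𝔸.T) ◁ 𝔸.ins one ▷ (𝔸.Tᘁ : C) ≫ Q ▷ (𝔸.T ⊗ (𝔸.Tᘁ : C))) ⊗≫
        Y.X ◁ (𝔸.T ◁ 𝔸.rotα ⊗≫ ev' 𝔸.T ▷ 𝔸.T ⊗≫ 𝟙 𝔸.T) := by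
      rw [← whisker_exchange]; monoidal
    _ = 𝟙 _ ⊗≫ X ◁ 𝔸.T ◁ coev 𝔸.T ⊗≫ X ◁ (𝔸.αbar ≫ (𝔸.T ◁ 𝔸.ins one ≫ ω ▷ 𝔸.T)) ▷ (𝔸.Tᘁ : C) ⊗≫
        (𝟙 (X ⊗ 𝔸.T ⊗ 𝔸.T) ⊗≫ P ▷ 𝔸.T ⊗≫ Y.X ◁ 𝔸.α) ▷ (𝔸.Tᘁ : C) ⊗≫ Y.X ◁ 𝔸.T ◁ ev' 𝔸.T ⊗≫ 𝟙 _ := by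
      rw [s5, s6, hQ]; monoidal
    _ = 𝟙 _ ⊗≫ X ◁ 𝔸.T ◁ coev 𝔸.T ⊗≫
        X ◁ (𝔸.αbar ≫ ω ▷ 𝔸.T ≫ 𝔸.T ◁ 𝔸.ins one ≫ 𝔸.α) ▷ (𝔸.Tᘁ : C) ⊗≫
        (P ▷ (𝔸.T ⊗ (𝔸.Tᘁ : C)) ≫ (Y.X ⊗ 𝔸.T) ◁ ev' 𝔸.T) ⊗≫ 𝟙 _ := by
      rw [← hα, whisker_exchange]; monoidal
    _ = X ◁ (𝟙 𝔸.T ⊗≫ 𝔸.T ◁ coev 𝔸.T ⊗≫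
        (𝔸.T ◁ ω ≫ 𝔸.A.bridge (𝔸.act one) 𝔸.act₀) ▷ (𝔸.Tᘁ : C) ⊗≫ 𝔸.T ◁ ev' 𝔸.T ⊗≫ 𝟙 𝔸.T) ≫ P := by
      rw [s3, ← whisker_exchange]; monoidal
    _ = _ := by
      rw [s4, MonoidalLinear.whiskerLeft_smul, Linear.smul_comp, MonoidalCategory.whiskerLeft_id,
        Category.id_comp]

end IsOrbifoldDatum

end OrbData

open FrobeniusAlgebra Leg

-- Sliding a box past a braiding

section Hexagon

variable {C : Type u₁} [Category.{v₁} C] [MonoidalCategory C] [BraidedCategory C] {X Y Z : C}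

/-- Naturality of the braiding in `t`, with one of the two elementary braidings brought to the other
side. -/
theorem exch_whisker_braiding (t : X ⊗ Z ⟶ Z ⊗ X) :
    X ◁ exch one Y Z ⊗≫ t ▷ Y ⊗≫ Z ◁ (β_ X Y).hom =
      𝟙 (X ⊗ Y ⊗ Z) ⊗≫ (β_ X Y).hom ▷ Z ⊗≫ Y ◁ t ⊗≫ exch one Y Z ▷ X ⊗≫ 𝟙 (Z ⊗ Y ⊗ X) := by
  have e := exch_naturality_left two t Y
  rw [exch_tensor_left, exch_tensor_left] at e
  have e1 : exch two Z Y ≫ exch one Y Z = 𝟙 _ := exch_exch two _ _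
  have e2 : exch one Y Z ≫ exch two Z Y = 𝟙 _ := exch_exch one _ _
  change X ◁ exch one Y Z ⊗≫ t ▷ Y ⊗≫ Z ◁ exch two X Y =
      𝟙 (X ⊗ Y ⊗ Z) ⊗≫ exch two X Y ▷ Z ⊗≫ Y ◁ t ⊗≫ exch one Y Z ▷ X ⊗≫ 𝟙 (Z ⊗ Y ⊗ X)
  calc
    _ = X ◁ exch one Y Z ⊗≫ t ▷ Y ⊗≫ Z ◁ exch two X Y ⊗≫ (exch two Z Y ≫ exch one Y Z) ▷ X ⊗≫
        𝟙 (Z ⊗ Y ⊗ X) := by rw [e1]; monoidal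
    _ = X ◁ exch one Y Z ⊗≫ (t ▷ Y ≫ (α_ _ _ _).hom ≫ Z ◁ exch two X Y ≫ (α_ _ _ _).inv ≫
        exch two Z Y ▷ X ≫ (α_ _ _ _).hom) ⊗≫ exch one Y Z ▷ X ⊗≫ 𝟙 (Z ⊗ Y ⊗ X) := by monoidal
    _ = X ◁ (exch one Y Z ≫ exch two Z Y) ⊗≫ exch two X Y ▷ Z ⊗≫ Y ◁ t ⊗≫ exch one Y Z ▷ X ⊗≫
        𝟙 (Z ⊗ Y ⊗ X) := by rw [e]; monoidal
    _ = _ := by rw [e2]; monoidal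

theorem exch_whisker_braiding' (t : Z ⊗ Y ⟶ Y ⊗ Z) :
    exch one Z X ▷ Y ⊗≫ X ◁ t ⊗≫ (β_ X Y).hom ▷ Z ⊗≫ 𝟙 (Y ⊗ X ⊗ Z) =
      𝟙 ((Z ⊗ X) ⊗ Y) ⊗≫ Z ◁ (β_ X Y).hom ⊗≫ t ▷ X ⊗≫ Y ◁ exch one Z X := by
  have e := exch_naturality_right two t X
  rw [exch_tensor_right, exch_tensor_right] at e
  have e1 : exch two X Z ≫ exch one Z X = 𝟙 _ := exch_exch two _ _
  have e2 : exch one Z X ≫ exch two X Z = 𝟙 _ := exch_exch one _ _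
  change exch one Z X ▷ Y ⊗≫ X ◁ t ⊗≫ exch two X Y ▷ Z ⊗≫ 𝟙 (Y ⊗ X ⊗ Z) =
      𝟙 ((Z ⊗ X) ⊗ Y) ⊗≫ Z ◁ exch two X Y ⊗≫ t ▷ X ⊗≫ Y ◁ exch one Z X
  calc
    _ = exch one Z X ▷ Y ⊗≫ X ◁ t ⊗≫ exch two X Y ▷ Z ⊗≫ Y ◁ (exch two X Z ≫ exch one Z X) := by
      rw [e1]; monoidal
    _ = exch one Z X ▷ Y ⊗≫ (X ◁ t ≫ (α_ _ _ _).inv ≫ exch two X Y ▷ Z ≫ (α_ _ _ _).hom ≫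
        Y ◁ exch two X Z ≫ (α_ _ _ _).inv) ⊗≫ Y ◁ exch one Z X := by monoidal
    _ = (exch one Z X ≫ exch two X Z) ▷ Y ⊗≫ Z ◁ exch two X Y ⊗≫ t ▷ X ⊗≫ Y ◁ exch one Z X := by
      rw [e]; monoidal
    _ = _ := by rw [e2]; monoidal

end Hexagon

-- Pulling `α` through crossings and the braiding

namespace PreObj

section Pass

variable {k : Type w} {C : Type u₁} [Category.{v₁} C] [MonoidalCategory C] [RightRigidCategory C]
  [PivotalCategory C] [BraidedCategory C] [Field k] [Preadditive C] [Linear k C] {𝔸 : OrbData k C}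
  (h : 𝔸.IsOrbifoldDatum) {J : Set Leg} {M : PreObj 𝔸 J} (hM : M.IsCrossing)

include h hM

/-- T1 with its last crossing undone by T5; the idempotent this leaves behind is absorbed by the two
remaining boxes. -/
theorem IsCrossing.pass_one (h1 : one ∈ J) :
    M.M.X ◁ 𝔸.α ⊗≫ M.τ ⟨one, h1⟩ ▷ 𝔸.T ⊗≫ 𝟙 (𝔸.T ⊗ M.M.X ⊗ 𝔸.T) =
      𝟙 _ ⊗≫ M.τ ⟨one, h1⟩ ▷ 𝔸.T ⊗≫ (𝔸.T ◁ exch one M.M.X 𝔸.T ⊗≫ 𝔸.α ▷ M.M.X ⊗≫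
        𝔸.T ◁ (𝔸.ins one ▷ M.M.X ≫ M.τbar ⟨one, h1⟩)) := by
  have t1 := hM.T1 h1
  have t5 : M.τ ⟨one, h1⟩ ≫ 𝔸.ins one ▷ M.M.X ≫ M.τbar ⟨one, h1⟩ =
    𝔸.A.bridge M.M.actRight 𝔸.act₀ := hM.T5 ⟨one, h1⟩
  have b : (M.M.X ◁ 𝔸.α ≫ (α_ _ _ _).inv ≫ M.τ ⟨one, h1⟩ ▷ 𝔸.T ≫ (α_ _ _ _).hom) ≫
      𝔸.T ◁ (M.insR ▷ 𝔸.T ≫ 𝔸.A.bridge M.M.actRight 𝔸.act₀) =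
      M.M.X ◁ 𝔸.α ≫ (α_ _ _ _).inv ≫ M.τ ⟨one, h1⟩ ▷ 𝔸.T ≫ (α_ _ _ _).hom :=
    RightLinear.comp_idemL (M := h.bimod one) (N := h.bimod one) (M' := M.M) h.splits
      h.cobalanced (hM.rightLinear ⟨one, h1⟩)
  rw [← t5] at b
  set t := M.τ ⟨one, h1⟩
  set t' := M.τbar ⟨one, h1⟩
  calc
    _ = M.M.X ◁ 𝔸.α ≫ (α_ _ _ _).inv ≫ t ▷ 𝔸.T ≫ (α_ _ _ _).hom := by monoidal
    _ = (M.M.X ◁ 𝔸.α ⊗≫ t ▷ 𝔸.T ⊗≫ 𝔸.T ◁ M.insR ▷ 𝔸.T ⊗≫ 𝔸.T ◁ t) ≫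
        𝔸.T ◁ (𝔸.ins one ▷ M.M.X ≫ t') := by rw [← b]; monoidal
    _ = _ := by rw [t1]; monoidal

omit h in
-- T3 with its final braiding undone.
theorem IsCrossing.pass_two (h2 : two ∈ J) :
    M.M.X ◁ 𝔸.α ⊗≫ M.τ ⟨two, h2⟩ ▷ 𝔸.T ⊗≫ 𝟙 (𝔸.T ⊗ M.M.X ⊗ 𝔸.T) =
      𝟙 _ ⊗≫ M.τ ⟨two, h2⟩ ▷ 𝔸.T ⊗≫ (𝔸.T ◁ M.τ ⟨two, h2⟩ ⊗≫
        (𝔸.ins two ▷ 𝔸.T ≫ 𝔸.α) ▷ M.M.X ⊗≫ 𝔸.T ◁ exch one 𝔸.T M.M.X) := by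
  have t3 := hM.T3 h2
  have e : exch two M.M.X 𝔸.T ≫ exch one 𝔸.T M.M.X = 𝟙 _ := exch_exch two _ _
  set t := M.τ ⟨two, h2⟩
  calc
    _ = M.M.X ◁ 𝔸.α ⊗≫ t ▷ 𝔸.T ⊗≫ 𝔸.T ◁ (exch two M.M.X 𝔸.T ≫ exch one 𝔸.T M.M.X) := by
      rw [e]; monoidal
    _ = (M.M.X ◁ 𝔸.α ⊗≫ t ▷ 𝔸.T ⊗≫ 𝔸.T ◁ exch two M.M.X 𝔸.T) ≫ 𝔸.T ◁ exch one 𝔸.T M.M.X := by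
      monoidal
    _ = _ := by rw [t3]; monoidal

/-- The inverse crossing passes through with the same box `R`. It is expanded to inverse crossing,
crossing, inverse crossing; `α` commutes with the bridge formed by the last two, the assumption on
the crossing is applied, and T4 collapses the first two. -/
theorem IsCrossing.bar_pass (i : J) {R : 𝔸.T ⊗ M.M.X ⊗ 𝔸.T ⟶ 𝔸.T ⊗ M.M.X ⊗ 𝔸.T}
    (e : M.M.X ◁ 𝔸.α ⊗≫ M.τ i ▷ 𝔸.T ⊗≫ 𝟙 (𝔸.T ⊗ M.M.X ⊗ 𝔸.T) = 𝟙 _ ⊗≫ M.τ i ▷ 𝔸.T ⊗≫ R) :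
    𝟙 (𝔸.T ⊗ M.M.X ⊗ 𝔸.T) ⊗≫ M.τbar i ▷ 𝔸.T ⊗≫ M.M.X ◁ 𝔸.α =
      𝟙 _ ⊗≫ 𝔸.A.bridge (𝔸.act i) M.M.actLeft ▷ 𝔸.T ⊗≫ R ⊗≫
        (𝔸.ins i ▷ M.M.X ≫ M.τbar i) ▷ 𝔸.T ⊗≫ 𝟙 _ := by
  have b1 : M.τbar i ≫ M.insR ▷ 𝔸.T ≫ 𝔸.A.bridge M.M.actRight 𝔸.act₀ = M.τbar i :=
    (hM.bar_cobalanced i).insR_bridge (M := M.M) (N := h.bimod one) h.splits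
  have b2 : 𝔸.A.bridge M.M.actRight 𝔸.act₀ ▷ 𝔸.T ≫ (α_ _ _ _).hom ≫ M.M.X ◁ 𝔸.α ≫
      (α_ _ _ _).inv = (α_ _ _ _).hom ≫ M.M.X ◁ 𝔸.α ≫ (α_ _ _ _).inv ≫
        𝔸.A.bridge M.M.actRight 𝔸.act₀ ▷ 𝔸.T := h.leftLinear.bridge M.M.actRight
  have t4 := hM.T4 i
  have t5 := hM.T5 i
  rw [← t5] at b2
  set t := M.τ i
  set t' := M.τbar i
  calc
    _ = 𝟙 _ ⊗≫ (t' ≫ M.insR ▷ 𝔸.T ≫ t ≫ 𝔸.ins i ▷ M.M.X ≫ t') ▷ 𝔸.T ⊗≫ M.M.X ◁ 𝔸.α := by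
      rw [t5, b1]
    _ = 𝟙 _ ⊗≫ (t' ≫ M.insR ▷ 𝔸.T) ▷ 𝔸.T ⊗≫ ((t ≫ 𝔸.ins i ▷ M.M.X ≫ t') ▷ 𝔸.T ≫
        (α_ _ _ _).hom ≫ M.M.X ◁ 𝔸.α ≫ (α_ _ _ _).inv) ⊗≫ 𝟙 _ := by monoidal
    _ = 𝟙 _ ⊗≫ (t' ≫ M.insR ▷ 𝔸.T) ▷ 𝔸.T ⊗≫ (M.M.X ◁ 𝔸.α ⊗≫ t ▷ 𝔸.T ⊗≫ 𝟙 (𝔸.T ⊗ M.M.X ⊗ 𝔸.T)) ⊗≫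
        (𝔸.ins i ▷ M.M.X ≫ t') ▷ 𝔸.T ⊗≫ 𝟙 _ := by rw [b2]; monoidal
    _ = 𝟙 _ ⊗≫ (t' ≫ M.insR ▷ 𝔸.T ≫ t) ▷ 𝔸.T ⊗≫ R ⊗≫
        (𝔸.ins i ▷ M.M.X ≫ t') ▷ 𝔸.T ⊗≫ 𝟙 _ := by rw [e]; monoidal
    _ = _ := by rw [t4]

end Pass

section Braid

variable {k : Type w} {C : Type u₁} [Category.{v₁} C] [MonoidalCategory C] [BraidedCategory C]
  {𝔸 : OrbData k C} (M N : PreObj 𝔸 Set.univ)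

/-- The morphism taking a `T`-strand past `M` and `N`, followed by the braiding of `M` and `N`. -/
def crossOver : M.M.X ⊗ N.M.X ⊗ 𝔸.T ⟶ 𝔸.T ⊗ N.M.X ⊗ M.M.X :=
  M.M.X ◁ N.τ ⟨one, Set.mem_univ _⟩ ≫ (α_ _ _ _).inv ≫ M.τ ⟨two, Set.mem_univ _⟩ ▷ N.M.X ≫
    (α_ _ _ _).hom ≫ 𝔸.T ◁ (β_ M.M.X N.M.X).hom

/-- The morphism taking a `T`-strand back past `N` and `M`. -/
def crossUnder : 𝔸.T ⊗ N.M.X ⊗ M.M.X ⟶ N.M.X ⊗ M.M.X ⊗ 𝔸.T :=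
  (α_ _ _ _).inv ≫ (𝔸.ins one ▷ N.M.X ≫ N.τbar ⟨one, Set.mem_univ _⟩) ▷ M.M.X ≫ (α_ _ _ _).hom ≫
    N.M.X ◁ (𝔸.ins two ▷ M.M.X ≫ M.τbar ⟨two, Set.mem_univ _⟩)

end Braid

section Braid

variable {k : Type w} [Field k] {C : Type u₁} [Category.{v₁} C] [Preadditive C] [Linear k C]
  [MonoidalCategory C] [MonoidalPreadditive C] [MonoidalLinear k C] [RightRigidCategory C]
  [PivotalCategory C] [BraidedCategory C] {𝔸 : OrbData k C}
  (h : 𝔸.IsOrbifoldDatum) {M N : PreObj 𝔸 Set.univ} (hM : M.IsCrossing) (hN : N.IsCrossing)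

include hN in
theorem ins_two_τbar_one : 𝔸.ins two ▷ N.M.X ≫ N.τbar ⟨one, Set.mem_univ _⟩ =
    N.τbar ⟨one, Set.mem_univ _⟩ ≫ N.M.X ◁ 𝔸.ins two :=
  (hN.bar_exchIn ⟨one, Set.mem_univ _⟩).insR _

include hN in
-- The inner `ψ₂²` is moved past the inverse crossing of `N` to stand directly before that of `M`,
-- which gives the shape of `crossUnder`.
theorem braidBalanced_eq : M.braidBalanced N =
    𝔸.φ ^ 2 • rightTrace 𝔸.T ((M.M.X ⊗ N.M.X) ◁ (𝔸.ins one ≫ 𝔸.ins two) ≫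
      ((α_ _ _ _).hom ≫ M.crossOver N ≫ M.crossUnder N ≫ (α_ _ _ _).inv)) := by
  have e := ins_two_τbar_one hN
  rw [braidBalanced]
  congr 2
  rw [crossOver, crossUnder]
  set t1 := N.τ ⟨one, Set.mem_univ _⟩
  set t1' := N.τbar ⟨one, Set.mem_univ _⟩
  set t2 := M.τ ⟨two, Set.mem_univ _⟩
  set t2' := M.τbar ⟨two, Set.mem_univ _⟩
  calc
    _ = 𝟙 _ ⊗≫ (M.M.X ⊗ N.M.X) ◁ (𝔸.ins one ≫ 𝔸.ins two) ⊗≫ M.M.X ◁ t1 ⊗≫ t2 ▷ N.M.X ⊗≫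
        ((𝔸.ins one ≫ 𝔸.ins two) ▷ (M.M.X ⊗ N.M.X) ≫ 𝔸.T ◁ (β_ M.M.X N.M.X).hom) ⊗≫
        t1' ▷ M.M.X ⊗≫ N.M.X ◁ t2' ⊗≫ 𝟙 _ := by
      monoidal
    _ = 𝟙 _ ⊗≫ (M.M.X ⊗ N.M.X) ◁ (𝔸.ins one ≫ 𝔸.ins two) ⊗≫ M.M.X ◁ t1 ⊗≫ t2 ▷ N.M.X ⊗≫
        𝔸.T ◁ (β_ M.M.X N.M.X).hom ⊗≫ (𝔸.ins one ▷ N.M.X ≫ (𝔸.ins two ▷ N.M.X ≫ t1')) ▷ M.M.X ⊗≫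
        N.M.X ◁ t2' ⊗≫ 𝟙 _ := by
      rw [← whisker_exchange]; monoidal
    _ = _ := by rw [e]; monoidal

include h hM hN in
-- The crossing of `N` absorbs the idempotent. Bridge and insertion then follow the strand of `T`
-- through the crossing of `M`, which exchanges `ρ₁`, and across the braiding.
theorem crossOver_idemL_one : M.crossOver N ≫ (α_ _ _ _).inv ≫
    (𝔸.ins one ▷ N.M.X ≫ 𝔸.A.bridge (𝔸.act one) N.M.actLeft) ▷ M.M.X ≫ (α_ _ _ _).hom =
      M.crossOver N := by
  have a : N.τ ⟨one, Set.mem_univ _⟩ ≫ 𝔸.ins one ▷ N.M.X ≫ 𝔸.A.bridge (𝔸.act one) N.M.actLeft =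
      N.τ ⟨one, Set.mem_univ _⟩ :=
    (hN.cobalanced ⟨one, Set.mem_univ _⟩).insR_bridge (M := h.bimod one) (N := N.M) h.splits
  have b1 : M.M.X ◁ 𝔸.ins one ≫ M.τ ⟨two, Set.mem_univ _⟩ =
      M.τ ⟨two, Set.mem_univ _⟩ ≫ 𝔸.ins one ▷ M.M.X :=
    (hM.exchOut ⟨two, Set.mem_univ _⟩).insR _
  have b2 : M.M.X ◁ 𝔸.A.bridge (𝔸.act one) N.M.actLeft ≫ (α_ _ _ _).inv ≫
      M.τ ⟨two, Set.mem_univ _⟩ ▷ N.M.X ≫ (α_ _ _ _).hom ≫ 𝔸.T ◁ (β_ M.M.X N.M.X).hom =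
      (α_ _ _ _).inv ≫ M.τ ⟨two, Set.mem_univ _⟩ ▷ N.M.X ≫ (α_ _ _ _).hom ≫
        𝔸.T ◁ (β_ M.M.X N.M.X).hom ≫ (α_ _ _ _).inv ≫
        𝔸.A.bridge (𝔸.act one) N.M.actLeft ▷ M.M.X ≫ (α_ _ _ _).hom :=
    (hM.exchOut ⟨two, Set.mem_univ _⟩).bridge N.M.actLeft
  rw [crossOver]
  set t1 := N.τ ⟨one, Set.mem_univ _⟩
  set t2 := M.τ ⟨two, Set.mem_univ _⟩
  set b := 𝔸.A.bridge (𝔸.act one) N.M.actLeft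
  symm
  calc
    _ = M.M.X ◁ (t1 ≫ 𝔸.ins one ▷ N.M.X) ≫ (M.M.X ◁ b ≫ (α_ _ _ _).inv ≫ t2 ▷ N.M.X ≫
        (α_ _ _ _).hom ≫ 𝔸.T ◁ (β_ M.M.X N.M.X).hom) := by
      conv_lhs => rw [← a]
      monoidal
    _ = M.M.X ◁ t1 ⊗≫ (M.M.X ◁ 𝔸.ins one ≫ t2) ▷ N.M.X ⊗≫ 𝔸.T ◁ (β_ M.M.X N.M.X).hom ⊗≫
        b ▷ M.M.X ⊗≫ 𝟙 _ := by rw [b2]; monoidal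
    _ = M.M.X ◁ t1 ⊗≫ t2 ▷ N.M.X ⊗≫ (𝔸.ins one ▷ (M.M.X ⊗ N.M.X) ≫ 𝔸.T ◁ (β_ M.M.X N.M.X).hom) ⊗≫
        b ▷ M.M.X ⊗≫ 𝟙 _ := by rw [b1]; monoidal
    _ = _ := by rw [← whisker_exchange]; monoidal

include h hM hN in
theorem crossOver_idemL_two : (M.crossOver N ≫ (α_ _ _ _).inv ≫
    (𝔸.ins one ▷ N.M.X ≫ N.τbar ⟨one, Set.mem_univ _⟩) ▷ M.M.X ≫ (α_ _ _ _).hom) ≫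
      N.M.X ◁ (𝔸.ins two ▷ M.M.X ≫ 𝔸.A.bridge (𝔸.act two) M.M.actLeft) =
    M.crossOver N ≫ (α_ _ _ _).inv ≫
      (𝔸.ins one ▷ N.M.X ≫ N.τbar ⟨one, Set.mem_univ _⟩) ▷ M.M.X ≫ (α_ _ _ _).hom := by
  have a : M.τ ⟨two, Set.mem_univ _⟩ ≫ 𝔸.ins two ▷ M.M.X ≫ 𝔸.A.bridge (𝔸.act two) M.M.actLeft =
      M.τ ⟨two, Set.mem_univ _⟩ :=
    (hM.cobalanced ⟨two, Set.mem_univ _⟩).insR_bridge (M := h.bimod two) (N := M.M) h.splits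
  have e := ins_two_τbar_one hN
  have b0 : 𝔸.ins one ▷ M.M.X ≫ 𝔸.A.bridge (𝔸.act two) M.M.actLeft =
      𝔸.A.bridge (𝔸.act two) M.M.actLeft ≫ 𝔸.ins one ▷ M.M.X :=
    whiskerRight_bridge h.act_two_ins_one _
  have b2 : (α_ _ _ _).inv ≫ 𝔸.A.bridge (𝔸.act two) M.M.actLeft ▷ N.M.X ≫ (α_ _ _ _).hom ≫
      𝔸.T ◁ (β_ M.M.X N.M.X).hom ≫ (α_ _ _ _).inv ≫ N.τbar ⟨one, Set.mem_univ _⟩ ▷ M.M.X ≫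
      (α_ _ _ _).hom = 𝔸.T ◁ (β_ M.M.X N.M.X).hom ≫ (α_ _ _ _).inv ≫
        N.τbar ⟨one, Set.mem_univ _⟩ ▷ M.M.X ≫ (α_ _ _ _).hom ≫
        N.M.X ◁ 𝔸.A.bridge (𝔸.act two) M.M.actLeft :=
    (hN.bar_exchIn ⟨one, Set.mem_univ _⟩).bridge M.M.actLeft
  rw [crossOver]
  set t1 := N.τ ⟨one, Set.mem_univ _⟩
  set t2 := M.τ ⟨two, Set.mem_univ _⟩
  set t1' := N.τbar ⟨one, Set.mem_univ _⟩
  set b := 𝔸.A.bridge (𝔸.act two) M.M.actLeft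
  set β := (β_ M.M.X N.M.X).hom
  calc
    _ = M.M.X ◁ t1 ⊗≫ t2 ▷ N.M.X ⊗≫ 𝔸.T ◁ β ⊗≫ (𝔸.ins one ▷ N.M.X ≫ (t1' ≫ N.M.X ◁ 𝔸.ins two)) ▷
        M.M.X ⊗≫ N.M.X ◁ b := by monoidal
    _ = M.M.X ◁ t1 ⊗≫ t2 ▷ N.M.X ⊗≫ (𝔸.T ◁ β ≫ (𝔸.ins one ≫ 𝔸.ins two) ▷ (N.M.X ⊗ M.M.X)) ⊗≫
        t1' ▷ M.M.X ⊗≫ N.M.X ◁ b := by rw [← e]; monoidal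
    _ = M.M.X ◁ t1 ⊗≫ t2 ▷ N.M.X ⊗≫ (𝔸.ins two ≫ 𝔸.ins one) ▷ (M.M.X ⊗ N.M.X) ⊗≫
        (𝔸.T ◁ β ≫ (α_ _ _ _).inv ≫ t1' ▷ M.M.X ≫ (α_ _ _ _).hom ≫ N.M.X ◁ b) := by
      rw [← h.ins_comm, whisker_exchange]; monoidal
    _ = M.M.X ◁ t1 ⊗≫ (t2 ≫ 𝔸.ins two ▷ M.M.X ≫ (𝔸.ins one ▷ M.M.X ≫ b)) ▷ N.M.X ⊗≫
        𝔸.T ◁ β ⊗≫ t1' ▷ M.M.X ⊗≫ 𝟙 _ := by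
      rw [← b2]; monoidal
    _ = M.M.X ◁ t1 ⊗≫ (t2 ≫ 𝔸.ins two ▷ M.M.X ≫ b) ▷ N.M.X ⊗≫
        (𝔸.ins one ▷ (M.M.X ⊗ N.M.X) ≫ 𝔸.T ◁ β) ⊗≫ t1' ▷ M.M.X ⊗≫ 𝟙 _ := by
      rw [b0]; monoidal
    _ = _ := by rw [a, ← whisker_exchange]; monoidal

include h hM hN

/-- `α` passes the crossing of `N` by T1 and that of `M` by T3, while naturality takes the emitted
crossings past the braiding. The boxes emitted on the far side are the same as in `crossUnder_α`,
which is why strand crossings and their inverses together commute with `α`. -/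
theorem crossOver_α : (M.M.X ⊗ N.M.X) ◁ 𝔸.α ⊗≫ M.crossOver N ▷ 𝔸.T ⊗≫
      𝟙 (𝔸.T ⊗ N.M.X ⊗ M.M.X ⊗ 𝔸.T) =
    𝟙 _ ⊗≫ M.crossOver N ▷ 𝔸.T ⊗≫
      (𝔸.T ◁ (N.M.X ◁ M.τ ⟨two, Set.mem_univ _⟩ ⊗≫ exch one N.M.X 𝔸.T ▷ M.M.X) ⊗≫
      (𝔸.ins two ▷ 𝔸.T ≫ 𝔸.α) ▷ (N.M.X ⊗ M.M.X) ⊗≫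
      𝔸.T ◁ ((𝔸.ins one ▷ N.M.X ≫ N.τbar ⟨one, Set.mem_univ _⟩) ▷ M.M.X ⊗≫
        N.M.X ◁ exch one 𝔸.T M.M.X)) := by
  have p1 := hN.pass_one h (Set.mem_univ _)
  have p2 := hM.pass_two (Set.mem_univ _)
  have x1 := exch_whisker_braiding (Y := N.M.X) (M.τ ⟨two, Set.mem_univ _⟩)
  have x2 := exch_whisker_braiding' (X := M.M.X)
    (𝔸.ins one ▷ N.M.X ≫ N.τbar ⟨one, Set.mem_univ _⟩)
  rw [crossOver]
  set t1 := N.τ ⟨one, Set.mem_univ _⟩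
  set t2 := M.τ ⟨two, Set.mem_univ _⟩
  set x := 𝔸.ins one ▷ N.M.X ≫ N.τbar ⟨one, Set.mem_univ _⟩
  set β := (β_ M.M.X N.M.X).hom
  set a := 𝔸.α
  set e1 := exch one N.M.X 𝔸.T
  set e2 := exch one 𝔸.T M.M.X
  set d := 𝔸.ins two ▷ 𝔸.T ≫ a
  calc
    _ = 𝟙 _ ⊗≫ M.M.X ◁ (N.M.X ◁ a ⊗≫ t1 ▷ 𝔸.T ⊗≫ 𝟙 (𝔸.T ⊗ N.M.X ⊗ 𝔸.T)) ⊗≫ t2 ▷ (N.M.X ⊗ 𝔸.T) ⊗≫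
        𝔸.T ◁ β ▷ 𝔸.T ⊗≫
        𝟙 (𝔸.T ⊗ N.M.X ⊗ M.M.X ⊗ 𝔸.T) := by monoidal
    _ = 𝟙 _ ⊗≫ M.M.X ◁ t1 ▷ 𝔸.T ⊗≫ M.M.X ◁ 𝔸.T ◁ e1 ⊗≫ M.M.X ◁ a ▷ N.M.X ⊗≫
        ((M.M.X ⊗ 𝔸.T) ◁ x ≫ t2 ▷ (N.M.X ⊗ 𝔸.T)) ⊗≫
        𝔸.T ◁ β ▷ 𝔸.T ⊗≫ 𝟙 (𝔸.T ⊗ N.M.X ⊗ M.M.X ⊗ 𝔸.T) := by rw [p1]; monoidal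
    _ = 𝟙 _ ⊗≫ M.M.X ◁ t1 ▷ 𝔸.T ⊗≫ M.M.X ◁ 𝔸.T ◁ e1 ⊗≫ (M.M.X ◁ a ⊗≫ t2 ▷ 𝔸.T ⊗≫
        𝟙 (𝔸.T ⊗ M.M.X ⊗ 𝔸.T)) ▷ N.M.X ⊗≫
        (𝔸.T ⊗ M.M.X) ◁ x ⊗≫ 𝔸.T ◁ β ▷ 𝔸.T ⊗≫
        𝟙 (𝔸.T ⊗ N.M.X ⊗ M.M.X ⊗ 𝔸.T) := by rw [whisker_exchange]; monoidal
    _ = 𝟙 _ ⊗≫ M.M.X ◁ t1 ▷ 𝔸.T ⊗≫ ((M.M.X ⊗ 𝔸.T) ◁ e1 ≫ t2 ▷ (𝔸.T ⊗ N.M.X)) ⊗≫ 𝔸.T ◁ t2 ▷ N.M.X ⊗≫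
        d ▷ M.M.X ▷ N.M.X ⊗≫ 𝔸.T ◁ (e2 ▷ N.M.X ⊗≫ M.M.X ◁ x ⊗≫ β ▷ 𝔸.T ⊗≫
        𝟙 (N.M.X ⊗ M.M.X ⊗ 𝔸.T)) := by rw [p2]; monoidal
    _ = 𝟙 _ ⊗≫ M.M.X ◁ t1 ▷ 𝔸.T ⊗≫ t2 ▷ (N.M.X ⊗ 𝔸.T) ⊗≫ 𝔸.T ◁ (M.M.X ◁ e1 ⊗≫ t2 ▷ N.M.X) ⊗≫
        (d ▷ (M.M.X ⊗ N.M.X) ≫ (𝔸.T ⊗ 𝔸.T) ◁ β) ⊗≫ 𝔸.T ◁ (x ▷ M.M.X ⊗≫ N.M.X ◁ e2) := by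
      rw [x2, whisker_exchange]; monoidal
    _ = 𝟙 _ ⊗≫ M.M.X ◁ t1 ▷ 𝔸.T ⊗≫ t2 ▷ (N.M.X ⊗ 𝔸.T) ⊗≫ 𝔸.T ◁ (M.M.X ◁ e1 ⊗≫ t2 ▷ N.M.X ⊗≫
        𝔸.T ◁ β) ⊗≫
        d ▷ (N.M.X ⊗ M.M.X) ⊗≫ 𝔸.T ◁ (x ▷ M.M.X ⊗≫ N.M.X ◁ e2) := by
      rw [← whisker_exchange]; monoidal
    _ = _ := by rw [x1]; monoidal

/-- `crossOver` is kept in front because it absorbs the bridges that `IsCrossing.bar_pass` leaves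
behind. -/
theorem crossUnder_α : M.crossOver N ▷ 𝔸.T ⊗≫ M.crossUnder N ▷ 𝔸.T ⊗≫ (N.M.X ⊗ M.M.X) ◁ 𝔸.α =
    M.crossOver N ▷ 𝔸.T ⊗≫
      (𝔸.T ◁ (N.M.X ◁ M.τ ⟨two, Set.mem_univ _⟩ ⊗≫ exch one N.M.X 𝔸.T ▷ M.M.X) ⊗≫
      (𝔸.ins two ▷ 𝔸.T ≫ 𝔸.α) ▷ (N.M.X ⊗ M.M.X) ⊗≫
      𝔸.T ◁ ((𝔸.ins one ▷ N.M.X ≫ N.τbar ⟨one, Set.mem_univ _⟩) ▷ M.M.X ⊗≫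
        N.M.X ◁ exch one 𝔸.T M.M.X)) ⊗≫ M.crossUnder N ▷ 𝔸.T ⊗≫ 𝟙 _ := by
  have p1 := hN.bar_pass h _ (hN.pass_one h (Set.mem_univ _))
  have p2 := hM.bar_pass h _ (hM.pass_two (Set.mem_univ _))
  have c1 := crossOver_idemL_one h hM hN
  have c2 := crossOver_idemL_two h hM hN
  have e3 := ins_two_τbar_one hN
  have b0 : 𝔸.ins two ▷ N.M.X ≫ 𝔸.A.bridge (𝔸.act one) N.M.actLeft =
      𝔸.A.bridge (𝔸.act one) N.M.actLeft ≫ 𝔸.ins two ▷ N.M.X :=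
    whiskerRight_bridge h.act_one_ins_two _
  rw [crossUnder]
  set K := M.crossOver N
  set t2 := M.τ ⟨two, Set.mem_univ _⟩
  set t1' := N.τbar ⟨one, Set.mem_univ _⟩
  set t2' := M.τbar ⟨two, Set.mem_univ _⟩
  set x := 𝔸.ins one ▷ N.M.X ≫ t1' with hx
  set y := 𝔸.ins two ▷ M.M.X ≫ t2' with hy
  set a := 𝔸.α
  set e1 := exch one N.M.X 𝔸.T
  set e2 := exch one 𝔸.T M.M.X
  set i1 := 𝔸.ins one
  set i2 := 𝔸.ins two
  set b1 := 𝔸.A.bridge (𝔸.act one) N.M.actLeft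
  set b2 := 𝔸.A.bridge (𝔸.act two) M.M.actLeft
  have e4 : x ≫ N.M.X ◁ i2 = (i1 ≫ i2) ▷ N.M.X ≫ t1' := by
    rw [hx, Category.assoc, ← e3, comp_whiskerRight, Category.assoc]
  calc
    _ = (K ≫ (α_ _ _ _).inv ≫ x ▷ M.M.X ≫ (α_ _ _ _).hom) ▷ 𝔸.T ⊗≫ N.M.X ◁ i2 ▷ M.M.X ▷ 𝔸.T ⊗≫
        N.M.X ◁ (𝟙 (𝔸.T ⊗ M.M.X ⊗ 𝔸.T) ⊗≫ t2' ▷ 𝔸.T ⊗≫ M.M.X ◁ a) ⊗≫ 𝟙 _ := by rw [hy]; monoidal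
    _ = ((K ≫ (α_ _ _ _).inv ≫ x ▷ M.M.X ≫ (α_ _ _ _).hom) ≫ N.M.X ◁ (i2 ▷ M.M.X ≫ b2)) ▷ 𝔸.T ⊗≫
        N.M.X ◁ 𝔸.T ◁ t2 ⊗≫ N.M.X ◁ (i2 ▷ 𝔸.T ≫ a) ▷ M.M.X ⊗≫ N.M.X ◁ 𝔸.T ◁ e2 ⊗≫
        N.M.X ◁ y ▷ 𝔸.T ⊗≫ 𝟙 _ := by
      rw [p2]; monoidal
    _ = K ▷ 𝔸.T ⊗≫ (x ▷ (M.M.X ⊗ 𝔸.T) ≫ (N.M.X ⊗ 𝔸.T) ◁ t2) ⊗≫ N.M.X ◁ (i2 ▷ 𝔸.T ≫ a) ▷ M.M.X ⊗≫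
        N.M.X ◁ 𝔸.T ◁ e2 ⊗≫
        N.M.X ◁ y ▷ 𝔸.T ⊗≫ 𝟙 _ := by rw [c2]; monoidal
    _ = K ▷ 𝔸.T ⊗≫ (𝔸.T ⊗ N.M.X) ◁ t2 ⊗≫ (x ≫ N.M.X ◁ i2) ▷ 𝔸.T ▷ M.M.X ⊗≫ N.M.X ◁ a ▷ M.M.X ⊗≫
        N.M.X ◁ 𝔸.T ◁ e2 ⊗≫
        N.M.X ◁ y ▷ 𝔸.T ⊗≫ 𝟙 _ := by rw [← whisker_exchange]; monoidal
    _ = K ▷ 𝔸.T ⊗≫ (𝔸.T ⊗ N.M.X) ◁ t2 ⊗≫ (i1 ≫ i2) ▷ N.M.X ▷ 𝔸.T ▷ M.M.X ⊗≫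
        (𝟙 (𝔸.T ⊗ N.M.X ⊗ 𝔸.T) ⊗≫ t1' ▷ 𝔸.T ⊗≫ N.M.X ◁ a) ▷ M.M.X ⊗≫ N.M.X ◁ 𝔸.T ◁ e2 ⊗≫
        N.M.X ◁ y ▷ 𝔸.T ⊗≫ 𝟙 _ := by
      rw [e4]; monoidal
    _ = K ▷ 𝔸.T ⊗≫ (𝔸.T ⊗ N.M.X) ◁ t2 ⊗≫ (i1 ▷ N.M.X ≫ (i2 ▷ N.M.X ≫ b1)) ▷ 𝔸.T ▷ M.M.X ⊗≫
        𝔸.T ◁ e1 ▷ M.M.X ⊗≫ a ▷ N.M.X ▷ M.M.X ⊗≫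
        𝔸.T ◁ x ▷ M.M.X ⊗≫ (x ▷ (𝔸.T ⊗ M.M.X) ≫ (N.M.X ⊗ 𝔸.T) ◁ e2) ⊗≫ N.M.X ◁ y ▷ 𝔸.T ⊗≫ 𝟙 _ := by
      rw [p1]; monoidal
    _ = K ▷ 𝔸.T ⊗≫ ((𝔸.T ⊗ N.M.X) ◁ t2 ≫ (i1 ▷ N.M.X ≫ b1) ▷ (𝔸.T ⊗ M.M.X)) ⊗≫
        (i2 ▷ (N.M.X ⊗ 𝔸.T) ≫ 𝔸.T ◁ e1) ▷ M.M.X ⊗≫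
        a ▷ N.M.X ▷ M.M.X ⊗≫ 𝔸.T ◁ x ▷ M.M.X ⊗≫ (𝔸.T ⊗ N.M.X) ◁ e2 ⊗≫ x ▷ M.M.X ▷ 𝔸.T ⊗≫
        N.M.X ◁ y ▷ 𝔸.T ⊗≫ 𝟙 _ := by
      rw [b0, ← whisker_exchange x]; monoidal
    _ = (K ≫ (α_ _ _ _).inv ≫ (i1 ▷ N.M.X ≫ b1) ▷ M.M.X ≫ (α_ _ _ _).hom) ▷ 𝔸.T ⊗≫
        (𝔸.T ⊗ N.M.X) ◁ t2 ⊗≫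
        𝔸.T ◁ e1 ▷ M.M.X ⊗≫ (i2 ▷ 𝔸.T ≫ a) ▷ N.M.X ▷ M.M.X ⊗≫ 𝔸.T ◁ x ▷ M.M.X ⊗≫
        (𝔸.T ⊗ N.M.X) ◁ e2 ⊗≫ x ▷ M.M.X ▷ 𝔸.T ⊗≫
        N.M.X ◁ y ▷ 𝔸.T ⊗≫ 𝟙 _ := by
      rw [whisker_exchange, ← whisker_exchange i2 e1]; monoidal
    _ = _ := by rw [c1]; monoidal

theorem crossOver_crossUnder_α :
    (M.M.X ⊗ N.M.X) ◁ 𝔸.α ⊗≫ ((α_ _ _ _).hom ≫ M.crossOver N ≫ M.crossUnder N ≫ (α_ _ _ _).inv) ▷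
      𝔸.T ⊗≫ 𝟙 _ =
    𝟙 _ ⊗≫ ((α_ _ _ _).hom ≫ M.crossOver N ≫ M.crossUnder N ≫ (α_ _ _ _).inv) ▷ 𝔸.T ⊗≫
      (N.M.X ⊗ M.M.X) ◁ 𝔸.α := by
  have l1 := crossOver_α h hM hN
  have l2 := crossUnder_α h hM hN
  set K := M.crossOver N
  set K' := M.crossUnder N
  calc
    _ = ((M.M.X ⊗ N.M.X) ◁ 𝔸.α ⊗≫ K ▷ 𝔸.T ⊗≫ 𝟙 (𝔸.T ⊗ N.M.X ⊗ M.M.X ⊗ 𝔸.T)) ⊗≫ K' ▷ 𝔸.T ⊗≫ 𝟙 _ := by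
      monoidal
    _ = 𝟙 _ ⊗≫ (K ▷ 𝔸.T ⊗≫ K' ▷ 𝔸.T ⊗≫ (N.M.X ⊗ M.M.X) ◁ 𝔸.α) := by
      rw [l1, l2]; monoidal
    _ = _ := by monoidal

end Braid

end PreObj

open FrobeniusAlgebra Leg

-- Naturality of partial traces

section Trace

variable {C : Type u₁} [Category.{v₁} C] [MonoidalCategory C] [RightRigidCategory C]
  [PivotalCategory C] {X Y Z T : C}

theorem comp_rightTrace (g : X ⟶ Y) (f : Y ⊗ T ⟶ Z ⊗ T) :
    g ≫ rightTrace T f = rightTrace T (g ▷ T ≫ f) := by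
  rw [rightTrace, rightTrace]
  calc
    _ = 𝟙 _ ⊗≫ (g ▷ 𝟙_ C ≫ Y ◁ coev T) ⊗≫ f ▷ (Tᘁ : C) ⊗≫ Z ◁ ev' T ⊗≫ 𝟙 _ := by monoidal
    _ = _ := by rw [← whisker_exchange]; monoidal

theorem rightTrace_comp (f : X ⊗ T ⟶ Y ⊗ T) (g : Y ⟶ Z) :
    rightTrace T f ≫ g = rightTrace T (f ≫ g ▷ T) := by
  rw [rightTrace, rightTrace]
  calc
    _ = 𝟙 _ ⊗≫ X ◁ coev T ⊗≫ f ▷ (Tᘁ : C) ⊗≫ (Y ◁ ev' T ≫ g ▷ 𝟙_ C) ⊗≫ 𝟙 _ := by monoidal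
    _ = _ := by rw [whisker_exchange]; monoidal

end Trace

section Outer

variable {C : Type u₁} [Category.{v₁} C] [MonoidalCategory C] {A : FrobeniusAlgebra C}
  {M N : Bimod A.toMon A.toMon} {V W : C}

theorem FrobeniusAlgebra.Cobalanced.whiskerLeft_outer {l : A.X ⊗ W ⟶ W} {g : V ⟶ N.X ⊗ W}
    (hg : A.Cobalanced N.actRight l g) :
    A.Cobalanced (outer M N).actRight l (M.X ◁ g ≫ (α_ _ _ _).inv) := by
  have hg' : g ≫ A.coactR N.actRight ▷ W ≫ (α_ _ _ _).hom = g ≫ N.X ◁ A.coactL l := hg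
  have e : A.coactR (outer M N).actRight =
      M.X ◁ A.coactR N.actRight ≫ (α_ _ _ _).inv := by
    rw [coactR, coactR]; monoidal
  rw [FrobeniusAlgebra.Cobalanced, e]
  calc
    _ = M.X ◁ (g ≫ A.coactR N.actRight ▷ W ≫ (α_ _ _ _).hom) ≫ (α_ _ _ _).inv := by monoidal
    _ = _ := by rw [hg']; monoidal

theorem FrobeniusAlgebra.Balanced.whiskerLeft_outer {l : A.X ⊗ W ⟶ W} {g : N.X ⊗ W ⟶ V}
    (hg : A.Balanced N.actRight l g) :
    A.Balanced (outer M N).actRight l ((α_ _ _ _).hom ≫ M.X ◁ g) := by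
  have hg' : N.actRight ▷ W ≫ g = (α_ _ _ _).hom ≫ N.X ◁ l ≫ g := hg
  rw [FrobeniusAlgebra.Balanced]
  calc
    _ = 𝟙 _ ⊗≫ M.X ◁ (N.actRight ▷ W ≫ g) := by monoidal
    _ = _ := by rw [hg']; monoidal

end Outer

-- The braiding characterised without a trace

namespace PreObj

variable {k : Type w} [Field k] {C : Type u₁} [Category.{v₁} C] [Preadditive C] [Linear k C]
  [MonoidalCategory C] [MonoidalPreadditive C] [MonoidalLinear k C] [RightRigidCategory C]
  [PivotalCategory C] [BraidedCategory C] {𝔸 : OrbData k C}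
  (h : 𝔸.IsOrbifoldDatum)

variable (M N : PreObj 𝔸 Set.univ) in
/-- The morphism whose partial trace over `T` is the braiding of `M` and `N`. -/
def crossBoth : (M.M.X ⊗ N.M.X) ⊗ 𝔸.T ⟶ (N.M.X ⊗ M.M.X) ⊗ 𝔸.T :=
  (α_ _ _ _).hom ≫ M.crossOver N ≫ M.crossUnder N ≫ (α_ _ _ _).inv

variable {M N : PreObj 𝔸 Set.univ} (hM : M.IsCrossing) (hN : N.IsCrossing)

include hM in
theorem crossBoth_cobalanced :
    𝔸.A.Cobalanced (outer N.M M.M).actRight 𝔸.act₀ (M.crossBoth N) := by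
  have := FrobeniusAlgebra.Cobalanced.comp (FrobeniusAlgebra.Cobalanced.whiskerLeft_outer (hM.bar_cobalanced ⟨two, Set.mem_univ _⟩) (M := N.M))
    ((α_ _ _ _).hom ≫ M.crossOver N ≫ (α_ _ _ _).inv ≫ (𝔸.ins one ▷ N.M.X ≫
      N.τbar ⟨one, Set.mem_univ _⟩) ▷ M.M.X ≫ (α_ _ _ _).hom ≫ N.M.X ◁ 𝔸.ins two ▷ M.M.X)
  convert this using 1
  simp [crossBoth, crossUnder]

include hN in
theorem crossBoth_balanced :
    𝔸.A.Balanced (outer M.M N.M).actRight 𝔸.act₀ (M.crossBoth N) := by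
  have := FrobeniusAlgebra.Balanced.comp (FrobeniusAlgebra.Balanced.whiskerLeft_outer (hN.balanced ⟨one, Set.mem_univ _⟩) (M := M.M))
    ((α_ _ _ _).inv ≫ M.τ ⟨two, Set.mem_univ _⟩ ▷ N.M.X ≫
      (α_ _ _ _).hom ≫ 𝔸.T ◁ (β_ M.M.X N.M.X).hom ≫ M.crossUnder N ≫ (α_ _ _ _).inv)
  convert this using 1
  simp [crossBoth, crossOver]

include h hM hN

/-- A `T`-strand attached to the right of `N ⊗ M` can be moved through the braiding. -/
theorem braidBalanced_bridge :
    M.braidBalanced N ▷ 𝔸.T ≫ 𝔸.A.bridge (outer N.M M.M).actRight 𝔸.act₀ = M.crossBoth N := by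
  have c := crossOver_crossUnder_α h hM hN
  rw [← crossBoth] at c
  have e := h.rightTrace_whiskerRight_bridge (crossBoth_cobalanced (N := N) hM) <| by
    refine Eq.trans ?_ (c.trans ?_) <;> monoidal
  rw [braidBalanced_eq hN, MonoidalLinear.smul_whiskerRight, Linear.smul_comp]
  refine (congrArg (𝔸.φ ^ 2 • ·) e).trans ?_
  rw [smul_smul, mul_inv_cancel₀ (pow_ne_zero 2 h.φ_ne_zero), one_smul]

omit hM hN in
-- The loop of `rightTrace_bridge` is a nonzero scalar, so `y` is recovered from its composite with
-- an attached `T`-strand by closing that strand. Identities between morphisms into a right module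
-- may therefore be tested with such a strand attached.
theorem eq_smul_rightTrace {X : C} {Y : Bimod 𝔸.A.toMon 𝔸.A.toMon} (y : X ⟶ Y.X) :
    y = 𝔸.φ ^ 2 • rightTrace 𝔸.T (X ◁ (𝔸.ins one ≫ 𝔸.ins two) ≫
      y ▷ 𝔸.T ≫ 𝔸.A.bridge Y.actRight 𝔸.act₀) := by
  rw [← Category.assoc, whisker_exchange, Category.assoc, ← comp_rightTrace,
    h.rightTrace_bridge, Linear.comp_smul, Category.comp_id, smul_smul,
    mul_inv_cancel₀ (pow_ne_zero 2 h.φ_ne_zero), one_smul]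

omit hM hN in
theorem eq_of_whiskerRight_bridge {X : C} {Y : Bimod 𝔸.A.toMon 𝔸.A.toMon} {y y' : X ⟶ Y.X}
    (e : y ▷ 𝔸.T ≫ 𝔸.A.bridge Y.actRight 𝔸.act₀ = y' ▷ 𝔸.T ≫ 𝔸.A.bridge Y.actRight 𝔸.act₀) :
    y = y' := by
  rw [eq_smul_rightTrace h y, e, ← eq_smul_rightTrace h y']

/-- With a `T`-strand attached the trace disappears by `braidBalanced_bridge`, and balancedness
follows from left-linearity of the crossing of `N` and balancedness of that of `M`. -/
theorem braidBalanced_balanced :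
    𝔸.A.Balanced M.M.actRight N.M.actLeft (M.braidBalanced N) := by
  refine eq_of_whiskerRight_bridge h (Y := outer N.M M.M) ?_
  have e := braidBalanced_bridge h hM hN
  simp only [comp_whiskerRight, Category.assoc]
  rw [e, crossBoth, crossOver]
  have e1 : M.M.actRight ▷ 𝔸.T ≫ M.τ ⟨two, Set.mem_univ _⟩ =
    (α_ _ _ _).hom ≫ M.M.X ◁ 𝔸.act₀ ≫ M.τ ⟨two, Set.mem_univ _⟩ := hM.balanced _
  have e2 : N.M.actLeft ▷ 𝔸.T ≫ N.τ ⟨one, Set.mem_univ _⟩ = (α_ _ _ _).hom ≫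
    𝔸.A.X ◁ N.τ ⟨one, Set.mem_univ _⟩ ≫ (α_ _ _ _).inv ≫ 𝔸.act₀ ▷ N.M.X := hN.leftLinear _
  set t1 := N.τ ⟨one, Set.mem_univ _⟩
  set t2 := M.τ ⟨two, Set.mem_univ _⟩
  set r := 𝔸.T ◁ (β_ M.M.X N.M.X).hom ≫ M.crossUnder N ≫ (α_ _ _ _).inv
  calc
    _ = 𝟙 _ ⊗≫ (M.M.actRight ▷ (N.M.X ⊗ 𝔸.T) ≫ M.M.X ◁ t1) ⊗≫ t2 ▷ N.M.X ⊗≫ r := by monoidal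
    _ = 𝟙 _ ⊗≫ (M.M.X ⊗ 𝔸.A.X) ◁ t1 ⊗≫ (M.M.actRight ▷ 𝔸.T ≫ t2) ▷ N.M.X ⊗≫ r := by
      rw [← whisker_exchange]; monoidal
    _ = 𝟙 _ ⊗≫ M.M.X ◁ ((α_ _ _ _).hom ≫ 𝔸.A.X ◁ t1 ≫ (α_ _ _ _).inv ≫ 𝔸.act₀ ▷ N.M.X) ⊗≫
        t2 ▷ N.M.X ⊗≫ r := by rw [e1]; monoidal
    _ = _ := by rw [← e2]; monoidal

/-- The balanced map of the braiding takes values in the image of the idempotent. -/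
theorem braidBalanced_idemL :
    M.braidBalanced N ≫ idemL (𝔸.A.sq 𝔸.ψ) N.M M.M = M.braidBalanced N := by
  -- The insertion of `ψ₂²` commutes with the left action of `T`, so the last part of the crossing
  -- is still left-linear. The idempotent slides back through it and is absorbed by the inverse
  -- crossing of `N`.
  have hl : LeftLinear 𝔸.act₀ M.M.actLeft (𝔸.ins two ▷ M.M.X ≫ M.τbar ⟨two, Set.mem_univ _⟩) := by
    have e : 𝔸.act₀ ▷ M.M.X ≫ M.τbar ⟨two, Set.mem_univ _⟩ = _ := hM.bar_leftLinear _
    rw [LeftLinear, ← comp_whiskerRight_assoc, h.act₀_ins, comp_whiskerRight_assoc, e]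
    monoidal
  have e := hl.comp_idemL (M := N.M) (N := h.bimod two) (N' := M.M) h.splits
    (hN.bar_cobalanced ⟨one, Set.mem_univ _⟩)
  rw [braidBalanced_eq hN, Linear.smul_comp, rightTrace_comp]
  congr 2
  rw [crossUnder]
  set t1' := N.τbar ⟨one, Set.mem_univ _⟩
  set f := 𝔸.ins two ▷ M.M.X ≫ M.τbar ⟨two, Set.mem_univ _⟩
  set i := idemL (𝔸.A.sq 𝔸.ψ) N.M M.M
  set K := M.crossOver N
  calc
    _ = (M.M.X ⊗ N.M.X) ◁ (𝔸.ins one ≫ 𝔸.ins two) ⊗≫ K ⊗≫ 𝔸.ins one ▷ (N.M.X ⊗ M.M.X) ⊗≫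
        (((α_ _ _ _).inv ≫ t1' ▷ M.M.X ≫ (α_ _ _ _).hom ≫ N.M.X ◁ f) ≫ (α_ _ _ _).inv ≫ i ▷ 𝔸.T ≫
          (α_ _ _ _).hom) ⊗≫ 𝟙 _ := by monoidal
    _ = _ := by rw [e]; monoidal

/-- Needed for the relative trace in the twist. It is tested with a `T`-strand attached:
balancedness moves the action of `A` onto that strand on both sides. -/
theorem braidBalanced_rightLinear :
    M.M.X ◁ N.M.actRight ≫ M.braidBalanced N = (α_ _ _ _).inv ≫ M.braidBalanced N ▷ 𝔸.A.X ≫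
      (α_ _ _ _).hom ≫ N.M.X ◁ M.M.actRight := by
  have e := braidBalanced_bridge h hM hN
  have b : (outer M.M N.M).actRight ▷ 𝔸.T ≫ M.crossBoth N = (α_ _ _ _).hom ≫ _ :=
    crossBoth_balanced (M := M) hN
  have b' : (outer N.M M.M).actRight ▷ 𝔸.T ≫ 𝔸.A.bridge (outer N.M M.M).actRight 𝔸.act₀ =
    (α_ _ _ _).hom ≫ _ := bridge_isBalanced (M := outer N.M M.M) (N := h.bimod one)
  have key : (outer M.M N.M).actRight ≫ M.braidBalanced N =
      M.braidBalanced N ▷ 𝔸.A.X ≫ (outer N.M M.M).actRight := by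
    refine eq_of_whiskerRight_bridge h (Y := outer N.M M.M) ?_
    generalize (outer M.M N.M).actRight = r at b ⊢
    rw [comp_whiskerRight, Category.assoc, e, b]
    generalize (outer N.M M.M).actRight = r' at b' e ⊢
    rw [comp_whiskerRight, Category.assoc, b', associator_naturality_left_assoc,
      ← whisker_exchange_assoc]
    exact congrArg (fun k => (α_ _ _ _).hom ≫ (M.M.X ⊗ N.M.X) ◁ 𝔸.act₀ ≫ k) e.symm
  change ((α_ _ _ _).hom ≫ M.M.X ◁ N.M.actRight) ≫ _ = _ at key
  rw [Category.assoc] at key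
  rw [← cancel_epi (α_ _ _ _).hom, key, Iso.hom_inv_id_assoc]

end PreObj

open FrobeniusAlgebra Leg

-- Relative traces under a separable Frobenius functor

section Trace

variable {C : Type u₁} [Category.{v₁} C] [MonoidalCategory C] [RightRigidCategory C]
  [PivotalCategory C] {D : Type u₂} [Category.{v₂} D] [MonoidalCategory D] [RightRigidCategory D]
  [PivotalCategory D]

theorem rightTrace_eq_of_iso {X Y T S : D} (e : S ≅ (Tᘁ : D)) {c : 𝟙_ D ⟶ T ⊗ S}
    {p : T ⊗ S ⟶ 𝟙_ D} (hc : c ≫ T ◁ e.hom = coev T) (hp : T ◁ e.hom ≫ ev' T = p)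
    (f : X ⊗ T ⟶ Y ⊗ T) :
    rightTrace T f = (ρ_ X).inv ≫ X ◁ c ≫ (α_ _ _ _).inv ≫ f ▷ S ≫ (α_ _ _ _).hom ≫ Y ◁ p ≫
      (ρ_ Y).hom := by
  rw [rightTrace, ← hc, ← hp]
  calc
    _ = 𝟙 _ ⊗≫ X ◁ c ⊗≫ ((X ⊗ T) ◁ e.hom ≫ f ▷ (Tᘁ : D)) ⊗≫ Y ◁ ev' T ⊗≫ 𝟙 _ := by monoidal
    _ = _ := by rw [whisker_exchange]; monoidal

theorem IsFrobenius.whiskerLeft_insR_μ {F : C ⥤ D} [F.LaxMonoidal] [F.OplaxMonoidal]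
    (hF : IsFrobenius F) {A : FrobeniusAlgebra C} {a' : 𝟙_ D ⟶ F.obj A.X} (X : C) {M : C}
    (r : M ⊗ A.X ⟶ M) :
    F.obj X ◁ (hF.mapAlgebra A).insR a' (μ F M A.X ≫ F.map r) ≫ μ F X M =
      μ F X M ≫ (hF.mapAlgebra A).insR a'
        (μ F (X ⊗ M) A.X ≫ F.map ((α_ _ _ _).hom ≫ X ◁ r)) := by
  refine (congrArg (fun t => F.obj X ◁ t ≫ μ F X M) (FrobeniusAlgebra.insR_eq _ _ _)).trans
    (Eq.trans ?_ (congrArg (fun t => μ F X M ≫ t) (FrobeniusAlgebra.insR_eq _ _ _).symm))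
  change F.obj X ◁ ((ρ_ _).inv ≫ F.obj M ◁ a' ≫ μ F M A.X ≫ F.map r) ≫ μ F X M =
    μ F X M ≫ (ρ_ _).inv ≫ F.obj (X ⊗ M) ◁ a' ≫ μ F (X ⊗ M) A.X ≫ F.map _
  simp only [MonoidalCategory.whiskerLeft_comp, Category.assoc, F.map_comp]
  rw [μ_natural_right, rightUnitor_inv_naturality_assoc, ← whisker_exchange_assoc,
    Functor.LaxMonoidal.associativity_assoc, associator_naturality_right_assoc,
    rightUnitor_tensor_inv, Category.assoc, Iso.inv_hom_id_assoc]

/-- Relative partial traces of right linear morphisms are preserved. -/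
theorem SplitsImage.rightTrace_bmap {F : C ⥤ D} [F.LaxMonoidal] [F.OplaxMonoidal]
    {hF : IsFrobenius F} {A : FrobeniusAlgebra C} {a' : 𝟙_ D ⟶ F.obj A.X}
    (h : SplitsImage F hF A a') (hA : A.IsSymmetric) {a : 𝟙_ C ⟶ A.X} (ha : A.Splits a)
    {P M : Bimod A.toMon A.toMon} {Y : C}
    (hp : F.obj M.X ◁ (hF.dualIso M.X).hom ≫ ev' (F.obj M.X) = mapPairing F (ev' M.X))
    {f : P.X ⊗ M.X ⟶ Y ⊗ M.X} (hf : RightLinear M.actRight M.actRight f) :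
    rightTrace (F.obj M.X) (F.obj P.X ◁ (hF.mapAlgebra A).insR a'
      (μ F M.X A.X ≫ F.map M.actRight) ≫ bmap F f) =
      F.map (rightTrace M.X (P.X ◁ A.insR a M.actRight ≫ f)) := by
  have hf' : P.X ◁ M.actRight ≫ f = (α_ _ _ _).inv ≫ f ▷ A.X ≫ (α_ _ _ _).hom ≫ Y ◁ M.actRight :=
    hf
  -- The trace is cut into two halves between `P ⊗ M` and `M*`. The coevaluation half is cobalanced
  -- by symmetry of `A`, the evaluation half is balanced by right-linearity of `f`, so the insertion
  -- between them can be exchanged as usual.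
  have hg : A.Cobalanced (outer P M).actRight (dual M).actLeft
      ((ρ_ _).inv ≫ P.X ◁ coev M.X ≫ (α_ _ _ _).inv) := by
    have e : A.Cobalanced M.actRight (A.dualL M.actRight) (coev M.X) := hA.coev_coactR M.actRight
    exact (e.whiskerLeft_outer (M := P)).comp _
  have hb : A.Balanced (outer P M).actRight (dual M).actLeft
      (f ▷ (M.Xᘁ : C) ≫ (α_ _ _ _).hom ≫ Y ◁ ev' M.X ≫ (ρ_ _).hom) := by
    have e := A.dualL_ev' M.actRight
    change ((α_ _ _ _).hom ≫ P.X ◁ M.actRight) ▷ (M.Xᘁ : C) ≫ _ =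
      (α_ _ _ _).hom ≫ (P.X ⊗ M.X) ◁ A.dualL M.actRight ≫ _
    calc
      _ = 𝟙 _ ⊗≫ (P.X ◁ M.actRight ≫ f) ▷ (M.Xᘁ : C) ⊗≫ Y ◁ ev' M.X ⊗≫ 𝟙 _ := by monoidal
      _ = 𝟙 _ ⊗≫ f ▷ A.X ▷ (M.Xᘁ : C) ⊗≫ Y ◁ ((α_ _ _ _).inv ≫ M.actRight ▷ (M.Xᘁ : C) ≫
          ev' M.X) ⊗≫ 𝟙 _ := by rw [hf']; monoidal
      _ = 𝟙 _ ⊗≫ (f ▷ (A.X ⊗ (M.Xᘁ : C)) ≫ (Y ⊗ M.X) ◁ A.dualL M.actRight) ⊗≫ Y ◁ ev' M.X ⊗≫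
          𝟙 _ := by rw [← e]; monoidal
      _ = _ := by rw [← whisker_exchange]; monoidal
  have key := h.map_idemL_idemR (a := a) (M := outer P M) (N := dual M)
  have e1 := hg.comp_idemL (M := outer P M) (N := dual M) ha
  have e2 := hb.idemR_comp (M := outer P M) (N := dual M) ha
  have e3 := hF.whiskerLeft_insR_μ (a' := a') P.X M.actRight
  have main : F.map ((ρ_ _).inv ≫ P.X ◁ coev M.X ≫ (α_ _ _ _).inv) ≫
      midIns hF a' (outer P M) (dual M) ≫
      F.map (f ▷ (M.Xᘁ : C) ≫ (α_ _ _ _).hom ≫ Y ◁ ev' M.X ≫ (ρ_ _).hom) =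
      F.map (((ρ_ _).inv ≫ P.X ◁ coev M.X ≫ (α_ _ _ _).inv) ≫
        A.insR a (outer P M).actRight ▷ (M.Xᘁ : C) ≫
        f ▷ (M.Xᘁ : C) ≫ (α_ _ _ _).hom ≫ Y ◁ ev' M.X ≫ (ρ_ _).hom) := by
    have gen {U V W : C} {g : U ⟶ V} {i j s : V ⟶ V} {b : V ⟶ W} {m : F.obj V ⟶ F.obj V}
        (k : F.map i ≫ m ≫ F.map j = F.map (i ≫ s)) (k1 : g ≫ i = g) (k2 : j ≫ b = b) :
        F.map g ≫ m ≫ F.map b = F.map (g ≫ s ≫ b) := by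
      calc
        _ = F.map g ≫ (F.map i ≫ m ≫ F.map j) ≫ F.map b := by
          conv_lhs => rw [← k1, ← k2]
          simp only [F.map_comp, Category.assoc]
        _ = _ := by rw [k, ← F.map_comp, ← F.map_comp, Category.assoc, reassoc_of% k1]
    exact gen key e1 e2
  have e4 : A.insR a (outer P M).actRight = P.X ◁ A.insR a M.actRight := by
    change A.insR a ((α_ _ _ _).hom ≫ P.X ◁ M.actRight) = _
    rw [FrobeniusAlgebra.insR, FrobeniusAlgebra.insR]; monoidal
  rw [e4] at main
  rw [rightTrace_eq_of_iso (hF.dualIso M.X) (hF.coev_dualIso M.X) hp]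
  have e5 : rightTrace M.X (P.X ◁ A.insR a M.actRight ≫ f) =
      ((ρ_ _).inv ≫ P.X ◁ coev M.X ≫ (α_ _ _ _).inv) ≫ (P.X ◁ A.insR a M.actRight) ▷ (M.Xᘁ : C) ≫
        f ▷ (M.Xᘁ : C) ≫ (α_ _ _ _).hom ≫ Y ◁ ev' M.X ≫ (ρ_ _).hom := by
    rw [rightTrace]; monoidal
  rw [e5, ← main, midIns]
  change _ = F.map _ ≫ (δ F (P.X ⊗ M.X) (M.Xᘁ : C) ≫ (hF.mapAlgebra A).insR a' (μ F (P.X ⊗ M.X) A.X ≫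
    F.map ((α_ _ _ _).hom ≫ P.X ◁ M.actRight)) ▷ F.obj (M.Xᘁ : C) ≫
      μ F (P.X ⊗ M.X) (M.Xᘁ : C)) ≫ F.map _
  generalize (hF.mapAlgebra A).insR a' (μ F (P.X ⊗ M.X) A.X ≫
    F.map ((α_ _ _ _).hom ≫ P.X ◁ M.actRight)) = dd at e3 ⊢
  generalize (hF.mapAlgebra A).insR a' (μ F M.X A.X ≫ F.map M.actRight) = d at e3 ⊢
  simp only [mapPairing, mapCopairing, bmap, MonoidalCategory.whiskerLeft_comp, comp_whiskerRight,
    Category.assoc, F.map_comp]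
  have e6 := congrArg (fun k => k ▷ F.obj (M.Xᘁ : C)) e3
  simp only [comp_whiskerRight] at e6
  have e7 := hF.δ_μ' P.X M.X (M.Xᘁ : C)
  have e8 := hF.δ_μ Y M.X (M.Xᘁ : C)
  rw [reassoc_of% e6, reassoc_of% e7, reassoc_of% e8, μ_natural_right_assoc, δ_natural_right_assoc,
    right_unitality_inv_assoc, ← Functor.OplaxMonoidal.right_unitality_hom]
  simp

end Trace

open FrobeniusAlgebra Leg

theorem FrobeniusAlgebra.bridge_outer {C : Type u₁} [Category.{v₁} C] [MonoidalCategory C]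
    {A : FrobeniusAlgebra C} (M N : Bimod A.toMon A.toMon) {W : C} (l : A.X ⊗ W ⟶ W) :
    A.bridge (outer M N).actRight l =
      (α_ _ _ _).hom ≫ M.X ◁ A.bridge N.actRight l ≫ (α_ _ _ _).inv := by
  change A.bridge ((α_ _ _ _).hom ≫ M.X ◁ N.actRight) l = _
  rw [bridge, bridge, MonoidalCategory.tensorHom_def, MonoidalCategory.tensorHom_def]
  monoidal

-- The transported functor is ribbon

namespace PreObj

variable {k : Type w} [Field k]
    {C : Type u₁} [Category.{v₁} C] [Preadditive C] [Linear k C] [MonoidalCategory C]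
    [MonoidalPreadditive C] [MonoidalLinear k C]
    [RightRigidCategory C] [PivotalCategory C] [BraidedCategory C] [HasCoequalizers C]
    {D : Type u₂} [Category.{v₂} D] [Preadditive D] [Linear k D] [MonoidalCategory D]
    [MonoidalPreadditive D] [MonoidalLinear k D]
    [RightRigidCategory D] [PivotalCategory D] [BraidedCategory D] [HasCoequalizers D]
    (hC : IsRibbon C) (hD : IsRibbon D)
    {F : C ⥤ D} [F.LaxBraided] [F.OplaxMonoidal]
    (hF : IsRibbonFrobenius F) {𝔸 : OrbData k C} (h : 𝔸.IsOrbifoldDatum)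
    {ψF : 𝟙_ D ⟶ F.obj 𝔸.A.X} {φF : k} (hcomp : IsCompatible hF.frobenius 𝔸 ψF φF)
    {M N : PreObj 𝔸 Set.univ} (hM : M.IsCrossing) (hN : N.IsCrossing)

include h hM hN in
-- The inclusion and the insertion at the start of `braid` form, behind the projection, an
-- idempotent that the balanced map of the braiding absorbs.
theorem relProj_braid : relProj M.M N.M ≫ M.braid N =
    M.braidBalanced N ≫ N.insR ▷ M.M.X ≫ relProj N.M M.M := by
  have e := (braidBalanced_balanced h hM hN).bridge_insR (M := M.M) (N := N.M) h.splits
  have e' : 𝔸.A.bridge M.M.actRight N.M.actLeft ≫ M.insR ▷ N.M.X ≫ M.braidBalanced N =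
    M.braidBalanced N := e
  rw [braid, ← Category.assoc, relProj_incl, reassoc_of% e']

include hC hD in
theorem transport_crossOver :
    ((PreObj.transport 𝔸 Set.univ hF.frobenius ψF φF).obj M).crossOver
      ((PreObj.transport 𝔸 Set.univ hF.frobenius ψF φF).obj N) = tmap F (M.crossOver N) := by
  have e1 := hF.frobenius.whiskerLeft_bmap_bmap (N.τ ⟨one, Set.mem_univ _⟩)
    (M.τ ⟨two, Set.mem_univ _⟩)
  have e2 := (hF.frobenius.oplaxBraided (hF.dualIso_ev' hC hD)).tmap_exch two
    (M.M.X ◁ N.τ ⟨one, Set.mem_univ _⟩ ≫ (α_ _ _ _).inv ≫ M.τ ⟨two, Set.mem_univ _⟩ ▷ N.M.X ≫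
      (α_ _ _ _).hom)
  rw [← e1] at e2
  simp only [Category.assoc] at e2
  exact e2

include hC hD h hcomp hM hN

/-- Each inverse crossing takes both of its strands from what precedes it; the lemmas
`crossOver_idemL_one` and `crossOver_idemL_two` allow merging there. -/
theorem transport_crossOver_crossUnder :
    ((PreObj.transport 𝔸 Set.univ hF.frobenius ψF φF).obj M).crossOver
        ((PreObj.transport 𝔸 Set.univ hF.frobenius ψF φF).obj N) ≫
      ((PreObj.transport 𝔸 Set.univ hF.frobenius ψF φF).obj M).crossUnder
        ((PreObj.transport 𝔸 Set.univ hF.frobenius ψF φF).obj N) =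
    tmap F (M.crossOver N ≫ M.crossUnder N) := by
  rw [transport_crossOver hC hD hF]
  have e1 := hcomp.stronglySeparable.splitsImage.tmap_whiskerRight (M := h.bimod one) (N := N.M)
    (crossOver_idemL_one h hM hN)
    (Balanced.idemR_comp h.splits (hN.bar_balanced ⟨one, Set.mem_univ _⟩))
  have e2 := hcomp.stronglySeparable.splitsImage.tmap_whiskerLeft (M := h.bimod two) (N := M.M)
    (crossOver_idemL_two h hM hN)
    (Balanced.idemR_comp h.splits (hM.bar_balanced ⟨two, Set.mem_univ _⟩))
  have gen {P Q R S T U : D} {t : P ⟶ Q} {x : Q ⟶ R} {y : R ⟶ S} {z : S ⟶ T} {u : T ⟶ U}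
      {s : P ⟶ T} {r : P ⟶ U} (k1 : t ≫ x ≫ y ≫ z = s) (k2 : s ≫ u = r) :
      t ≫ x ≫ y ≫ z ≫ u = r := by
    rw [← k2, ← k1]; simp only [Category.assoc]
  refine (gen e1 e2).trans ?_
  rw [crossUnder]
  simp only [Category.assoc]
  rfl

/-- The balanced map of the braiding is transported to the balanced map of the braiding. -/
theorem transport_braidBalanced :
    ((PreObj.transport 𝔸 Set.univ hF.frobenius ψF φF).obj M).braidBalanced
      ((PreObj.transport 𝔸 Set.univ hF.frobenius ψF φF).obj N) = bmap F (M.braidBalanced N) := by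
  have h' := h.transport hC hD hF hcomp
  have hM' := hM.transport hC hD hF h hcomp
  have hN' := hN.transport hC hD hF h hcomp
  -- Both sides are compared with an `F(T)`-strand attached. No trace is transported, and the
  -- scalars `φ` and `φF` never have to be related.
  refine eq_of_whiskerRight_bridge h'
    (Y := outer ((PreObj.transport 𝔸 Set.univ hF.frobenius ψF φF).obj N).M
      ((PreObj.transport 𝔸 Set.univ hF.frobenius ψF φF).obj M).M)
    ((braidBalanced_bridge h' hM' hN').trans ?_)
  have e0 := transport_crossOver_crossUnder hC hD hF h hcomp hM hN
  have e1 := hF.frobenius.bmap_whiskerLeft_bmap (M.braidBalanced N)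
    (𝔸.A.bridge M.M.actRight 𝔸.act₀)
  have e2 := braidBalanced_bridge h hM hN
  rw [bridge_outer, crossBoth] at e2
  have e3 : M.crossOver N ≫ M.crossUnder N = (α_ _ _ _).inv ≫ M.braidBalanced N ▷ 𝔸.T ≫
      (α_ _ _ _).hom ≫ N.M.X ◁ 𝔸.A.bridge M.M.actRight 𝔸.act₀ := by
    rw [← cancel_epi (α_ _ _ _).hom, ← cancel_mono (α_ _ _ _).inv]
    simpa using e2.symm
  rw [e3, ← e1, ← hF.frobenius.bridge_eq] at e0
  have e4 := bridge_outer (A := hF.frobenius.mapAlgebra 𝔸.A)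
    ((mapBimod F 𝔸.A.toMon).obj N.M) ((mapBimod F 𝔸.A.toMon).obj M.M)
    (μ F 𝔸.A.X 𝔸.T ≫ F.map 𝔸.act₀)
  refine Eq.trans ?_ (congrArg (fun t => bmap F (M.braidBalanced N) ▷ F.obj 𝔸.T ≫ t) e4.symm)
  have gen {P Q R S X Y : D} {x : P ⊗ Q ⊗ R ⟶ S} {y : S ⟶ X ⊗ Y ⊗ R}
      {b : P ⊗ Q ⟶ X ⊗ Y} {u : Y ⊗ R ⟶ Y ⊗ R}
      (k : x ≫ y = (α_ P Q R).inv ≫ b ▷ R ≫ (α_ X Y R).hom ≫ X ◁ u) :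
      (α_ P Q R).hom ≫ x ≫ y ≫ (α_ X Y R).inv =
        b ▷ R ≫ (α_ X Y R).hom ≫ X ◁ u ≫ (α_ X Y R).inv := by
    rw [reassoc_of% k, Iso.hom_inv_id_assoc]
  exact gen e0

/-- Tested on the projection. The balanced map upstairs factors through the inclusion of `N ⊗_A M`
(`e7`), so the insertion downstairs meets the identity provided by strong separability (`e6`). -/
theorem braid_μIso :
    ((PreObj.transport 𝔸 Set.univ hF.frobenius ψF φF).obj M).braid
        ((PreObj.transport 𝔸 Set.univ hF.frobenius ψF φF).obj N) ≫
        (hcomp.stronglySeparable.μIso N.M M.M).hom.hom =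
      (hcomp.stronglySeparable.μIso M.M N.M).hom.hom ≫ F.map (M.braid N) := by
  have h' := h.transport hC hD hF hcomp
  have hM' := hM.transport hC hD hF h hcomp
  have hN' := hN.transport hC hD hF h hcomp
  have e1 := relProj_braid h hM hN
  have e2 := relProj_braid h' hM' hN'
  have e3 := hcomp.stronglySeparable.relProj_μIso M.M N.M
  have e4 := hcomp.stronglySeparable.relProj_μIso N.M M.M
  have e5 := transport_braidBalanced hC hD hF h hcomp hM hN
  have e6 := hcomp.stronglySeparable N.M M.M
  have e7 : (M.braidBalanced N ≫ N.insR ▷ M.M.X ≫ relProj N.M M.M) ≫ 𝔸.A.incl N.M M.M =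
      M.braidBalanced N := by
    have e : _ ≫ _ ≫ 𝔸.A.bridge N.M.actRight M.M.actLeft = _ := braidBalanced_idemL h hM hN
    rw [← relProj_incl] at e
    refine Eq.trans ?_ e
    simp only [Category.assoc]
    rfl
  have gen {P Q : D} {X Y Y' X' : C} {q : F.obj X ⊗ F.obj Y ⟶ P} [Epi q] {c : P ⟶ Q}
      {m : Q ⟶ F.obj Y'} {m' : P ⟶ F.obj X'} {q' : F.obj Y ⊗ F.obj X ⟶ Q} {p : X ⊗ Y ⟶ X'}
      {p' : Y ⊗ X ⟶ Y'} {i' : Y' ⟶ Y ⊗ X} {b : X ⊗ Y ⟶ Y ⊗ X} {d : F.obj Y ⟶ F.obj Y}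
      {d' : Y ⟶ Y} {bD : F.obj X ⊗ F.obj Y ⟶ F.obj Y ⊗ F.obj X} {cC : X' ⟶ Y'}
      (k1 : p ≫ cC = b ≫ d' ▷ X ≫ p') (k2 : q ≫ c = bD ≫ d ▷ F.obj X ≫ q')
      (k3 : q ≫ m' = μ F X Y ≫ F.map p) (k4 : q' ≫ m = μ F Y X ≫ F.map p') (k5 : bD = bmap F b)
      (k6 : F.map i' ≫ δ F Y X ≫ d ▷ F.obj X ≫ μ F Y X ≫ F.map p' = 𝟙 _)
      (k7 : (b ≫ d' ▷ X ≫ p') ≫ i' = b) : c ≫ m = m' ≫ F.map cC := by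
    rw [← cancel_epi q, reassoc_of% k2, reassoc_of% k3, ← F.map_comp, k1, k4, k5, bmap]
    conv_lhs => rw [← k7]
    simp only [F.map_comp, Category.assoc]
    rw [k6, Category.comp_id]
  have : Epi (relProj ((mapBimod F 𝔸.A.toMon).obj M.M) ((mapBimod F 𝔸.A.toMon).obj N.M)) :=
    inferInstance
  exact @gen _ _ _ _ _ _ _ this _ _ _ _ _ _ _ _ _ _ _ _ e1 e2 e3 e4 e5 e6 e7

omit hN in
theorem transport_relTwist :
    ((PreObj.transport 𝔸 Set.univ hF.frobenius ψF φF).obj M).relTwist = F.map M.relTwist := by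
  have e := hcomp.stronglySeparable.splitsImage.rightTrace_bmap h.symmetric h.splits
    (hF.dualIso_ev' hC hD M.M.X) (P := M.M) (braidBalanced_rightLinear h hM hM)
  have e' := transport_braidBalanced hC hD hF h hcomp hM hM
  rw [relTwist, e']
  exact e

end PreObj

end FrobTransport

-- Assembly of the main theorem

theorem mainTheorem4 {k : Type w} [Field k] [IsAlgClosed k]
    {C : Type u₁} [Category.{v₁} C] [Abelian C] [Linear k C] [MonoidalCategory C]
    [MonoidalPreadditive C] [MonoidalLinear k C] [RightRigidCategory C] [PivotalCategory C]
    [BraidedCategory C] (hC : IsModularFusion k C)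
    {D : Type u₂} [Category.{v₂} D] [Abelian D] [Linear k D] [MonoidalCategory D]
    [MonoidalPreadditive D] [MonoidalLinear k D] [RightRigidCategory D] [PivotalCategory D]
    [BraidedCategory D] (hD : IsModularFusion k D)
    (F : C ⥤ D) [F.Additive] [F.Linear k] [F.LaxBraided] [F.OplaxMonoidal]
    (hF : IsRibbonFrobenius F) (𝔸 : OrbData k C) (h𝔸 : 𝔸.IsOrbifoldDatum)
    (ψF : 𝟙_ D ⟶ F.obj 𝔸.A.X) (φF : k) (hcomp : IsCompatible hF.frobenius 𝔸 ψF φF) :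
    -- `F(𝔸)` is an orbifold datum
    (𝔸.transport hF.frobenius ψF φF).IsOrbifoldDatum ∧
    -- the functor `F^A` on bimodules is strong monoidal
    ∃ _ : (mapBimod F 𝔸.A.toMon).Monoidal,
      (∀ M N : Bimod 𝔸.A.toMon 𝔸.A.toMon,
        relProj ((mapBimod F 𝔸.A.toMon).obj M) ((mapBimod F 𝔸.A.toMon).obj N) ≫
            (Functor.LaxMonoidal.μ (mapBimod F 𝔸.A.toMon) M N).hom =
          Functor.LaxMonoidal.μ F M.X N.X ≫ F.map (relProj M N)) ∧
      (Functor.LaxMonoidal.ε (mapBimod F 𝔸.A.toMon)).hom = 𝟙 (F.obj 𝔸.A.X) ∧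
      -- for each set of crossings,
      (∀ J : Set Leg,
        -- it induces a functor on the categories of bimodules with crossings,
        ∃ h : ∀ M : PreObj 𝔸 J, M.IsCrossing →
            ((PreObj.transport 𝔸 J hF.frobenius ψF φF).obj M).IsCrossing,
          -- which is strong monoidal,
          (∀ M N : CrossingCat 𝔸 J,
            ∃ e : ((PreObj.transport 𝔸 J hF.frobenius ψF φF).obj M.obj).tensor
                ((PreObj.transport 𝔸 J hF.frobenius ψF φF).obj N.obj) ≅
                (PreObj.transport 𝔸 J hF.frobenius ψF φF).obj (M.obj.tensor N.obj),
              e.hom.hom = Functor.LaxMonoidal.μ (mapBimod F 𝔸.A.toMon) M.obj.M N.obj.M) ∧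
          (∃ e : PreObj.unit (𝔸.transport hF.frobenius ψF φF) J ≅
              (PreObj.transport 𝔸 J hF.frobenius ψF φF).obj (PreObj.unit 𝔸 J),
            e.hom.hom = Functor.LaxMonoidal.ε (mapBimod F 𝔸.A.toMon)) ∧
          -- pivotal,
          (∀ M : CrossingCat 𝔸 J, ∃ e : F.obj M.obj.M.Xᘁ ≅ (F.obj M.obj.M.X)ᘁ,
            IsDualityIso hF.frobenius ψF φF M.obj e) ∧
          -- and a full embedding if `(F, 𝔸)` is full
          (¬ IsZero (F.obj (𝟙_ C)) → (mapBimod F 𝔸.A.toMon).Full →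
            (crossingFunctor 𝔸 J hF.frobenius ψF φF h).Full ∧
              (crossingFunctor 𝔸 J hF.frobenius ψF φF h).Faithful)) ∧
      -- the functor for both crossings is ribbon
      (∀ M N : CrossingCat 𝔸 Set.univ,
        ((PreObj.transport 𝔸 Set.univ hF.frobenius ψF φF).obj M.obj).braid
            ((PreObj.transport 𝔸 Set.univ hF.frobenius ψF φF).obj N.obj) ≫
            (Functor.LaxMonoidal.μ (mapBimod F 𝔸.A.toMon) N.obj.M M.obj.M).hom =
          (Functor.LaxMonoidal.μ (mapBimod F 𝔸.A.toMon) M.obj.M N.obj.M).hom ≫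
            F.map (M.obj.braid N.obj)) ∧
      (∀ M : CrossingCat 𝔸 Set.univ,
        ((PreObj.transport 𝔸 Set.univ hF.frobenius ψF φF).obj M.obj).relTwist =
          F.map M.obj.relTwist) := by
  have hs := hcomp.stronglySeparable
  refine ⟨h𝔸.transport hC.ribbon hD.ribbon hF hcomp, hs.coreMonoidal.toMonoidal,
    fun M N => hs.relProj_μIso M N, rfl,
    fun J => ⟨fun M hM => hM.transport hC.ribbon hD.ribbon hF h𝔸 hcomp,
      fun M N => ⟨PreObj.tensorIso hC.ribbon hD.ribbon hF h𝔸 hcomp M.property N.property, rfl⟩,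
      ⟨PreObj.unitIso hF ψF φF, rfl⟩,
      fun M => ⟨hF.frobenius.dualIso M.obj.M.X,
        hF.isDualityIso hC.ribbon hD.ribbon ψF φF M.obj⟩,
      fun h1 hfull => ⟨PreObj.crossingFunctor_full hC h1 h𝔸 hs _,
        PreObj.crossingFunctor_faithful hC h1 h𝔸 hs _⟩⟩,
    fun M N => PreObj.braid_μIso hC.ribbon hD.ribbon hF h𝔸 hcomp M.property N.property,
    fun M => PreObj.transport_relTwist hC.ribbon hD.ribbon hF h𝔸 hcomp M.property⟩
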